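/- **Conventions.** Let $\mathbb K$ be a field with an embedding $\mathbb K\subset\mathbb R$. $\mathcal{MHS}_{\mathbb K}$ is the category of $\mathbb K$-mixed Hodge structures $(V,W_*,F^*)$ on finite-dimensional $\mathbb K$-vector spaces, with the usual tensor product. For filtered spaces, $W_m\mathrm{Hom}(V,V')$ and $F^m\mathrm{Hom}(V_{\mathbb C},V'_{\mathbb C})$ are the maps shifting the filtrations by $m$. DGAs are graded commutative, graded by $n\ge 0$, with $H^0$ the ground field. A *$\mathbb K$-non-abelian mixed Hodge structure* is an abelian rigid $\mathbb K$-tensor category $\mathcal C$ (a $\mathbb K$-linear symmetric monoidal category with bilinear tensor product) with exact faithful $\mathbb K$-linear tensor functors $\tau_1:\mathcal C\to\mathcal{MHS}_{\mathbb K}$ and $\tau_2:\mathcal{MHS}_{\mathbb K}\to\mathcal C$ such that $\tau_1\circ\tau_2=\mathrm{id}$ (as tensor functors). **Data.** Let $\mathcal D=\{\iota:(A^*,W_*)\to(B^*,W_*,F^*)\}$ be a $\mathbb K$-mixed Hodge diagram: $A$ is a filtered $\mathbb K$-DGA and $B$ a bifiltered $\mathbb C$-DGA (with $W$ exhaustive,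 $F$ finite in each degree, $1\in W_0$, $1\in F^0$), $W_{-1}A=0$, $W_{-1}B=0$, $\iota:A_{\mathbb C}\to B$ is a filtered DGA map inducing an isomorphism on the $E_1$-terms of the spectral sequences of $W$, the differential of ${}_WE_0(B)$ is strictly compatible with $F$, and $F$ induces on ${}_WE_1^{p,q}$ a $\mathbb K$-Hodge structure of weight $q$. Assume that $d|_{B^0}:B^0\to B^1$ is strictly compatible with $W_*$ and with $F^*$. Put $W'_iA^n=W_{i-n}A^n$ and $W'_iB^n=W_{i-n}B^n$. Fix * a filtered $1$-minimal model $\varphi:(M^*,W_*)\to(A^*,W'_*)$ (so $d$ and the product of $M$ are strictly compatible with $W$); * a bigraded $1$-minimal model $N=\bigoplus_{P,Q\ge0}N^{P,Q}$ of $\mathcal D$, $N^{0,0}=N^0=\mathbb C$, with DGA maps $\psi:N\to B$, $\psi'':N\to A_{\mathbb C}$, $\psi':N\to\overline B$ and homotopies $H$ from $\iota\psi''$ to $\psi$ and $H'$ from $\bar\iota\psi''$ to $\psi'$, such that $\psi$ is a $1$-quasi-isomorphism, $\psi'',H,H'$ map $N^{P,Q}$ to $W'_{P+Q}$, $\psi(N^{P,Q})\subset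 W'_{P+Q}\cap F^P$ and $\psi'(N^{P,Q})\subset W'_{P+Q}\cap F^Q+\sum_{i\ge2}W'_{P+Q-i}\cap F^{Q-i+1}$; and a canonical sequence $\mathcal V_1,\mathcal V_2,\dots$ of bigraded subspaces with $N^1=\bigoplus\mathcal V_i$ for $\psi$; * a subspace $C\subset B^0$ such that $d|_C:C\to d(B^0)$ is bijective. **The canonical isomorphism.** $C$ determines an isomorphism of DGAs $\mathcal I:N\to M_{\mathbb C}$ and a homotopy $\mathcal H:N\to B\otimes(t,dt)$ from $\psi$ to $\iota\varphi\mathcal I$ such that, for every $v\in\mathcal V_i$, $$\mathcal H(v)=\psi(v)+\int_0^t\mathcal H(dv)-db\otimes t-b\otimes dt,\qquad b\in C,\quad db=\psi(v)-\iota\varphi\mathcal I(v)+\int_0^1\mathcal H(dv).$$ Let $F^r(M^1_{\mathbb C})=\mathcal I\big(\bigoplus_{P\ge r}(N^1)^{P,Q}\big)$. **The categories.** Objects of $\mathrm{Rep}$ are $(V,W_*,F^*,\Omega)$ with $(V,W_*,F^*)\in\mathcal{MHS}_{\mathbb K}$ and $\Omega\in M^1\otimes W_{-1}\mathrm{End}(V)$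 with $d\Omega+\Omega\wedge\Omega=0$ and $\Omega\in\sum_rF^r(M^1_{\mathbb C})\otimes F^{-r}\mathrm{End}(V_{\mathbb C})$ (that is, a representation in $W_{-1}\mathrm{End}(V)$ of the Lie algebra dual to $M$ which is compatible with the Hodge filtrations). Morphisms are the morphisms of mixed Hodge structures commuting with $\Omega$; the tensor product uses $\Omega\otimes1+1\otimes\Omega'$. Objects of $VMHS^u(\mathcal D)$ are $(V,W_*,F^*,\omega,\omega',a)$ where $(V,W_*,F^*)\in\mathcal{MHS}_{\mathbb K}$, $\omega\in A^1\otimes W_{-1}\mathrm{End}(V)$, $\omega'\in B^1\otimes W_{-1}\mathrm{End}(V_{\mathbb C})$ and $\omega'\in\sum_rF^rB^1\otimes F^{-r}\mathrm{End}(V_{\mathbb C})$, $d\omega+\omega\wedge\omega=0$, $d\omega'+\omega'\wedge\omega'=0$, $a\in\mathrm{id}+B^0\otimes W_{-1}\mathrm{End}(V_{\mathbb C})$ and $da+\omega'a-a\,\iota(\omega)=0$. Morphisms from the object with index $1$ to that with index $2$ are the pairs $(b,b')$ with $b\in A^0\otimes W_0\mathrm{Hom}(V_1,V_2)$, $b'\in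 B^0\otimes W_0\mathrm{Hom}(V_{1\mathbb C},V_{2\mathbb C})$, $b'\in\sum_rF^rB^0\otimes F^{-r}\mathrm{Hom}(V_{1\mathbb C},V_{2\mathbb C})$, $db+\omega_2b-b\omega_1=0$, $db'+\omega_2'b'-b'\omega_1'=0$ and $a_2\iota(b)=b'a_1$. **Statement.** The pair $(\mathcal I,\mathcal H)$ exists. For every such pair: 1. For every $(V,\Omega)\in\mathrm{Rep}$, write $\mathcal H(\mathcal I^{-1}\Omega)=\alpha+\beta\,dt$. There is $g\in B[t]\otimes\mathrm{End}(V_{\mathbb C})$ with $\partial_tg=g\beta$ and $g|_{t=0}=1$, and $a_\Omega=g|_{t=1}$ satisfies $a_\Omega\in\mathrm{id}+B^0\otimes W_{-1}\mathrm{End}(V_{\mathbb C})$ and $da_\Omega+\psi(\mathcal I^{-1}\Omega)a_\Omega-a_\Omega\,\iota\varphi(\Omega)=0$; it is natural in $(V,\Omega)$. Hence $\Phi_C(V,\Omega)=(V,\varphi(\Omega),\psi(\mathcal I^{-1}\Omega),a_\Omega)$, $\Phi_C(f)=(f,f)$ defines a functor $\Phi_C:\mathrm{Rep}\to VMHS^u(\mathcal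 D)$, and it is an equivalence. If $C\cdot C\subset C$, then $a_\Omega\in\mathrm{id}+C\otimes W_{-1}\mathrm{End}(V_{\mathbb C})$. 2. There are a symmetric tensor structure on $VMHS^u(\mathcal D)$ for which $\Phi_C$ is a symmetric tensor functor, and a quasi-inverse $\Phi'_C$ of $\Phi_C$, such that, with $\varepsilon_C:VMHS^u(\mathcal D)\xrightarrow{\Phi'_C}\mathrm{Rep}\xrightarrow{\text{forget}}\mathcal{MHS}_{\mathbb K}$ and $\kappa(V)=(V,0,0,\mathrm{id})$, the triple $(VMHS^u(\mathcal D),\varepsilon_C,\kappa)$ is a $\mathbb K$-non-abelian mixed Hodge structure. That is, $VMHS^u(\mathcal D)$ is an abelian rigid $\mathbb K$-tensor category, $\varepsilon_C$ and $\kappa$ are exact faithful tensor functors, and $\varepsilon_C\circ\kappa=\mathrm{id}$. 3. If every closed element of $M^1$ lies in $W_1M^1$, then $\Omega\in\sum_kW_kM^1\otimes W_{-k}\mathrm{End}(V)$ for every $(V,\Omega)\in\mathrm{Rep}$; so in this case $\mathrm{Rep}$ is the category of representations $\Omega:\mathfrak n\to\mathrm{End}(V)$ of the dual Lie algebra $\mathfrak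 n$ of $M$ which are morphisms of mixed Hodge structures. -/

import Mathlib

open CategoryTheory MonoidalCategory
open scoped TensorProduct Polynomial

universe u v

namespace NonabelianHodge

section LinearAlgebra

/-- The submodule `P ⊗ Q` of `M ⊗ N`. -/
abbrev tens (k : Type*) [Field k] {M N : Type*} [AddCommGroup M] [Module k M] [AddCommGroup N]
    [Module k N] (P : Submodule k M) (Q : Submodule k N) : Submodule k (M ⊗[k] N) :=
  Submodule.map₂ (TensorProduct.mk k M N) P Q

/-- The linear maps shifting the given filtrations by `m`.  For increasing filtrations `W` this is
`W_m Hom(V₁, V₂)`, for decreasing filtrations `F` it is `F^m Hom(V₁, V₂)`. -/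
def filtHom {k : Type*} [Field k] {V₁ V₂ : Type*} [AddCommGroup V₁] [Module k V₁]
    [AddCommGroup V₂] [Module k V₂] (W₁ : ℤ → Submodule k V₁) (W₂ : ℤ → Submodule k V₂) (m : ℤ) :
    Submodule k (V₁ →ₗ[k] V₂) where
  carrier := {f | ∀ i, W₁ i ≤ (W₂ (i + m)).comap f}
  add_mem' hf hg i _ hx := add_mem (S := Submodule k V₂) (hf i hx) (hg i hx)
  zero_mem' i _ _ := zero_mem (W₂ (i + m))
  smul_mem' c _ hf i _ hx := Submodule.smul_mem _ c (hf i hx)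

variable (K : Type u) [Field K] [Algebra K ℝ]

/-- Complex conjugation on `ℂ`, as a `K`-linear map. -/
def conjK : ℂ →ₗ[K] ℂ where
  toFun := starRingEnd ℂ
  map_add' := map_add _
  map_smul' c z := by
    have : algebraMap K ℂ c = ((algebraMap K ℝ c : ℝ) : ℂ) := rfl
    simp [Algebra.smul_def, this]

/-- Complex conjugation on the complexification of a `K`-vector space. -/
def conjC (V : Type*) [AddCommGroup V] [Module K V] : ℂ ⊗[K] V →ₛₗ[starRingEnd ℂ] ℂ ⊗[K] V where
  toFun := (conjK K).rTensor V
  map_add' := map_add _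
  map_smul' c x := by
    induction x using TensorProduct.induction_on with
    | zero => simp
    | tmul a y => simp [TensorProduct.smul_tmul', conjK]
    | add x y hx hy => simp only [smul_add, map_add, hx, hy]

/-- The complex conjugate of a complex subspace of a complexification. -/
def conjSub {V : Type*} [AddCommGroup V] [Module K V] (P : Submodule ℂ (ℂ ⊗[K] V)) :
    Submodule ℂ (ℂ ⊗[K] V) := P.comap (conjC K V)

/-- For `bot ≤ G p ≤ top`, the filtration induced by `G` on the subquotient `top / bot` of the
complexification is a Hodge structure of weight `n`: the filtration on the quotient is decreasing
and finite, and `G^p ⊕ conj G^{n+1-p}` is the whole quotient, for every `p`. -/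
structure IsHodgeStructure {V : Type*} [AddCommGroup V] [Module K V]
    (top bot : Submodule ℂ (ℂ ⊗[K] V)) (G : ℤ → Submodule ℂ (ℂ ⊗[K] V)) (n : ℤ) : Prop where
  anti : Antitone G
  eventually_top : ∃ p, G p = top
  eventually_bot : ∃ p, G p = bot
  sup_eq : ∀ p, G p ⊔ conjSub K (G (n + 1 - p)) = top
  inf_eq : ∀ p, G p ⊓ conjSub K (G (n + 1 - p)) = bot

/-- The bilinear map `V_ℂ × V'_ℂ → (V ⊗ V')_ℂ`. -/
noncomputable def cxMul (V V' : Type*) [AddCommGroup V] [Module K V] [AddCommGroup V']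
    [Module K V'] : (ℂ ⊗[K] V) →ₗ[ℂ] (ℂ ⊗[K] V') →ₗ[ℂ] ℂ ⊗[K] (V ⊗[K] V') :=
  (TensorProduct.mk ℂ (ℂ ⊗[K] V) (ℂ ⊗[K] V')).compr₂
    (TensorProduct.AlgebraTensorModule.distribBaseChange K ℂ V V').symm.toLinearMap

@[simp] theorem cxMul_tmul {V V' : Type*} [AddCommGroup V] [Module K V] [AddCommGroup V']
    [Module K V'] (a b : ℂ) (x : V) (y : V') :
    cxMul K V V' (a ⊗ₜ x) (b ⊗ₜ y) = (a * b) ⊗ₜ[K] (x ⊗ₜ[K] y) := by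
  simp [cxMul]

end LinearAlgebra

section Bifiltered

variable (K : Type u) [Field K] [Algebra K ℝ]

/-- A finite-dimensional `K`-vector space with an increasing filtration `W` and a decreasing
filtration `F` on its complexification. -/
structure BifilteredSpace : Type (u + 1) where
  V : Type u
  [grp : AddCommGroup V]
  [mod : Module K V]
  [fin : FiniteDimensional K V]
  W : ℤ → Submodule K V
  W_mono : Monotone W
  F : ℤ → Submodule ℂ (ℂ ⊗[K] V)
  F_anti : Antitone F

namespace BifilteredSpace

attribute [instance] grp mod fin

variable {K}

/-- The complexification of the underlying vector space. -/
abbrev VC (X : BifilteredSpace K) : Type u := ℂ ⊗[K] X.V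

/-- The weight filtration on the complexification. -/
noncomputable def WC (X : BifilteredSpace K) (n : ℤ) : Submodule ℂ X.VC := (X.W n).baseChange ℂ

/-- The space of linear maps compatible with both filtrations. -/
def homs (X Y : BifilteredSpace K) : Submodule K (X.V →ₗ[K] Y.V) where
  carrier := {f | (∀ n, ∀ x ∈ X.W n, f x ∈ Y.W n) ∧
    ∀ p, ∀ x ∈ X.F p, f.baseChange ℂ x ∈ Y.F p}
  add_mem' hf hg := ⟨fun n x h => add_mem (hf.1 n x h) (hg.1 n x h), fun p x h => by
    rw [LinearMap.baseChange_add]; exact add_mem (hf.2 p x h) (hg.2 p x h)⟩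
  zero_mem' := ⟨fun _ _ _ => zero_mem _, fun _ _ _ => by simp⟩
  smul_mem' c _ hf := ⟨fun n x h => Submodule.smul_mem _ c (hf.1 n x h), fun p x h => by
    rw [LinearMap.baseChange_smul]; exact Submodule.smul_of_tower_mem _ c (hf.2 p x h)⟩

instance : Category (BifilteredSpace K) where
  Hom X Y := homs X Y
  id X := ⟨LinearMap.id, fun _ _ h => h, fun _ _ h => by simpa using h⟩
  comp f g := ⟨g.1 ∘ₗ f.1, fun n x h => g.2.1 n _ (f.2.1 n x h), fun p x h => by
    rw [LinearMap.baseChange_comp]; exact g.2.2 p _ (f.2.2 p x h)⟩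

/-- The linear map underlying a morphism. -/
def lin {X Y : BifilteredSpace K} (f : X ⟶ Y) : X.V →ₗ[K] Y.V := f.1

theorem lin_W {X Y : BifilteredSpace K} (f : X ⟶ Y) {n : ℤ} {x : X.V} (h : x ∈ X.W n) :
    lin f x ∈ Y.W n := f.2.1 n x h
theorem lin_F {X Y : BifilteredSpace K} (f : X ⟶ Y) {p : ℤ} {x : X.VC} (h : x ∈ X.F p) :
    (lin f).baseChange ℂ x ∈ Y.F p := f.2.2 p x h

/-- Constructor for morphisms. -/
def mkHom {X Y : BifilteredSpace K} (f : X.V →ₗ[K] Y.V) (hW : ∀ n, ∀ x ∈ X.W n, f x ∈ Y.W n)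
    (hF : ∀ p, ∀ x ∈ X.F p, f.baseChange ℂ x ∈ Y.F p) : X ⟶ Y := ⟨f, hW, hF⟩

@[ext] theorem hom_ext {X Y : BifilteredSpace K} {f g : X ⟶ Y} (h : lin f = lin g) : f = g :=
  Subtype.ext h

@[simp] theorem lin_mkHom {X Y : BifilteredSpace K} (f : X.V →ₗ[K] Y.V)
    (hW : ∀ n, ∀ x ∈ X.W n, f x ∈ Y.W n) (hF : ∀ p, ∀ x ∈ X.F p, f.baseChange ℂ x ∈ Y.F p) :
    lin (mkHom f hW hF) = f := rfl
@[simp] theorem lin_id (X : BifilteredSpace K) : lin (𝟙 X) = LinearMap.id := rfl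
@[simp] theorem lin_comp {X Y Z : BifilteredSpace K} (f : X ⟶ Y) (g : Y ⟶ Z) :
    lin (f ≫ g) = lin g ∘ₗ lin f := rfl

instance : Preadditive (BifilteredSpace K) where
  homGroup X Y := inferInstanceAs (AddCommGroup (homs X Y))
  add_comp _ _ _ _ _ _ := Subtype.ext (LinearMap.comp_add _ _ _)
  comp_add _ _ _ _ _ _ := Subtype.ext (LinearMap.add_comp _ _ _)

instance : Linear K (BifilteredSpace K) where
  homModule X Y := inferInstanceAs (Module K (homs X Y))
  smul_comp _ _ _ _ _ _ := Subtype.ext (LinearMap.comp_smul _ _ _)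
  comp_smul _ _ _ _ _ _ := Subtype.ext (LinearMap.smul_comp _ _ _)

/-- The forgetful functor to vector spaces. -/
def forget : BifilteredSpace K ⥤ ModuleCat.{u} K where
  obj X := ModuleCat.of K X.V
  map f := ModuleCat.ofHom (lin f)

instance : (forget (K := K)).Faithful where
  map_injective h := hom_ext (congrArg ModuleCat.Hom.hom h)

/-- `W_n(V ⊗ V') = ∑ W_i V ⊗ W_{n-i} V'`. -/
def tensW (X Y : BifilteredSpace K) (n : ℤ) : Submodule K (X.V ⊗[K] Y.V) :=
  ⨆ i, tens K (X.W i) (Y.W (n - i))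

/-- `F^p(V ⊗ V')_ℂ = ∑ F^i V_ℂ ⊗ F^{p-i} V'_ℂ`. -/
noncomputable def tensF (X Y : BifilteredSpace K) (p : ℤ) : Submodule ℂ (ℂ ⊗[K] (X.V ⊗[K] Y.V)) :=
  ⨆ i, Submodule.map₂ (cxMul K X.V Y.V) (X.F i) (Y.F (p - i))

theorem tmul_mem_tensW {X Y : BifilteredSpace K} {i j n : ℤ} (h : i + j = n) {x : X.V} {y : Y.V}
    (hx : x ∈ X.W i) (hy : y ∈ Y.W j) : x ⊗ₜ[K] y ∈ tensW X Y n := by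
  obtain rfl : j = n - i := by omega
  exact Submodule.mem_iSup_of_mem i (Submodule.apply_mem_map₂ _ hx hy)

theorem cxMul_mem_tensF {X Y : BifilteredSpace K} {i j n : ℤ} (h : i + j = n) {x : X.VC}
    {y : Y.VC} (hx : x ∈ X.F i) (hy : y ∈ Y.F j) : cxMul K X.V Y.V x y ∈ tensF X Y n := by
  obtain rfl : j = n - i := by omega
  exact Submodule.mem_iSup_of_mem i (Submodule.apply_mem_map₂ _ hx hy)

theorem tensW_le {X Y : BifilteredSpace K} {n : ℤ} {P : Submodule K (X.V ⊗[K] Y.V)}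
    (h : ∀ i j, i + j = n → ∀ x ∈ X.W i, ∀ y ∈ Y.W j, x ⊗ₜ[K] y ∈ P) : tensW X Y n ≤ P :=
  iSup_le fun i => Submodule.map₂_le.2 fun x hx y hy => h i (n - i) (by omega) x hx y hy

theorem tensF_le {X Y : BifilteredSpace K} {n : ℤ} {P : Submodule ℂ (ℂ ⊗[K] (X.V ⊗[K] Y.V))}
    (h : ∀ i j, i + j = n → ∀ x ∈ X.F i, ∀ y ∈ Y.F j, cxMul K X.V Y.V x y ∈ P) :
    tensF X Y n ≤ P :=
  iSup_le fun i => Submodule.map₂_le.2 fun x hx y hy => h i (n - i) (by omega) x hx y hy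

/-- The tensor product with the usual filtrations. -/
noncomputable abbrev tensor (X Y : BifilteredSpace K) : BifilteredSpace K where
  V := X.V ⊗[K] Y.V
  W := tensW X Y
  W_mono _ b hab := tensW_le fun i _ h _ hx _ hy => tmul_mem_tensW (i := i) (j := b - i)
    (by omega) hx (Y.W_mono (by omega) hy)
  F := tensF X Y
  F_anti a _ hab := tensF_le fun i _ h _ hx _ hy => cxMul_mem_tensF (i := i) (j := a - i)
    (by omega) hx (Y.F_anti (by omega) hy)

/-- The unit object `K(0)`, of weight `0` and type `(0, 0)`. -/
noncomputable abbrev unit : BifilteredSpace K where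
  V := K
  W n := if 0 ≤ n then ⊤ else ⊥
  W_mono a b h := by
    by_cases h0 : 0 ≤ a
    · simp [h0, h0.trans h]
    · simp [h0]
  F p := if p ≤ 0 then ⊤ else ⊥
  F_anti a b h := by
    by_cases h0 : b ≤ 0
    · simp [h0, h.trans h0]
    · simp [h0]

theorem mem_of_eq {R M : Type*} [Semiring R] [AddCommMonoid M] [Module R M] {P : Submodule R M}
    {a b : M} (h : a = b) (hb : b ∈ P) : a ∈ P := h ▸ hb

theorem baseChange_cxMul {V V' U U' : Type*} [AddCommGroup V] [Module K V] [AddCommGroup V']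
    [Module K V'] [AddCommGroup U] [Module K U] [AddCommGroup U'] [Module K U']
    (f : V →ₗ[K] U) (g : V' →ₗ[K] U') (x : ℂ ⊗[K] V) (y : ℂ ⊗[K] V') :
    (TensorProduct.map f g).baseChange ℂ (cxMul K V V' x y) =
      cxMul K U U' (f.baseChange ℂ x) (g.baseChange ℂ y) := by
  induction x using TensorProduct.induction_on with
  | zero => simp
  | add x₁ x₂ h₁ h₂ => simp only [map_add, LinearMap.add_apply, h₁, h₂]
  | tmul a v =>
    induction y using TensorProduct.induction_on with
    | zero => simp
    | add y₁ y₂ h₁ h₂ => simp only [map_add, h₁, h₂]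
    | tmul b w => simp

/-- The tensor product of morphisms. -/
noncomputable def tensorMap {X₁ Y₁ X₂ Y₂ : BifilteredSpace K} (f : X₁ ⟶ Y₁) (g : X₂ ⟶ Y₂) :
    tensor X₁ X₂ ⟶ tensor Y₁ Y₂ :=
  mkHom (TensorProduct.map (lin f) (lin g))
    (fun n => by
      change tensW X₁ X₂ n ≤ (tensW Y₁ Y₂ n).comap _
      exact tensW_le fun i j h x hx y hy => tmul_mem_tensW h (lin_W f hx) (lin_W g hy))
    (fun p => by
      change tensF X₁ X₂ p ≤ (tensF Y₁ Y₂ p).comap _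
      exact tensF_le fun i j h x hx y hy => mem_of_eq
        (P := tensF Y₁ Y₂ p) (baseChange_cxMul (lin f) (lin g) x y) (cxMul_mem_tensF h (lin_F f hx) (lin_F g hy)))

/-- An isomorphism from a linear equivalence compatible with the filtrations both ways. -/
def mkIso {X Y : BifilteredSpace K} (e : X.V ≃ₗ[K] Y.V)
    (hW : ∀ n, X.W n ≤ (Y.W n).comap e.toLinearMap)
    (hW' : ∀ n, Y.W n ≤ (X.W n).comap e.symm.toLinearMap)
    (hF : ∀ p, X.F p ≤ (Y.F p).comap (e.toLinearMap.baseChange ℂ))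
    (hF' : ∀ p, Y.F p ≤ (X.F p).comap (e.symm.toLinearMap.baseChange ℂ)) : X ≅ Y where
  hom := mkHom e.toLinearMap (fun n _ h => hW n h) (fun p _ h => hF p h)
  inv := mkHom e.symm.toLinearMap (fun n _ h => hW' n h) (fun p _ h => hF' p h)
  hom_inv_id := by ext; simp
  inv_hom_id := by ext; simp

@[simp] theorem lin_mkIso_hom {X Y : BifilteredSpace K} (e : X.V ≃ₗ[K] Y.V) (h₁ h₂ h₃ h₄) :
    lin (mkIso (X := X) (Y := Y) e h₁ h₂ h₃ h₄).hom = e.toLinearMap := rfl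

theorem assoc_cxMul {V V' V'' : Type*} [AddCommGroup V] [Module K V] [AddCommGroup V']
    [Module K V'] [AddCommGroup V''] [Module K V''] (x : ℂ ⊗[K] V) (y : ℂ ⊗[K] V')
    (z : ℂ ⊗[K] V'') :
    (TensorProduct.assoc K V V' V'').toLinearMap.baseChange ℂ
      (cxMul K (V ⊗[K] V') V'' (cxMul K V V' x y) z) =
      cxMul K V (V' ⊗[K] V'') x (cxMul K V' V'' y z) := by
  induction x using TensorProduct.induction_on with
  | zero => simp
  | add x₁ x₂ h₁ h₂ => simp only [map_add, LinearMap.add_apply, h₁, h₂]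
  | tmul a v =>
    induction y using TensorProduct.induction_on with
    | zero => simp
    | add y₁ y₂ h₁ h₂ => simp only [map_add, LinearMap.add_apply, h₁, h₂]
    | tmul b w =>
      induction z using TensorProduct.induction_on with
      | zero => simp
      | add z₁ z₂ h₁ h₂ => simp only [map_add, h₁, h₂]
      | tmul c t => simp [mul_assoc]

theorem assoc_symm_cxMul {V V' V'' : Type*} [AddCommGroup V] [Module K V] [AddCommGroup V']
    [Module K V'] [AddCommGroup V''] [Module K V''] (x : ℂ ⊗[K] V) (y : ℂ ⊗[K] V')
    (z : ℂ ⊗[K] V'') :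
    (TensorProduct.assoc K V V' V'').symm.toLinearMap.baseChange ℂ
      (cxMul K V (V' ⊗[K] V'') x (cxMul K V' V'' y z)) =
      cxMul K (V ⊗[K] V') V'' (cxMul K V V' x y) z := by
  rw [← assoc_cxMul, ← LinearMap.comp_apply, ← LinearMap.baseChange_comp]
  simp

theorem comm_cxMul {V V' : Type*} [AddCommGroup V] [Module K V] [AddCommGroup V']
    [Module K V'] (x : ℂ ⊗[K] V) (y : ℂ ⊗[K] V') :
    (TensorProduct.comm K V V').toLinearMap.baseChange ℂ (cxMul K V V' x y) =
      cxMul K V' V y x := by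
  induction x using TensorProduct.induction_on with
  | zero => simp
  | add x₁ x₂ h₁ h₂ => simp only [map_add, LinearMap.add_apply, h₁, h₂]
  | tmul a v =>
    induction y using TensorProduct.induction_on with
    | zero => simp
    | add y₁ y₂ h₁ h₂ => simp only [map_add, LinearMap.add_apply, h₁, h₂]
    | tmul b w => simp [mul_comm]

theorem lid_cxMul {V : Type*} [AddCommGroup V] [Module K V] (c : ℂ) (r : K) (y : ℂ ⊗[K] V) :
    (TensorProduct.lid K V).toLinearMap.baseChange ℂ (cxMul K K V (c ⊗ₜ r) y) = (r • c) • y := by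
  induction y using TensorProduct.induction_on with
  | zero => simp
  | add y₁ y₂ h₁ h₂ => simp only [map_add, smul_add, h₁, h₂]
  | tmul b w => simp [TensorProduct.smul_tmul']

theorem lid_symm_baseChange {V : Type*} [AddCommGroup V] [Module K V] (y : ℂ ⊗[K] V) :
    (TensorProduct.lid K V).symm.toLinearMap.baseChange ℂ y = cxMul K K V (1 ⊗ₜ 1) y := by
  induction y using TensorProduct.induction_on with
  | zero => simp
  | add y₁ y₂ h₁ h₂ => simp only [map_add, h₁, h₂]
  | tmul b w => simp

/-- The associativity constraint. -/
noncomputable def assoc (X Y Z : BifilteredSpace K) :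
    tensor (tensor X Y) Z ≅ tensor X (tensor Y Z) :=
  mkIso (X := tensor (tensor X Y) Z) (Y := tensor X (tensor Y Z)) (TensorProduct.assoc K X.V Y.V Z.V)
    (fun n => tensW_le (X := tensor X Y) fun i j h t ht z hz => by
      revert t
      change tensW X Y i ≤ Submodule.comap ((TensorProduct.mk K _ _).flip z)
        (Submodule.comap (TensorProduct.assoc K X.V Y.V Z.V).toLinearMap (tensW X (tensor Y Z) n))
      exact tensW_le fun a b hab x hx y hy => tmul_mem_tensW (Y := tensor Y Z) (i := a) (j := b + j)
        (by omega) hx (tmul_mem_tensW rfl hy hz))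
    (fun n => tensW_le (Y := tensor Y Z) fun i j h x hx t ht => by
      revert t
      change tensW Y Z j ≤ Submodule.comap (TensorProduct.mk K _ _ x)
        (Submodule.comap (TensorProduct.assoc K X.V Y.V Z.V).symm.toLinearMap
          (tensW (tensor X Y) Z n))
      exact tensW_le fun a b hab y hy z hz => tmul_mem_tensW (X := tensor X Y) (i := i + a) (j := b)
        (by omega) (tmul_mem_tensW rfl hx hy) hz)
    (fun n => tensF_le (X := tensor X Y) fun i j h t ht z hz => by
      revert t
      change tensF X Y i ≤ Submodule.comap ((cxMul K _ _).flip z)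
        (Submodule.comap ((TensorProduct.assoc K X.V Y.V Z.V).toLinearMap.baseChange ℂ)
          (tensF X (tensor Y Z) n))
      exact tensF_le fun a b hab x hx y hy => mem_of_eq
        (P := tensF X (tensor Y Z) n) (assoc_cxMul x y z)
        (cxMul_mem_tensF (Y := tensor Y Z) (i := a) (j := b + j) (n := n)
          (by omega) hx (cxMul_mem_tensF rfl hy hz)))
    (fun n => tensF_le (Y := tensor Y Z) fun i j h x hx t ht => by
      revert t
      change tensF Y Z j ≤ Submodule.comap (cxMul K _ _ x)
        (Submodule.comap ((TensorProduct.assoc K X.V Y.V Z.V).symm.toLinearMap.baseChange ℂ)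
          (tensF (tensor X Y) Z n))
      exact tensF_le fun a b hab y hy z hz => mem_of_eq
        (P := tensF (tensor X Y) Z n) (assoc_symm_cxMul x y z)
        (cxMul_mem_tensF (X := tensor X Y) (i := i + a) (j := b) (n := n)
          (by omega) (cxMul_mem_tensF rfl hx hy) hz))

/-- The commutativity constraint. -/
noncomputable def comm (X Y : BifilteredSpace K) : tensor X Y ≅ tensor Y X :=
  mkIso (X := tensor X Y) (Y := tensor Y X) (TensorProduct.comm K X.V Y.V)
    (fun _ => tensW_le fun i j h _ hx _ hy =>
      tmul_mem_tensW (i := j) (j := i) (by omega) hy hx)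
    (fun _ => tensW_le fun i j h _ hx _ hy =>
      tmul_mem_tensW (i := j) (j := i) (by omega) hy hx)
    (fun p => tensF_le fun i j h _ hx _ hy => mem_of_eq (P := tensF Y X p) (comm_cxMul _ _)
      (cxMul_mem_tensF (i := j) (j := i) (by omega) hy hx))
    (fun p => tensF_le fun i j h _ hx _ hy => mem_of_eq (P := tensF X Y p) (comm_cxMul _ _)
      (cxMul_mem_tensF (i := j) (j := i) (by omega) hy hx))

theorem unit_W_of_lt {i : ℤ} (h : ¬ 0 ≤ i) {x : K} (hx : x ∈ (unit (K := K)).W i) : x = 0 := by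
  rw [show (unit (K := K)).W i = ⊥ from if_neg h] at hx
  exact hx

theorem unit_F_of_lt {i : ℤ} (h : ¬ i ≤ 0) {x : ℂ ⊗[K] K} (hx : x ∈ (unit (K := K)).F i) :
    x = 0 := by
  rw [show (unit (K := K)).F i = ⊥ from if_neg h] at hx
  exact hx

theorem lid_cxMul_mem {V : Type*} [AddCommGroup V] [Module K V] (P : Submodule ℂ (ℂ ⊗[K] V))
    (x : ℂ ⊗[K] K) {y : ℂ ⊗[K] V} (hy : y ∈ P) :
    (TensorProduct.lid K V).toLinearMap.baseChange ℂ (cxMul K K V x y) ∈ P := by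
  induction x using TensorProduct.induction_on with
  | zero => simp
  | add x₁ x₂ h₁ h₂ => rw [map_add, LinearMap.add_apply, map_add]; exact add_mem h₁ h₂
  | tmul c r => rw [lid_cxMul]; exact Submodule.smul_mem _ _ hy

/-- The left unit constraint. -/
noncomputable def leftUnit (X : BifilteredSpace K) : tensor unit X ≅ X :=
  mkIso (X := tensor unit X) (Y := X) (TensorProduct.lid K X.V)
    (fun n => tensW_le (X := unit) fun i j h x hx y hy => by
      by_cases h0 : 0 ≤ i
      · exact Submodule.smul_mem _ _ (X.W_mono (by omega) hy)
      · rw [unit_W_of_lt h0 hx]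
        exact mem_of_eq (by rw [TensorProduct.zero_tmul]) (zero_mem _))
    (fun n y hy => tmul_mem_tensW (X := unit) (i := 0) (j := n) (by omega)
      (mem_of_eq rfl Submodule.mem_top) hy)
    (fun n => tensF_le (X := unit) fun i j h x hx y hy => by
      by_cases h0 : i ≤ 0
      · exact lid_cxMul_mem _ x (X.F_anti (by omega) hy)
      · rw [unit_F_of_lt h0 hx]
        exact mem_of_eq (by rw [map_zero, LinearMap.zero_apply]) (zero_mem _))
    (fun n y hy => mem_of_eq (P := tensF unit X n) (lid_symm_baseChange y)
      (cxMul_mem_tensF (X := unit) (i := 0) (j := n) (by omega)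
        (mem_of_eq rfl Submodule.mem_top) hy))

noncomputable instance : MonoidalCategoryStruct (BifilteredSpace K) where
  tensorObj := tensor
  tensorHom f g := tensorMap f g
  whiskerLeft X _ _ f := tensorMap (𝟙 X) f
  whiskerRight f Y := tensorMap f (𝟙 Y)
  tensorUnit := unit
  associator := assoc
  leftUnitor := leftUnit
  rightUnitor X := comm X unit ≪≫ leftUnit X

noncomputable instance : MonoidalCategory (BifilteredSpace K) :=
  Monoidal.induced forget
    { μIso _ _ := Iso.refl _
      εIso := Iso.refl _
      whiskerLeft_eq _ _ _ _ := by rfl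
      whiskerRight_eq _ _ := by rfl
      tensorHom_eq _ _ := by rfl
      associator_eq X Y Z := by
        ext : 1
        refine TensorProduct.ext_threefold fun x y z => ?_
        rfl
      leftUnitor_eq X := by
        ext : 1
        refine TensorProduct.ext' fun x y => ?_
        rfl
      rightUnitor_eq X := by
        ext : 1
        refine TensorProduct.ext' fun x y => ?_
        rfl }

noncomputable instance : (forget (K := K)).Monoidal :=
  Monoidal.fromInducedMonoidal _ _

noncomputable instance : BraidedCategory (BifilteredSpace K) :=
  BraidedCategory.ofFaithful forget comm fun X Y => by
    ext : 1
    refine TensorProduct.ext' fun x y => ?_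
    rfl

noncomputable instance : SymmetricCategory (BifilteredSpace K) where
  symmetry X Y := by
    ext : 1
    refine TensorProduct.ext' fun x y => ?_
    rfl

end BifilteredSpace
end Bifiltered
end NonabelianHodge

namespace NonabelianHodge

section MixedHodge

variable (K : Type u) [Field K] [Algebra K ℝ]

/-- `(W, F)` is a `K`-mixed Hodge structure: `W` is finite, and `F` induces a Hodge structure of
weight `n` on `Gr_n^W`, for every `n`. -/
def isMHS : ObjectProperty (BifilteredSpace K) := fun X =>
  (∃ n, X.W n = ⊤) ∧ (∃ n, X.W n = ⊥) ∧
    ∀ n, IsHodgeStructure K (X.WC n) (X.WC (n - 1)) (fun p => X.F p ⊓ X.WC n ⊔ X.WC (n - 1)) n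

/-- The category of `K`-mixed Hodge structures (on finite-dimensional spaces). -/
abbrev MHS := (isMHS K).FullSubcategory

end MixedHodge

section DGA

/-- Cohomologically connected differential graded algebras over `k`, graded commutative and
concentrated in non-negative degrees. -/
structure DGA (k : Type v) [Field k] : Type (max v (u + 1)) where
  carrier : Type u
  [ring : Ring carrier]
  [alg : Algebra k carrier]
  gr : ℕ → Submodule k carrier
  [graded : GradedAlgebra gr]
  d : carrier →ₗ[k] carrier
  d_mem : ∀ n, ∀ x ∈ gr n, d x ∈ gr (n + 1)
  d_d : ∀ x, d (d x) = 0
  comm : ∀ p q, ∀ x ∈ gr p, ∀ y ∈ gr q, y * x = (-1 : carrier) ^ (p * q) * (x * y)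
  leibniz : ∀ p, ∀ x ∈ gr p, ∀ y, d (x * y) = d x * y + (-1 : carrier) ^ p * (x * d y)
  one_ne_zero : (1 : carrier) ≠ 0
  connected : ∀ x ∈ gr 0, d x = 0 → ∃ c : k, x = algebraMap k carrier c

namespace DGA

attribute [instance] ring alg graded

variable {k : Type v} [Field k]

/-- The coboundaries of degree `n`. -/
def coboundaries (A : DGA.{u} k) : ℕ → Submodule k A.carrier
  | 0 => ⊥
  | n + 1 => (A.gr n).map A.d

theorem one_mem (A : DGA.{u} k) : (1 : A.carrier) ∈ A.gr 0 := SetLike.GradedOne.one_mem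

theorem d_one (A : DGA.{u} k) : A.d 1 = 0 := by
  have h := A.leibniz 0 1 A.one_mem 1
  simpa using h

/-- The map `f` is injective on the `n`-th cohomology. -/
def InjOnH (A B : DGA.{u} k) (f : A.carrier → B.carrier) (n : ℕ) : Prop :=
  ∀ x ∈ A.gr n, A.d x = 0 → f x ∈ B.coboundaries n → x ∈ A.coboundaries n

/-- The map `f` is surjective on the `n`-th cohomology. -/
def SurjOnH (A B : DGA.{u} k) (f : A.carrier → B.carrier) (n : ℕ) : Prop :=
  ∀ y ∈ B.gr n, B.d y = 0 → ∃ x ∈ A.gr n, A.d x = 0 ∧ y - f x ∈ B.coboundaries n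

/-- Morphisms of differential graded algebras. -/
structure IsMorphism (A B : DGA.{u} k) (f : A.carrier →ₐ[k] B.carrier) : Prop where
  map_gr : ∀ n, ∀ x ∈ A.gr n, f x ∈ B.gr n
  map_d : ∀ x, f (A.d x) = B.d (f x)

/-- `1`-quasi-isomorphisms: morphisms inducing isomorphisms on `H⁰`, `H¹` and an injection on
`H²`. -/
structure IsOneQuasiIso (A B : DGA.{u} k) (f : A.carrier →ₐ[k] B.carrier) : Prop
    extends IsMorphism A B f where
  inj₀ : InjOnH A B f 0
  surj₀ : SurjOnH A B f 0
  inj₁ : InjOnH A B f 1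
  surj₁ : SurjOnH A B f 1
  inj₂ : InjOnH A B f 2

/-- `Vs 0, Vs 1, …` are the spaces `𝒱₁, 𝒱₂, …` exhibiting `M` as a `1`-minimal algebra:
`M` is the exterior algebra on `M¹ = ⨁ 𝒱ᵢ`, and `d 𝒱ᵢ` lies in the subalgebra generated by the
`𝒱ⱼ` with `j < i`. -/
structure IsOneMinimal (M : DGA.{u} k) (Vs : ℕ → Submodule k M.carrier) : Prop where
  free : ∃ e : ExteriorAlgebra k (M.gr 1) ≃ₐ[k] M.carrier,
    ∀ x : M.gr 1, e (ExteriorAlgebra.ι k x) = x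
  indep : iSupIndep Vs
  iSup_eq : ⨆ i, Vs i = M.gr 1
  d_mem_adjoin : ∀ i, ∀ x ∈ Vs i,
    M.d x ∈ Algebra.adjoin k (⋃ j ∈ Set.Iio i, (Vs j : Set M.carrier))

/-- `Vs` is a canonical sequence for `f : N → B`: writing `N_n` for the subalgebra generated by
`Vs 0, …, Vs (n - 1)`, the map `f` induces an isomorphism from `Vs 0` to `H¹(B)`, and `d` induces
an isomorphism from `Vs n` to the kernel of `H²(N_n) → H²(B)` for `n ≥ 1`. -/
structure IsCanonicalSequence (N B : DGA.{u} k) (f : N.carrier →ₐ[k] B.carrier)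
    (Vs : ℕ → Submodule k N.carrier) : Prop extends IsOneMinimal N Vs where
  inj₁ : ∀ x ∈ Vs 0, f x ∈ B.coboundaries 1 → x = 0
  surj₁ : ∀ y ∈ B.gr 1, B.d y = 0 → ∃ x ∈ Vs 0, y - f x ∈ B.coboundaries 1
  inj₂ : ∀ n ≠ 0, ∀ x ∈ Vs n, (∃ y ∈ ⨆ j ∈ Set.Iio n, Vs j, N.d x = N.d y) → x = 0
  surj₂ : ∀ n ≠ 0, ∀ z ∈ N.gr 2, z ∈ Algebra.adjoin k (⋃ j ∈ Set.Iio n, (Vs j : Set N.carrier)) →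
    N.d z = 0 → f z ∈ B.coboundaries 2 →
      ∃ x ∈ Vs n, ∃ y ∈ ⨆ j ∈ Set.Iio n, Vs j, z = N.d x + N.d y

end DGA

/-- Increasing filtrations `W` on a differential graded algebra (`W i n` is the part of `W_i` in
degree `n`) compatible with the differential and the multiplication. -/
structure WeightFiltration {k : Type v} [Field k] (A : DGA.{u} k) where
  W : ℤ → ℕ → Submodule k A.carrier
  le_gr : ∀ i n, W i n ≤ A.gr n
  mono : ∀ n, Monotone fun i => W i n
  exhaustive : ∀ n, ∀ x ∈ A.gr n, ∃ i, x ∈ W i n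
  d_mem : ∀ i n, ∀ x ∈ W i n, A.d x ∈ W i (n + 1)
  one_mem : 1 ∈ W 0 0
  mul_mem : ∀ i j m n, ∀ x ∈ W i m, ∀ y ∈ W j n, x * y ∈ W (i + j) (m + n)

/-- Decreasing filtrations `F` on a differential graded algebra, finite in every degree, and
compatible with the differential and the multiplication. -/
structure HodgeFiltration {k : Type v} [Field k] (B : DGA.{u} k) where
  F : ℤ → ℕ → Submodule k B.carrier
  le_gr : ∀ p n, F p n ≤ B.gr n
  anti : ∀ n, Antitone fun p => F p n
  eventually_top : ∀ n, ∃ p, F p n = B.gr n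
  eventually_bot : ∀ n, ∃ p, F p n = ⊥
  d_mem : ∀ p n, ∀ x ∈ F p n, B.d x ∈ F p (n + 1)
  one_mem : 1 ∈ F 0 0
  mul_mem : ∀ p q m n, ∀ x ∈ F p m, ∀ y ∈ F q n, x * y ∈ F (p + q) (m + n)

namespace WeightFiltration

variable {k : Type v} [Field k] {A : DGA.{u} k} (𝒲 : WeightFiltration A)

/-- The cycles of `E₀` in degree `n` and weight `l`: `E₁^{-l,n+l} = Hⁿ(Gr_l^W A)` is the quotient
`cycles l n / boundaries l n`. -/
def cycles (l : ℤ) (n : ℕ) : Submodule k A.carrier :=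
  𝒲.W l n ⊓ (𝒲.W (l - 1) (n + 1)).comap A.d

/-- The image of `W_l` of degree `n - 1` in degree `n`. -/
def dW (l : ℤ) : ℕ → Submodule k A.carrier
  | 0 => ⊥
  | n + 1 => (𝒲.W l n).map A.d

/-- The boundaries of `E₀` in degree `n` and weight `l`. -/
def boundaries (l : ℤ) (n : ℕ) : Submodule k A.carrier := 𝒲.W (l - 1) n ⊔ 𝒲.dW l n

end WeightFiltration

variable (K : Type u) [Field K] [Algebra K ℝ]

/-- `K`-mixed Hodge diagrams. -/
structure MixedHodgeDiagram : Type (u + 1) where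
  A : DGA.{u} K
  WA : WeightFiltration A
  B : DGA.{u} ℂ
  WB : WeightFiltration B
  FB : HodgeFiltration B
  WA_neg : ∀ n, WA.W (-1) n = ⊥
  WB_neg : ∀ n, WB.W (-1) n = ⊥
  /-- The map `ι : A_ℂ → B`. -/
  ι : ℂ ⊗[K] A.carrier →ₐ[ℂ] B.carrier
  ι_d : ∀ x, ι (A.d.baseChange ℂ x) = B.d (ι x)
  ι_W : ∀ i n, (WA.W i n).baseChange ℂ ≤ (WB.W i n).comap ι.toLinearMap
  /-- `ι` is injective on `E₁`. -/
  inj_E₁ : ∀ l n, (WA.cycles l n).baseChange ℂ ⊓ (WB.boundaries l n).comap ι.toLinearMap =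
    (WA.boundaries l n).baseChange ℂ
  /-- `ι` is surjective on `E₁`. -/
  surj_E₁ : ∀ l n, ((WA.cycles l n).baseChange ℂ).map ι.toLinearMap ⊔ WB.boundaries l n =
    WB.cycles l n
  /-- The differential of `E₀(B)` is strictly compatible with `F`. -/
  strict_E₀ : ∀ l p n, (FB.F p (n + 1) ⊓ WB.W l (n + 1) ⊔ WB.W (l - 1) (n + 1)) ⊓
      WB.boundaries l (n + 1) ≤
    (FB.F p n ⊓ WB.W l n).map B.d ⊔ WB.W (l - 1) (n + 1)
  /-- The filtration induced by `F` is a Hodge structure of weight `n + l` on `E₁^{-l,n+l}`. -/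
  hodge_E₁ : ∀ l (n : ℕ), IsHodgeStructure K ((WA.cycles l n).baseChange ℂ)
    ((WA.boundaries l n).baseChange ℂ)
    (fun p => (WA.cycles l n).baseChange ℂ ⊓
      ((FB.F p n ⊓ WB.cycles l n) ⊔ WB.boundaries l n).comap ι.toLinearMap) (n + l)

end DGA
end NonabelianHodge

namespace NonabelianHodge

section Forms

variable {k : Type v} [Field k]
variable {V₁ V₂ V₃ V₄ : Type*} [AddCommGroup V₁] [Module k V₁] [AddCommGroup V₂] [Module k V₂]
  [AddCommGroup V₃] [Module k V₃] [AddCommGroup V₄] [Module k V₄]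

/-- The product `(x ⊗ f) (y ⊗ g) = xy ⊗ (f ∘ g)` of forms with values in spaces of linear maps. -/
noncomputable def wedge {A : Type u} [Ring A] [Algebra k A] (x : A ⊗[k] (V₂ →ₗ[k] V₃))
    (y : A ⊗[k] (V₁ →ₗ[k] V₂)) : A ⊗[k] (V₁ →ₗ[k] V₃) :=
  TensorProduct.map₂ (LinearMap.mul k A) (LinearMap.llcomp k V₁ V₂ V₃) x y

section wedge

variable {A B : Type u} [Ring A] [Algebra k A] [Ring B] [Algebra k B]

@[simp] theorem wedge_tmul (x y : A) (f : V₂ →ₗ[k] V₃) (g : V₁ →ₗ[k] V₂) :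
    wedge (x ⊗ₜ[k] f) (y ⊗ₜ[k] g) = (x * y) ⊗ₜ[k] (f ∘ₗ g) := rfl

theorem wedge_add (x : A ⊗[k] (V₂ →ₗ[k] V₃)) (y y' : A ⊗[k] (V₁ →ₗ[k] V₂)) :
    wedge x (y + y') = wedge x y + wedge x y' := map_add _ _ _
theorem add_wedge (x x' : A ⊗[k] (V₂ →ₗ[k] V₃)) (y : A ⊗[k] (V₁ →ₗ[k] V₂)) :
    wedge (x + x') y = wedge x y + wedge x' y := by simp [wedge]
theorem wedge_sub (x : A ⊗[k] (V₂ →ₗ[k] V₃)) (y y' : A ⊗[k] (V₁ →ₗ[k] V₂)) :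
    wedge x (y - y') = wedge x y - wedge x y' := map_sub _ _ _
theorem sub_wedge (x x' : A ⊗[k] (V₂ →ₗ[k] V₃)) (y : A ⊗[k] (V₁ →ₗ[k] V₂)) :
    wedge (x - x') y = wedge x y - wedge x' y := by simp [wedge]
theorem wedge_smul (c : k) (x : A ⊗[k] (V₂ →ₗ[k] V₃)) (y : A ⊗[k] (V₁ →ₗ[k] V₂)) :
    wedge x (c • y) = c • wedge x y := map_smul _ _ _
theorem smul_wedge (c : k) (x : A ⊗[k] (V₂ →ₗ[k] V₃)) (y : A ⊗[k] (V₁ →ₗ[k] V₂)) :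
    wedge (c • x) y = c • wedge x y := by simp [wedge]
@[simp] theorem wedge_zero (x : A ⊗[k] (V₂ →ₗ[k] V₃)) :
    wedge x (0 : A ⊗[k] (V₁ →ₗ[k] V₂)) = 0 := map_zero _
@[simp] theorem zero_wedge (y : A ⊗[k] (V₁ →ₗ[k] V₂)) :
    wedge (0 : A ⊗[k] (V₂ →ₗ[k] V₃)) y = 0 := by simp [wedge]

theorem wedge_assoc (x : A ⊗[k] (V₃ →ₗ[k] V₄)) (y : A ⊗[k] (V₂ →ₗ[k] V₃))
    (z : A ⊗[k] (V₁ →ₗ[k] V₂)) : wedge (wedge x y) z = wedge x (wedge y z) := by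
  induction x using TensorProduct.induction_on with
  | zero => simp
  | add x₁ x₂ h₁ h₂ => simp only [add_wedge, h₁, h₂]
  | tmul a f =>
    induction y using TensorProduct.induction_on with
    | zero => simp
    | add y₁ y₂ h₁ h₂ => simp only [add_wedge, wedge_add, h₁, h₂]
    | tmul b g =>
      induction z using TensorProduct.induction_on with
      | zero => simp
      | add z₁ z₂ h₁ h₂ => simp only [wedge_add, h₁, h₂]
      | tmul c h => simp [mul_assoc, LinearMap.comp_assoc]

@[simp] theorem one_wedge (y : A ⊗[k] (V₁ →ₗ[k] V₂)) :
    wedge ((1 : A) ⊗ₜ[k] (LinearMap.id : V₂ →ₗ[k] V₂)) y = y := by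
  induction y using TensorProduct.induction_on with
  | zero => simp
  | add y₁ y₂ h₁ h₂ => simp only [wedge_add, h₁, h₂]
  | tmul b g => simp

@[simp] theorem wedge_one (y : A ⊗[k] (V₁ →ₗ[k] V₂)) :
    wedge y ((1 : A) ⊗ₜ[k] (LinearMap.id : V₁ →ₗ[k] V₁)) = y := by
  induction y using TensorProduct.induction_on with
  | zero => simp
  | add y₁ y₂ h₁ h₂ => simp only [add_wedge, h₁, h₂]
  | tmul b g => simp

theorem tens_le {M N : Type*} [AddCommGroup M] [Module k M] [AddCommGroup N]
    [Module k N] {P : Submodule k M} {Q : Submodule k N} {R : Submodule k (M ⊗[k] N)}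
    (h : ∀ x ∈ P, ∀ y ∈ Q, x ⊗ₜ[k] y ∈ R) : tens k P Q ≤ R := Submodule.map₂_le.2 h

theorem tmul_mem_tens {M N : Type*} [AddCommGroup M] [Module k M] [AddCommGroup N]
    [Module k N] {P : Submodule k M} {Q : Submodule k N} {x : M} {y : N} (hx : x ∈ P)
    (hy : y ∈ Q) : x ⊗ₜ[k] y ∈ tens k P Q := Submodule.apply_mem_map₂ _ hx hy

theorem wedge_mem {P P' P'' : Submodule k A} {Q : Submodule k (V₂ →ₗ[k] V₃)}
    {Q' : Submodule k (V₁ →ₗ[k] V₂)} {Q'' : Submodule k (V₁ →ₗ[k] V₃)}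
    (hP : ∀ x ∈ P, ∀ y ∈ P', x * y ∈ P'') (hQ : ∀ f ∈ Q, ∀ g ∈ Q', f ∘ₗ g ∈ Q'')
    {x : A ⊗[k] (V₂ →ₗ[k] V₃)} {y : A ⊗[k] (V₁ →ₗ[k] V₂)} (hx : x ∈ tens k P Q)
    (hy : y ∈ tens k P' Q') : wedge x y ∈ tens k P'' Q'' := by
  have h : tens k P Q ≤ (tens k P'' Q'').comap ((TensorProduct.map₂ (LinearMap.mul k A)
      (LinearMap.llcomp k V₁ V₂ V₃)).flip y) := by
    refine tens_le fun a ha f hf => ?_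
    have h' : tens k P' Q' ≤ (tens k P'' Q'').comap (TensorProduct.map₂ (LinearMap.mul k A)
        (LinearMap.llcomp k V₁ V₂ V₃) (a ⊗ₜ f)) :=
      tens_le fun b hb g hg => tmul_mem_tens (hP a ha b hb) (hQ f hf g hg)
    exact h' hy
  exact h hx

/-- Applying a linear map to the coefficients of a form. -/
noncomputable def mapForm (f : A →ₗ[k] B) : A ⊗[k] (V₁ →ₗ[k] V₂) →ₗ[k] B ⊗[k] (V₁ →ₗ[k] V₂) :=
  f.rTensor _

@[simp] theorem mapForm_tmul (f : A →ₗ[k] B) (x : A) (g : V₁ →ₗ[k] V₂) :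
    mapForm f (x ⊗ₜ[k] g) = f x ⊗ₜ[k] g := rfl

theorem mapForm_wedge (f : A →ₐ[k] B) (x : A ⊗[k] (V₂ →ₗ[k] V₃)) (y : A ⊗[k] (V₁ →ₗ[k] V₂)) :
    mapForm f.toLinearMap (wedge x y) =
      wedge (mapForm f.toLinearMap x) (mapForm f.toLinearMap y) := by
  induction x using TensorProduct.induction_on with
  | zero => simp
  | add x₁ x₂ h₁ h₂ => simp only [add_wedge, map_add, h₁, h₂]
  | tmul a f =>
    induction y using TensorProduct.induction_on with
    | zero => simp
    | add y₁ y₂ h₁ h₂ => simp only [wedge_add, map_add, h₁, h₂]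
    | tmul b g => simp

theorem mapForm_mem {f : A →ₗ[k] B} {P : Submodule k A} {P' : Submodule k B}
    {Q : Submodule k (V₁ →ₗ[k] V₂)} (h : ∀ x ∈ P, f x ∈ P') {x : A ⊗[k] (V₁ →ₗ[k] V₂)}
    (hx : x ∈ tens k P Q) : mapForm f x ∈ tens k P' Q :=
  (show tens k P Q ≤ (tens k P' Q).comap (mapForm f) from
    tens_le fun a ha _ hg => tmul_mem_tens (h a ha) hg) hx

theorem mapForm_comp {A' : Type u} [Ring A'] [Algebra k A'] (f : A →ₗ[k] B) (g : B →ₗ[k] A')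
    (x : A ⊗[k] (V₁ →ₗ[k] V₂)) : mapForm g (mapForm f x) = mapForm (g ∘ₗ f) x := by
  simp [mapForm, LinearMap.rTensor_comp]

end wedge

/-- The exterior differential of forms with values in spaces of linear maps. -/
noncomputable def dForm (A : DGA.{u} k) :
    A.carrier ⊗[k] (V₁ →ₗ[k] V₂) →ₗ[k] A.carrier ⊗[k] (V₁ →ₗ[k] V₂) := mapForm A.d

@[simp] theorem dForm_tmul (A : DGA.{u} k) (x : A.carrier) (g : V₁ →ₗ[k] V₂) :
    dForm A (x ⊗ₜ[k] g) = A.d x ⊗ₜ[k] g := rfl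

theorem dForm_wedge (A : DGA.{u} k) {Q : Submodule k (V₂ →ₗ[k] V₃)}
    {x : A.carrier ⊗[k] (V₂ →ₗ[k] V₃)} (hx : x ∈ tens k (A.gr 0) Q)
    (y : A.carrier ⊗[k] (V₁ →ₗ[k] V₂)) :
    dForm A (wedge x y) = wedge (dForm A x) y + wedge x (dForm A y) := by
  let m : A.carrier ⊗[k] (V₂ →ₗ[k] V₃) →ₗ[k] A.carrier ⊗[k] (V₁ →ₗ[k] V₂) →ₗ[k]
      A.carrier ⊗[k] (V₁ →ₗ[k] V₃) :=
    TensorProduct.map₂ (LinearMap.mul k A.carrier) (LinearMap.llcomp k V₁ V₂ V₃)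
  have h : tens k (A.gr 0) Q ≤ LinearMap.eqLocus (dForm A ∘ₗ m.flip y)
      (m.flip y ∘ₗ dForm A + m.flip (dForm A y)) := by
    refine tens_le fun a ha f _ => ?_
    have h' : dForm A ∘ₗ m (a ⊗ₜ f) = m (A.d a ⊗ₜ f) + m (a ⊗ₜ f) ∘ₗ dForm A := by
      refine TensorProduct.ext' fun b g => ?_
      simp [m, A.leibniz 0 a ha b, TensorProduct.add_tmul]
    exact LinearMap.congr_fun h' y
  exact h hx

/-- The covariant derivative `db + ω₂ b - b ω₁`. -/
noncomputable def covD (A : DGA.{u} k) (ω₁ : A.carrier ⊗[k] (V₁ →ₗ[k] V₁))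
    (ω₂ : A.carrier ⊗[k] (V₂ →ₗ[k] V₂)) (b : A.carrier ⊗[k] (V₁ →ₗ[k] V₂)) :
    A.carrier ⊗[k] (V₁ →ₗ[k] V₂) := dForm A b + wedge ω₂ b - wedge b ω₁

theorem covD_wedge (A : DGA.{u} k) {ω₁ : A.carrier ⊗[k] (V₁ →ₗ[k] V₁)}
    {ω₂ : A.carrier ⊗[k] (V₂ →ₗ[k] V₂)} {ω₃ : A.carrier ⊗[k] (V₃ →ₗ[k] V₃)}
    {Q : Submodule k (V₂ →ₗ[k] V₃)}
    {c : A.carrier ⊗[k] (V₂ →ₗ[k] V₃)} (hc : c ∈ tens k (A.gr 0) Q)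
    (b : A.carrier ⊗[k] (V₁ →ₗ[k] V₂)) :
    covD A ω₁ ω₃ (wedge c b) = wedge (covD A ω₂ ω₃ c) b + wedge c (covD A ω₁ ω₂ b) := by
  simp only [covD, dForm_wedge A hc, add_wedge, sub_wedge, wedge_add, wedge_sub, wedge_assoc]
  abel

theorem covD_add (A : DGA.{u} k) (ω₁ : A.carrier ⊗[k] (V₁ →ₗ[k] V₁))
    (ω₂ : A.carrier ⊗[k] (V₂ →ₗ[k] V₂)) (b c : A.carrier ⊗[k] (V₁ →ₗ[k] V₂)) :
    covD A ω₁ ω₂ (b + c) = covD A ω₁ ω₂ b + covD A ω₁ ω₂ c := by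
  simp only [covD, map_add, add_wedge, wedge_add]
  abel

theorem covD_smul (A : DGA.{u} k) (ω₁ : A.carrier ⊗[k] (V₁ →ₗ[k] V₁))
    (ω₂ : A.carrier ⊗[k] (V₂ →ₗ[k] V₂)) (r : k) (b : A.carrier ⊗[k] (V₁ →ₗ[k] V₂)) :
    covD A ω₁ ω₂ (r • b) = r • covD A ω₁ ω₂ b := by
  simp only [covD, map_smul, smul_wedge, wedge_smul, smul_add, smul_sub]

@[simp] theorem covD_zero (A : DGA.{u} k) (ω₁ : A.carrier ⊗[k] (V₁ →ₗ[k] V₁))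
    (ω₂ : A.carrier ⊗[k] (V₂ →ₗ[k] V₂)) : covD A ω₁ ω₂ 0 = 0 := by simp [covD]

theorem covD_one_tmul (A : DGA.{u} k) {ω₁ : A.carrier ⊗[k] (V₁ →ₗ[k] V₁)}
    {ω₂ : A.carrier ⊗[k] (V₂ →ₗ[k] V₂)} {f : V₁ →ₗ[k] V₂}
    (h : wedge ω₂ (1 ⊗ₜ f) = wedge (1 ⊗ₜ f) ω₁) : covD A ω₁ ω₂ (1 ⊗ₜ f) = 0 := by
  rw [covD, h, dForm_tmul, A.d_one]; simp

end Forms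
end NonabelianHodge

namespace NonabelianHodge

section Complexification

variable (K : Type u) [Field K] [Algebra K ℝ]
variable {V₁ V₂ V₃ : Type u} [AddCommGroup V₁] [Module K V₁] [AddCommGroup V₂] [Module K V₂]
  [AddCommGroup V₃] [Module K V₃]

/-- The complexification `A ⊗ Hom(V₁, V₂) → A_ℂ ⊗ Hom(V₁_ℂ, V₂_ℂ)`, `x ⊗ f ↦ x ⊗ f_ℂ`. -/
noncomputable def cxForm {A : Type u} [Ring A] [Algebra K A] :
    A ⊗[K] (V₁ →ₗ[K] V₂) →ₗ[K] (ℂ ⊗[K] A) ⊗[ℂ] (ℂ ⊗[K] V₁ →ₗ[ℂ] ℂ ⊗[K] V₂) :=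
  TensorProduct.lift (LinearMap.mk₂ K
    (fun x f => ((1 : ℂ) ⊗ₜ[K] x) ⊗ₜ[ℂ] f.baseChange ℂ)
    (fun x y f => by simp [TensorProduct.tmul_add, TensorProduct.add_tmul])
    (fun c x f => by simp [TensorProduct.smul_tmul'])
    (fun x f g => by simp [LinearMap.baseChange_add, TensorProduct.tmul_add])
    (fun c x f => by simp [LinearMap.baseChange_smul]))

@[simp] theorem cxForm_tmul {A : Type u} [Ring A] [Algebra K A] (x : A) (f : V₁ →ₗ[K] V₂) :
    cxForm K (x ⊗ₜ[K] f) = ((1 : ℂ) ⊗ₜ[K] x) ⊗ₜ[ℂ] f.baseChange ℂ := rfl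

theorem cxForm_wedge {A : Type u} [Ring A] [Algebra K A] (x : A ⊗[K] (V₂ →ₗ[K] V₃))
    (y : A ⊗[K] (V₁ →ₗ[K] V₂)) : cxForm K (wedge x y) = wedge (cxForm K x) (cxForm K y) := by
  induction x using TensorProduct.induction_on with
  | zero => simp
  | add x₁ x₂ h₁ h₂ => simp only [add_wedge, map_add, h₁, h₂]
  | tmul a f =>
    induction y using TensorProduct.induction_on with
    | zero => simp
    | add y₁ y₂ h₁ h₂ => simp only [wedge_add, map_add, h₁, h₂]
    | tmul b g => simp [LinearMap.baseChange_comp]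

end Complexification

section Homotopy

/-- Homotopies `H : N → B ⊗ (t, dt)` from `f₀` to `f₁`, linear over `σ`.  An element of
`B ⊗ (t, dt)` is written `α + β dt` with `α, β` polynomials in `t` with coefficients in `B`; thus
`H x = α x + β x dt`.  As `dt` has degree one, `(α + β dt) (α' + β' dt)` is
`α α' + (α β' + (-1)^{deg α'} β α') dt`, and the differential of `α + β dt` is
`d_B α + (d_B β + (-1)^n ∂α/∂t) dt` if its degree is `n`. -/
structure Homotopy (N B : DGA.{u} ℂ) (σ : ℂ →+* ℂ) (f₀ f₁ : N.carrier → B.carrier) where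
  α : N.carrier →ₛₗ[σ] B.carrier[X]
  β : N.carrier →ₛₗ[σ] B.carrier[X]
  α_gr : ∀ n, ∀ x ∈ N.gr n, ∀ i, (α x).coeff i ∈ B.gr n
  β_gr : ∀ n, ∀ x ∈ N.gr (n + 1), ∀ i, (β x).coeff i ∈ B.gr n
  β_gr_zero : ∀ x ∈ N.gr 0, β x = 0
  α_one : α 1 = 1
  α_mul : ∀ x y, α (x * y) = α x * α y
  β_mul : ∀ n x, ∀ y ∈ N.gr n, β (x * y) = α x * β y + (-1) ^ n * (β x * α y)
  α_d : ∀ x i, (α (N.d x)).coeff i = B.d ((α x).coeff i)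
  β_d : ∀ n, ∀ x ∈ N.gr n, ∀ i, (β (N.d x)).coeff i =
    B.d ((β x).coeff i) + (-1) ^ n * (Polynomial.derivative (α x)).coeff i
  at_zero : ∀ x, (α x).eval 0 = f₀ x
  at_one : ∀ x, (α x).eval 1 = f₁ x

/-- `∫₀ᵗ p dt`. -/
noncomputable def polyIntegral {B : Type u} [Ring B] [Algebra ℂ B] (p : B[X]) : B[X] :=
  p.sum fun i b => Polynomial.monomial (i + 1) (((i : ℂ) + 1)⁻¹ • b)

end Homotopy

section Models

variable {K : Type u} [Field K] [Algebra K ℝ]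

/-- A filtered `1`-minimal model `φ : (M, W) → (A, W')` of the filtered algebra `(A, W')`, where
`W'_i Aⁿ = W_{i-n} Aⁿ`. -/
structure FilteredModel (D : MixedHodgeDiagram K) where
  M : DGA.{u} K
  WM : WeightFiltration M
  minimal : ∃ Vs, M.IsOneMinimal Vs
  strict_d : ∀ i n, WM.W i (n + 1) ⊓ (M.gr n).map M.d ≤ (WM.W i n).map M.d
  strict_mul : ∀ l m n, ∀ x ∈ WM.W l (m + n),
    x ∈ ⨆ i, Submodule.map₂ (LinearMap.mul K M.carrier) (WM.W i m) (WM.W (l - i) n)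
  φ : M.carrier →ₐ[K] D.A.carrier
  quasiIso : M.IsOneQuasiIso D.A φ
  φ_W : ∀ i n, ∀ x ∈ WM.W i n, φ x ∈ D.WA.W (i - n) n

/-- A bigraded `1`-minimal model `N = ⨁ N^{P,Q}` of a mixed Hodge diagram, with the maps `ψ` to
`B`, `ψ''` to `A_ℂ` and `ψ'` to the complex conjugate of `B` (that is, `ψ'` is a conjugate-linear
map to `B`), the homotopies from `ι ψ''` to `ψ` and from the conjugate of `ι` composed with `ψ''`
to `ψ'`, and a bigraded canonical sequence for `ψ`. -/
structure BigradedModel (D : MixedHodgeDiagram K) where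
  N : DGA.{u} ℂ
  big : ℕ × ℕ → Submodule ℂ N.carrier
  isInternal : DirectSum.IsInternal big
  big_homogeneous : ∀ s, ∀ x ∈ big s, ∀ n, (DirectSum.decompose N.gr x n : N.carrier) ∈ big s
  big_zero : big (0, 0) = N.gr 0
  big_d : ∀ s, ∀ x ∈ big s, N.d x ∈ big s
  big_mul : ∀ s t, ∀ x ∈ big s, ∀ y ∈ big t, x * y ∈ big (s + t)
  ψ : N.carrier →ₐ[ℂ] D.B.carrier
  quasiIso : N.IsOneQuasiIso D.B ψ
  Vs : ℕ → Submodule ℂ N.carrier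
  canonical : N.IsCanonicalSequence D.B ψ Vs
  Vs_big : ∀ i, Vs i = ⨆ s, Vs i ⊓ big s
  ψ'' : N.carrier →ₐ[ℂ] ℂ ⊗[K] D.A.carrier
  ψ''_gr : ∀ n, ∀ x ∈ N.gr n, ψ'' x ∈ (D.A.gr n).baseChange ℂ
  ψ''_d : ∀ x, ψ'' (N.d x) = D.A.d.baseChange ℂ (ψ'' x)
  ψ' : N.carrier →+* D.B.carrier
  ψ'_smul : ∀ (c : ℂ) x, ψ' (c • x) = starRingEnd ℂ c • ψ' x
  ψ'_gr : ∀ n, ∀ x ∈ N.gr n, ψ' x ∈ D.B.gr n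
  ψ'_d : ∀ x, ψ' (N.d x) = D.B.d (ψ' x)
  H : Homotopy N D.B (RingHom.id ℂ) (fun x => D.ι (ψ'' x)) ψ
  H' : Homotopy N D.B (starRingEnd ℂ) (fun x => D.ι (conjC K D.A.carrier (ψ'' x))) ψ'
  ψ''_big : ∀ P Q (n : ℕ), ∀ x ∈ big (P, Q) ⊓ N.gr n, ψ'' x ∈ (D.WA.W (P + Q - n) n).baseChange ℂ
  ψ_big : ∀ P Q (n : ℕ), ∀ x ∈ big (P, Q) ⊓ N.gr n, ψ x ∈ D.WB.W (P + Q - n) n ⊓ D.FB.F P n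
  ψ'_big : ∀ P Q (n : ℕ), ∀ x ∈ big (P, Q) ⊓ N.gr n, ψ' x ∈
    (D.WB.W (P + Q - n) n ⊓ D.FB.F Q n) ⊔
      ⨆ i : ℕ, ⨆ _ : 2 ≤ i, D.WB.W (P + Q - i - n) n ⊓ D.FB.F (Q - i + 1) n
  H_W : ∀ P Q (n : ℕ), ∀ x ∈ big (P, Q) ⊓ N.gr n, ∀ i, (H.α x).coeff i ∈ D.WB.W (P + Q - n) n
  H_W' : ∀ P Q (n : ℕ), ∀ x ∈ big (P, Q) ⊓ N.gr (n + 1), ∀ i,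
    (H.β x).coeff i ∈ D.WB.W (P + Q - n) n
  H'_W : ∀ P Q (n : ℕ), ∀ x ∈ big (P, Q) ⊓ N.gr n, ∀ i, (H'.α x).coeff i ∈ D.WB.W (P + Q - n) n
  H'_W' : ∀ P Q (n : ℕ), ∀ x ∈ big (P, Q) ⊓ N.gr (n + 1), ∀ i,
    (H'.β x).coeff i ∈ D.WB.W (P + Q - n) n

/-- The Hodge filtration `F^r N¹ = ⨁_{P ≥ r} (N¹)^{P,Q}`. -/
def BigradedModel.F₁ {D : MixedHodgeDiagram K} (𝒩 : BigradedModel D) (r : ℤ) :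
    Submodule ℂ 𝒩.N.carrier := ⨆ s : ℕ × ℕ, ⨆ _ : r ≤ s.1, 𝒩.big s ⊓ 𝒩.N.gr 1

/-- `C` is a subspace of `B⁰` which `d` maps bijectively onto `d(B⁰)`. -/
structure IsSplitting (B : DGA.{u} ℂ) (C : Submodule ℂ B.carrier) : Prop where
  le : C ≤ B.gr 0
  inj : ∀ x ∈ C, B.d x = 0 → x = 0
  surj : ∀ x ∈ B.gr 0, ∃ y ∈ C, B.d y = B.d x

/-- The canonical isomorphism `ℐ : N → M_ℂ` and the canonical homotopy `ℋ` from `ψ` to `ι φ ℐ`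
determined by `C`: for `v` in a member of the canonical sequence,
`ℋ v = ψ v + ∫₀ᵗ ℋ(dv) - db ⊗ t - b ⊗ dt`, where `b ∈ C` is the element with
`db = ψ v - ι φ ℐ v + ∫₀¹ ℋ(dv)`; the integral of the degree two form `ℋ(dv) = α + β dt` is
the negative of the integral of `β`. -/
structure CanonicalIso {D : MixedHodgeDiagram K} (ℳ : FilteredModel D) (𝒩 : BigradedModel D)
    (C : Submodule ℂ D.B.carrier) where
  I : 𝒩.N.carrier ≃ₐ[ℂ] ℂ ⊗[K] ℳ.M.carrier
  I_gr : ∀ n x, x ∈ 𝒩.N.gr n ↔ I x ∈ (ℳ.M.gr n).baseChange ℂ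
  I_d : ∀ x, I (𝒩.N.d x) = ℳ.M.d.baseChange ℂ (I x)
  H : Homotopy 𝒩.N D.B (RingHom.id ℂ) 𝒩.ψ
    (fun x => D.ι (Algebra.TensorProduct.map (AlgHom.id ℂ ℂ) ℳ.φ (I x)))
  canonical : ∀ i, ∀ v ∈ 𝒩.Vs i, ∃ b ∈ C,
    D.B.d b = 𝒩.ψ v - D.ι (Algebra.TensorProduct.map (AlgHom.id ℂ ℂ) ℳ.φ (I v))
      - (polyIntegral (H.β (𝒩.N.d v))).eval 1 ∧
    H.α v = Polynomial.C (𝒩.ψ v) - polyIntegral (H.β (𝒩.N.d v))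
      - Polynomial.C (D.B.d b) * Polynomial.X ∧
    H.β v = -Polynomial.C b

end Models

end NonabelianHodge

namespace NonabelianHodge

section Rep

variable {K : Type u} [Field K] [Algebra K ℝ]

/-- Bifiltered spaces `V` with an element `Ω` of `M ⊗ End(V)`. -/
structure PreRep (M : DGA.{u} K) : Type (u + 1) where
  X : BifilteredSpace K
  Ω : M.carrier ⊗[K] (X.V →ₗ[K] X.V)

namespace PreRep

open BifilteredSpace

variable {M : DGA.{u} K}

section

variable {V V' V₁ V₂ V₃ : Type u} [AddCommGroup V] [Module K V] [AddCommGroup V'] [Module K V']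
  [AddCommGroup V₁] [Module K V₁] [AddCommGroup V₂] [Module K V₂] [AddCommGroup V₃] [Module K V₃]

/-- Composition with `f` on the left. -/
noncomputable def post (f : V₁ →ₗ[K] V₂) :
    M.carrier ⊗[K] (V →ₗ[K] V₁) →ₗ[K] M.carrier ⊗[K] (V →ₗ[K] V₂) :=
  (LinearMap.llcomp K V V₁ V₂ f).lTensor _

/-- Composition with `f` on the right. -/
noncomputable def pre (f : V₁ →ₗ[K] V₂) :
    M.carrier ⊗[K] (V₂ →ₗ[K] V) →ₗ[K] M.carrier ⊗[K] (V₁ →ₗ[K] V) :=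
  ((LinearMap.llcomp K V₁ V₂ V).flip f).lTensor _

@[simp] theorem post_id (x : M.carrier ⊗[K] (V →ₗ[K] V₁)) : post LinearMap.id x = x := by
  rw [post, show LinearMap.llcomp K V V₁ V₁ LinearMap.id = LinearMap.id from rfl]; simp
@[simp] theorem pre_id (x : M.carrier ⊗[K] (V →ₗ[K] V₁)) : pre LinearMap.id x = x := by
  rw [pre, show (LinearMap.llcomp K V V V₁).flip LinearMap.id = LinearMap.id from rfl]; simp
theorem post_post (f : V₁ →ₗ[K] V₂) (g : V₂ →ₗ[K] V₃) (x : M.carrier ⊗[K] (V →ₗ[K] V₁)) :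
    post g (post f x) = post (g ∘ₗ f) x := by
  rw [post, post, post, ← LinearMap.comp_apply, ← LinearMap.lTensor_comp]; rfl
theorem pre_pre (f : V₁ →ₗ[K] V₂) (g : V₂ →ₗ[K] V₃) (x : M.carrier ⊗[K] (V₃ →ₗ[K] V)) :
    pre f (pre g x) = pre (g ∘ₗ f) x := by
  rw [pre, pre, pre, ← LinearMap.comp_apply, ← LinearMap.lTensor_comp]; rfl
theorem post_pre (f : V₁ →ₗ[K] V₂) (g : V →ₗ[K] V') (x : M.carrier ⊗[K] (V₂ →ₗ[K] V)) :
    post g (pre f x) = pre f (post g x) := by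
  rw [pre, pre, post, post, ← LinearMap.comp_apply, ← LinearMap.lTensor_comp,
    ← LinearMap.comp_apply, ← LinearMap.lTensor_comp]; rfl

/-- The map induced by `h ↦ h ⊗ g`. -/
noncomputable def rT (g : V →ₗ[K] V') :
    M.carrier ⊗[K] (V₁ →ₗ[K] V₂) →ₗ[K] M.carrier ⊗[K] (V₁ ⊗[K] V →ₗ[K] V₂ ⊗[K] V') :=
  ((TensorProduct.mapBilinear (RingHom.id K) V₁ V V₂ V').flip g).lTensor _

/-- The map induced by `h ↦ g ⊗ h`. -/
noncomputable def lT (g : V →ₗ[K] V') :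
    M.carrier ⊗[K] (V₁ →ₗ[K] V₂) →ₗ[K] M.carrier ⊗[K] (V ⊗[K] V₁ →ₗ[K] V' ⊗[K] V₂) :=
  (TensorProduct.mapBilinear (RingHom.id K) V V₁ V' V₂ g).lTensor _

end

/-- Morphisms: morphisms `f` of bifiltered spaces with `f Ω = Ω f`. -/
@[ext] structure Hom (R S : PreRep M) : Type u where
  f : R.X ⟶ S.X
  comm : post (lin f) R.Ω = pre (lin f) S.Ω

instance : Category (PreRep M) where
  Hom R S := Hom R S
  id R := ⟨𝟙 R.X, by simp⟩
  comp f g := ⟨f.f ≫ g.f, by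
    rw [lin_comp, ← post_post, f.comm, post_pre, g.comm, pre_pre]⟩

@[ext] theorem hom_ext {R S : PreRep M} {f g : R ⟶ S} (h : Hom.f f = Hom.f g) : f = g := Hom.ext h

/-- The forgetful functor to bifiltered spaces. -/
def forget : PreRep M ⥤ BifilteredSpace K where
  obj R := R.X
  map f := f.f

instance : (forget (M := M)).Faithful where
  map_injective h := hom_ext h

/-- An isomorphism of bifiltered spaces commuting with `Ω` is an isomorphism. -/
def mkIso {R S : PreRep M} (e : R.X ≅ S.X) (h : post (lin e.hom) R.Ω = pre (lin e.hom) S.Ω) :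
    R ≅ S where
  hom := ⟨e.hom, h⟩
  inv := ⟨e.inv, by
    have h₁ : lin e.inv ∘ₗ lin e.hom = LinearMap.id := congrArg lin e.hom_inv_id
    have h₂ : lin e.hom ∘ₗ lin e.inv = LinearMap.id := congrArg lin e.inv_hom_id
    have h' := congrArg (fun x => pre (lin e.inv) (post (lin e.inv) x)) h
    simp only [post_post, post_pre, pre_pre, h₁, h₂, post_id, pre_id] at h'
    exact h'.symm⟩
  hom_inv_id := hom_ext e.hom_inv_id
  inv_hom_id := hom_ext e.inv_hom_id

/-- The tensor product, with `Ω ⊗ 1 + 1 ⊗ Ω'`. -/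
noncomputable abbrev tensor (R S : PreRep M) : PreRep M where
  X := R.X ⊗ S.X
  Ω := rT (V := S.X.V) LinearMap.id R.Ω + lT (V := R.X.V) LinearMap.id S.Ω

/-- The unit object, with `Ω = 0`. -/
noncomputable abbrev unit : PreRep M where
  X := 𝟙_ _
  Ω := 0

/-- The tensor product of morphisms. -/
noncomputable def tensorMap {R R' S S' : PreRep M} (f : R ⟶ R') (g : S ⟶ S') :
    tensor R S ⟶ tensor R' S' where
  f := Hom.f f ⊗ₘ Hom.f g
  comm := by
    have h₁ : post (TensorProduct.map (lin f.f) (lin g.f)) (rT (V := S.X.V) LinearMap.id R.Ω) =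
        rT (lin g.f) (post (lin f.f) R.Ω) := by
      rw [post, post, rT, rT, ← LinearMap.comp_apply, ← LinearMap.lTensor_comp,
        ← LinearMap.comp_apply, ← LinearMap.lTensor_comp]
      congr 2
      ext; simp
    have h₂ : post (TensorProduct.map (lin f.f) (lin g.f)) (lT (V := R.X.V) LinearMap.id S.Ω) =
        lT (lin f.f) (post (lin g.f) S.Ω) := by
      rw [post, post, lT, lT, ← LinearMap.comp_apply, ← LinearMap.lTensor_comp,
        ← LinearMap.comp_apply, ← LinearMap.lTensor_comp]
      congr 2
      ext; simp
    have h₃ : pre (TensorProduct.map (lin f.f) (lin g.f)) (rT (V := S'.X.V) LinearMap.id R'.Ω) =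
        rT (lin g.f) (pre (lin f.f) R'.Ω) := by
      rw [pre, pre, rT, rT, ← LinearMap.comp_apply, ← LinearMap.lTensor_comp,
        ← LinearMap.comp_apply, ← LinearMap.lTensor_comp]
      congr 2
      ext; simp
    have h₄ : pre (TensorProduct.map (lin f.f) (lin g.f)) (lT (V := R'.X.V) LinearMap.id S'.Ω) =
        lT (lin f.f) (pre (lin g.f) S'.Ω) := by
      rw [pre, pre, lT, lT, ← LinearMap.comp_apply, ← LinearMap.lTensor_comp,
        ← LinearMap.comp_apply, ← LinearMap.lTensor_comp]
      congr 2
      ext; simp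
    change post (TensorProduct.map (lin f.f) (lin g.f)) (_ + _) =
      pre (TensorProduct.map (lin f.f) (lin g.f)) (_ + _)
    rw [map_add, map_add, h₁, h₂, h₃, h₄, f.comm, g.comm]

/-- The associativity constraint. -/
noncomputable def assoc (R S T : PreRep M) : tensor (tensor R S) T ≅ tensor R (tensor S T) :=
  mkIso (α_ R.X S.X T.X) (by
    change post (TensorProduct.assoc K R.X.V S.X.V T.X.V).toLinearMap (_ + _) =
      pre (TensorProduct.assoc K R.X.V S.X.V T.X.V).toLinearMap (_ + _)
    simp only [map_add, add_assoc]
    congr 1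
    · simp only [post, pre, rT, ← LinearMap.comp_apply, ← LinearMap.lTensor_comp]
      congr 2
      ext; rfl
    congr 1
    · simp only [post, pre, rT, lT, ← LinearMap.comp_apply, ← LinearMap.lTensor_comp]
      congr 2
      ext; rfl
    · simp only [post, pre, lT, ← LinearMap.comp_apply, ← LinearMap.lTensor_comp]
      congr 2
      ext; rfl)

/-- The commutativity constraint. -/
noncomputable def comm (R S : PreRep M) : tensor R S ≅ tensor S R :=
  mkIso (β_ R.X S.X) (by
    change post (TensorProduct.comm K R.X.V S.X.V).toLinearMap (_ + _) =
      pre (TensorProduct.comm K R.X.V S.X.V).toLinearMap (_ + _)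
    simp only [map_add]
    rw [add_comm]
    congr 1
    · simp only [post, pre, rT, lT, ← LinearMap.comp_apply, ← LinearMap.lTensor_comp]
      congr 2
      ext; simp
    · simp only [post, pre, rT, lT, ← LinearMap.comp_apply, ← LinearMap.lTensor_comp]
      congr 2
      ext; simp)

/-- The left unit constraint. -/
noncomputable def leftUnit (R : PreRep M) : tensor unit R ≅ R :=
  mkIso (λ_ R.X) (by
    change post (TensorProduct.lid K R.X.V).toLinearMap (_ + _) =
      pre (TensorProduct.lid K R.X.V).toLinearMap _
    rw [map_zero, zero_add]
    simp only [post, pre, lT, ← LinearMap.comp_apply, ← LinearMap.lTensor_comp]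
    congr 2
    ext; simp)

noncomputable instance : MonoidalCategoryStruct (PreRep M) where
  tensorObj := tensor
  tensorHom f g := tensorMap f g
  whiskerLeft X _ _ f := tensorMap (𝟙 X) f
  whiskerRight f Y := tensorMap f (𝟙 Y)
  tensorUnit := unit
  associator := assoc
  leftUnitor := leftUnit
  rightUnitor X := comm X unit ≪≫ leftUnit X

noncomputable instance : MonoidalCategory (PreRep M) :=
  Monoidal.induced forget
    { μIso _ _ := Iso.refl _
      εIso := Iso.refl _
      whiskerLeft_eq X _ _ f := by
        simp only [Iso.refl_hom, Iso.refl_inv, Category.id_comp, Category.comp_id]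
        exact MonoidalCategory.id_tensorHom _ _
      whiskerRight_eq f Y := by
        simp only [Iso.refl_hom, Iso.refl_inv, Category.id_comp, Category.comp_id]
        exact MonoidalCategory.tensorHom_id _ _
      tensorHom_eq _ _ := by
        simp only [Iso.refl_hom, Iso.refl_inv, Category.id_comp, Category.comp_id]; rfl
      associator_eq X Y Z :=
        BifilteredSpace.hom_ext (TensorProduct.ext_threefold fun x y z => rfl)
      leftUnitor_eq X := BifilteredSpace.hom_ext (TensorProduct.ext' fun x y => rfl)
      rightUnitor_eq X := BifilteredSpace.hom_ext (TensorProduct.ext' fun x y => rfl) }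

noncomputable instance : (forget (M := M)).Monoidal :=
  Monoidal.fromInducedMonoidal _ _

noncomputable instance : BraidedCategory (PreRep M) :=
  BraidedCategory.ofFaithful forget comm fun X Y =>
    BifilteredSpace.hom_ext (TensorProduct.ext' fun x y => rfl)

noncomputable instance : SymmetricCategory (PreRep M) where
  symmetry X Y := hom_ext (SymmetricCategory.symmetry X.X Y.X)

end PreRep
end Rep
end NonabelianHodge

namespace NonabelianHodge

section Rep

variable {K : Type u} [Field K] [Algebra K ℝ] {D : MixedHodgeDiagram K} {ℳ : FilteredModel D}
  {𝒩 : BigradedModel D} {C : Submodule ℂ D.B.carrier} (J : CanonicalIso ℳ 𝒩 C)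

/-- The element `ℐ⁻¹ Ω` of `N ⊗ End(V_ℂ)`. -/
noncomputable def CanonicalIso.form (R : PreRep ℳ.M) :
    𝒩.N.carrier ⊗[ℂ] (R.X.VC →ₗ[ℂ] R.X.VC) := mapForm J.I.symm.toLinearMap (cxForm K R.Ω)

/-- Unipotent Hodge representations of the Lie algebra dual to `M`, with the Hodge filtration
`F^r(M¹_ℂ) = ℐ(F^r N¹)`: mixed Hodge structures `V` with a form `Ω` in `M¹ ⊗ W_{-1} End(V)`
which satisfies the Maurer–Cartan equation (that is, a representation on `V` with values in
`W_{-1} End(V)`) and lies in `F⁰(M¹_ℂ ⊗ End(V_ℂ))`. -/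
structure IsHodgeRep (R : PreRep ℳ.M) : Prop where
  isMHS : isMHS K R.X
  weight : R.Ω ∈ tens K (ℳ.M.gr 1) (filtHom R.X.W R.X.W (-1))
  maurerCartan : dForm ℳ.M R.Ω + wedge R.Ω R.Ω = 0
  hodge : J.form R ∈ ⨆ r : ℤ, tens ℂ (𝒩.F₁ r) (filtHom R.X.F R.X.F (-r))

/-- The objects of `HodgeRep`. -/
def isRep : ObjectProperty (PreRep ℳ.M) := IsHodgeRep J

/-- The category of unipotent Hodge representations. -/
abbrev HodgeRep := (isRep J).FullSubcategory

/-- The forgetful functor from representations to mixed Hodge structures. -/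
def forgetRep : HodgeRep J ⥤ MHS K :=
  ObjectProperty.lift _ ((isRep J).ι ⋙ PreRep.forget) fun R => R.property.isMHS

end Rep

section VMHS

variable {K : Type u} [Field K] [Algebra K ℝ] (D : MixedHodgeDiagram K)

/-- The form `ι(ω)` with values in the complexification. -/
noncomputable def MixedHodgeDiagram.ιForm {V₁ V₂ : Type u} [AddCommGroup V₁] [Module K V₁]
    [AddCommGroup V₂] [Module K V₂] (ω : D.A.carrier ⊗[K] (V₁ →ₗ[K] V₂)) :
    D.B.carrier ⊗[ℂ] (ℂ ⊗[K] V₁ →ₗ[ℂ] ℂ ⊗[K] V₂) :=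
  mapForm D.ι.toLinearMap (cxForm K ω)

/-- `F⁰(Bⁿ ⊗ Hom(V_ℂ, V'_ℂ))`. -/
noncomputable def MixedHodgeDiagram.F₀ (n : ℕ) (X Y : BifilteredSpace K) :
    Submodule ℂ (D.B.carrier ⊗[ℂ] (X.VC →ₗ[ℂ] Y.VC)) :=
  ⨆ r : ℤ, tens ℂ (D.FB.F r n) (filtHom X.F Y.F (-r))

/-- Unipotent variations of mixed Hodge structure over a mixed Hodge diagram. -/
structure VMHS : Type (u + 1) where
  toMHS : MHS K
  ω : D.A.carrier ⊗[K] (toMHS.obj.V →ₗ[K] toMHS.obj.V)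
  ω_weight : ω ∈ tens K (D.A.gr 1) (filtHom toMHS.obj.W toMHS.obj.W (-1))
  ω_maurerCartan : dForm D.A ω + wedge ω ω = 0
  ω' : D.B.carrier ⊗[ℂ] (toMHS.obj.VC →ₗ[ℂ] toMHS.obj.VC)
  ω'_weight : ω' ∈ tens ℂ (D.B.gr 1) (filtHom toMHS.obj.WC toMHS.obj.WC (-1))
  ω'_maurerCartan : dForm D.B ω' + wedge ω' ω' = 0
  ω'_hodge : ω' ∈ D.F₀ 1 toMHS.obj toMHS.obj
  a : D.B.carrier ⊗[ℂ] (toMHS.obj.VC →ₗ[ℂ] toMHS.obj.VC)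
  a_weight : a - 1 ⊗ₜ LinearMap.id ∈
    tens ℂ (D.B.gr 0) (filtHom toMHS.obj.WC toMHS.obj.WC (-1))
  a_flat : covD D.B (D.ιForm ω) ω' a = 0

namespace VMHS

variable {D}

/-- The mixed Hodge structure as a bifiltered space. -/
abbrev X (x : VMHS D) : BifilteredSpace K := x.toMHS.obj

/-- The pairs `(b, b')` which are morphisms from `x` to `y`. -/
structure IsHom (x y : VMHS D) (b : D.A.carrier ⊗[K] (x.X.V →ₗ[K] y.X.V))
    (b' : D.B.carrier ⊗[ℂ] (x.X.VC →ₗ[ℂ] y.X.VC)) : Prop where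
  weight : b ∈ tens K (D.A.gr 0) (filtHom x.X.W y.X.W 0)
  flat : covD D.A x.ω y.ω b = 0
  weight' : b' ∈ tens ℂ (D.B.gr 0) (filtHom x.X.WC y.X.WC 0)
  hodge' : b' ∈ D.F₀ 0 x.X y.X
  flat' : covD D.B x.ω' y.ω' b' = 0
  comm : wedge y.a (D.ιForm b) = wedge b' x.a

theorem ιForm_wedge {V₁ V₂ V₃ : Type u} [AddCommGroup V₁] [Module K V₁] [AddCommGroup V₂]
    [Module K V₂] [AddCommGroup V₃] [Module K V₃] (x : D.A.carrier ⊗[K] (V₂ →ₗ[K] V₃))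
    (y : D.A.carrier ⊗[K] (V₁ →ₗ[K] V₂)) :
    D.ιForm (wedge x y) = wedge (D.ιForm x) (D.ιForm y) := by
  rw [MixedHodgeDiagram.ιForm, cxForm_wedge, mapForm_wedge]; rfl

theorem ιForm_one_tmul {V₁ V₂ : Type u} [AddCommGroup V₁] [Module K V₁]
    [AddCommGroup V₂] [Module K V₂] (f : V₁ →ₗ[K] V₂) :
    D.ιForm ((1 : D.A.carrier) ⊗ₜ[K] f) = (1 : D.B.carrier) ⊗ₜ[ℂ] f.baseChange ℂ := by
  rw [MixedHodgeDiagram.ιForm, cxForm_tmul, mapForm_tmul, ← Algebra.TensorProduct.one_def]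
  simp

theorem ιForm_zero {V₁ V₂ : Type u} [AddCommGroup V₁] [Module K V₁]
    [AddCommGroup V₂] [Module K V₂] : D.ιForm (0 : D.A.carrier ⊗[K] (V₁ →ₗ[K] V₂)) = 0 := by
  rw [MixedHodgeDiagram.ιForm, map_zero, map_zero]

theorem ιForm_smul {V₁ V₂ : Type u} [AddCommGroup V₁] [Module K V₁]
    [AddCommGroup V₂] [Module K V₂] (c : K) (x : D.A.carrier ⊗[K] (V₁ →ₗ[K] V₂)) :
    D.ιForm (c • x) = algebraMap K ℂ c • D.ιForm x := by
  rw [MixedHodgeDiagram.ιForm, map_smul, ← algebraMap_smul ℂ c (cxForm K x), map_smul]; rfl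

theorem ιForm_add {V₁ V₂ : Type u} [AddCommGroup V₁] [Module K V₁]
    [AddCommGroup V₂] [Module K V₂] (x y : D.A.carrier ⊗[K] (V₁ →ₗ[K] V₂)) :
    D.ιForm (x + y) = D.ιForm x + D.ιForm y := by
  rw [MixedHodgeDiagram.ιForm, map_add, map_add]; rfl

theorem filtHom_comp {k : Type*} [Field k] {V₁ V₂ V₃ : Type*} [AddCommGroup V₁] [Module k V₁]
    [AddCommGroup V₂] [Module k V₂] [AddCommGroup V₃] [Module k V₃] {W₁ : ℤ → Submodule k V₁}
    {W₂ : ℤ → Submodule k V₂} {W₃ : ℤ → Submodule k V₃} {l m n : ℤ} (h : l + m = n)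
    {f : V₂ →ₗ[k] V₃} {g : V₁ →ₗ[k] V₂} (hf : f ∈ filtHom W₂ W₃ l) (hg : g ∈ filtHom W₁ W₂ m) :
    f ∘ₗ g ∈ filtHom W₁ W₃ n := fun i x hx => by
  have := hf _ (hg i hx)
  rw [show i + m + l = i + n by omega] at this
  exact this

theorem wedge_mem_F₀ {X Y Z : BifilteredSpace K} {x : D.B.carrier ⊗[ℂ] (Y.VC →ₗ[ℂ] Z.VC)}
    {y : D.B.carrier ⊗[ℂ] (X.VC →ₗ[ℂ] Y.VC)} (hx : x ∈ D.F₀ 0 Y Z) (hy : y ∈ D.F₀ 0 X Y) :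
    wedge x y ∈ D.F₀ 0 X Z := by
  have h : D.F₀ 0 Y Z ≤ (D.F₀ 0 X Z).comap ((TensorProduct.map₂ (LinearMap.mul ℂ D.B.carrier)
      (LinearMap.llcomp ℂ X.VC Y.VC Z.VC)).flip y) := by
    refine iSup_le fun r x hx => ?_
    have h' : D.F₀ 0 X Y ≤ (D.F₀ 0 X Z).comap (TensorProduct.map₂ (LinearMap.mul ℂ D.B.carrier)
        (LinearMap.llcomp ℂ X.VC Y.VC Z.VC) x) := by
      refine iSup_le fun s y hy => Submodule.mem_iSup_of_mem (r + s) ?_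
      exact wedge_mem (fun u hu v hv => D.FB.mul_mem r s 0 0 u hu v hv)
        (fun f hf g hg => filtHom_comp (by omega) hf hg) hx hy
    exact h' hy
  exact h hx

theorem wedge_weight {k : Type*} [Field k] (A : DGA.{u} k) {V₁ V₂ V₃ : Type*} [AddCommGroup V₁]
    [Module k V₁] [AddCommGroup V₂] [Module k V₂] [AddCommGroup V₃] [Module k V₃]
    {W₁ : ℤ → Submodule k V₁} {W₂ : ℤ → Submodule k V₂} {W₃ : ℤ → Submodule k V₃}
    {x : A.carrier ⊗[k] (V₂ →ₗ[k] V₃)} {y : A.carrier ⊗[k] (V₁ →ₗ[k] V₂)}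
    (hx : x ∈ tens k (A.gr 0) (filtHom W₂ W₃ 0)) (hy : y ∈ tens k (A.gr 0) (filtHom W₁ W₂ 0)) :
    wedge x y ∈ tens k (A.gr 0) (filtHom W₁ W₃ 0) :=
  wedge_mem (fun u hu v hv => by
    have := SetLike.GradedMul.mul_mem (A := A.gr) hu hv
    rwa [add_zero] at this) (fun _ hf _ hg => filtHom_comp (add_zero 0) hf hg) hx hy

theorem isHom_comp {x y z : VMHS D} {b : D.A.carrier ⊗[K] (x.X.V →ₗ[K] y.X.V)}
    {b' : D.B.carrier ⊗[ℂ] (x.X.VC →ₗ[ℂ] y.X.VC)} {c : D.A.carrier ⊗[K] (y.X.V →ₗ[K] z.X.V)}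
    {c' : D.B.carrier ⊗[ℂ] (y.X.VC →ₗ[ℂ] z.X.VC)} (h : IsHom x y b b') (k : IsHom y z c c') :
    IsHom x z (wedge c b) (wedge c' b') where
  weight := wedge_weight D.A k.weight h.weight
  flat := by rw [covD_wedge D.A k.weight, k.flat, h.flat, zero_wedge, wedge_zero, add_zero]
  weight' := wedge_weight D.B k.weight' h.weight'
  hodge' := wedge_mem_F₀ k.hodge' h.hodge'
  flat' := by
    rw [covD_wedge D.B k.weight', k.flat', h.flat', zero_wedge, wedge_zero, add_zero]
  comm := by
    rw [ιForm_wedge, ← wedge_assoc, k.comm, wedge_assoc, h.comm, wedge_assoc]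

theorem baseChange_mem {V V' : Type u} [AddCommGroup V] [Module K V] [AddCommGroup V']
    [Module K V'] {P : Submodule K V} {Q : Submodule K V'} {f : V →ₗ[K] V'}
    (h : ∀ x ∈ P, f x ∈ Q) : P.baseChange ℂ ≤ (Q.baseChange ℂ).comap (f.baseChange ℂ) := by
  rw [Submodule.baseChange_eq_span, Submodule.span_le]
  rintro _ ⟨x, hx, rfl⟩
  exact Submodule.tmul_mem_baseChange_of_mem 1 (h x hx)

/-- A morphism of mixed Hodge structures commuting with the data defines a constant morphism. -/
theorem isHom_const {x y : VMHS D} (f : x.X ⟶ y.X)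
    (h : wedge y.ω (1 ⊗ₜ BifilteredSpace.lin f) = wedge (1 ⊗ₜ BifilteredSpace.lin f) x.ω)
    (h' : wedge y.ω' (1 ⊗ₜ (BifilteredSpace.lin f).baseChange ℂ) =
      wedge (1 ⊗ₜ (BifilteredSpace.lin f).baseChange ℂ) x.ω')
    (ha : wedge y.a (1 ⊗ₜ (BifilteredSpace.lin f).baseChange ℂ) =
      wedge (1 ⊗ₜ (BifilteredSpace.lin f).baseChange ℂ) x.a) :
    IsHom x y (1 ⊗ₜ BifilteredSpace.lin f) (1 ⊗ₜ (BifilteredSpace.lin f).baseChange ℂ) where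
  weight := tmul_mem_tens D.A.one_mem fun i v hv => by
    simpa using BifilteredSpace.lin_W f hv
  flat := covD_one_tmul D.A h
  weight' := tmul_mem_tens D.B.one_mem fun i v hv => by
    rw [add_zero]
    exact baseChange_mem (fun _ => BifilteredSpace.lin_W f) hv
  hodge' := Submodule.mem_iSup_of_mem 0 (tmul_mem_tens D.FB.one_mem fun i v hv => by
    simpa using BifilteredSpace.lin_F f hv)
  flat' := covD_one_tmul D.B h'
  comm := by rw [ιForm_one_tmul, ha]

/-- The group of morphisms. -/
def homs (x y : VMHS D) : AddSubgroup ((D.A.carrier ⊗[K] (x.X.V →ₗ[K] y.X.V)) ×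
    (D.B.carrier ⊗[ℂ] (x.X.VC →ₗ[ℂ] y.X.VC))) where
  carrier := {p | IsHom x y p.1 p.2}
  add_mem' {p q} hp hq := by
    refine ⟨add_mem hp.weight hq.weight, ?_, add_mem hp.weight' hq.weight',
      add_mem hp.hodge' hq.hodge', ?_, ?_⟩
    · rw [Prod.fst_add, covD_add, hp.flat, hq.flat, add_zero]
    · rw [Prod.snd_add, covD_add, hp.flat', hq.flat', add_zero]
    · rw [Prod.fst_add, Prod.snd_add, ιForm_add, wedge_add, add_wedge, hp.comm, hq.comm]
  zero_mem' := ⟨zero_mem _, covD_zero _ _ _, zero_mem _, zero_mem _, covD_zero _ _ _, by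
    rw [Prod.fst_zero, Prod.snd_zero, ιForm_zero, wedge_zero, zero_wedge]⟩
  neg_mem' {p} hp := by
    refine ⟨neg_mem hp.weight, ?_, neg_mem hp.weight', neg_mem hp.hodge', ?_, ?_⟩
    · rw [Prod.fst_neg, ← neg_one_smul K p.1, covD_smul, hp.flat, smul_zero]
    · rw [Prod.snd_neg, ← neg_one_smul ℂ p.2, covD_smul, hp.flat', smul_zero]
    · rw [Prod.fst_neg, Prod.snd_neg, ← neg_one_smul K p.1, ← neg_one_smul ℂ p.2, ιForm_smul,
        wedge_smul, smul_wedge, hp.comm, map_neg, map_one]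

theorem isHom_smul {x y : VMHS D} (c : K) {b : D.A.carrier ⊗[K] (x.X.V →ₗ[K] y.X.V)}
    {b' : D.B.carrier ⊗[ℂ] (x.X.VC →ₗ[ℂ] y.X.VC)} (h : IsHom x y b b') :
    IsHom x y (c • b) (algebraMap K ℂ c • b') where
  weight := Submodule.smul_mem _ _ h.weight
  flat := by rw [covD_smul, h.flat, smul_zero]
  weight' := Submodule.smul_mem _ _ h.weight'
  hodge' := Submodule.smul_mem _ _ h.hodge'
  flat' := by rw [covD_smul, h.flat', smul_zero]
  comm := by rw [ιForm_smul, wedge_smul, smul_wedge, h.comm]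

noncomputable instance : Category (VMHS D) where
  Hom x y := homs x y
  id x := ⟨(1 ⊗ₜ LinearMap.id, 1 ⊗ₜ LinearMap.id), by
    have := isHom_const (x := x) (y := x) (𝟙 _) (by simp) (by simp) (by simp)
    rwa [BifilteredSpace.lin_id, LinearMap.baseChange_id] at this⟩
  comp f g := ⟨(wedge g.1.1 f.1.1, wedge g.1.2 f.1.2), isHom_comp f.2 g.2⟩
  id_comp f := Subtype.ext (Prod.ext (wedge_one _) (wedge_one _))
  comp_id f := Subtype.ext (Prod.ext (one_wedge _) (one_wedge _))
  assoc f g h := Subtype.ext (Prod.ext (wedge_assoc _ _ _).symm (wedge_assoc _ _ _).symm)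

/-- The pair of forms underlying a morphism. -/
def pair {x y : VMHS D} (f : x ⟶ y) : (D.A.carrier ⊗[K] (x.X.V →ₗ[K] y.X.V)) ×
    (D.B.carrier ⊗[ℂ] (x.X.VC →ₗ[ℂ] y.X.VC)) := f.1

/-- Constructor for morphisms. -/
def mkHom {x y : VMHS D} {b : D.A.carrier ⊗[K] (x.X.V →ₗ[K] y.X.V)}
    {b' : D.B.carrier ⊗[ℂ] (x.X.VC →ₗ[ℂ] y.X.VC)} (h : IsHom x y b b') : x ⟶ y := ⟨(b, b'), h⟩

theorem hom_ext {x y : VMHS D} {f g : x ⟶ y} (h : pair f = pair g) : f = g := Subtype.ext h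

theorem pair_comp {x y z : VMHS D} (f : x ⟶ y) (g : y ⟶ z) :
    pair (f ≫ g) = (wedge (pair g).1 (pair f).1, wedge (pair g).2 (pair f).2) := rfl

theorem pair_id (x : VMHS D) : pair (𝟙 x) = (1 ⊗ₜ LinearMap.id, 1 ⊗ₜ LinearMap.id) := rfl

theorem pair_mkHom {x y : VMHS D} {b : D.A.carrier ⊗[K] (x.X.V →ₗ[K] y.X.V)}
    {b' : D.B.carrier ⊗[ℂ] (x.X.VC →ₗ[ℂ] y.X.VC)} (h : IsHom x y b b') :
    pair (mkHom h) = (b, b') := rfl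

noncomputable instance : Preadditive (VMHS D) where
  homGroup x y := inferInstanceAs (AddCommGroup (homs x y))
  add_comp _ _ _ _ _ _ := Subtype.ext (Prod.ext (wedge_add _ _ _) (wedge_add _ _ _))
  comp_add _ _ _ _ _ _ := Subtype.ext (Prod.ext (add_wedge _ _ _) (add_wedge _ _ _))

theorem pair_add {x y : VMHS D} (f g : x ⟶ y) : pair (f + g) = pair f + pair g := rfl

/-- Scalar multiplication on morphisms. -/
noncomputable instance {x y : VMHS D} : SMul K (x ⟶ y) := ⟨fun c f => mkHom (isHom_smul c f.2)⟩

theorem pair_smul {x y : VMHS D} (c : K) (f : x ⟶ y) :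
    pair (c • f) = (c • (pair f).1, algebraMap K ℂ c • (pair f).2) := rfl

noncomputable instance {x y : VMHS D} : Module K (x ⟶ y) where
  one_smul f := hom_ext (by rw [pair_smul, one_smul, map_one, one_smul])
  mul_smul c c' f := hom_ext (by
    rw [pair_smul, pair_smul, pair_smul, mul_smul, map_mul, mul_smul])
  smul_zero c := hom_ext (Prod.ext (smul_zero _) (smul_zero _))
  smul_add c f g := hom_ext (by
    rw [pair_smul, pair_add, pair_add, pair_smul, pair_smul]
    exact Prod.ext (smul_add _ _ _) (smul_add _ _ _))
  add_smul c c' f := hom_ext (by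
    rw [pair_smul, pair_add, pair_smul, pair_smul, add_smul, map_add, add_smul]; rfl)
  zero_smul f := hom_ext (by rw [pair_smul, zero_smul, map_zero, zero_smul]; rfl)

noncomputable instance : Linear K (VMHS D) where
  smul_comp _ _ _ c f g := hom_ext (by
    rw [pair_comp, pair_smul, pair_smul, pair_comp, wedge_smul, wedge_smul])
  comp_smul _ _ _ f c g := hom_ext (by
    rw [pair_comp, pair_smul, pair_smul, pair_comp, smul_wedge, smul_wedge])

/-- The constant morphism defined by a morphism of mixed Hodge structures. -/
noncomputable def const {x y : VMHS D} (f : x.X ⟶ y.X)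
    (h : wedge y.ω (1 ⊗ₜ BifilteredSpace.lin f) = wedge (1 ⊗ₜ BifilteredSpace.lin f) x.ω)
    (h' : wedge y.ω' (1 ⊗ₜ (BifilteredSpace.lin f).baseChange ℂ) =
      wedge (1 ⊗ₜ (BifilteredSpace.lin f).baseChange ℂ) x.ω')
    (ha : wedge y.a (1 ⊗ₜ (BifilteredSpace.lin f).baseChange ℂ) =
      wedge (1 ⊗ₜ (BifilteredSpace.lin f).baseChange ℂ) x.a) : x ⟶ y :=
  mkHom (isHom_const f h h' ha)

theorem pair_const {x y : VMHS D} (f : x.X ⟶ y.X) {h h' ha} :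
    pair (const f h h' ha) =
      (1 ⊗ₜ BifilteredSpace.lin f, 1 ⊗ₜ (BifilteredSpace.lin f).baseChange ℂ) := rfl

theorem const_id {x : VMHS D} {h h' ha} : const (x := x) (y := x) (𝟙 _) h h' ha = 𝟙 x :=
  hom_ext (by rw [pair_const, pair_id, BifilteredSpace.lin_id, LinearMap.baseChange_id])

theorem const_comp {x y z : VMHS D} (f : x.X ⟶ y.X) (g : y.X ⟶ z.X)
    {h₁ h₂ h₃ h₄ h₅ h₆ h₇ h₈ h₉} : const (x := x) (y := z) (f ≫ g) h₁ h₂ h₃ =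
      const (x := x) (y := y) f h₄ h₅ h₆ ≫ const (x := y) (y := z) g h₇ h₈ h₉ :=
  hom_ext (by
    rw [pair_comp, pair_const, pair_const, pair_const, BifilteredSpace.lin_comp,
      LinearMap.baseChange_comp, wedge_tmul, wedge_tmul, one_mul, one_mul])

end VMHS

/-- The constant variation `(V, 0, 0, id)`. -/
noncomputable def κObj (V : MHS K) : VMHS D where
  toMHS := V
  ω := 0
  ω_weight := zero_mem _
  ω_maurerCartan := by simp
  ω' := 0
  ω'_weight := zero_mem _
  ω'_maurerCartan := by simp
  ω'_hodge := zero_mem _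
  a := 1 ⊗ₜ LinearMap.id
  a_weight := by rw [sub_self]; exact zero_mem _
  a_flat := covD_one_tmul D.B (by rw [VMHS.ιForm_zero, wedge_zero, zero_wedge])

/-- The functor `κ`, sending `V` to the constant variation `(V, 0, 0, id)`. -/
noncomputable def κ : MHS K ⥤ VMHS D where
  obj V := κObj D V
  map {V V'} f := VMHS.const (x := κObj D V) (y := κObj D V') f.hom
    ((zero_wedge _).trans (wedge_zero _).symm) ((zero_wedge _).trans (wedge_zero _).symm)
    ((one_wedge _).trans (wedge_one _).symm)
  map_id V := VMHS.const_id (x := κObj D V)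
  map_comp {V V' V''} f g :=
    VMHS.const_comp (x := κObj D V) (y := κObj D V') (z := κObj D V'') f.hom g.hom

end VMHS
end NonabelianHodge

namespace NonabelianHodge

section Phi

variable {K : Type u} [Field K] [Algebra K ℝ] {D : MixedHodgeDiagram K} {ℳ : FilteredModel D}
  {𝒩 : BigradedModel D} {C : Submodule ℂ D.B.carrier} (J : CanonicalIso ℳ 𝒩 C)

/-- The form `φ(Ω)`. -/
noncomputable def formA (R : PreRep ℳ.M) : D.A.carrier ⊗[K] (R.X.V →ₗ[K] R.X.V) :=
  mapForm ℳ.φ.toLinearMap R.Ω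

/-- The form `ψ(ℐ⁻¹(Ω))`. -/
noncomputable def formB (R : PreRep ℳ.M) : D.B.carrier ⊗[ℂ] (R.X.VC →ₗ[ℂ] R.X.VC) :=
  mapForm 𝒩.ψ.toLinearMap (J.form R)

/-- Write `ℋ(ℐ⁻¹(Ω)) = α + β dt`, a flat connection on `V_ℂ` over `B ⊗ (t, dt)`.  Its parallel
transport along `t` from `0` to `1` is `a = g(1)`, where `g` with coefficients in `B[t]` is the
solution of `∂g/∂t = g β` with `g(0) = 1`. -/
def IsParallelTransport (R : PreRep ℳ.M) (a : D.B.carrier ⊗[ℂ] (R.X.VC →ₗ[ℂ] R.X.VC)) : Prop :=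
  ∃ g : D.B.carrier[X] ⊗[ℂ] (R.X.VC →ₗ[ℂ] R.X.VC),
    mapForm (Polynomial.derivative.restrictScalars ℂ) g = wedge g (mapForm J.H.β (J.form R)) ∧
    mapForm ((Polynomial.leval 0).restrictScalars ℂ) g = 1 ⊗ₜ LinearMap.id ∧
    mapForm ((Polynomial.leval 1).restrictScalars ℂ) g = a

/-- The parallel transports of all representations, with the properties which make `Φ_C` a
functor. -/
structure Transport where
  a : ∀ R : HodgeRep J, D.B.carrier ⊗[ℂ] (R.obj.X.VC →ₗ[ℂ] R.obj.X.VC)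
  isParallelTransport : ∀ R, IsParallelTransport J R.obj (a R)
  weight : ∀ R, a R - 1 ⊗ₜ LinearMap.id ∈
    tens ℂ (D.B.gr 0) (filtHom R.obj.X.WC R.obj.X.WC (-1))
  flat : ∀ R, covD D.B (D.ιForm (formA R.obj)) (formB J R.obj) (a R) = 0
  natural : ∀ {R S : HodgeRep J} (f : R ⟶ S),
    wedge (a S) (1 ⊗ₜ (BifilteredSpace.lin f.hom.f).baseChange ℂ) =
      wedge (1 ⊗ₜ (BifilteredSpace.lin f.hom.f).baseChange ℂ) (a R)

theorem dForm_mapForm {k : Type v} [Field k] {A B : DGA.{u} k} (f : A.carrier →ₐ[k] B.carrier)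
    (hf : ∀ x, f (A.d x) = B.d (f x)) {V₁ V₂ : Type*} [AddCommGroup V₁] [Module k V₁]
    [AddCommGroup V₂] [Module k V₂] (x : A.carrier ⊗[k] (V₁ →ₗ[k] V₂)) :
    dForm B (mapForm f.toLinearMap x) = mapForm f.toLinearMap (dForm A x) := by
  induction x using TensorProduct.induction_on with
  | zero => simp
  | add x y hx hy => simp only [map_add, hx, hy]
  | tmul a g => simp [hf]

theorem maurerCartan_mapForm {k : Type v} [Field k] {A B : DGA.{u} k}
    {f : A.carrier →ₐ[k] B.carrier}
    (hf : ∀ x, f (A.d x) = B.d (f x)) {V : Type*} [AddCommGroup V] [Module k V]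
    {x : A.carrier ⊗[k] (V →ₗ[k] V)} (h : dForm A x + wedge x x = 0) :
    dForm B (mapForm f.toLinearMap x) +
      wedge (mapForm f.toLinearMap x) (mapForm f.toLinearMap x) = 0 := by
  rw [dForm_mapForm f hf, ← mapForm_wedge, ← map_add, h, map_zero]

theorem cxForm_mem {A : Type u} [Ring A] [Algebra K A] {P : Submodule K A} (X : BifilteredSpace K)
    {x : A ⊗[K] (X.V →ₗ[K] X.V)} {m : ℤ} (h : x ∈ tens K P (filtHom X.W X.W m)) :
    cxForm K x ∈ tens ℂ (P.baseChange ℂ) (filtHom X.WC X.WC m) := by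
  have h' : tens K P (filtHom X.W X.W m) ≤
      ((tens ℂ (P.baseChange ℂ) (filtHom X.WC X.WC m)).restrictScalars K).comap (cxForm K) :=
    tens_le fun a ha f hf => tmul_mem_tens (Submodule.tmul_mem_baseChange_of_mem 1 ha)
      fun i v hv => VMHS.baseChange_mem (hf i) hv
  exact h' h

theorem form_weight (R : HodgeRep J) :
    J.form R.obj ∈ tens ℂ (𝒩.N.gr 1) (filtHom R.obj.X.WC R.obj.X.WC (-1)) :=
  mapForm_mem (P := (ℳ.M.gr 1).baseChange ℂ)
    (fun x hx => (J.I_gr 1 _).2 (by simpa using hx)) (cxForm_mem R.obj.X R.property.weight)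

theorem form_maurerCartan (R : HodgeRep J) :
    dForm 𝒩.N (J.form R.obj) + wedge (J.form R.obj) (J.form R.obj) = 0 := by
  have h₁ : ∀ x : ℳ.M.carrier ⊗[K] (R.obj.X.V →ₗ[K] R.obj.X.V),
      dForm 𝒩.N (mapForm J.I.symm.toLinearMap (cxForm K x)) =
        mapForm J.I.symm.toLinearMap (cxForm K (dForm ℳ.M x)) := fun x => by
    induction x using TensorProduct.induction_on with
    | zero => simp
    | add x y hx hy => simp only [map_add, hx, hy]
    | tmul a g =>
      have : 𝒩.N.d (J.I.symm (1 ⊗ₜ a)) = J.I.symm (1 ⊗ₜ ℳ.M.d a) := by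
        rw [AlgEquiv.eq_symm_apply, J.I_d]; simp
      simp [this]
  have h₂ := mapForm_wedge (J.I.symm : _ →ₐ[ℂ] 𝒩.N.carrier) (cxForm K R.obj.Ω)
    (cxForm K R.obj.Ω)
  change dForm 𝒩.N (mapForm J.I.symm.toLinearMap (cxForm K R.obj.Ω)) +
    wedge (mapForm J.I.symm.toLinearMap (cxForm K R.obj.Ω))
      (mapForm J.I.symm.toLinearMap (cxForm K R.obj.Ω)) = 0
  rw [h₁]
  refine (congrArg _ h₂.symm).trans ?_
  rw [← cxForm_wedge]
  refine (map_add (mapForm J.I.symm.toLinearMap) _ _).symm.trans ?_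
  rw [← map_add, R.property.maurerCartan, map_zero, map_zero]

theorem formB_hodge (R : HodgeRep J) : formB J R.obj ∈ D.F₀ 1 R.obj.X R.obj.X := by
  have h : ⨆ r : ℤ, tens ℂ (𝒩.F₁ r) (filtHom R.obj.X.F R.obj.X.F (-r)) ≤
      (D.F₀ 1 R.obj.X R.obj.X).comap (mapForm 𝒩.ψ.toLinearMap) := by
    refine iSup_le fun r x hx => Submodule.mem_iSup_of_mem r (mapForm_mem ?_ hx)
    change 𝒩.F₁ r ≤ (D.FB.F r 1).comap 𝒩.ψ.toLinearMap
    exact iSup_le fun s => iSup_le fun hs y hy =>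
      D.FB.anti 1 hs (𝒩.ψ_big s.1 s.2 1 y hy).2
  exact h R.property.hodge

variable {J}

/-- The object `Φ_C(V, Ω) = (V, φ(Ω), ψ(ℐ⁻¹(Ω)), a)`. -/
noncomputable def PhiObj (T : Transport J) (R : HodgeRep J) : VMHS D where
  toMHS := (forgetRep J).obj R
  ω := formA R.obj
  ω_weight := mapForm_mem (ℳ.quasiIso.map_gr 1) R.property.weight
  ω_maurerCartan := maurerCartan_mapForm ℳ.quasiIso.map_d R.property.maurerCartan
  ω' := formB J R.obj
  ω'_weight := mapForm_mem (𝒩.quasiIso.map_gr 1) (form_weight J R)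
  ω'_maurerCartan := maurerCartan_mapForm 𝒩.quasiIso.map_d (form_maurerCartan J R)
  ω'_hodge := formB_hodge J R
  a := T.a R
  a_weight := T.weight R
  a_flat := T.flat R

theorem wedge_one_tmul_of_hom {R S : PreRep ℳ.M} (f : R ⟶ S) :
    wedge S.Ω (1 ⊗ₜ BifilteredSpace.lin f.f) = wedge (1 ⊗ₜ BifilteredSpace.lin f.f) R.Ω := by
  have h₁ : ∀ x : ℳ.M.carrier ⊗[K] (R.X.V →ₗ[K] R.X.V),
      wedge (1 ⊗ₜ BifilteredSpace.lin f.f) x = PreRep.post (BifilteredSpace.lin f.f) x := fun x => by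
    induction x using TensorProduct.induction_on with
    | zero => simp
    | add x y hx hy => simp only [map_add, wedge_add, hx, hy]
    | tmul a g => rw [wedge_tmul, one_mul]; rfl
  have h₂ : ∀ x : ℳ.M.carrier ⊗[K] (S.X.V →ₗ[K] S.X.V),
      wedge x (1 ⊗ₜ BifilteredSpace.lin f.f) = PreRep.pre (BifilteredSpace.lin f.f) x := fun x => by
    induction x using TensorProduct.induction_on with
    | zero => simp
    | add x y hx hy => simp only [map_add, add_wedge, hx, hy]
    | tmul a g => rw [wedge_tmul, mul_one]; rfl
  rw [h₁, h₂, PreRep.Hom.comm f]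

theorem formA_hom {R S : PreRep ℳ.M} (f : R ⟶ S) :
    wedge (formA S) (1 ⊗ₜ BifilteredSpace.lin f.f) =
      wedge (1 ⊗ₜ BifilteredSpace.lin f.f) (formA R) := by
  have h := congrArg (mapForm ℳ.φ.toLinearMap) (wedge_one_tmul_of_hom f)
  rw [mapForm_wedge, mapForm_wedge, mapForm_tmul] at h
  simpa [formA] using h

theorem form_hom (J : CanonicalIso ℳ 𝒩 C) {R S : PreRep ℳ.M} (f : R ⟶ S) :
    wedge (J.form S) (1 ⊗ₜ (BifilteredSpace.lin f.f).baseChange ℂ) =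
      wedge (1 ⊗ₜ (BifilteredSpace.lin f.f).baseChange ℂ) (J.form R) := by
  have h := congrArg (mapForm (J.I.symm : _ →ₐ[ℂ] 𝒩.N.carrier).toLinearMap)
    (congrArg (cxForm K) (wedge_one_tmul_of_hom f))
  rw [cxForm_wedge, cxForm_wedge, mapForm_wedge, mapForm_wedge, cxForm_tmul, mapForm_tmul,
    ← Algebra.TensorProduct.one_def, AlgHom.toLinearMap_apply, map_one] at h
  exact h

theorem formB_hom (J : CanonicalIso ℳ 𝒩 C) {R S : PreRep ℳ.M} (f : R ⟶ S) :
    wedge (formB J S) (1 ⊗ₜ (BifilteredSpace.lin f.f).baseChange ℂ) =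
      wedge (1 ⊗ₜ (BifilteredSpace.lin f.f).baseChange ℂ) (formB J R) := by
  have h := congrArg (mapForm 𝒩.ψ.toLinearMap) (form_hom J f)
  rw [mapForm_wedge, mapForm_wedge, mapForm_tmul] at h
  simpa [formB] using h

/-- The functor `Φ_C : HodgeRep J ⥤ VMHS D`. -/
noncomputable def Phi (T : Transport J) : HodgeRep J ⥤ VMHS D where
  obj R := PhiObj T R
  map {R S} f := VMHS.const (x := PhiObj T R) (y := PhiObj T S) f.hom.f (formA_hom f.hom)
    (formB_hom J f.hom) (T.natural f)
  map_id R := VMHS.const_id (x := PhiObj T R)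
  map_comp {R S U} f g :=
    VMHS.const_comp (x := PhiObj T R) (y := PhiObj T S) (z := PhiObj T U) f.hom.f g.hom.f

end Phi

section NMHS

variable (K : Type u) [Field K] [Algebra K ℝ]

/-- `(C, τ₁, τ₂)` is a `K`-non-abelian mixed Hodge structure: the symmetric monoidal category `C`
is an abelian rigid `K`-tensor category, and `τ₁ : C ⥤ MHS K` and `τ₂ : MHS K ⥤ C` are exact
faithful `K`-linear tensor functors with `τ₁ ∘ τ₂ = id` (as tensor functors). -/
structure IsNMHS [(isMHS K).IsMonoidal] (C : Type (u + 1)) [Category.{u} C] [Preadditive C]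
    [Linear K C] [MonoidalCategory C] [SymmetricCategory C] (τ₁ : C ⥤ MHS K) (τ₂ : MHS K ⥤ C) :
    Prop where
  abelian : ∃ h : Abelian C, h.toPreadditive = ‹Preadditive C›
  rigid : Nonempty (RigidCategory C)
  bilinear : ∃ _ : MonoidalPreadditive C, MonoidalLinear K C
  faithful₁ : τ₁.Faithful
  linear₁ : ∃ _ : τ₁.Additive, τ₁.Linear K
  exact₁ : Limits.PreservesFiniteLimits τ₁ ∧ Limits.PreservesFiniteColimits τ₁
  faithful₂ : τ₂.Faithful
  linear₂ : ∃ _ : τ₂.Additive, τ₂.Linear K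
  exact₂ : Limits.PreservesFiniteLimits τ₂ ∧ Limits.PreservesFiniteColimits τ₂
  tensor : ∃ (_ : τ₁.Braided) (_ : τ₂.Braided) (h : τ₂ ⋙ τ₁ = 𝟭 (MHS K)),
    NatTrans.IsMonoidal (eqToHom h)

end NMHS
end NonabelianHodge

open NonabelianHodge

/-!
# Unipotent variations over a mixed Hodge diagram and representations of its `1`-minimal model

**The canonical isomorphism.**  The homotopy `ℋ` and the isomorphism `ℐ` form one homomorphism from
`N` to the cylinder `M × (B ⊗ (t, dt))`, where an element `α + β dt` is encoded as an upper
triangular `2 × 2` matrix of polynomials.  As `N` is an exterior algebra on `⨁ 𝒱ᵢ`, the homomorphism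
is built on one `𝒱ᵢ` after another: `d v` lies in the part already treated, the obstruction vanishes
in `H²(M)` because it does so in `H²(B)`, and the complement `C` provides the primitive `b`
(`exists_lift`).  Its component in `M` is bijective, by induction on the stages
(`exists_canonicalIso`).  That `ι` is a quasi-isomorphism follows from the isomorphism on `E₁` by
induction on the weight (`cone_acyclic`).

**Parallel transport.**  The equation `∂g/∂t = g β` is solved by iterated integrals, a finite sum
because `β` lowers weights (`exists_transport`).  Solutions are unique, which shows that `a_Ω` is
natural (`transport_natural`) and flat (`transport_flat`).

**The equivalence.**  In a basis adapted to the weight filtration, unipotent forms are strictly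
triangular matrices, and statements on flat forms are proved by induction on the distance from the
diagonal.  Flat sections of connections coming from a `1`-minimal model are constant
(`exists_const_of_flat`), so that `Φ` is fully faithful.  Every flat unipotent form is
gauge equivalent to one coming from the model (`exists_gauge`), compatibly with the Hodge filtration
for `ω'`: this needs a strictness property of `ψ : N → B` on `H¹` (`eq_zero_of_mem_hodge`), which
follows from the Hodge structures on `E₁`, the homotopies to `ψ` and `ψ'`, and the strictness of `d`
on `B⁰`.  Comparing the two gauge transformations gives a constant unipotent map, by which the Hodge
filtration has to be twisted; the result is a representation whose image under `Φ` is isomorphic to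
the given variation (`exists_iso_PhiObj`).

**Mixed Hodge structures and representations.**  Deligne's splitting (`exists_deligneGrading`) shows
that morphisms are strict and that tensor products, duals, kernels and cokernels of mixed Hodge
structures are mixed Hodge structures.  The forms on these spaces are again compatible with both
filtrations, so representations form an abelian rigid tensor category.

**Transport of structure.**  The tensor structure on variations is transported along `Φ`.  The
quasi-inverse is chosen to send the constant variation on `V` to the trivial representation on `V`
itself, not only up to isomorphism, so that `ε ∘ κ` is equal to the identity
(`exists_symmetric_of_equivalence`).

**Weights.**  The Maurer–Cartan equation determines `d` of a matrix entry of `Ω` from entries closer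
to the diagonal; strictness of `d` and the weight of closed elements give the weight of the entry
(`mem_weight_of_closed`).
-/

namespace NonabelianHodge

open Submodule (mem_sup mem_comap tmul_mem_baseChange_of_mem mem_iSup_of_mem mem_sup_left
  mem_sup_right baseChange_eq_span span_le baseChange_bot baseChange_top comap_mono map_mono
  add_mem_sup mem_dualAnnihilator iSup_induction' mkQ_surjective liftQ_mkQ)
open TensorProduct (induction_on ext' tmul_smul tmul_add smul_tmul' smul_tmul add_tmul tmul_sum
  tmul_neg neg_tmul zero_tmul tmul_zero sum_tmul sub_tmul tmul_sub mapBilinear mapBilinear_apply)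
open LinearMap (baseChange_comp baseChange_id baseChange_tmul baseChange_zero mulLeft)
open Matrix (mul_apply map_apply one_apply_ne)
open Finset (sum_congr sum_eq_zero mem_filter mem_Icc sum_add_distrib sum_comm mem_image_of_mem)

noncomputable section

variable {K : Type u} [Field K] [Algebra K ℝ] {D : MixedHodgeDiagram K} {ℳ : FilteredModel D}
  {𝒩 : BigradedModel D} {C : Submodule ℂ D.B.carrier}

/-! ### Tensors, contractions and complexification -/

section Slices

variable {k : Type*} [Field k] {M N H H' : Type*} [AddCommGroup M] [Module k M]
  [AddCommGroup N] [Module k N] [AddCommGroup H] [Module k H] [AddCommGroup H'] [Module k H']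

/-- The contraction `m ⊗ h ↦ θ(m) h` of a tensor with a linear form on its first factor. -/
def slice (θ : M →ₗ[k] k) : M ⊗[k] H →ₗ[k] H :=
  (TensorProduct.lid k H).toLinearMap ∘ₗ θ.rTensor H

@[simp] theorem slice_tmul (θ : M →ₗ[k] k) (m : M) (h : H) : slice θ (m ⊗ₜ[k] h) = θ m • h := by
  simp [slice]

theorem slice_rTensor (θ : N →ₗ[k] k) (f : M →ₗ[k] N) (x : M ⊗[k] H) :
    slice θ (f.rTensor H x) = slice (θ ∘ₗ f) x := by
  induction x using induction_on with
  | zero => simp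
  | add x y hx hy => simp only [map_add, hx, hy]
  | tmul m h => simp

theorem slice_lTensor (θ : M →ₗ[k] k) (f : H →ₗ[k] H') (x : M ⊗[k] H) :
    slice θ (f.lTensor M x) = f (slice θ x) := by
  induction x using induction_on with
  | zero => simp
  | add x y hx hy => simp only [map_add, hx, hy]
  | tmul m h => simp

theorem equivFinsuppOfBasisLeft_eq_slice {ι : Type*} [DecidableEq ι] (e : Module.Basis ι k M)
    (x : M ⊗[k] H) (i : ι) :
    TensorProduct.equivFinsuppOfBasisLeft e x i = slice (e.coord i) x := by
  induction x using induction_on with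
  | zero => simp
  | add x y hx hy => simp only [map_add, Finsupp.add_apply, hx, hy]
  | tmul m h => simp

/-- The expansion of a tensor along a basis of its first factor. -/
theorem exists_eq_sum_slice {ι : Type*} (e : Module.Basis ι k M) (x : M ⊗[k] H) :
    ∃ s : Finset ι, x = ∑ i ∈ s, e i ⊗ₜ[k] slice (e.coord i) x := by
  classical
  refine ⟨(TensorProduct.equivFinsuppOfBasisLeft e x).support, ?_⟩
  conv_lhs => rw [← (TensorProduct.equivFinsuppOfBasisLeft e).symm_apply_apply x]
  rw [TensorProduct.equivFinsuppOfBasisLeft_symm_apply, Finsupp.sum]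
  exact sum_congr rfl fun i _ => by rw [equivFinsuppOfBasisLeft_eq_slice]

theorem eq_zero_of_slice {x : M ⊗[k] H} (h : ∀ θ : M →ₗ[k] k, slice θ x = 0) : x = 0 := by
  obtain ⟨s, hs⟩ := exists_eq_sum_slice (Module.Basis.ofVectorSpace k M) x
  rw [hs]
  exact sum_eq_zero fun i _ => by rw [h, tmul_zero]

theorem eq_of_slice {x y : M ⊗[k] H} (h : ∀ θ : M →ₗ[k] k, slice θ x = slice θ y) : x = y :=
  sub_eq_zero.1 (eq_zero_of_slice fun θ => by rw [map_sub, h, sub_self])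

/-- Membership in `P ⊗ Q` can be tested by contracting with linear forms. -/
theorem mem_tens_iff {P : Submodule k M} {Q : Submodule k H} {x : M ⊗[k] H} :
    x ∈ tens k P Q ↔ (∀ θ : M →ₗ[k] k, slice θ x ∈ Q) ∧
      ∀ θ : M →ₗ[k] k, (∀ p ∈ P, θ p = 0) → slice θ x = 0 := by
  constructor
  · refine fun hx => ⟨fun θ => ?_, fun θ hθ => ?_⟩
    · exact (tens_le (R := Q.comap (slice θ)) fun p _ q hq => by
        simpa using Q.smul_mem _ hq) hx
    · exact (tens_le (R := LinearMap.ker (slice θ)) fun p hp q _ => by simp [hθ p hp]) hx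
  · rintro ⟨h₁, h₂⟩
    obtain ⟨P', hP'⟩ := Submodule.exists_isCompl P
    let π : M →ₗ[k] M := P.subtype ∘ₗ P.projectionOnto P' hP'
    have hπ : ∀ p ∈ P, π p = p := fun p hp =>
      congrArg Subtype.val (Submodule.projectionOnto_apply_left hP' ⟨p, hp⟩)
    have hx : x = π.rTensor H x := by
      refine eq_of_slice fun θ => ?_
      rw [slice_rTensor, ← sub_eq_zero]
      have := h₂ (θ - θ ∘ₗ π) fun p hp => by simp [hπ p hp]
      rwa [show slice (H := H) (θ - θ ∘ₗ π) x = slice θ x - slice (θ ∘ₗ π) x by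
        simp [slice, LinearMap.rTensor_sub]] at this
    obtain ⟨s, hs⟩ := exists_eq_sum_slice (Module.Basis.ofVectorSpace k M) x
    rw [hx, hs, map_sum]
    exact sum_mem fun i _ => tmul_mem_tens (Submodule.coe_mem _) (h₁ _)

theorem exists_dual_of_notMem {P : Submodule k M} {x : M} (hx : x ∉ P) :
    ∃ θ : M →ₗ[k] k, (∀ p ∈ P, θ p = 0) ∧ θ x ≠ 0 := by
  obtain ⟨f, hf, hP⟩ := Submodule.exists_le_ker_of_notMem hx
  exact ⟨f, fun p hp => hP hp, hf⟩

end Slices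

section BaseChange

variable {K : Type*} [Field K] {L : Type*} [Field L] [Algebra K L]
variable {V V' : Type*} [AddCommGroup V] [Module K V] [AddCommGroup V'] [Module K V']

/-- Membership in the extension of scalars of a subspace can be tested by `K`-linear forms on the
larger field. -/
theorem mem_baseChange_iff {P : Submodule K V} {x : L ⊗[K] V} :
    x ∈ P.baseChange L ↔ ∀ θ : L →ₗ[K] K, slice θ x ∈ P := by
  constructor
  · intro hx
    rw [baseChange_eq_span] at hx
    induction hx using Submodule.span_induction with
    | mem y hy => obtain ⟨p, hp, rfl⟩ := hy; intro θ; simpa using P.smul_mem _ hp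
    | zero => simp
    | add y z _ _ hy hz => intro θ; rw [map_add]; exact add_mem (hy θ) (hz θ)
    | smul c y _ hy =>
      intro θ
      have : slice θ (c • y) = slice (θ ∘ₗ mulLeft K c) y := by
        clear hy
        rename_i hm
        clear hm
        induction y using induction_on with
        | zero => simp
        | add a b ha hb => simp only [smul_add, map_add, ha, hb]
        | tmul a b => simp [smul_tmul']
      rw [this]; exact hy _
  · intro h
    obtain ⟨s, hs⟩ := exists_eq_sum_slice (Module.Basis.ofVectorSpace K L) x
    rw [hs]
    exact sum_mem fun i _ => tmul_mem_baseChange_of_mem _ (h _)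

theorem slice_baseChange (θ : L →ₗ[K] K) (f : V →ₗ[K] V') (x : L ⊗[K] V) :
    slice θ (f.baseChange L x) = f (slice θ x) := by
  induction x using induction_on with
  | zero => simp
  | add x y hx hy => simp only [map_add, hx, hy]
  | tmul m h => simp

theorem baseChange_comap (f : V →ₗ[K] V') (P : Submodule K V') :
    (P.comap f).baseChange L = (P.baseChange L).comap (f.baseChange L) := by
  ext x
  simp only [mem_baseChange_iff, mem_comap, slice_baseChange]

theorem baseChange_inf (P Q : Submodule K V) :
    (P ⊓ Q).baseChange L = P.baseChange L ⊓ Q.baseChange L := by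
  ext x
  simp only [mem_baseChange_iff, Submodule.mem_inf, forall_and]

theorem baseChange_ker (f : V →ₗ[K] V') :
    (LinearMap.ker f).baseChange L = LinearMap.ker (f.baseChange L) := by
  rw [← Submodule.comap_bot, baseChange_comap, baseChange_bot, Submodule.comap_bot]

theorem baseChange_map (f : V →ₗ[K] V') (P : Submodule K V) :
    (P.map f).baseChange L = (P.baseChange L).map (f.baseChange L) := by
  apply le_antisymm
  · rw [baseChange_eq_span, span_le]
    rintro _ ⟨_, ⟨p, hp, rfl⟩, rfl⟩
    exact ⟨1 ⊗ₜ p, tmul_mem_baseChange_of_mem _ hp, by simp⟩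
  · rw [Submodule.map_le_iff_le_comap, baseChange_eq_span, span_le]
    rintro _ ⟨p, hp, rfl⟩
    have := tmul_mem_baseChange_of_mem (1 : L) (Submodule.mem_map_of_mem (f := f) hp)
    simpa using this

theorem baseChange_mono {P Q : Submodule K V} (h : P ≤ Q) : P.baseChange L ≤ Q.baseChange L :=
  fun _ hx => mem_baseChange_iff.2 fun θ => h (mem_baseChange_iff.1 hx θ)

theorem baseChange_sup (P Q : Submodule K V) :
    (P ⊔ Q).baseChange L = P.baseChange L ⊔ Q.baseChange L := by
  apply le_antisymm
  · rw [baseChange_eq_span, span_le]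
    rintro _ ⟨_, h, rfl⟩
    obtain ⟨p, hp, q, hq, rfl⟩ := mem_sup.1 h
    rw [map_add]
    exact add_mem_sup (tmul_mem_baseChange_of_mem 1 hp)
      (tmul_mem_baseChange_of_mem 1 hq)
  · exact sup_le (baseChange_mono le_sup_left) (baseChange_mono le_sup_right)

theorem one_tmul_mem_baseChange {P : Submodule K V} {x : V} :
    (1 : L) ⊗ₜ[K] x ∈ P.baseChange L ↔ x ∈ P := by
  refine ⟨fun h => ?_, tmul_mem_baseChange_of_mem 1⟩
  obtain ⟨θ, -, hθ⟩ := exists_dual_of_notMem (k := K) (P := ⊥) (x := (1 : L)) (by simp)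
  have := mem_baseChange_iff.1 h θ
  rw [slice_tmul] at this
  exact (P.smul_mem_iff hθ).1 this

theorem baseChange_injective_of_le {P Q : Submodule K V} (h : P.baseChange L ≤ Q.baseChange L) :
    P ≤ Q := fun _ hx =>
  one_tmul_mem_baseChange.1 (h (tmul_mem_baseChange_of_mem (1 : L) hx))

end BaseChange

section Graded

variable {k : Type*} [Field k] {V : Type*} [AddCommGroup V] [Module k V] {σ : Type*}

/-- A family of subspaces is independent as soon as it is independent on the graded pieces of a
filtration. -/
theorem iSupIndep_of_filtration (W : ℤ → Submodule k V) (hW : Monotone W) (deg : σ → ℤ)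
    (I : σ → Submodule k V) (hI : ∀ s, I s ≤ W (deg s))
    (h : ∀ (n : ℤ) (S : Finset σ) (x : σ → V), (∀ s ∈ S, deg s = n) → (∀ s ∈ S, x s ∈ I s) →
      ∑ s ∈ S, x s ∈ W (n - 1) → ∀ s ∈ S, x s = 0) : iSupIndep I := by
  classical
  rw [iSupIndep_iff_finsetSum_eq_zero_imp_eq_zero]
  intro S x hx h0
  obtain ⟨N, hN⟩ : ∃ N : ℤ, ∀ s ∈ S, deg s < N := by
    obtain ⟨N, hN⟩ := (S.image deg).bddAbove
    exact ⟨N + 1, fun s hs => Int.lt_add_one_iff.2 (hN (mem_image_of_mem _ hs))⟩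
  have key : ∀ j : ℕ, ∀ s ∈ S, N - j ≤ deg s → x s = 0 := by
    intro j
    induction j with
    | zero => intro s hs h; have := hN s hs; simp at h; omega
    | succ j ih =>
      have h' := h (N - (j + 1)) (S.filter fun s => deg s = N - (j + 1)) x
        (fun s hs => (mem_filter.1 hs).2) (fun s hs => hx s (mem_filter.1 hs).1) (by
          rw [← Finset.sum_filter_add_sum_filter_not S (fun s => deg s = N - (j + 1))] at h0
          rw [eq_neg_of_add_eq_zero_left h0]
          refine neg_mem (sum_mem fun s hs => ?_)
          obtain ⟨hs, hs'⟩ := mem_filter.1 hs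
          by_cases hd : N - j ≤ deg s
          · rw [ih s hs hd]; exact zero_mem _
          · exact hW (by omega) (hI s (hx s hs)))
      intro s hs hd
      by_cases hd' : N - j ≤ deg s
      · exact ih s hs hd'
      · exact h' s (mem_filter.2 ⟨hs, by push_cast at hd; omega⟩)
  intro s hs
  exact key (N - deg s).toNat s hs (by have := hN s hs; omega)

/-- If every step of a finite filtration is filled by the pieces `I s` of the corresponding degree,
then the filtration is the one defined by the degree. -/
theorem eq_iSup_of_filtration (W : ℤ → Submodule k V) (hW : Monotone W) (hbot : ∃ n, W n = ⊥)
    (deg : σ → ℤ) (I : σ → Submodule k V) (hI : ∀ s, I s ≤ W (deg s))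
    (h : ∀ n, W n ≤ W (n - 1) ⊔ ⨆ s ∈ {s | deg s = n}, I s) (n : ℤ) :
    W n = ⨆ s ∈ {s | deg s ≤ n}, I s := by
  apply le_antisymm
  · obtain ⟨a, ha⟩ := hbot
    by_cases hn : n ≤ a
    · exact (hW hn).trans (ha.le.trans bot_le)
    · obtain ⟨j, rfl⟩ : ∃ j : ℕ, n = a + j := ⟨(n - a).toNat, by omega⟩
      clear hn
      induction j with
      | zero => simp [ha]
      | succ j ih =>
        refine (h _).trans (sup_le ?_ (biSup_mono fun s hs => ?_))
        · push_cast
          rw [← add_assoc, add_sub_cancel_right]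
          refine ih.trans (biSup_mono fun s hs => ?_)
          simp only [Set.mem_ofPred_eq] at hs ⊢; omega
        · simp only [Set.mem_ofPred_eq] at hs ⊢; omega
  · exact iSup₂_le fun s hs => (hI s).trans (hW hs)

/-- A basis adapted to a decomposition of a finite-dimensional space. -/
theorem exists_basis_of_iSupIndep [FiniteDimensional k V] (I : σ → Submodule k V)
    (hI : iSupIndep I) (htop : ⨆ s, I s = ⊤) :
    ∃ (n : ℕ) (b : Module.Basis (Fin n) k V) (t : Fin n → σ), (∀ i, b i ∈ I (t i)) ∧
      ∀ (T : Set σ) x, x ∈ ⨆ s ∈ T, I s ↔ ∀ i, b.repr x i ≠ 0 → t i ∈ T := by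
  classical
  have hint : DirectSum.IsInternal I :=
    (DirectSum.isInternal_submodule_iff_iSupIndep_and_iSup_eq_top I).2 ⟨hI, htop⟩
  let b₀ := hint.collectedBasis fun s => Module.finBasis k (I s)
  have : Fintype (Σ s, Fin (Module.finrank k (I s))) := FiniteDimensional.fintypeBasisIndex b₀
  let e := Fintype.equivFin (Σ s, Fin (Module.finrank k (I s)))
  have hmem : ∀ i, b₀.reindex e i ∈ I ((e.symm i).1) := fun i => by
    rw [Module.Basis.reindex_apply]; exact hint.collectedBasis_mem _ _
  refine ⟨_, b₀.reindex e, fun i => (e.symm i).1, hmem, fun T x => ⟨fun hx i hi => ?_, fun h => ?_⟩⟩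
  · by_contra hT
    apply hi
    have : ⨆ s ∈ T, I s ≤ LinearMap.ker ((b₀.reindex e).coord i) := by
      refine iSup₂_le fun s hs y hy => ?_
      rw [LinearMap.mem_ker, Module.Basis.coord_apply, Module.Basis.repr_reindex_apply]
      exact hint.collectedBasis_repr_of_mem_ne _ (fun h => hT (by subst h; exact hs)) hy
    exact this hx
  · rw [← (b₀.reindex e).sum_repr x]
    refine sum_mem fun i _ => ?_
    by_cases hi : (b₀.reindex e).repr x i = 0
    · rw [hi, zero_smul]; exact zero_mem _
    · exact Submodule.smul_mem _ _ (mem_iSup_of_mem _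
        (mem_iSup_of_mem (h i hi) (hmem i)))

/-- The projections onto the pieces of a decomposition of a finite-dimensional space. -/
theorem exists_projections_of_iSupIndep [FiniteDimensional k V] [DecidableEq σ]
    (I : σ → Submodule k V) (hI : iSupIndep I) (htop : ⨆ s, I s = ⊤) :
    ∃ (S : Finset σ) (π : σ → V →ₗ[k] V), (∀ s x, π s x ∈ I s) ∧ (∀ s, ∀ x ∈ I s, π s x = x) ∧
      (∀ x, ∑ s ∈ S, π s x = x) ∧ (∀ s t x, π s (π t x) = if s = t then π t x else 0) ∧
      ∀ (T : Set σ) x, x ∈ ⨆ s ∈ T, I s ↔ ∀ s, s ∉ T → π s x = 0 := by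
  obtain ⟨n, b, t, hb, ht⟩ := exists_basis_of_iSupIndep I hI htop
  let π : σ → V →ₗ[k] V := fun s => ∑ i, if t i = s then (b.coord i).smulRight (b i) else 0
  have hπ : ∀ s x, π s x = ∑ i, if t i = s then b.repr x i • b i else 0 := fun s x => by
    simp only [π, LinearMap.sum_apply]
    exact sum_congr rfl fun i _ => by split_ifs <;> simp
  have hrepr : ∀ s x i, b.repr (π s x) i = if t i = s then b.repr x i else 0 := fun s x i => by
    rw [hπ, map_sum, Finset.sum_apply']
    rw [Finset.sum_eq_single i]
    · split_ifs <;> simp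
    · intro j _ hj
      split_ifs <;> simp [hj]
    · simp
  have hmem : ∀ s x, π s x ∈ I s := fun s x => by
    rw [hπ]
    refine sum_mem fun i _ => ?_
    split_ifs with h
    · exact h ▸ Submodule.smul_mem _ _ (hb i)
    · exact zero_mem _
  have hT : ∀ (T : Set σ) x, x ∈ ⨆ s ∈ T, I s ↔ ∀ s, s ∉ T → π s x = 0 := by
    intro T x
    rw [ht]
    constructor
    · intro h s hs
      refine b.repr.injective (Finsupp.ext fun i => ?_)
      rw [hrepr, map_zero, Finsupp.zero_apply]
      split_ifs with hi
      · by_contra h0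
        exact hs (hi ▸ h i h0)
      · rfl
    · intro h i hi
      by_contra hn
      have := hrepr (t i) x i
      rw [h _ hn, if_pos rfl] at this
      exact hi (by rw [← this]; simp)
  have horth : ∀ s t x, π s (π t x) = if s = t then π t x else 0 := by
    intro s s' x
    refine b.repr.injective (Finsupp.ext fun i => ?_)
    rw [hrepr, hrepr]
    by_cases h : s = s'
    · subst h; rw [if_pos rfl, hrepr]; split_ifs <;> rfl
    · rw [if_neg h]
      split_ifs with h₁ h₂ <;> simp_all
  refine ⟨Finset.univ.image t, π, hmem, fun s x hx => ?_, fun x => ?_, horth, hT⟩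
  · refine b.repr.injective (Finsupp.ext fun i => ?_)
    rw [hrepr]
    split_ifs with h
    · rfl
    · by_contra h0
      have := (ht {s} x).1 (mem_iSup_of_mem s (mem_iSup_of_mem rfl hx)) i
        (fun h => h0 h.symm)
      exact h this
  · refine b.repr.injective (Finsupp.ext fun i => ?_)
    rw [map_sum, Finset.sum_apply']
    simp_rw [hrepr]
    rw [Finset.sum_ite_eq]
    simp

/-- A basis adapted to a finite increasing filtration. -/
theorem exists_adapted_basis [FiniteDimensional k V] (W : ℤ → Submodule k V) (hW : Monotone W)
    (htop : ∃ n, W n = ⊤) (hbot : ∃ n, W n = ⊥) :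
    ∃ (n : ℕ) (b : Module.Basis (Fin n) k V) (w : Fin n → ℤ),
      ∀ m x, x ∈ W m ↔ ∀ i, b.repr x i ≠ 0 → w i ≤ m := by
  have hc : ∀ m, ∃ P ≤ W m, P ⊓ W (m - 1) = ⊥ ∧ W m ≤ W (m - 1) ⊔ P := by
    intro m
    obtain ⟨P, hP⟩ := Submodule.exists_isCompl (W (m - 1))
    have hle : W (m - 1) ≤ W m := hW (by omega)
    refine ⟨P ⊓ W m, inf_le_right, ?_, ?_⟩
    · rw [eq_bot_iff]
      exact (le_inf inf_le_right (inf_le_left.trans inf_le_left)).trans hP.inf_eq_bot.le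
    · rw [← sup_inf_assoc_of_le P hle, hP.sup_eq_top, top_inf_eq]
  choose P hP hinf hsup using hc
  have hind : iSupIndep P := by
    refine iSupIndep_of_filtration W hW id P hP fun n S x hd hx hs s hsS => ?_
    obtain rfl : s = n := hd s hsS
    have : S = {s} := Finset.eq_singleton_iff_unique_mem.2 ⟨hsS, fun t ht => hd t ht⟩
    rw [this, Finset.sum_singleton] at hs
    exact (Submodule.mem_bot k).1 (hinf s ▸ ⟨hx s hsS, hs⟩)
  have hWP := eq_iSup_of_filtration W hW hbot id P hP fun n => (hsup n).trans
    (sup_le_sup_left (by simp) _)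
  obtain ⟨a, ha⟩ := htop
  obtain ⟨n, b, t, -, ht⟩ := exists_basis_of_iSupIndep P hind (top_le_iff.1 (by
    rw [← ha, hWP]; exact iSup₂_le fun s _ => le_iSup P s))
  exact ⟨n, b, t, fun m x => by rw [hWP]; exact ht _ x⟩

end Graded

/-! ### The Deligne splitting of a mixed Hodge structure -/

section Conjugation

variable {V V' : Type*} [AddCommGroup V] [Module K V] [AddCommGroup V'] [Module K V']

@[simp] theorem conjC_tmul (c : ℂ) (x : V) :
    conjC K V (c ⊗ₜ x) = (starRingEnd ℂ c) ⊗ₜ x := rfl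

@[simp] theorem conjC_conjC (x : ℂ ⊗[K] V) : conjC K V (conjC K V x) = x := by
  induction x using induction_on with
  | zero => simp
  | add x y hx hy => rw [map_add, map_add, hx, hy]
  | tmul c v => simp

theorem conjC_baseChange (f : V →ₗ[K] V') (x : ℂ ⊗[K] V) :
    conjC K V' (f.baseChange ℂ x) = f.baseChange ℂ (conjC K V x) := by
  induction x using induction_on with
  | zero => simp
  | add x y hx hy => simp only [map_add, hx, hy]
  | tmul c v => simp

theorem conjC_mem_baseChange {P : Submodule K V} {x : ℂ ⊗[K] V} (hx : x ∈ P.baseChange ℂ) :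
    conjC K V x ∈ P.baseChange ℂ := by
  rw [mem_baseChange_iff] at hx ⊢
  intro θ
  have : slice θ (conjC K V x) = slice (θ ∘ₗ conjK K) x := by
    clear hx
    induction x using induction_on with
    | zero => simp
    | add x y hx hy => simp only [map_add, hx, hy]
    | tmul c v => simp [conjK]
  rw [this]; exact hx _

end Conjugation

namespace IsHodgeStructure

variable {V : Type*} [AddCommGroup V] [Module K V] {top bot : Submodule ℂ (ℂ ⊗[K] V)}
  {G : ℤ → Submodule ℂ (ℂ ⊗[K] V)} {n : ℤ} (h : IsHodgeStructure K top bot G n)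

include h

theorem bot_le (p : ℤ) : bot ≤ G p := by rw [← h.inf_eq p]; exact inf_le_left

theorem le_top (p : ℤ) : G p ≤ top := by rw [← h.sup_eq p]; exact le_sup_left

theorem mem_bot {p q : ℤ} (hpq : n + 1 ≤ p + q) {x : ℂ ⊗[K] V} (hx : x ∈ G p)
    (hx' : conjC K V x ∈ G q) : x ∈ bot := by
  rw [← h.inf_eq p]
  exact ⟨hx, h.anti (by omega) hx'⟩

theorem conj_mem_bot {x : ℂ ⊗[K] V} (hx : x ∈ bot) : conjC K V x ∈ bot := by
  have h' : ∀ q, conjC K V x ∈ G q := fun q => by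
    rw [← h.inf_eq (n + 1 - q)] at hx
    have := hx.2
    rw [show n + 1 - (n + 1 - q) = q by omega] at this
    exact this
  exact h.mem_bot (p := n + 1) (q := 0) (by omega) (h' _) (by simpa using h.bot_le 0 hx)

/-- The types `(p, n - p)` of a Hodge structure of weight `n` are independent. -/
theorem mem_bot_of_sum_mem (S : Finset ℤ) (c : ℤ → ℂ ⊗[K] V) (hc : ∀ p ∈ S, c p ∈ G p)
    (hc' : ∀ p ∈ S, conjC K V (c p) ∈ G (n - p)) (hs : ∑ p ∈ S, c p ∈ bot) :
    ∀ p ∈ S, c p ∈ bot := by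
  induction S using Finset.induction_on_max with
  | empty => simp
  | insert a S ha ih =>
    have haS : a ∉ S := fun h => lt_irrefl _ (ha a h)
    rw [Finset.sum_insert haS] at hs
    have h₁ : c a ∈ bot := by
      refine h.mem_bot (p := a) (q := n - a + 1) (by omega) (hc a (by simp)) ?_
      rw [show c a = (c a + ∑ p ∈ S, c p) - ∑ p ∈ S, c p by abel, map_sub, map_sum]
      refine sub_mem (h.bot_le _ (h.conj_mem_bot hs)) (sum_mem fun p hp => ?_)
      exact h.anti (by have := ha p hp; omega) (hc' p (by simp [hp]))
    have h₂ := ih (fun p hp => hc p (by simp [hp])) (fun p hp => hc' p (by simp [hp]))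
      ((add_mem_cancel_left h₁).1 hs)
    intro p hp
    rcases Finset.mem_insert.1 hp with rfl | hp
    exacts [h₁, h₂ p hp]

/-- Each step of the filtration is the sum of the types it contains, by descending induction. -/
theorem G_le (p : ℤ) : G p ≤ bot ⊔ ⨆ p' ∈ {p' | p ≤ p'}, (G p' ⊓ conjSub K (G (n - p'))) := by
  obtain ⟨p₀, hp₀⟩ := h.eventually_bot
  by_cases hp : p₀ ≤ p
  · exact (h.anti hp).trans (hp₀.le.trans le_sup_left)
  · obtain ⟨j, rfl⟩ : ∃ j : ℕ, p = p₀ - j := ⟨(p₀ - p).toNat, by omega⟩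
    clear hp
    induction j with
    | zero => simp [hp₀]
    | succ j ih =>
      have h₁ : G (p₀ - (j + 1 : ℕ)) = G (p₀ - j) ⊔
          (G (p₀ - (j + 1 : ℕ)) ⊓ conjSub K (G (n - (p₀ - (j + 1 : ℕ))))) := by
        have h₂ := h.sup_eq (p₀ - j)
        rw [show n + 1 - (p₀ - (j : ℤ)) = n - (p₀ - (j + 1 : ℕ)) by push_cast; ring] at h₂
        rw [inf_comm, ← sup_inf_assoc_of_le _ (h.anti (by push_cast; omega)), h₂,
          inf_eq_right.2 (h.le_top _)]
      rw [h₁]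
      refine sup_le (ih.trans (sup_le_sup_left (biSup_mono fun s hs => ?_) _)) ?_
      · simp only [Set.mem_ofPred_eq] at hs ⊢; push_cast; omega
      · exact le_sup_of_le_right (le_biSup (fun p' => G p' ⊓ conjSub K (G (n - p')))
          (show p₀ - ((j + 1 : ℕ) : ℤ) ∈ {p' | p₀ - ((j + 1 : ℕ) : ℤ) ≤ p'} by simp))

end IsHodgeStructure

namespace BifilteredSpace

variable (X : BifilteredSpace K)

theorem WC_mono : Monotone X.WC := fun _ _ h => baseChange_mono (X.W_mono h)

variable {X} in
theorem conjC_mem_WC {n : ℤ} {x : X.VC} (h : x ∈ X.WC n) : conjC K X.V x ∈ X.WC n :=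
  conjC_mem_baseChange h

variable {X} in
theorem lin_WC {Y : BifilteredSpace K} (f : X ⟶ Y) {n : ℤ} {x : X.VC} (h : x ∈ X.WC n) :
    (lin f).baseChange ℂ x ∈ Y.WC n := VMHS.baseChange_mem (fun _ => lin_W f) h

/-- The piece `I^{p,q}` of the Deligne splitting: the elements `x` of `F^p ∩ W_{p+q}` whose
conjugate lies in `F^q ∩ W_{p+q} + ∑_{i ≥ 2} F^{q-i+1} ∩ W_{p+q-i}`.  This sum is expressed as the
intersection of the spaces `F^{q-k} + W_{p+q-k-2}`. -/
def deligne (s : ℤ × ℤ) : Submodule ℂ X.VC :=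
  X.F s.1 ⊓ X.WC (s.1 + s.2) ⊓
    ⨅ k : ℕ, conjSub K (X.F (s.2 - k) ⊔ X.WC (s.1 + s.2 - k - 2))

/-- A bigrading of the complexification which splits both filtrations and is compatible with
conjugation modulo lower weights, given by its projections. -/
structure HodgeGrading where
  π : ℤ × ℤ → X.VC →ₗ[ℂ] X.VC
  S : Finset (ℤ × ℤ)
  sum : ∀ x, ∑ s ∈ S, π s x = x
  orth : ∀ s t x, π s (π t x) = if s = t then π t x else 0
  mem_W : ∀ n x, x ∈ X.WC n ↔ ∀ s, n < s.1 + s.2 → π s x = 0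
  mem_F : ∀ p x, x ∈ X.F p ↔ ∀ s, s.1 < p → π s x = 0
  conj : ∀ s t x, s.1 + s.2 ≤ t.1 + t.2 → t ≠ s.swap → π t (conjC K X.V (π s x)) = 0

section Deligne

variable {X}

theorem mem_deligne {s : ℤ × ℤ} {x : X.VC} : x ∈ X.deligne s ↔ x ∈ X.F s.1 ∧
    x ∈ X.WC (s.1 + s.2) ∧
      ∀ k : ℕ, conjC K X.V x ∈ X.F (s.2 - k) ⊔ X.WC (s.1 + s.2 - k - 2) := by
  simp [deligne, conjSub, and_assoc]

theorem deligne_le_WC (s : ℤ × ℤ) : X.deligne s ≤ X.WC (s.1 + s.2) :=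
  inf_le_left.trans inf_le_right

theorem lin_deligne {Y : BifilteredSpace K} (f : X ⟶ Y) {s : ℤ × ℤ} {x : X.VC}
    (h : x ∈ X.deligne s) : (lin f).baseChange ℂ x ∈ Y.deligne s := by
  rw [mem_deligne] at h ⊢
  refine ⟨lin_F f h.1, lin_WC f h.2.1, fun k => ?_⟩
  rw [conjC_baseChange]
  obtain ⟨u, hu, v, hv, huv⟩ := mem_sup.1 (h.2.2 k)
  rw [← huv, map_add]
  exact add_mem_sup (lin_F f hu) (lin_WC f hv)

variable (hX : isMHS K X)
include hX

theorem exists_WC_eq_bot : ∃ n, X.WC n = ⊥ := by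
  obtain ⟨n, hn⟩ := hX.2.1
  exact ⟨n, by rw [WC, hn, baseChange_bot]⟩

theorem exists_WC_eq_top : ∃ n, X.WC n = ⊤ := by
  obtain ⟨n, hn⟩ := hX.1
  exact ⟨n, by rw [WC, hn, baseChange_top]⟩

theorem WC_eq_bot_of_forall {n : ℤ} {x : X.VC} (h : ∀ k : ℕ, x ∈ X.WC (n - k)) : x = 0 := by
  obtain ⟨m, hm⟩ := exists_WC_eq_bot hX
  have := X.WC_mono (show n - (n - m).toNat ≤ m by omega) (h (n - m).toNat)
  rwa [hm] at this

/-- `I^{p,q}` meets the lower weights trivially: the condition on the conjugate of an element of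
`I^{p,q}` pushes it down one weight at a time. -/
theorem eq_zero_of_mem_deligne {s : ℤ × ℤ} {x : X.VC} (hx : x ∈ X.deligne s)
    (hx' : x ∈ X.WC (s.1 + s.2 - 1)) : x = 0 := by
  rw [mem_deligne] at hx
  refine WC_eq_bot_of_forall hX (n := s.1 + s.2 - 1) fun k => ?_
  induction k with
  | zero => simpa using hx'
  | succ k ih =>
    obtain ⟨u, hu, v, hv, huv⟩ := mem_sup.1 (hx.2.2 k)
    have h := hX.2.2 (s.1 + s.2 - 1 - k)
    rw [show s.1 + s.2 - (k : ℤ) - 2 = s.1 + s.2 - 1 - k - 1 by ring] at hv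
    push_cast
    rw [← sub_sub]
    -- in weight `p + q - 1 - k` the element has types in `F^p` and in the conjugate of `F^{q-k}`
    refine h.mem_bot (p := s.1) (q := s.2 - k) (by omega)
      (mem_sup_left ⟨hx.1, ih⟩) ?_
    rw [← huv]
    refine add_mem_sup ⟨hu, ?_⟩ hv
    rw [eq_sub_of_add_eq huv]
    exact sub_mem (conjC_mem_WC ih) (X.WC_mono (by omega) hv)

/-- An element of type `(p, q)` of `Gr^W_n` lifts to `I^{p,q}`: a lift in `F^p` is corrected, one
weight at a time, by elements of `F^p`. -/
theorem exists_deligne {p q n : ℤ} (hn : p + q = n) {x : X.VC}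
    (hx : x ∈ X.F p ⊓ X.WC n ⊔ X.WC (n - 1))
    (hx' : conjC K X.V x ∈ X.F q ⊓ X.WC n ⊔ X.WC (n - 1)) :
    ∃ y ∈ X.deligne (p, q), x - y ∈ X.WC (n - 1) := by
  have key : ∀ m : ℕ, ∃ u ∈ X.F p ⊓ X.WC n, x - u ∈ X.WC (n - 1) ∧
      ∃ l, (∀ k : ℕ, l ∈ X.F (q - k) ⊔ X.WC (n - k - 2)) ∧
        conjC K X.V u - l ∈ X.WC (n - 1 - m) := by
    intro m
    induction m with
    | zero =>
      obtain ⟨u, hu, w, hw, huw⟩ := mem_sup.1 hx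
      obtain ⟨l, hl, w', hw', hlw⟩ := mem_sup.1 hx'
      refine ⟨u, hu, by rw [← huw, add_sub_cancel_left]; exact hw, l,
        fun k => mem_sup_left (X.F_anti (by omega) hl.1), ?_⟩
      have : conjC K X.V u - l = w' - conjC K X.V w := by
        rw [← eq_sub_iff_add_eq] at huw
        rw [huw, map_sub, ← hlw]; abel
      rw [this]
      simpa using sub_mem hw' (conjC_mem_WC hw)
    | succ m ih =>
      obtain ⟨u, hu, hxu, l, hl, hul⟩ := ih
      -- split the error in weight `n - 1 - m` into a part in `F^p` and one whose conjugate is in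
      -- `F^{q - m}`
      have h := hX.2.2 (n - 1 - m)
      have hw := conjC_mem_WC hul
      rw [← h.sup_eq p] at hw
      obtain ⟨a, ha, b, hb, hab⟩ := mem_sup.1 hw
      obtain ⟨a', ha', a'', ha'', haa⟩ := mem_sup.1 ha
      rw [show n - 1 - (m : ℤ) + 1 - p = q - m by omega] at hb
      have hb : conjC K X.V b ∈ X.F (q - m) ⊓ X.WC (n - 1 - m) ⊔ X.WC (n - 1 - m - 1) := hb
      obtain ⟨b', hb', b'', hb'', hbb⟩ := mem_sup.1 hb
      refine ⟨u - a', sub_mem hu ⟨ha'.1, X.WC_mono (by omega) ha'.2⟩, ?_, l + b', fun k => ?_, ?_⟩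
      · rw [sub_sub_eq_add_sub, add_sub_right_comm]
        exact add_mem hxu (X.WC_mono (by omega) ha'.2)
      · refine add_mem (hl k) ?_
        by_cases hk : m ≤ k
        · exact mem_sup_left (X.F_anti (by omega) hb'.1)
        · exact mem_sup_right (X.WC_mono (by omega) hb'.2)
      · have h₁ : conjC K X.V u - l = conjC K X.V a' + conjC K X.V a'' + (b' + b'') := by
          have := congrArg (conjC K X.V) hab
          rw [conjC_conjC, map_add, ← haa, map_add, ← hbb] at this
          exact this.symm
        have h₂ : conjC K X.V (u - a') - (l + b') = conjC K X.V a'' + b'' := by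
          rw [map_sub, show conjC K X.V u - conjC K X.V a' - (l + b') =
            (conjC K X.V u - l) - conjC K X.V a' - b' by abel, h₁]; abel
        rw [h₂, show n - 1 - ((m + 1 : ℕ) : ℤ) = n - 1 - m - 1 by push_cast; ring]
        exact add_mem (conjC_mem_WC ha'') hb''
  obtain ⟨m, hm⟩ := exists_WC_eq_bot hX
  obtain ⟨u, hu, hxu, l, hl, hul⟩ := key (n - m).toNat
  have := X.WC_mono (show n - 1 - (n - m).toNat ≤ m by omega) hul
  rw [hm, Submodule.mem_bot, sub_eq_zero] at this
  exact ⟨u, mem_deligne.2 ⟨hu.1, by simpa [hn] using hu.2, fun k => by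
    rw [this]; simpa [hn] using hl k⟩, hxu⟩

theorem conjC_deligne {s : ℤ × ℤ} {x : X.VC} (hx : x ∈ X.deligne s) :
    conjC K X.V x ∈ X.deligne s.swap ⊔ X.WC (s.1 + s.2 - 1) := by
  rw [mem_deligne] at hx
  obtain ⟨y, hy, hxy⟩ := exists_deligne hX (p := s.2) (q := s.1) (n := s.1 + s.2) (by ring)
    (x := conjC K X.V x) (by
      obtain ⟨u, hu, v, hv, huv⟩ := mem_sup.1 (hx.2.2 0)
      rw [← huv]
      refine add_mem_sup ⟨by simpa using hu, ?_⟩ (X.WC_mono (by simp) hv)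
      rw [eq_sub_of_add_eq huv]
      exact sub_mem (conjC_mem_WC hx.2.1) (X.WC_mono (by simp) hv))
    (by rw [conjC_conjC]; exact mem_sup_left ⟨hx.1, hx.2.1⟩)
  rw [← add_sub_cancel y (conjC K X.V x)]
  exact add_mem_sup hy hxy

theorem hodge_le_deligne (n p : ℤ) : (X.F p ⊓ X.WC n ⊔ X.WC (n - 1)) ⊓
      conjSub K (X.F (n - p) ⊓ X.WC n ⊔ X.WC (n - 1)) ≤
    X.WC (n - 1) ⊔ X.deligne (p, n - p) := by
  intro x hx
  obtain ⟨y, hy, hxy⟩ := exists_deligne hX (p := p) (q := n - p) (n := n) (by ring) hx.1 hx.2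
  rw [← sub_add_cancel x y]
  exact add_mem_sup hxy hy

theorem iSupIndep_deligne : iSupIndep X.deligne := by
  classical
  have hle : ∀ s : ℤ × ℤ, X.deligne s ≤ X.WC (s.1 + s.2) := fun s => deligne_le_WC s
  have hW := X.WC_mono
  have key := @iSupIndep_of_filtration ℂ _ X.VC _ _ (ℤ × ℤ) X.WC hW (fun s => s.1 + s.2)
    X.deligne hle
  apply key
  intro n S x hd hx hs
  have hinj : Set.InjOn Prod.fst (S : Set (ℤ × ℤ)) := fun s hs t ht h => by
    have h₁ := hd s hs
    have h₂ := hd t ht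
    exact Prod.ext h (by omega)
  have hs' : ∀ s ∈ S, (s.1, n - s.1) = s := fun s hs => Prod.ext rfl (by
    have := hd s hs; simp; omega)
  have h := (hX.2.2 n).mem_bot_of_sum_mem (S.image Prod.fst) (fun p => x (p, n - p))
    (by
      simp only [Finset.mem_image, forall_exists_index, and_imp, forall_apply_eq_imp_iff₂]
      intro s hsS
      have := mem_deligne.1 (hx s hsS)
      rw [hs' s hsS]
      exact mem_sup_left ⟨this.1, by rw [← hd s hsS]; exact this.2.1⟩)
    (by
      simp only [Finset.mem_image, forall_exists_index, and_imp, forall_apply_eq_imp_iff₂]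
      intro s hsS
      rw [hs' s hsS]
      have hn := hd s hsS
      obtain ⟨y, hy, w, hw, hyw⟩ := mem_sup.1 (conjC_deligne hX (hx s hsS))
      rw [← hyw]
      rw [hn] at hw
      have := mem_deligne.1 hy
      refine add_mem_sup ⟨?_, ?_⟩ hw
      · rw [show n - s.1 = s.2 by omega]; exact this.1
      · rw [← hn, add_comm]; exact this.2.1)
    (by
      rw [Finset.sum_image hinj, sum_congr rfl fun s hsS => by rw [hs' s hsS]]
      exact hs)
  intro s hsS
  have h' := h s.1 (mem_image_of_mem _ hsS)
  rw [hs' s hsS] at h'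
  exact eq_zero_of_mem_deligne hX (hx s hsS) (by rw [hd s hsS]; exact h')

/-- The subspaces `I^{p,q}` recover the weight filtration. -/
theorem WC_eq_deligne (n : ℤ) : X.WC n = ⨆ s ∈ {s : ℤ × ℤ | s.1 + s.2 ≤ n}, X.deligne s := by
  have hle : ∀ s : ℤ × ℤ, X.deligne s ≤ X.WC (s.1 + s.2) := fun s => deligne_le_WC s
  have hW := X.WC_mono
  have key := @eq_iSup_of_filtration ℂ _ X.VC _ _ (ℤ × ℤ) X.WC hW (exists_WC_eq_bot hX)
    (fun s => s.1 + s.2) X.deligne hle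
  refine key (fun n => ?_) n
  obtain ⟨p, hp⟩ := (hX.2.2 n).eventually_top
  nth_rewrite 1 [← hp]
  refine ((hX.2.2 n).G_le p).trans (sup_le le_sup_left (iSup₂_le fun p' _ => ?_))
  refine (hodge_le_deligne hX n p').trans (sup_le_sup_left ?_ _)
  exact le_biSup X.deligne (show (p', n - p') ∈ {s : ℤ × ℤ | s.1 + s.2 = n} by simp)

/-- The subspaces `I^{p,q}` recover the Hodge filtration. -/
theorem F_eq_deligne (p : ℤ) : X.F p = ⨆ s ∈ {s : ℤ × ℤ | p ≤ s.1}, X.deligne s := by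
  apply le_antisymm
  · have key : ∀ (j : ℕ) (n : ℤ), X.WC (n - j) = ⊥ →
        X.F p ⊓ X.WC n ≤ ⨆ s ∈ {s : ℤ × ℤ | p ≤ s.1}, X.deligne s := by
      intro j
      induction j with
      | zero => intro n hn; simp at hn; simp [hn]
      | succ j ih =>
        intro n hn x hx
        obtain ⟨w, hw, z, hz, hwz⟩ := mem_sup.1 ((hX.2.2 n).G_le p
          (mem_sup_left hx))
        have hz' : ∀ z ∈ (⨆ p' ∈ {p' | p ≤ p'}, (X.F p' ⊓ X.WC n ⊔ X.WC (n - 1)) ⊓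
            conjSub K (X.F (n - p') ⊓ X.WC n ⊔ X.WC (n - 1))),
            z ∈ X.WC (n - 1) ⊔ ⨆ s ∈ {s : ℤ × ℤ | p ≤ s.1 ∧ s.1 + s.2 = n}, X.deligne s := by
          refine iSup₂_le (a := X.WC (n - 1) ⊔
            ⨆ s ∈ {s : ℤ × ℤ | p ≤ s.1 ∧ s.1 + s.2 = n}, X.deligne s) fun p' hp' => ?_
          refine (hodge_le_deligne hX n p').trans (sup_le_sup_left ?_ _)
          exact le_biSup X.deligne
            (show (p', n - p') ∈ {s : ℤ × ℤ | p ≤ s.1 ∧ s.1 + s.2 = n} by simpa using hp')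
        obtain ⟨w', hw', y, hy, hwy⟩ := mem_sup.1 (hz' z hz)
        have hyF : y ∈ X.F p := by
          refine (show ⨆ s ∈ {s : ℤ × ℤ | p ≤ s.1 ∧ s.1 + s.2 = n}, X.deligne s ≤ X.F p from
            iSup₂_le fun s hs v hv => X.F_anti ?_ (mem_deligne.1 hv).1) hy
          simp only [Set.mem_ofPred_eq] at hs; exact hs.1
        have hxy : x - y = w + w' := by rw [← hwz, ← hwy]; abel
        rw [← sub_add_cancel x y]
        refine add_mem (ih (n - 1) (by rw [← hn]; congr 1; push_cast; ring)
          ⟨sub_mem hx.1 hyF, by rw [hxy]; exact add_mem hw hw'⟩) ?_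
        refine (show ⨆ s ∈ {s : ℤ × ℤ | p ≤ s.1 ∧ s.1 + s.2 = n}, X.deligne s ≤
          ⨆ s ∈ {s : ℤ × ℤ | p ≤ s.1}, X.deligne s from biSup_mono fun s hs => ?_) hy
        simp only [Set.mem_ofPred_eq] at hs ⊢; exact hs.1
    obtain ⟨m, hm⟩ := exists_WC_eq_bot hX
    obtain ⟨n, hn⟩ := exists_WC_eq_top hX
    have := key (n - m).toNat n (by
      rw [eq_bot_iff, ← hm]
      exact X.WC_mono (by omega))
    rwa [hn, inf_top_eq] at this
  · exact iSup₂_le fun s hs x hx => X.F_anti hs (mem_deligne.1 hx).1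

/-- The Deligne splitting of a mixed Hodge structure. -/
theorem exists_deligneGrading : ∃ g : X.HodgeGrading, (∀ s x, g.π s x ∈ X.deligne s) ∧
    ∀ s, ∀ x ∈ X.deligne s, g.π s x = x := by
  have htop : ⨆ s, X.deligne s = ⊤ := by
    obtain ⟨n, hn⟩ := exists_WC_eq_top hX
    rw [eq_top_iff, ← hn, WC_eq_deligne hX]
    exact iSup₂_le fun s _ => le_iSup X.deligne s
  obtain ⟨S, π, h₁, h₂, h₃, h₄, h₅⟩ :=
    exists_projections_of_iSupIndep X.deligne (iSupIndep_deligne hX) htop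
  refine ⟨⟨π, S, h₃, h₄, fun n x => ?_, fun p x => ?_, fun s t x hst hne => ?_⟩, h₁, h₂⟩
  · rw [WC_eq_deligne hX, h₅]; simp
  · rw [F_eq_deligne hX, h₅]; simp
  · obtain ⟨y, hy, w, hw, hyw⟩ := mem_sup.1 (conjC_deligne hX (h₁ s x))
    rw [← hyw, map_add]
    rw [WC_eq_deligne hX, h₅] at hw
    rw [hw t (by simp; omega), ← h₂ _ y hy, h₄, if_neg hne, add_zero]

end Deligne

namespace HodgeGrading

variable {X} (g : X.HodgeGrading)

theorem mem_of_forall {P : Submodule ℂ X.VC} {x : X.VC} (h : ∀ s, g.π s x ∈ P) : x ∈ P := by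
  rw [← g.sum x]; exact sum_mem fun s _ => h s

theorem π_mem_W {n : ℤ} {s : ℤ × ℤ} (h : s.1 + s.2 ≤ n) (x : X.VC) : g.π s x ∈ X.WC n :=
  (g.mem_W _ _).2 fun t ht => by rw [g.orth, if_neg]; rintro rfl; omega

theorem π_mem_F {p : ℤ} {s : ℤ × ℤ} (h : p ≤ s.1) (x : X.VC) : g.π s x ∈ X.F p :=
  (g.mem_F _ _).2 fun t ht => by rw [g.orth, if_neg]; rintro rfl; omega

theorem π_eq_zero {s : ℤ × ℤ} (h : s ∉ g.S) (x : X.VC) : g.π s x = 0 := by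
  rw [← g.sum x, map_sum]
  exact sum_eq_zero fun t ht => by rw [g.orth, if_neg]; rintro rfl; exact h ht

theorem ext_π {x y : X.VC} (h : ∀ s, g.π s x = g.π s y) : x = y := by
  rw [← g.sum x, ← g.sum y]; exact sum_congr rfl fun s _ => h s

theorem mem_G {n p : ℤ} {x : X.VC} : x ∈ X.F p ⊓ X.WC n ⊔ X.WC (n - 1) ↔
    ∀ s : ℤ × ℤ, (n < s.1 + s.2 ∨ (s.1 + s.2 = n ∧ s.1 < p)) → g.π s x = 0 := by
  constructor
  · intro hx s hs
    obtain ⟨u, hu, w, hw, rfl⟩ := mem_sup.1 hx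
    rw [map_add, (g.mem_W _ _).1 hw s (by omega), add_zero]
    rcases hs with hs | hs
    · exact (g.mem_W _ _).1 hu.2 s hs
    · exact (g.mem_F _ _).1 hu.1 s hs.2
  · intro h
    refine g.mem_of_forall fun s => ?_
    rcases lt_trichotomy (s.1 + s.2) n with hs | hs | hs
    · exact mem_sup_right (g.π_mem_W (by omega) x)
    · by_cases hp : s.1 < p
      · rw [h s (Or.inr ⟨hs, hp⟩)]; exact zero_mem _
      · exact mem_sup_left ⟨g.π_mem_F (by omega) x, g.π_mem_W hs.le x⟩
    · rw [h s (Or.inl hs)]; exact zero_mem _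

theorem exists_bounds : ∃ a b : ℤ, ∀ s ∈ g.S, a < s.1 ∧ s.1 < b ∧ a < s.1 + s.2 ∧
    s.1 + s.2 < b := by
  obtain ⟨N, hN⟩ : ∃ N : ℕ, ∀ s ∈ g.S, |s.1| + |s.1 + s.2| < N := by
    obtain ⟨N, hN⟩ := (g.S.image fun s => |s.1| + |s.1 + s.2|).bddAbove
    refine ⟨N.toNat + 1, fun s hs => ?_⟩
    have := hN (mem_image_of_mem _ hs)
    push_cast; omega
  refine ⟨-N, N, fun s hs => ?_⟩
  have := hN s hs
  have h₁ := abs_nonneg s.1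
  have h₂ := abs_nonneg (s.1 + s.2)
  have h₃ := abs_lt.1 (show |s.1| < (N : ℤ) by omega)
  have h₄ := abs_lt.1 (show |s.1 + s.2| < (N : ℤ) by omega)
  omega

/-- A bifiltered space with a Hodge grading is a mixed Hodge structure. -/
theorem isMHS (g : X.HodgeGrading) : NonabelianHodge.isMHS K X := by
  obtain ⟨a, b, hab⟩ := g.exists_bounds
  have htop : X.WC b = ⊤ := eq_top_iff.2 fun x _ => g.mem_of_forall fun s => by
    by_cases hs : s ∈ g.S
    · exact g.π_mem_W (hab s hs).2.2.2.le x
    · rw [g.π_eq_zero hs]; exact zero_mem _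
  have hbot : X.WC a = ⊥ := eq_bot_iff.2 fun x hx => g.ext_π fun s => by
    rw [map_zero]
    by_cases hs : s ∈ g.S
    · exact (g.mem_W _ _).1 hx s (hab s hs).2.2.1
    · exact g.π_eq_zero hs x
  have hle : ∀ n, X.WC (n - 1) ≤ X.WC n := fun n => X.WC_mono (by omega)
  refine ⟨⟨b, ?_⟩, ⟨a, ?_⟩, fun n => ⟨?_, ⟨a, ?_⟩, ⟨b, ?_⟩, fun p => ?_, fun p => ?_⟩⟩
  · exact eq_top_iff.2 (baseChange_injective_of_le (L := ℂ) (by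
      rw [baseChange_top]; exact htop.ge))
  · exact eq_bot_iff.2 (baseChange_injective_of_le (L := ℂ) (by
      rw [baseChange_bot]; exact hbot.le))
  · exact fun p q h => sup_le_sup_right (inf_le_inf_right _ (X.F_anti h)) _
  · refine le_antisymm (sup_le inf_le_right (hle n)) fun x hx => g.mem_G.2 fun s hs => ?_
    rcases hs with hs | hs
    · exact (g.mem_W _ _).1 hx s hs
    · refine g.π_eq_zero (fun h => ?_) x
      have := (hab s h).1; omega
  · refine le_antisymm (fun x hx => (g.mem_W _ _).2 fun s hs => ?_) le_sup_right
    by_cases h : s ∈ g.S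
    · exact g.mem_G.1 hx s (by have := (hab s h).2.1; omega)
    · exact g.π_eq_zero h x
  · have h₁ : ∀ q, X.F q ⊓ X.WC n ⊔ X.WC (n - 1) ≤ X.WC n := fun q => sup_le inf_le_right (hle n)
    refine le_antisymm (sup_le (h₁ p) fun x hx => ?_) fun x hx => g.mem_of_forall fun s => ?_
    · have := conjC_mem_WC (h₁ _ hx); rwa [conjC_conjC] at this
    · rcases lt_trichotomy (s.1 + s.2) n with hs | hs | hs
      · exact mem_sup_left (mem_sup_right (g.π_mem_W (by omega) x))
      · by_cases hp : s.1 < p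
        · refine mem_sup_right (g.mem_G.2 fun t ht => g.conj s t x (by omega) ?_)
          rintro rfl
          simp at ht; omega
        · exact mem_sup_left (mem_sup_left
            ⟨g.π_mem_F (by omega) x, g.π_mem_W hs.le x⟩)
      · rw [(g.mem_W _ _).1 hx s hs]; exact zero_mem _
  · refine le_antisymm (fun x hx => (g.mem_W _ _).2 fun s hs => ?_)
      (le_inf le_sup_right fun x hx => mem_sup_right (conjC_mem_WC hx))
    have h₁ := g.mem_G.1 hx.1
    have h₂ := g.mem_G.1 hx.2
    by_cases hsn : n < s.1 + s.2
    · exact h₁ s (Or.inl hsn)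
    by_cases hsp : s.1 < p
    · exact h₁ s (Or.inr ⟨by omega, hsp⟩)
    rw [← conjC_conjC x, ← g.sum (conjC K X.V x), map_sum, map_sum]
    refine sum_eq_zero fun t _ => ?_
    by_cases ht : n < t.1 + t.2
    · rw [h₂ t (Or.inl ht), map_zero, map_zero]
    by_cases hst : s = t.swap
    · rw [h₂ t (Or.inr _), map_zero, map_zero]
      subst hst
      simp at hsp hs hsn
      omega
    · exact g.conj t s _ (by omega) hst

end HodgeGrading

end BifilteredSpace

/-! ### Tensor products of mixed Hodge structures -/

section TensorOfComplexifications

variable {V V' : Type*} [AddCommGroup V] [Module K V] [AddCommGroup V'] [Module K V']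

theorem conjC_cxMul (x : ℂ ⊗[K] V) (y : ℂ ⊗[K] V') :
    conjC K (V ⊗[K] V') (cxMul K V V' x y) = cxMul K V V' (conjC K V x) (conjC K V' y) := by
  induction x using induction_on with
  | zero => simp
  | add x₁ x₂ h₁ h₂ => simp only [map_add, LinearMap.add_apply, h₁, h₂]
  | tmul a v =>
    induction y using induction_on with
    | zero => simp
    | add y₁ y₂ h₁ h₂ => simp only [map_add, h₁, h₂]
    | tmul b w => simp

theorem cxMul_induction {P : ℂ ⊗[K] (V ⊗[K] V') → Prop} (h₀ : P 0)
    (h₁ : ∀ x y, P (cxMul K V V' x y)) (h₂ : ∀ x y, P x → P y → P (x + y)) (z) : P z := by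
  obtain ⟨w, rfl⟩ :=
    (TensorProduct.AlgebraTensorModule.distribBaseChange K ℂ V V').symm.surjective z
  induction w using induction_on with
  | zero => simpa using h₀
  | add x y hx hy => rw [map_add]; exact h₂ _ _ hx hy
  | tmul x y => exact h₁ x y

/-- The tensor product of endomorphisms of complexifications. -/
def cxMap (f : ℂ ⊗[K] V →ₗ[ℂ] ℂ ⊗[K] V) (g : ℂ ⊗[K] V' →ₗ[ℂ] ℂ ⊗[K] V') :
    ℂ ⊗[K] (V ⊗[K] V') →ₗ[ℂ] ℂ ⊗[K] (V ⊗[K] V') :=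
  (TensorProduct.AlgebraTensorModule.distribBaseChange K ℂ V V').symm.toLinearMap ∘ₗ
    TensorProduct.map f g ∘ₗ
      (TensorProduct.AlgebraTensorModule.distribBaseChange K ℂ V V').toLinearMap

@[simp] theorem cxMap_cxMul (f : ℂ ⊗[K] V →ₗ[ℂ] ℂ ⊗[K] V) (g : ℂ ⊗[K] V' →ₗ[ℂ] ℂ ⊗[K] V')
    (x : ℂ ⊗[K] V) (y : ℂ ⊗[K] V') :
    cxMap f g (cxMul K V V' x y) = cxMul K V V' (f x) (g y) := by
  simp [cxMap, cxMul]

theorem cxMap_sum {σ τ : Type*} (S : Finset σ) (S' : Finset τ)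
    {f : σ → ℂ ⊗[K] V →ₗ[ℂ] ℂ ⊗[K] V} {g : τ → ℂ ⊗[K] V' →ₗ[ℂ] ℂ ⊗[K] V'}
    (hf : ∀ x, ∑ i ∈ S, f i x = x) (hg : ∀ y, ∑ j ∈ S', g j y = y) (z : ℂ ⊗[K] (V ⊗[K] V')) :
    ∑ i ∈ S ×ˢ S', cxMap (f i.1) (g i.2) z = z := by
  induction z using cxMul_induction with
  | h₀ => simp
  | h₂ x y hx hy => simp only [map_add, sum_add_distrib, hx, hy]
  | h₁ x y =>
    simp only [cxMap_cxMul]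
    rw [Finset.sum_product]
    conv_rhs => rw [← hf x, ← hg y]
    simp only [map_sum, LinearMap.sum_apply]
    rw [sum_comm]

theorem cxMap_cxMap (f f' : ℂ ⊗[K] V →ₗ[ℂ] ℂ ⊗[K] V) (g g' : ℂ ⊗[K] V' →ₗ[ℂ] ℂ ⊗[K] V')
    (z : ℂ ⊗[K] (V ⊗[K] V')) : cxMap f g (cxMap f' g' z) = cxMap (f ∘ₗ f') (g ∘ₗ g') z := by
  induction z using cxMul_induction with
  | h₀ => simp
  | h₂ x y hx hy => simp only [map_add, hx, hy]
  | h₁ x y => simp only [cxMap_cxMul, LinearMap.comp_apply]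

theorem cxMap_conjC_cxMap {f f' : ℂ ⊗[K] V →ₗ[ℂ] ℂ ⊗[K] V} {g g' : ℂ ⊗[K] V' →ₗ[ℂ] ℂ ⊗[K] V'}
    (h : (∀ x, f (conjC K V (f' x)) = 0) ∨ ∀ y, g (conjC K V' (g' y)) = 0)
    (z : ℂ ⊗[K] (V ⊗[K] V')) : cxMap f g (conjC K _ (cxMap f' g' z)) = 0 := by
  induction z using cxMul_induction with
  | h₀ => simp
  | h₂ x y hx hy => simp only [map_add, hx, hy, add_zero]
  | h₁ x y =>
    rw [cxMap_cxMul, conjC_cxMul, cxMap_cxMul]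
    rcases h with h | h <;> simp [h]

end TensorOfComplexifications

namespace BifilteredSpace

section Construction

variable {X : BifilteredSpace K}

/-- A Hodge grading from a finite complete family of orthogonal projections of given types. -/
def HodgeGrading.ofProjections {σ : Type*} [DecidableEq σ] (I : Finset σ)
    (ρ : σ → X.VC →ₗ[ℂ] X.VC) (t : σ → ℤ × ℤ) (sum : ∀ x, ∑ i ∈ I, ρ i x = x)
    (orth : ∀ i j x, ρ i (ρ j x) = if i = j then ρ j x else 0)
    (mem_W : ∀ n x, x ∈ X.WC n ↔ ∀ i ∈ I, n < (t i).1 + (t i).2 → ρ i x = 0)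
    (mem_F : ∀ p x, x ∈ X.F p ↔ ∀ i ∈ I, (t i).1 < p → ρ i x = 0)
    (conj : ∀ i ∈ I, ∀ j ∈ I, ∀ x, (t i).1 + (t i).2 ≤ (t j).1 + (t j).2 → t j ≠ (t i).swap →
      ρ j (conjC K X.V (ρ i x)) = 0) : X.HodgeGrading :=
  have hρ : ∀ s x i, ρ i (∑ j ∈ I with t j = s, ρ j x) = if i ∈ I ∧ t i = s then ρ i x else 0 := by
    intro s x i
    rw [map_sum]
    simp_rw [orth]
    rw [Finset.sum_ite_eq]
    simp
  have h0 : ∀ s x, (∑ j ∈ I with t j = s, ρ j x = 0) ↔ ∀ j ∈ I, t j = s → ρ j x = 0 := by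
    intro s x
    constructor
    · intro h j hj hjs
      have := hρ s x j
      rwa [h, map_zero, if_pos ⟨hj, hjs⟩, eq_comm] at this
    · intro h
      exact sum_eq_zero fun j hj => h j (mem_filter.1 hj).1 (mem_filter.1 hj).2
  { π := fun s => ∑ j ∈ I with t j = s, ρ j
    S := I.image t
    sum := fun x => by
      simp only [LinearMap.sum_apply]
      rw [Finset.sum_fiberwise_of_maps_to (fun i hi => mem_image_of_mem t hi), sum]
    orth := fun s s' x => by
      simp only [LinearMap.sum_apply]
      simp_rw [hρ]
      by_cases h : s = s'
      · subst h
        rw [if_pos rfl]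
        refine sum_congr rfl fun i hi => if_pos ?_
        simpa using hi
      · rw [if_neg h]
        refine sum_eq_zero fun i hi => if_neg ?_
        rintro ⟨_, h'⟩
        exact h ((mem_filter.1 hi).2.symm.trans h')
    mem_W := fun n x => by
      rw [mem_W]
      simp only [LinearMap.sum_apply, h0]
      exact ⟨fun h s hs j hj hjs => h j hj (hjs ▸ hs), fun h j hj hs => h _ hs j hj rfl⟩
    mem_F := fun n x => by
      rw [mem_F]
      simp only [LinearMap.sum_apply, h0]
      exact ⟨fun h s hs j hj hjs => h j hj (hjs ▸ hs), fun h j hj hs => h _ hs j hj rfl⟩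
    conj := fun s s' x hs hne => by
      simp only [LinearMap.sum_apply, map_sum]
      refine sum_eq_zero fun i hi => sum_eq_zero fun j hj => ?_
      obtain ⟨hi, his⟩ := mem_filter.1 hi
      obtain ⟨hj, hjs⟩ := mem_filter.1 hj
      exact conj i hi j hj x (by rw [his, hjs]; exact hs) (by rw [his, hjs]; exact hne) }

end Construction

section Unit

theorem isMHS_unit : isMHS K (unit (K := K)) := by
  have hWC : ∀ n : ℤ, (unit (K := K)).WC n = if 0 ≤ n then ⊤ else ⊥ := fun n => by
    by_cases h : 0 ≤ n <;> simp [WC, h]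
  refine HodgeGrading.isMHS (HodgeGrading.ofProjections (X := unit) {()} (fun _ => LinearMap.id)
    (fun _ => (0, 0)) ?_ ?_ ?_ ?_ ?_)
  · simp
  · simp
  · intro n x
    rw [hWC]
    by_cases h : 0 ≤ n
    · simp [h]
    · simp [h, not_le.1 h]
  · intro n x
    by_cases h : n ≤ 0
    · simp [h]
    · simp [h, not_le.1 h]
  · simp

end Unit

section Tensor

variable {X Y : BifilteredSpace K}

theorem cxMul_mem_WC {i j n : ℤ} (h : i + j ≤ n) {x : X.VC} {y : Y.VC} (hx : x ∈ X.WC i)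
    (hy : y ∈ Y.WC j) : cxMul K X.V Y.V x y ∈ (tensor X Y).WC n := by
  have : Submodule.map₂ (cxMul K X.V Y.V) (X.WC i) (Y.WC j) ≤ (tensor X Y).WC n := by
    rw [WC, WC, baseChange_eq_span, baseChange_eq_span,
      Submodule.map₂_span_span, span_le]
    rintro _ ⟨_, ⟨v, hv, rfl⟩, _, ⟨w, hw, rfl⟩, rfl⟩
    change cxMul K X.V Y.V (1 ⊗ₜ v) (1 ⊗ₜ w) ∈ _
    rw [cxMul_tmul, one_mul]
    exact tmul_mem_baseChange_of_mem 1 ((tensor X Y).W_mono h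
      (tmul_mem_tensW rfl hv hw))
  exact this (Submodule.apply_mem_map₂ _ hx hy)

theorem cxMap_mem_WC (g : X.HodgeGrading) (g' : Y.HodgeGrading) {i j : ℤ × ℤ} {n : ℤ}
    (h : i.1 + i.2 + (j.1 + j.2) ≤ n) (z : ℂ ⊗[K] (X.V ⊗[K] Y.V)) :
    cxMap (g.π i) (g'.π j) z ∈ (tensor X Y).WC n := by
  induction z using cxMul_induction with
  | h₀ => rw [map_zero]; exact zero_mem _
  | h₂ x y hx hy => rw [map_add]; exact add_mem hx hy
  | h₁ x y =>
    rw [cxMap_cxMul]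
    exact cxMul_mem_WC h (g.π_mem_W le_rfl x) (g'.π_mem_W le_rfl y)

theorem cxMap_mem_F (g : X.HodgeGrading) (g' : Y.HodgeGrading) {i j : ℤ × ℤ} {n : ℤ}
    (h : n ≤ i.1 + j.1) (z : ℂ ⊗[K] (X.V ⊗[K] Y.V)) :
    cxMap (g.π i) (g'.π j) z ∈ tensF X Y n := by
  induction z using cxMul_induction with
  | h₀ => rw [map_zero]; exact zero_mem _
  | h₂ x y hx hy => rw [map_add]; exact add_mem hx hy
  | h₁ x y =>
    rw [cxMap_cxMul]
    exact (tensor X Y).F_anti h (cxMul_mem_tensF rfl (g.π_mem_F le_rfl x) (g'.π_mem_F le_rfl y))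

theorem mem_WC_tensor (g : X.HodgeGrading) (g' : Y.HodgeGrading) (n : ℤ)
    (x : ℂ ⊗[K] (X.V ⊗[K] Y.V)) : x ∈ (tensor X Y).WC n ↔ ∀ i ∈ g.S ×ˢ g'.S,
      n < (i.1 + i.2).1 + (i.1 + i.2).2 → cxMap (g.π i.1) (g'.π i.2) x = 0 := by
  constructor
  · intro hx i _ hi
    refine (show (tensor X Y).WC n ≤
      LinearMap.ker (cxMap (g.π i.1) (g'.π i.2)) from ?_) hx
    rw [WC, baseChange_eq_span, span_le]
    rintro _ ⟨t, ht, rfl⟩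
    revert t
    change tensW X Y n ≤ ((LinearMap.ker (cxMap (g.π i.1) (g'.π i.2))).restrictScalars K).comap
      (TensorProduct.mk K ℂ _ 1)
    refine tensW_le fun a b hab v hv w hw => ?_
    change cxMap (g.π i.1) (g'.π i.2) (1 ⊗ₜ (v ⊗ₜ w)) = 0
    rw [show (1 : ℂ) ⊗ₜ[K] (v ⊗ₜ[K] w) = cxMul K X.V Y.V (1 ⊗ₜ v) (1 ⊗ₜ w) by simp, cxMap_cxMul]
    by_cases ha : a < i.1.1 + i.1.2
    · rw [(g.mem_W a _).1 (tmul_mem_baseChange_of_mem 1 hv) _ ha]; simp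
    · rw [(g'.mem_W b _).1 (tmul_mem_baseChange_of_mem 1 hw) _
        (by simp at hi; omega)]
      simp
  · intro h
    rw [← cxMap_sum g.S g'.S g.sum g'.sum x]
    refine sum_mem fun i hi => ?_
    by_cases hn : n < (i.1 + i.2).1 + (i.1 + i.2).2
    · rw [h i hi hn]; exact zero_mem _
    · refine cxMap_mem_WC g g' ?_ x
      simp at hn; omega

theorem mem_F_tensor (g : X.HodgeGrading) (g' : Y.HodgeGrading) (n : ℤ)
    (x : ℂ ⊗[K] (X.V ⊗[K] Y.V)) : x ∈ tensF X Y n ↔ ∀ i ∈ g.S ×ˢ g'.S,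
      (i.1 + i.2).1 < n → cxMap (g.π i.1) (g'.π i.2) x = 0 := by
  constructor
  · intro hx i _ hi
    refine (show tensF X Y n ≤ LinearMap.ker (cxMap (g.π i.1) (g'.π i.2)) from ?_) hx
    refine tensF_le fun a b hab v hv w hw => ?_
    rw [LinearMap.mem_ker, cxMap_cxMul]
    by_cases ha : i.1.1 < a
    · rw [(g.mem_F a _).1 hv _ ha]; simp
    · rw [(g'.mem_F b _).1 hw _ (by simp at hi; omega)]; simp
  · intro h
    rw [← cxMap_sum g.S g'.S g.sum g'.sum x]
    refine sum_mem fun i hi => ?_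
    by_cases hn : (i.1 + i.2).1 < n
    · rw [h i hi hn]; exact zero_mem _
    · refine cxMap_mem_F g g' ?_ x
      simp at hn; omega

/-- The tensor product of Hodge gradings. -/
def HodgeGrading.tensor (g : X.HodgeGrading) (g' : Y.HodgeGrading) :
    (tensor X Y).HodgeGrading :=
  HodgeGrading.ofProjections (X := BifilteredSpace.tensor X Y) (g.S ×ˢ g'.S)
    (fun i => cxMap (g.π i.1) (g'.π i.2))
    (fun i => i.1 + i.2) (cxMap_sum g.S g'.S g.sum g'.sum) (fun i j x => by
      refine (cxMap_cxMap _ _ _ _ x).trans ?_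
      have h : ∀ s s', g.π s ∘ₗ g.π s' = if s = s' then g.π s' else 0 := fun s s' => by
        refine LinearMap.ext fun x => (g.orth s s' x).trans ?_
        split_ifs <;> rfl
      have h' : ∀ s s', g'.π s ∘ₗ g'.π s' = if s = s' then g'.π s' else 0 := fun s s' => by
        refine LinearMap.ext fun x => (g'.orth s s' x).trans ?_
        split_ifs <;> rfl
      rw [h, h']
      by_cases h₁ : i.1 = j.1 <;> by_cases h₂ : i.2 = j.2 <;>
        simp [h₁, h₂, Prod.ext_iff, cxMap])
    (mem_WC_tensor g g') (mem_F_tensor g g') (fun i hi j hj x hd hne => by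
      refine cxMap_conjC_cxMap ?_ x
      by_cases h : i.1.1 + i.1.2 ≤ j.1.1 + j.1.2 ∧ j.1 ≠ i.1.swap
      · exact Or.inl fun x => g.conj _ _ x h.1 h.2
      · refine Or.inr fun x => g'.conj _ _ x ?_ ?_
        · by_contra h'
          simp only [Prod.fst_add, Prod.snd_add, Prod.ext_iff, ne_eq, Prod.swap] at hd h
          omega
        · intro h'
          simp only [Prod.fst_add, Prod.snd_add, Prod.ext_iff, ne_eq, Prod.swap] at hd h hne h'
          omega)

end Tensor

theorem isMHS_tensor {X Y : BifilteredSpace K} (hX : isMHS K X) (hY : isMHS K Y) :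
    isMHS K (tensor X Y) := by
  obtain ⟨g, -⟩ := exists_deligneGrading hX
  obtain ⟨g', -⟩ := exists_deligneGrading hY
  exact (g.tensor g').isMHS

instance : (isMHS K).IsMonoidal where
  prop_unit := isMHS_unit
  prop_tensor _ _ h₁ h₂ := isMHS_tensor h₁ h₂

end BifilteredSpace

/-! ### Matrices of forms with values in linear maps -/

section Entries

variable {k : Type*} [Field k] {A : Type u} [Ring A] [Algebra k A]
variable {V₁ V₂ V₃ : Type*} [AddCommGroup V₁] [Module k V₁] [AddCommGroup V₂] [Module k V₂]
  [AddCommGroup V₃] [Module k V₃] {ι₁ ι₂ ι₃ : Type*} [Fintype ι₁] [Fintype ι₂] [Fintype ι₃]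
  [DecidableEq ι₁] [DecidableEq ι₂] [DecidableEq ι₃]
  (b₁ : Module.Basis ι₁ k V₁) (b₂ : Module.Basis ι₂ k V₂) (b₃ : Module.Basis ι₃ k V₃)

/-- The linear map sending `b₁ j` to `b₂ i` and the other members of `b₁` to `0`. -/
def elemMap (i : ι₂) (j : ι₁) : V₁ →ₗ[k] V₂ := (b₁.coord j).smulRight (b₂ i)

/-- The entry with index `(i, j)` of the matrix of a form with values in linear maps. -/
def entry (i : ι₂) (j : ι₁) : A ⊗[k] (V₁ →ₗ[k] V₂) →ₗ[k] A :=
  (TensorProduct.rid k A).toLinearMap ∘ₗ (b₂.coord i ∘ₗ LinearMap.applyₗ (b₁ j)).lTensor A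

/-- The matrix of a form with values in linear maps, with respect to two bases. -/
def toMat : A ⊗[k] (V₁ →ₗ[k] V₂) →ₗ[k] Matrix ι₂ ι₁ A :=
  LinearMap.pi fun i => LinearMap.pi fun j => entry b₁ b₂ i j

@[simp] theorem toMat_tmul (x : A) (f : V₁ →ₗ[k] V₂) (i : ι₂) (j : ι₁) :
    toMat b₁ b₂ (x ⊗ₜ[k] f) i j = b₂.repr (f (b₁ j)) i • x :=
  TensorProduct.rid_tmul _ _

theorem eq_sum_elemMap (f : V₁ →ₗ[k] V₂) :
    f = ∑ i, ∑ j, b₂.repr (f (b₁ j)) i • elemMap b₁ b₂ i j := by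
  refine b₁.ext fun j => ?_
  conv_lhs => rw [← b₂.sum_repr (f (b₁ j))]
  simp [elemMap, Finsupp.single_apply]

theorem eq_sum_toMat (x : A ⊗[k] (V₁ →ₗ[k] V₂)) :
    x = ∑ i, ∑ j, toMat b₁ b₂ x i j ⊗ₜ[k] elemMap b₁ b₂ i j := by
  induction x using induction_on with
  | zero => simp
  | add x y hx hy =>
    simp only [map_add, Matrix.add_apply, add_tmul, sum_add_distrib]
    rw [← hx, ← hy]
  | tmul x f =>
    conv_lhs => rw [eq_sum_elemMap b₁ b₂ f]
    simp only [toMat_tmul, tmul_sum, tmul_smul,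
      smul_tmul']

/-- The form with a given matrix. -/
def ofMat (m : Matrix ι₂ ι₁ A) : A ⊗[k] (V₁ →ₗ[k] V₂) :=
  ∑ i, ∑ j, m i j ⊗ₜ[k] elemMap b₁ b₂ i j

@[simp] theorem toMat_ofMat (m : Matrix ι₂ ι₁ A) : toMat b₁ b₂ (ofMat b₁ b₂ m) = m := by
  ext i j
  simp only [ofMat, map_sum, Matrix.sum_apply, toMat_tmul, elemMap, LinearMap.smulRight_apply,
    Module.Basis.coord_apply, Module.Basis.repr_self, map_smul, Finsupp.smul_apply, smul_eq_mul,
    Finsupp.single_apply]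
  simp

@[simp] theorem ofMat_toMat (x : A ⊗[k] (V₁ →ₗ[k] V₂)) : ofMat b₁ b₂ (toMat b₁ b₂ x) = x :=
  (eq_sum_toMat b₁ b₂ x).symm

theorem toMat_injective : Function.Injective (toMat (A := A) b₁ b₂) :=
  Function.LeftInverse.injective (ofMat_toMat b₁ b₂)

theorem toMat_wedge (x : A ⊗[k] (V₂ →ₗ[k] V₃)) (y : A ⊗[k] (V₁ →ₗ[k] V₂)) :
    toMat b₁ b₃ (wedge x y) = toMat b₂ b₃ x * toMat b₁ b₂ y := by
  induction x using induction_on with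
  | zero => simp
  | add x₁ x₂ h₁ h₂ => simp only [add_wedge, map_add, h₁, h₂, Matrix.add_mul]
  | tmul a f =>
    induction y using induction_on with
    | zero => simp
    | add y₁ y₂ h₁ h₂ => simp only [wedge_add, map_add, h₁, h₂, Matrix.mul_add]
    | tmul c g =>
      ext i j
      rw [wedge_tmul, toMat_tmul, mul_apply]
      simp only [toMat_tmul, smul_mul_smul_comm]
      rw [← Finset.sum_smul]
      congr 1
      conv_lhs => rw [LinearMap.comp_apply, ← b₂.sum_repr (g (b₁ j))]
      simp only [map_sum, map_smul, Finsupp.finsetSum_apply, Finsupp.smul_apply, smul_eq_mul]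
      exact sum_congr rfl fun _ _ => mul_comm _ _

theorem toMat_mapForm {B : Type u} [Ring B] [Algebra k B] (f : A →ₗ[k] B)
    (x : A ⊗[k] (V₁ →ₗ[k] V₂)) : toMat b₁ b₂ (mapForm f x) = (toMat b₁ b₂ x).map f := by
  induction x using induction_on with
  | zero => ext; simp
  | add x y hx hy => ext; simp [hx, hy]
  | tmul a g => ext; simp

theorem toMat_one_tmul (f : V₁ →ₗ[k] V₂) : toMat (A := A) b₁ b₂ (1 ⊗ₜ f) =
    (LinearMap.toMatrix b₁ b₂ f).map (algebraMap k A) := by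
  ext i j
  simp [LinearMap.toMatrix_apply, Algebra.algebraMap_eq_smul_one]

theorem toMat_one : toMat (A := A) b₁ b₁ (1 ⊗ₜ LinearMap.id) = 1 := by
  rw [toMat_one_tmul, LinearMap.toMatrix_id]
  ext i j
  by_cases h : i = j <;> simp [h, Matrix.one_apply]

theorem toMat_slice (θ : A →ₗ[k] k) (x : A ⊗[k] (V₁ →ₗ[k] V₂)) (i : ι₂) (j : ι₁) :
    b₂.repr (slice θ x (b₁ j)) i = θ (toMat b₁ b₂ x i j) := by
  induction x using induction_on with
  | zero => simp
  | add x y hx hy => simp [hx, hy]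
  | tmul a g => simp [mul_comm]

end Entries

section Adapted

variable {k : Type*} [Field k] {V V₁ V₂ : Type*} [AddCommGroup V] [Module k V]
  [AddCommGroup V₁] [Module k V₁] [AddCommGroup V₂] [Module k V₂]

/-- The basis `b` is adapted to the increasing filtration `W`: the spaces `W m` are spanned by the
`b i` of weight `w i ≤ m`.  A decreasing filtration `F` is treated as `m ↦ F (-m)`. -/
def IsAdapted {ι : Type*} (b : Module.Basis ι k V) (w : ι → ℤ) (W : ℤ → Submodule k V) : Prop :=
  ∀ m x, x ∈ W m ↔ ∀ i, b.repr x i ≠ 0 → w i ≤ m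

theorem IsAdapted.mem {ι : Type*} {b : Module.Basis ι k V} {w : ι → ℤ} {W : ℤ → Submodule k V}
    (h : IsAdapted b w W) (i : ι) : b i ∈ W (w i) :=
  (h _ _).2 fun j hj => by
    classical
    rw [b.repr_self, Finsupp.single_apply] at hj
    split_ifs at hj with h'
    · rw [h']
    · exact absurd rfl hj

theorem filtHom_neg (F₁ : ℤ → Submodule k V₁) (F₂ : ℤ → Submodule k V₂) (r : ℤ) :
    filtHom F₁ F₂ (-r) = filtHom (fun m => F₁ (-m)) (fun m => F₂ (-m)) r := by
  ext f
  constructor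
  · intro h i
    have := h (-i)
    rwa [show -i + -r = -(i + r) by ring] at this
  · intro h i
    have := h (-i)
    simp only [neg_neg] at this
    rwa [show -(-i + r) = i + -r by ring] at this

variable {ι₁ ι₂ : Type*} [Fintype ι₁] [Fintype ι₂] [DecidableEq ι₁] [DecidableEq ι₂]
  {b₁ : Module.Basis ι₁ k V₁} {b₂ : Module.Basis ι₂ k V₂} {w₁ : ι₁ → ℤ} {w₂ : ι₂ → ℤ}
  {W₁ : ℤ → Submodule k V₁} {W₂ : ℤ → Submodule k V₂}

theorem mem_filtHom_iff (h₁ : IsAdapted b₁ w₁ W₁) (h₂ : IsAdapted b₂ w₂ W₂) {m : ℤ}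
    {f : V₁ →ₗ[k] V₂} : f ∈ filtHom W₁ W₂ m ↔
      ∀ i j, b₂.repr (f (b₁ j)) i ≠ 0 → w₂ i ≤ w₁ j + m := by
  constructor
  · intro hf i j h
    exact (h₂ _ _).1 (hf _ (h₁.mem j)) i h
  · intro h n x hx
    rw [mem_comap, ← b₁.sum_repr x, map_sum]
    refine sum_mem fun j _ => ?_
    rw [map_smul]
    by_cases hj : b₁.repr x j = 0
    · simp [hj]
    · refine Submodule.smul_mem _ _ ((h₂ _ _).2 fun i hi => (h i j hi).trans ?_)
      have := (h₁ _ _).1 hx j hj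
      omega

theorem elemMap_mem (h₁ : IsAdapted b₁ w₁ W₁) (h₂ : IsAdapted b₂ w₂ W₂) (i : ι₂) (j : ι₁) {m : ℤ}
    (h : w₂ i ≤ w₁ j + m) : elemMap b₁ b₂ i j ∈ filtHom W₁ W₂ m := by
  rw [mem_filtHom_iff h₁ h₂]
  intro i' j' h'
  simp only [elemMap, LinearMap.smulRight_apply, Module.Basis.coord_apply, Module.Basis.repr_self,
    map_smul, Finsupp.smul_apply, smul_eq_mul, Finsupp.single_apply, ne_eq, mul_eq_zero, not_or,
    ite_eq_right_iff, one_ne_zero, imp_false, not_not] at h'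
  rw [h'.1, ← h'.2]
  exact h

variable {A : Type u} [Ring A] [Algebra k A]

/-- Shifting the filtrations by `m` is a condition on the matrix entries in adapted bases. -/
theorem mem_tens_filtHom_iff (h₁ : IsAdapted b₁ w₁ W₁) (h₂ : IsAdapted b₂ w₂ W₂)
    {P : Submodule k A} {m : ℤ} {x : A ⊗[k] (V₁ →ₗ[k] V₂)} : x ∈ tens k P (filtHom W₁ W₂ m) ↔
      ∀ i j, toMat b₁ b₂ x i j ∈ P ∧ (w₁ j + m < w₂ i → toMat b₁ b₂ x i j = 0) := by
  constructor
  · intro hx i j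
    refine ⟨(tens_le (fun y hy f _ => ?_) :
        tens k P (filtHom W₁ W₂ m) ≤ P.comap (entry b₁ b₂ i j)) hx, fun hij =>
      (tens_le (fun y _ f hf => ?_) :
        tens k P (filtHom W₁ W₂ m) ≤ LinearMap.ker (entry b₁ b₂ i j)) hx⟩
    · change toMat b₁ b₂ (y ⊗ₜ f) i j ∈ P
      rw [toMat_tmul]; exact P.smul_mem _ hy
    · change toMat b₁ b₂ (y ⊗ₜ f) i j = 0
      have : b₂.repr (f (b₁ j)) i = 0 := by
        by_contra h0
        exact absurd ((mem_filtHom_iff h₁ h₂).1 hf i j h0) (not_le.2 hij)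
      rw [toMat_tmul, this, zero_smul]
  · intro h
    rw [eq_sum_toMat b₁ b₂ x]
    refine sum_mem fun i _ => sum_mem fun j _ => ?_
    by_cases hij : w₁ j + m < w₂ i
    · rw [(h i j).2 hij, zero_tmul]; exact zero_mem _
    · exact tmul_mem_tens (h i j).1 (elemMap_mem h₁ h₂ i j (not_lt.1 hij))

/-- Membership in `∑ G r ⊗ W_r Hom(V₁, V₂)` in terms of matrices. -/
theorem mem_iSup_tens_iff (h₁ : IsAdapted b₁ w₁ W₁) (h₂ : IsAdapted b₂ w₂ W₂)
    {G : ℤ → Submodule k A} (hG : Antitone G) {x : A ⊗[k] (V₁ →ₗ[k] V₂)} :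
    x ∈ ⨆ r : ℤ, tens k (G r) (filtHom W₁ W₂ r) ↔ ∀ i j, toMat b₁ b₂ x i j ∈ G (w₂ i - w₁ j) := by
  constructor
  · intro hx i j
    refine (iSup_le fun r => tens_le fun y hy f hf => ?_ : (⨆ r : ℤ, tens k (G r)
      (filtHom W₁ W₂ r)) ≤ (G (w₂ i - w₁ j)).comap
        (entry b₁ b₂ i j)) hx
    change toMat b₁ b₂ (y ⊗ₜ f) i j ∈ G (w₂ i - w₁ j)
    rw [toMat_tmul]
    by_cases h0 : b₂.repr (f (b₁ j)) i = 0
    · rw [h0, zero_smul]; exact zero_mem _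
    · refine Submodule.smul_mem _ _ (hG ?_ hy)
      have := (mem_filtHom_iff h₁ h₂).1 hf i j h0
      omega
  · intro h
    rw [eq_sum_toMat b₁ b₂ x]
    refine sum_mem fun i _ => sum_mem fun j _ => ?_
    exact mem_iSup_of_mem (w₂ i - w₁ j)
      (tmul_mem_tens (h i j) (elemMap_mem h₁ h₂ i j (by omega)))

/-- Membership in `∑ G r ⊗ W_r Hom(V₁, V₂)` can be tested by contracting with linear forms. -/
theorem mem_iSup_tens_iff_slice (h₁ : IsAdapted b₁ w₁ W₁) (h₂ : IsAdapted b₂ w₂ W₂)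
    {G : ℤ → Submodule k A} (hG : Antitone G) {x : A ⊗[k] (V₁ →ₗ[k] V₂)} :
    x ∈ ⨆ r : ℤ, tens k (G r) (filtHom W₁ W₂ r) ↔ ∀ r, ∀ θ : A →ₗ[k] k, (∀ y ∈ G r, θ y = 0) →
      slice θ x ∈ filtHom W₁ W₂ (r - 1) := by
  rw [mem_iSup_tens_iff h₁ h₂ hG]
  constructor
  · intro h r θ hθ
    rw [mem_filtHom_iff h₁ h₂]
    intro i j hij
    rw [toMat_slice] at hij
    by_contra hlt
    exact hij (hθ _ (hG (by omega) (h i j)))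
  · intro h i j
    by_contra hij
    obtain ⟨θ, hθ, hθ'⟩ := exists_dual_of_notMem hij
    have := (mem_filtHom_iff h₁ h₂).1 (h _ θ hθ) i j (by rw [toMat_slice]; exact hθ')
    omega

end Adapted

/-! ### Matrices of forms and gauge transformations -/

section Levels

variable {R α β γ : Type*} [Ring R] [Fintype β] {u : α → ℤ} {v : β → ℤ} {w : γ → ℤ}
  {X : Matrix α β R} {Y : Matrix β γ R} {a b : ℤ} {i : α} {j : γ}

/-- If the entries of `X` and `Y` vanish where the weight difference is less than `a` and `b`, then
those of `X * Y` vanish where it is less than `a + b`. -/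
theorem mul_apply_eq_zero_of_level (hX : ∀ i l, v l - u i < a → X i l = 0)
    (hY : ∀ l j, w j - v l < b → Y l j = 0) (h : w j - u i < a + b) : (X * Y) i j = 0 := by
  rw [mul_apply]
  refine sum_eq_zero fun l _ => ?_
  by_cases hl : v l - u i < a
  · rw [hX i l hl, zero_mul]
  · rw [hY l j (by omega), mul_zero]

/-- Multiplication by a unipotent matrix does not change the leading entries. -/
theorem mul_unipotent_apply [DecidableEq β] {Y : Matrix β β R} {j : β}
    (hX : ∀ i l, v l - u i < a → X i l = 0)
    (hY : ∀ l j, v j ≤ v l → Y l j = (1 : Matrix β β R) l j) (h : v j - u i < a + 1) :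
    (X * Y) i j = X i j := by
  rw [← sub_eq_zero, ← Matrix.sub_apply]
  nth_rw 2 [← Matrix.mul_one X]
  rw [← Matrix.mul_sub]
  exact mul_apply_eq_zero_of_level hX (fun l j hl => by
    rw [Matrix.sub_apply, hY l j (by omega), sub_self]) h

end Levels

section MatrixForms

variable {k : Type v} [Field k] {ι ι₁ ι₂ ι₃ : Type*} [Fintype ι] [Fintype ι₁] [Fintype ι₂]
  [Fintype ι₃] [DecidableEq ι] [DecidableEq ι₁] [DecidableEq ι₂]

theorem DGA.map_d_mul (A : DGA.{u} k) {p : ℕ} {x : Matrix ι₃ ι₂ A.carrier}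
    (hx : ∀ i j, x i j ∈ A.gr p) (y : Matrix ι₂ ι₁ A.carrier) :
    (x * y).map A.d = x.map A.d * y + (-1 : A.carrier) ^ p • (x * y.map A.d) := by
  ext i j
  simp only [map_apply, mul_apply, map_sum, Matrix.add_apply, Matrix.smul_apply,
    smul_eq_mul, Finset.mul_sum, ← sum_add_distrib]
  exact sum_congr rfl fun l _ => A.leibniz p _ (hx i l) _

theorem DGA.map_d_mul_zero (A : DGA.{u} k) {x : Matrix ι₃ ι₂ A.carrier}
    (hx : ∀ i j, x i j ∈ A.gr 0) (y : Matrix ι₂ ι₁ A.carrier) :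
    (x * y).map A.d = x.map A.d * y + x * y.map A.d := by
  simpa using A.map_d_mul hx y

theorem DGA.map_d_mul_one (A : DGA.{u} k) {x : Matrix ι₃ ι₂ A.carrier}
    (hx : ∀ i j, x i j ∈ A.gr 1) (y : Matrix ι₂ ι₁ A.carrier) :
    (x * y).map A.d = x.map A.d * y - x * y.map A.d := by
  simpa [sub_eq_add_neg] using A.map_d_mul hx y

theorem DGA.map_d_map_d (A : DGA.{u} k) (x : Matrix ι₂ ι₁ A.carrier) :
    (x.map A.d).map A.d = 0 := by
  ext i j; exact A.d_d _

/-- The data needed to lift flat connections along a morphism `f : M → A` of filtered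
differential graded algebras: closed elements of degree one lift up to exact elements, and closed
elements of degree two which become exact are exact, compatibly with the filtrations. -/
structure IsGaugePair (M A : DGA.{u} k) (f : M.carrier →ₐ[k] A.carrier)
    (FM : ℤ → ℕ → Submodule k M.carrier) (FA : ℤ → ℕ → Submodule k A.carrier) : Prop where
  map_d : ∀ x, f (M.d x) = A.d (f x)
  le_M : ∀ r n, FM r n ≤ M.gr n
  le_A : ∀ r n, FA r n ≤ A.gr n
  d_M : ∀ r n, ∀ x ∈ FM r n, M.d x ∈ FM r (n + 1)
  d_A : ∀ r n, ∀ x ∈ FA r n, A.d x ∈ FA r (n + 1)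
  one_A : 1 ∈ FA 0 0
  mul_M : ∀ p q m n, ∀ x ∈ FM p m, ∀ y ∈ FM q n, x * y ∈ FM (p + q) (m + n)
  mul_A : ∀ p q m n, ∀ x ∈ FA p m, ∀ y ∈ FA q n, x * y ∈ FA (p + q) (m + n)
  map_F : ∀ r n, ∀ x ∈ FM r n, f x ∈ FA r n
  lift₁ : ∀ r, ∀ y ∈ FA r 1, A.d y = 0 →
    ∃ x ∈ FM r 1, M.d x = 0 ∧ ∃ z ∈ FA r 0, y = f x + A.d z
  lift₂ : ∀ r, ∀ x ∈ FM r 2, M.d x = 0 → (∃ z ∈ A.gr 1, f x = A.d z) → ∃ y ∈ FM r 1, M.d y = x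

/-- A flat connection which is strictly triangular with respect to the weights `w` is equivalent,
under a unipotent gauge transformation, to the image of a flat connection on `M`; the entries are
corrected one weight difference at a time. -/
theorem IsGaugePair.exists_gauge {M A : DGA.{u} k} {f : M.carrier →ₐ[k] A.carrier}
    {FM : ℤ → ℕ → Submodule k M.carrier} {FA : ℤ → ℕ → Submodule k A.carrier}
    (h : IsGaugePair M A f FM FA) (w t : ι → ℤ) {ω : Matrix ι ι A.carrier}
    (hω : ∀ i j, ω i j ∈ FA (t j - t i) 1) (hω₀ : ∀ i j, w j ≤ w i → ω i j = 0)
    (mc : ω.map A.d + ω * ω = 0) :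
    ∃ (Ω : Matrix ι ι M.carrier) (b : Matrix ι ι A.carrier),
      (∀ i j, Ω i j ∈ FM (t j - t i) 1) ∧ (∀ i j, w j ≤ w i → Ω i j = 0) ∧
      Ω.map M.d + Ω * Ω = 0 ∧ (∀ i j, b i j ∈ FA (t j - t i) 0) ∧
      (∀ i j, w j ≤ w i → b i j = (1 : Matrix ι ι A.carrier) i j) ∧
      b.map A.d + Ω.map f * b - b * ω = 0 := by
  have key : ∀ m : ℕ, ∃ (Ω : Matrix ι ι M.carrier) (b : Matrix ι ι A.carrier),
      (∀ i j, Ω i j ∈ FM (t j - t i) 1) ∧ (∀ i j, w j ≤ w i → Ω i j = 0) ∧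
      (∀ i j, b i j ∈ FA (t j - t i) 0) ∧
      (∀ i j, w j ≤ w i → b i j = (1 : Matrix ι ι A.carrier) i j) ∧
      (∀ i j, w j - w i ≤ m → (Ω.map M.d + Ω * Ω) i j = 0) ∧
      ∀ i j, w j - w i ≤ m → (b.map A.d + Ω.map f * b - b * ω) i j = 0 := by
    intro m
    induction m with
    | zero =>
      refine ⟨0, 1, fun i j => zero_mem _, fun _ _ _ => rfl, fun i j => ?_, fun _ _ _ => rfl,
        fun i j _ => ?_, fun i j hij => ?_⟩
      · by_cases hij : i = j
        · subst hij; simpa using h.one_A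
        · rw [one_apply_ne hij]; exact zero_mem _
      · simp
      · have h1 : (1 : Matrix ι ι A.carrier).map A.d = 0 := by
          ext i j
          by_cases hij : i = j
          · subst hij; simp [A.d_one]
          · simp [one_apply_ne hij]
        simp only [h1, one_mul, mul_one, zero_add, Matrix.sub_apply, map_apply]
        simp [hω₀ i j (by push_cast at hij; omega)]
    | succ m ih =>
      obtain ⟨Ω, b, hΩ, hΩ₀, hb, hb₀, hE, hG⟩ := ih
      set E := Ω.map M.d + Ω * Ω with hEdef
      set G := b.map A.d + Ω.map f * b - b * ω with hGdef
      have hΩ1 : ∀ i j, Ω i j ∈ M.gr 1 := fun i j => h.le_M _ _ (hΩ i j)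
      have hω1 : ∀ i j, ω i j ∈ A.gr 1 := fun i j => h.le_A _ _ (hω i j)
      have hb1 : ∀ i j, b i j ∈ A.gr 0 := fun i j => h.le_A _ _ (hb i j)
      have hfΩ : ∀ i j, Ω.map f i j ∈ FA (t j - t i) 1 := fun i j => h.map_F _ _ _ (hΩ i j)
      have hfΩ1 : ∀ i j, Ω.map f i j ∈ A.gr 1 := fun i j => h.le_A _ _ (hfΩ i j)
      have hfd : (Ω.map f).map A.d = (Ω.map M.d).map f := by
        ext i j; exact (h.map_d _).symm
      have hfm : (Ω * Ω).map f = Ω.map f * Ω.map f :=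
        Matrix.map_mul (f := (f : M.carrier →+* A.carrier))
      have hdE : E.map M.d = E * Ω - Ω * E := by
        rw [hEdef, Matrix.map_add _ (map_add _), M.map_d_map_d, M.map_d_mul_one hΩ1]
        noncomm_ring
      have hfE : E.map f = (Ω.map f).map A.d + Ω.map f * Ω.map f := by
        rw [hEdef, Matrix.map_add _ (map_add _), hfm, hfd]
      have hdω : ω.map A.d = - (ω * ω) := eq_neg_of_add_eq_zero_left mc
      have hdb : b.map A.d = G - Ω.map f * b + b * ω := by rw [hGdef]; abel
      have hdG : G.map A.d = E.map f * b - Ω.map f * G - G * ω := by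
        rw [hGdef, Matrix.map_sub _ (map_sub _), Matrix.map_add _ (map_add _), A.map_d_map_d,
          A.map_d_mul_one hfΩ1, A.map_d_mul_zero hb1, hdω, hdb, hfE]
        noncomm_ring
      have hEF : ∀ i j, E i j ∈ FM (t j - t i) 2 := fun i j => by
        refine add_mem (h.d_M _ _ _ (hΩ i j)) ?_
        rw [mul_apply]
        refine sum_mem fun l _ => ?_
        have := h.mul_M _ _ _ _ _ (hΩ i l) _ (hΩ l j)
        rwa [show t l - t i + (t j - t l) = t j - t i by ring] at this
      have hGF : ∀ i j, G i j ∈ FA (t j - t i) 1 := fun i j => by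
        refine sub_mem (add_mem (h.d_A _ _ _ (hb i j)) ?_) ?_
        · rw [mul_apply]
          refine sum_mem fun l _ => ?_
          have := h.mul_A _ _ _ _ _ (hfΩ i l) _ (hb l j)
          rwa [show t l - t i + (t j - t l) = t j - t i by ring] at this
        · rw [mul_apply]
          refine sum_mem fun l _ => ?_
          have := h.mul_A _ _ _ _ _ (hb i l) _ (hω l j)
          rwa [show t l - t i + (t j - t l) = t j - t i by ring] at this
      have hΩl : ∀ i j, w j - w i < 1 → Ω i j = 0 := fun i j h => hΩ₀ i j (by omega)
      have hωl : ∀ i j, w j - w i < 1 → ω i j = 0 := fun i j h => hω₀ i j (by omega)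
      have hfΩl : ∀ i j, w j - w i < 1 → Ω.map f i j = 0 := fun i j h => by
        rw [map_apply, hΩl i j h, map_zero]
      have hEl : ∀ i j, w j - w i < m + 1 → E i j = 0 := fun i j h => hE i j (by omega)
      have hfEl : ∀ i j, w j - w i < m + 1 → E.map f i j = 0 := fun i j h => by
        rw [map_apply, hEl i j h, map_zero]
      have hGl : ∀ i j, w j - w i < m + 1 → G i j = 0 := fun i j h => hG i j (by omega)
      -- the leading entries of `E` are closed, and those of `G` are primitives of their images
      have hEd : ∀ i j, w j - w i = (m + 1 : ℕ) → M.d (E i j) = 0 := fun i j hij => by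
        rw [← map_apply (f := M.d), hdE, Matrix.sub_apply,
          mul_apply_eq_zero_of_level hEl hΩl (by omega),
          mul_apply_eq_zero_of_level hΩl hEl (by omega), sub_zero]
      have hGd : ∀ i j, w j - w i = (m + 1 : ℕ) → A.d (G i j) = f (E i j) := fun i j hij => by
        rw [← map_apply (f := A.d), hdG, Matrix.sub_apply, Matrix.sub_apply,
          mul_unipotent_apply hfEl hb₀ (by omega), mul_apply_eq_zero_of_level hfΩl hGl (by omega),
          mul_apply_eq_zero_of_level hGl hωl (by omega), sub_zero, sub_zero, map_apply]
      -- correct `Ω` and `b` at level `m + 1` only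
      have hstep : ∀ i j, ∃ x ∈ FM (t j - t i) 1, ∃ z ∈ FA (t j - t i) 0,
          (w j - w i ≠ (m + 1 : ℕ) → x = 0 ∧ z = 0) ∧
          (w j - w i = (m + 1 : ℕ) → E i j = M.d x ∧ G i j = f x + A.d z) := by
        intro i j
        by_cases hij : w j - w i = (m + 1 : ℕ)
        · obtain ⟨x, hx, hxE⟩ := h.lift₂ _ _ (hEF i j) (hEd i j hij)
            ⟨G i j, h.le_A _ _ (hGF i j), (hGd i j hij).symm⟩
          obtain ⟨y, hy, hy0, z, hz, hyz⟩ := h.lift₁ _ (G i j - f x)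
            (sub_mem (hGF i j) (h.map_F _ _ _ hx))
            (by rw [map_sub, ← h.map_d, hxE, hGd i j hij, sub_self])
          refine ⟨x + y, add_mem hx hy, z, hz, fun h' => absurd hij h', fun _ => ⟨?_, ?_⟩⟩
          · rw [map_add, hy0, add_zero, hxE]
          · rw [map_add, add_assoc, ← hyz]; abel
        · exact ⟨0, zero_mem _, 0, zero_mem _, fun _ => ⟨rfl, rfl⟩, fun h' => absurd h' hij⟩
      choose X hX Z hZ hXZ₀ hXZ using hstep
      let X' : Matrix ι ι M.carrier := Matrix.of X
      let Z' : Matrix ι ι A.carrier := Matrix.of Z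
      have hX₀ : ∀ i j, w j - w i ≠ (m + 1 : ℕ) → X' i j = 0 := fun i j h => (hXZ₀ i j h).1
      have hZ₀ : ∀ i j, w j - w i ≠ (m + 1 : ℕ) → Z' i j = 0 := fun i j h => (hXZ₀ i j h).2
      have hXl : ∀ i j, w j - w i < m + 1 → X' i j = 0 := fun i j h => hX₀ i j (by omega)
      have hfXl : ∀ i j, w j - w i < m + 1 → X'.map f i j = 0 := fun i j h => by
        rw [map_apply, hXl i j h, map_zero]
      have hZl : ∀ i j, w j - w i < m + 1 → Z' i j = 0 := fun i j h => hZ₀ i j (by omega)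
      have hbZ : ∀ i j, w j ≤ w i → (b - Z') i j = (1 : Matrix ι ι A.carrier) i j := fun i j h => by
        rw [Matrix.sub_apply, hb₀ i j h, hZl i j (by omega), sub_zero]
      refine ⟨Ω - X', b - Z', fun i j => sub_mem (hΩ i j) (hX i j), fun i j hij => ?_,
        fun i j => sub_mem (hb i j) (hZ i j), hbZ, fun i j hij => ?_, fun i j hij => ?_⟩
      · rw [Matrix.sub_apply, hΩ₀ i j hij, hXl i j (by omega), sub_zero]
      · have e : (Ω - X').map M.d + (Ω - X') * (Ω - X') =
            E - X'.map M.d - (X' * Ω + Ω * X' - X' * X') := by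
          rw [hEdef, Matrix.map_sub _ (map_sub _)]; noncomm_ring
        rw [e, Matrix.sub_apply, Matrix.sub_apply, Matrix.sub_apply, Matrix.add_apply,
          mul_apply_eq_zero_of_level hXl hΩl (by push_cast at hij; omega),
          mul_apply_eq_zero_of_level hΩl hXl (by push_cast at hij; omega),
          mul_apply_eq_zero_of_level hXl hXl (by push_cast at hij; omega), map_apply]
        by_cases h' : w j - w i = (m + 1 : ℕ)
        · rw [(hXZ i j h').1]; simp [X']
        · rw [hE i j (by push_cast at hij h'; omega), hX₀ i j h']; simp
      · have e : (b - Z').map A.d + (Ω - X').map f * (b - Z') - (b - Z') * ω =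
            G - Z'.map A.d - X'.map f * (b - Z') - Ω.map f * Z' + Z' * ω := by
          rw [hGdef, Matrix.map_sub _ (map_sub _), Matrix.map_sub _ (map_sub _)]; noncomm_ring
        rw [e, Matrix.add_apply, Matrix.sub_apply, Matrix.sub_apply, Matrix.sub_apply,
          mul_unipotent_apply hfXl hbZ (by push_cast at hij; omega),
          mul_apply_eq_zero_of_level hfΩl hZl (by push_cast at hij; omega),
          mul_apply_eq_zero_of_level hZl hωl (by push_cast at hij; omega), map_apply,
          map_apply]
        by_cases h' : w j - w i = (m + 1 : ℕ)
        · rw [(hXZ i j h').2]; simp [X', Z']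
        · rw [hG i j (by push_cast at hij h'; omega), hX₀ i j h', hZ₀ i j h']; simp
  obtain ⟨L, hL⟩ := (Set.finite_range fun p : ι × ι => w p.2 - w p.1).bddAbove
  have hL' : ∀ i j, w j - w i ≤ L.toNat := fun i j =>
    (hL ⟨(i, j), rfl⟩).trans (Int.self_le_toNat L)
  obtain ⟨Ω, b, hΩ, hΩ₀, hb, hb₀, hE, hG⟩ := key L.toNat
  exact ⟨Ω, b, hΩ, hΩ₀, by ext i j; exact hE i j (hL' i j), hb, hb₀,
    by ext i j; exact hG i j (hL' i j)⟩

/-- Flat sections of the pullback along a `1`-quasi-isomorphism of strictly triangular flat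
connections are constant. -/
theorem exists_const_of_flat {M A : DGA.{u} k} {f : M.carrier →ₐ[k] A.carrier}
    (hinj : DGA.InjOnH M A f 1)
    (hM : ∀ x ∈ M.gr 0, ∃ c : k, x = algebraMap k _ c) {w₁ : ι₁ → ℤ} {w₂ : ι₂ → ℤ}
    {Ω₁ : Matrix ι₁ ι₁ M.carrier} {Ω₂ : Matrix ι₂ ι₂ M.carrier}
    (h₁ : ∀ i j, Ω₁ i j ∈ M.gr 1) (h₂ : ∀ i j, Ω₂ i j ∈ M.gr 1)
    (h₁₀ : ∀ i j, w₁ j ≤ w₁ i → Ω₁ i j = 0) (h₂₀ : ∀ i j, w₂ j ≤ w₂ i → Ω₂ i j = 0)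
    (mc₁ : Ω₁.map M.d + Ω₁ * Ω₁ = 0) (mc₂ : Ω₂.map M.d + Ω₂ * Ω₂ = 0)
    {b : Matrix ι₂ ι₁ A.carrier} (hb : ∀ i j, b i j ∈ A.gr 0)
    (hflat : b.map A.d + Ω₂.map f * b - b * Ω₁.map f = 0) :
    ∃ c : Matrix ι₂ ι₁ k, b = c.map (algebraMap k _) ∧
      Ω₂ * c.map (algebraMap k _) = c.map (algebraMap k _) * Ω₁ := by
  classical
  have hc : ∀ i j, ∃ c : k, (∃ c, b i j = algebraMap k _ c) → b i j = algebraMap k _ c := by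
    intro i j
    by_cases h : ∃ c, b i j = algebraMap k _ c
    · exact ⟨h.choose, fun _ => h.choose_spec⟩
    · exact ⟨0, fun h' => absurd h' h⟩
  choose c hc using hc
  let c' : Matrix ι₂ ι₁ M.carrier := (Matrix.of c).map (algebraMap k _)
  have hdc : ∀ i j, M.d (c' i j) = 0 := fun i j => by
    change M.d (algebraMap k _ _) = 0
    rw [Algebra.algebraMap_eq_smul_one, map_smul, M.d_one, smul_zero]
  have hc0 : ∀ i j, c' i j ∈ M.gr 0 := fun i j => by
    change algebraMap k _ _ ∈ _
    rw [Algebra.algebraMap_eq_smul_one]; exact Submodule.smul_mem _ _ M.one_mem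
  set X := Ω₂ * c' - c' * Ω₁ with hX
  have hX1 : ∀ i j, X i j ∈ M.gr 1 := fun i j => by
    refine sub_mem ?_ ?_ <;> rw [mul_apply]
    · exact sum_mem fun l _ => by
        have := SetLike.GradedMul.mul_mem (A := M.gr) (h₂ i l) (hc0 l j)
        rwa [add_zero] at this
    · exact sum_mem fun l _ => by
        have := SetLike.GradedMul.mul_mem (A := M.gr) (hc0 i l) (h₁ l j)
        rwa [zero_add] at this
  have hdX : X.map M.d = -(Ω₂ * X) - X * Ω₁ := by
    have hdc' : c'.map M.d = 0 := by ext i j; exact hdc i j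
    rw [hX, Matrix.map_sub _ (map_sub _), M.map_d_mul_one h₂, M.map_d_mul_zero hc0, hdc',
      eq_neg_of_add_eq_zero_left mc₁, eq_neg_of_add_eq_zero_left mc₂]
    simp only [Matrix.mul_sub, Matrix.sub_mul, Matrix.mul_zero, Matrix.zero_mul, Matrix.neg_mul,
      Matrix.mul_neg, Matrix.mul_assoc]
    abel
  obtain ⟨L, hL⟩ := (Set.finite_range fun p : ι₂ × ι₁ => w₁ p.2 - w₂ p.1).bddBelow
  have hL' : ∀ i j, L ≤ w₁ j - w₂ i := fun i j => hL ⟨(i, j), rfl⟩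
  have key : ∀ m : ℕ, ∀ i j, w₁ j - w₂ i < L + m → b i j = algebraMap k _ (c i j) ∧ X i j = 0 := by
    intro m
    induction m with
    | zero => intro i j hij; have := hL' i j; push_cast at hij; omega
    | succ m ih =>
      intro i j hij
      have e₁ : (Ω₂.map f * b) i j = f ((Ω₂ * c') i j) := by
        rw [mul_apply, mul_apply, map_sum]
        refine sum_congr rfl fun l _ => ?_
        rw [map_apply, map_mul]
        by_cases hl : w₂ l ≤ w₂ i
        · rw [h₂₀ i l hl, map_zero, zero_mul, zero_mul]
        · rw [(ih l j (by push_cast at hij; omega)).1]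
          change _ = f (Ω₂ i l) * f (algebraMap k _ (c l j))
          rw [AlgHom.commutes]
      have e₂ : (b * Ω₁.map f) i j = f ((c' * Ω₁) i j) := by
        rw [mul_apply, mul_apply, map_sum]
        refine sum_congr rfl fun l _ => ?_
        rw [map_apply, map_mul]
        by_cases hl : w₁ j ≤ w₁ l
        · rw [h₁₀ l j hl, map_zero, mul_zero, mul_zero]
        · rw [(ih i l (by push_cast at hij; omega)).1]
          change _ = f (algebraMap k _ (c i l)) * f (Ω₁ l j)
          rw [AlgHom.commutes]
      -- by induction on the level, the defect `X` is closed and its image is exact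
      have e₃ : f (X i j) = A.d (-(b i j)) := by
        have := congrFun (congrFun hflat i) j
        rw [Matrix.sub_apply, Matrix.add_apply, e₁, e₂, map_apply] at this
        rw [hX, Matrix.sub_apply, map_sub, map_neg, eq_neg_iff_add_eq_zero]
        refine Eq.trans ?_ this
        abel
      have e₄ : M.d (X i j) = 0 := by
        rw [← map_apply (f := M.d), hdX, Matrix.sub_apply, Matrix.neg_apply,
          mul_apply_eq_zero_of_level (u := w₂) (v := w₂) (w := w₁) (a := 1)
            (fun i l h => h₂₀ i l (by omega)) (fun l j h => (ih l j h).2)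
            (by push_cast at hij; omega),
          mul_apply_eq_zero_of_level (u := w₂) (v := w₁) (w := w₁) (b := 1)
            (fun i l h => (ih i l h).2) (fun l j h => h₁₀ l j (by omega))
            (by push_cast at hij; omega), neg_zero, sub_zero]
      have e₅ : X i j = 0 := by
        obtain ⟨z, hz, hzX⟩ := hinj _ (hX1 i j) e₄ ⟨-(b i j), neg_mem (hb i j), e₃.symm⟩
        obtain ⟨r, rfl⟩ := hM z hz
        rw [← hzX, Algebra.algebraMap_eq_smul_one, map_smul, M.d_one, smul_zero]
      refine ⟨hc i j (A.connected _ (hb i j) ?_), e₅⟩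
      rw [e₅, map_zero, map_neg, eq_comm, neg_eq_zero] at e₃
      exact e₃
  obtain ⟨U, hU⟩ := (Set.finite_range fun p : ι₂ × ι₁ => w₁ p.2 - w₂ p.1).bddAbove
  have hall : ∀ i j, b i j = algebraMap k _ (c i j) ∧ X i j = 0 := fun i j => by
    have h' : w₁ j - w₂ i ≤ U := hU ⟨(i, j), rfl⟩
    exact key (U + 1 - L).toNat i j (by have := Int.self_le_toNat (U + 1 - L); omega)
  refine ⟨Matrix.of c, ?_, sub_eq_zero.1 ?_⟩
  · ext i j; exact (hall i j).1
  · ext i j; exact (hall i j).2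

section Unipotent

variable {R : Type*} [Ring R]

/-- Unipotent triangular matrices with entries in a multiplicative family of subgroups have
inverses of the same kind. -/
theorem exists_unipotent_inverse (w : ι → ℤ) (P : ι → ι → AddSubgroup R)
    (hone : ∀ i, 1 ∈ P i i) (hmul : ∀ i l j, ∀ x ∈ P i l, ∀ y ∈ P l j, x * y ∈ P i j)
    {b : Matrix ι ι R} (hb : ∀ i j, b i j ∈ P i j)
    (hb₀ : ∀ i j, w j ≤ w i → b i j = (1 : Matrix ι ι R) i j) :
    ∃ c : Matrix ι ι R, (∀ i j, c i j ∈ P i j) ∧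
      (∀ i j, w j ≤ w i → c i j = (1 : Matrix ι ι R) i j) ∧ b * c = 1 ∧ c * b = 1 := by
  have h1 : ∀ i j, (1 : Matrix ι ι R) i j ∈ P i j := fun i j => by
    by_cases h : i = j
    · subst h; simpa using hone i
    · rw [one_apply_ne h]; exact zero_mem _
  set n : Matrix ι ι R := 1 - b with hn
  have hnP : ∀ i j, n i j ∈ P i j := fun i j => sub_mem (h1 i j) (hb i j)
  have hn0 : ∀ m : ℕ, ∀ i j, w j - w i < m → (n ^ m) i j = 0 := by
    have hn1 : ∀ i j, w j ≤ w i → n i j = 0 := fun i j h => by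
      rw [hn, Matrix.sub_apply, hb₀ i j h, sub_self]
    intro m
    induction m with
    | zero =>
      intro i j hij
      rw [pow_zero, one_apply_ne]
      rintro rfl
      simp at hij
    | succ m ih =>
      intro i j hij
      rw [pow_succ]
      exact mul_apply_eq_zero_of_level (w := w) ih (b := 1) (fun l j h => hn1 l j (by omega))
        (by push_cast at hij; exact hij)
  have hnm : ∀ m : ℕ, ∀ i j, (n ^ m) i j ∈ P i j := by
    intro m
    induction m with
    | zero => simpa using h1
    | succ m ih =>
      intro i j
      rw [pow_succ, mul_apply]
      exact sum_mem fun l _ => hmul _ _ _ _ (ih i l) _ (hnP l j)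
  obtain ⟨U, hU⟩ := (Set.finite_range fun p : ι × ι => w p.2 - w p.1).bddAbove
  have hnil : n ^ (U + 1).toNat = 0 := by
    ext i j
    have h' : w j - w i ≤ U := hU ⟨(i, j), rfl⟩
    exact hn0 _ i j (by have := Int.self_le_toNat (U + 1); omega)
  refine ⟨∑ m ∈ Finset.range (U + 1).toNat, n ^ m, fun i j => ?_, fun i j hij => ?_, ?_, ?_⟩
  · rw [Matrix.sum_apply]
    exact sum_mem fun m _ => hnm m i j
  · rw [Matrix.sum_apply]
    by_cases h0 : (U + 1).toNat = 0
    · have h' : w i - w i ≤ U := hU ⟨(i, i), rfl⟩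
      omega
    · rw [Finset.sum_eq_single 0]
      · simp
      · intro m _ hm
        exact hn0 m i j (by omega)
      · intro h'; simp at h'; omega
  · have := mul_neg_geom_sum n (U + 1).toNat
    rwa [hnil, sub_zero, hn, sub_sub_cancel] at this
  · have := geom_sum_mul_neg n (U + 1).toNat
    rwa [hnil, sub_zero, hn, sub_sub_cancel] at this

end Unipotent

end MatrixForms

/-! ### The cylinder `M × (B ⊗ (t, dt))` -/

section LinearChoice

variable {k : Type*} [Field k] {V W : Type*} [AddCommGroup V] [Module k V] [AddCommGroup W]
  [Module k W]

/-- A linear relation which is everywhere solvable contains the graph of a linear map. -/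
theorem exists_linearMap_of_relation (R : Submodule k (V × W)) (h : ∀ v, ∃ w, (v, w) ∈ R) :
    ∃ ℓ : V →ₗ[k] W, ∀ v, (v, ℓ v) ∈ R := by
  obtain ⟨s, hs⟩ := (LinearMap.fst k V W ∘ₗ R.subtype).exists_rightInverse_of_surjective
    (LinearMap.range_eq_top.2 fun v => by
      obtain ⟨w, hw⟩ := h v
      exact ⟨⟨(v, w), hw⟩, rfl⟩)
  refine ⟨LinearMap.snd k V W ∘ₗ R.subtype ∘ₗ s, fun v => ?_⟩
  have h1 : (s v : V × W).1 = v := LinearMap.congr_fun hs v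
  have h2 : (s v : V × W) ∈ R := (s v).2
  rw [← Prod.mk.eta (p := (s v : V × W)), h1] at h2
  exact h2

end LinearChoice

section AlgebraInduction

variable {k : Type*} [Field k] {A : Type*} [Ring A] [Algebra k A]

theorem adjoin_le_of_mul_left {s : Set A} {S : Submodule k A} (h1 : 1 ∈ S)
    (hmul : ∀ x ∈ s, ∀ y ∈ S, x * y ∈ S) : Subalgebra.toSubmodule (Algebra.adjoin k s) ≤ S := by
  rw [Algebra.adjoin_eq_span, span_le]
  intro x hx
  induction hx using Submonoid.closure_induction_left with
  | one => exact h1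
  | mul_left x hx y _ ih => exact hmul x hx y ih

end AlgebraInduction

section Polynomials

variable {B : Type u} [Ring B] [Algebra ℂ B]

theorem coeff_polyIntegral_succ (p : B[X]) (i : ℕ) :
    (polyIntegral p).coeff (i + 1) = ((i : ℂ) + 1)⁻¹ • p.coeff i := by
  rw [polyIntegral, Polynomial.sum, Polynomial.finsetSum_coeff]
  simp only [Polynomial.coeff_monomial, Nat.add_right_cancel_iff]
  rw [Finset.sum_ite_eq' p.support i]
  split_ifs with h
  · rfl
  · rw [Polynomial.notMem_support_iff.1 h, smul_zero]

@[simp] theorem coeff_polyIntegral_zero (p : B[X]) : (polyIntegral p).coeff 0 = 0 := by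
  rw [polyIntegral, Polynomial.sum, Polynomial.finsetSum_coeff]
  simp [Polynomial.coeff_monomial]

@[simp] theorem polyIntegral_add (p q : B[X]) :
    polyIntegral (p + q) = polyIntegral p + polyIntegral q := by
  ext (_ | i) <;> simp [coeff_polyIntegral_succ]

@[simp] theorem polyIntegral_smul (c : ℂ) (p : B[X]) :
    polyIntegral (c • p) = c • polyIntegral p := by
  ext (_ | i) <;> simp [coeff_polyIntegral_succ, smul_comm c]

@[simp] theorem polyIntegral_zero : polyIntegral (0 : B[X]) = 0 := by
  ext (_ | i) <;> simp [coeff_polyIntegral_succ]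

theorem coeff_derivative_eq_smul (p : B[X]) (i : ℕ) :
    (Polynomial.derivative p).coeff i = ((i : ℂ) + 1) • p.coeff (i + 1) := by
  rw [Polynomial.coeff_derivative, show ((i : B) + 1) = algebraMap ℂ B ((i : ℂ) + 1) by simp,
    ← Algebra.commutes, Algebra.smul_def]

@[simp] theorem derivative_polyIntegral (p : B[X]) :
    Polynomial.derivative (polyIntegral p) = p := by
  ext i
  rw [coeff_derivative_eq_smul, coeff_polyIntegral_succ, smul_inv_smul₀]
  exact_mod_cast Nat.succ_ne_zero i

theorem polyIntegral_derivative (p : B[X]) :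
    polyIntegral (Polynomial.derivative p) = p - Polynomial.C (p.coeff 0) := by
  ext (_ | i)
  · simp
  · rw [coeff_polyIntegral_succ, coeff_derivative_eq_smul, inv_smul_smul₀]
    · simp
    · exact_mod_cast Nat.succ_ne_zero i

/-- Evaluation at `1` is multiplicative, also for noncommutative coefficients. -/
theorem eval_one_mul (p q : B[X]) : (p * q).eval 1 = p.eval 1 * q.eval 1 :=
  map_mul (Polynomial.eval₂RingHom' (RingHom.id B) 1 fun _ => Commute.one_right _) p q

theorem eval_one_smul (c : ℂ) (p : B[X]) : (c • p).eval 1 = c • p.eval 1 := by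
  simp

/-- The coefficientwise action of a linear map on polynomials. -/
def mapPoly (d : B →ₗ[ℂ] B) : B[X] →ₗ[ℂ] B[X] :=
  Polynomial.lsum fun i => (Polynomial.monomial i).restrictScalars ℂ ∘ₗ d

@[simp] theorem coeff_mapPoly (d : B →ₗ[ℂ] B) (p : B[X]) (i : ℕ) :
    (mapPoly d p).coeff i = d (p.coeff i) := by
  rw [mapPoly, Polynomial.lsum_apply, Polynomial.sum, Polynomial.finsetSum_coeff]
  simp only [LinearMap.comp_apply, LinearMap.restrictScalars_apply, Polynomial.coeff_monomial]
  rw [Finset.sum_ite_eq' p.support i]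
  split_ifs with h
  · rfl
  · rw [Polynomial.notMem_support_iff.1 h, map_zero]

theorem mapPoly_C (d : B →ₗ[ℂ] B) (b : B) : mapPoly d (Polynomial.C b) = Polynomial.C (d b) := by
  ext i; simp only [coeff_mapPoly, Polynomial.coeff_C]; split_ifs <;> simp

theorem mapPoly_C_mul_X (d : B →ₗ[ℂ] B) (b : B) :
    mapPoly d (Polynomial.C b * Polynomial.X) = Polynomial.C (d b) * Polynomial.X := by
  ext i; simp only [coeff_mapPoly, Polynomial.coeff_C_mul, Polynomial.coeff_X]
  split_ifs <;> simp

theorem mapPoly_polyIntegral (d : B →ₗ[ℂ] B) (p : B[X]) :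
    mapPoly d (polyIntegral p) = polyIntegral (mapPoly d p) := by
  ext (_ | i) <;> simp [coeff_polyIntegral_succ]

theorem eval_one_mapPoly (d : B →ₗ[ℂ] B) (p : B[X]) : (mapPoly d p).eval 1 = d (p.eval 1) := by
  rw [Polynomial.eval_eq_sum_range' (n := max (mapPoly d p).natDegree p.natDegree + 1) (by omega),
    Polynomial.eval_eq_sum_range' (n := max (mapPoly d p).natDegree p.natDegree + 1) (by omega)]
  simp

theorem mapPoly_derivative (d : B →ₗ[ℂ] B) (p : B[X]) :
    mapPoly d (Polynomial.derivative p) = Polynomial.derivative (mapPoly d p) := by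
  ext i; rw [coeff_mapPoly, coeff_derivative_eq_smul, coeff_derivative_eq_smul]; simp

/-- The polynomials with coefficients in a subspace. -/
def polyIn (P : Submodule ℂ B) : Submodule ℂ B[X] where
  carrier := {p | ∀ i, p.coeff i ∈ P}
  add_mem' hp hq i := by rw [Polynomial.coeff_add]; exact add_mem (hp i) (hq i)
  zero_mem' i := by rw [Polynomial.coeff_zero]; exact zero_mem _
  smul_mem' c p hp i := by rw [Polynomial.coeff_smul]; exact Submodule.smul_mem _ _ (hp i)

theorem mul_mem_polyIn {P Q R : Submodule ℂ B} (h : ∀ x ∈ P, ∀ y ∈ Q, x * y ∈ R) {p q : B[X]}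
    (hp : p ∈ polyIn P) (hq : q ∈ polyIn Q) : p * q ∈ polyIn R := fun i => by
  rw [Polynomial.coeff_mul]
  exact sum_mem fun x _ => h _ (hp _) _ (hq _)

theorem polyIntegral_mem {P : Submodule ℂ B} {p : B[X]} (hp : p ∈ polyIn P) :
    polyIntegral p ∈ polyIn P := by
  rintro (_ | i)
  · simp
  · rw [coeff_polyIntegral_succ]; exact Submodule.smul_mem _ _ (hp i)

theorem C_mem_polyIn {P : Submodule ℂ B} {b : B} (hb : b ∈ P) : Polynomial.C b ∈ polyIn P :=
  fun i => by rw [Polynomial.coeff_C]; split_ifs; exacts [hb, zero_mem _]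

theorem C_mul_X_mem_polyIn {P : Submodule ℂ B} {b : B} (hb : b ∈ P) :
    Polynomial.C b * Polynomial.X ∈ polyIn P := fun i => by
  rw [Polynomial.coeff_C_mul, Polynomial.coeff_X]; split_ifs <;> simp [hb]

theorem eval_one_mem {P : Submodule ℂ B} {p : B[X]} (hp : p ∈ polyIn P) : p.eval 1 ∈ P := by
  rw [Polynomial.eval_eq_sum_range]
  exact sum_mem fun i _ => by simpa using hp i

end Polynomials

section Cylinder

variable (M B : DGA.{u} ℂ)

theorem DGA.mapPoly_d_mul {p : ℕ} {x : B.carrier[X]} (hx : x ∈ polyIn (B.gr p))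
    (y : B.carrier[X]) :
    mapPoly B.d (x * y) = mapPoly B.d x * y + (-1) ^ p * (x * mapPoly B.d y) := by
  have h1 : ((-1 : B.carrier[X]) ^ p) = Polynomial.C ((-1 : B.carrier) ^ p) := by simp
  ext i
  rw [h1, coeff_mapPoly, Polynomial.coeff_add, Polynomial.coeff_C_mul, Polynomial.coeff_mul,
    Polynomial.coeff_mul, Polynomial.coeff_mul, map_sum, Finset.mul_sum, ← sum_add_distrib]
  exact sum_congr rfl fun l _ => by simp [B.leibniz p _ (hx _)]

theorem DGA.sq_eq_zero {x : M.carrier} (hx : x ∈ M.gr 1) : x * x = 0 := by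
  have h := M.comm 1 1 x hx x hx
  have h2 : (2 : ℂ) • (x * x) = 0 := by
    rw [two_smul]; nth_rw 1 [h]; simp
  exact (smul_eq_zero.1 h2).resolve_left two_ne_zero

theorem DGA.poly_sq_eq_zero {x : B.carrier[X]} (hx : x ∈ polyIn (B.gr 1)) : x * x = 0 := by
  have h2 : (2 : ℂ) • (x * x) = 0 := by
    ext i
    rw [Polynomial.coeff_smul, Polynomial.coeff_mul, two_smul, Polynomial.coeff_zero]
    nth_rw 1 [← Finset.Nat.sum_antidiagonal_swap]
    rw [← sum_add_distrib]
    refine sum_eq_zero fun p _ => ?_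
    have := B.comm 1 1 _ (hx p.1) _ (hx p.2)
    simp only [Prod.fst_swap, Prod.snd_swap, this]
    simp
  exact (smul_eq_zero.1 h2).resolve_left two_ne_zero

theorem DGA.poly_commute {x y : B.carrier[X]} (hx : x ∈ polyIn (B.gr 1))
    (hy : y ∈ polyIn (B.gr 0)) : x * y = y * x := by
  ext i
  rw [Polynomial.coeff_mul, Polynomial.coeff_mul, ← Finset.Nat.sum_antidiagonal_swap]
  refine sum_congr rfl fun p _ => ?_
  have := B.comm 1 0 _ (hx p.2) _ (hy p.1)
  simp only [Prod.fst_swap, Prod.snd_swap, this]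
  simp

/-- The part of degree `n - 1`. -/
def DGA.predGr : ℕ → Submodule ℂ B.carrier
  | 0 => ⊥
  | n + 1 => B.gr n

/-- The algebra `M × (B ⊗ (t, dt))`, in which the element `α + β dt` of degree `n` is represented by
the triangular matrix with diagonal entries `α` and `(-1) ^ n α` and off-diagonal entry `β`. -/
abbrev Cyl := M.carrier × Matrix (Fin 2) (Fin 2) B.carrier[X]

/-- The elements of degree `n` of `M × (B ⊗ (t, dt))`. -/
def Cyl.gr (n : ℕ) : Submodule ℂ (Cyl M B) where
  carrier := {x | x.1 ∈ M.gr n ∧ x.2 0 0 ∈ polyIn (B.gr n) ∧ x.2 0 1 ∈ polyIn (B.predGr n) ∧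
    x.2 1 0 = 0 ∧ x.2 1 1 = (-1) ^ n * x.2 0 0}
  add_mem' := fun {x y} ⟨h₁, h₂, h₃, h₄, h₅⟩ ⟨k₁, k₂, k₃, k₄, k₅⟩ =>
    ⟨add_mem h₁ k₁, add_mem h₂ k₂, add_mem h₃ k₃, by simp [h₄, k₄],
      by simp [h₅, k₅, mul_add]⟩
  zero_mem' := ⟨zero_mem _, zero_mem _, zero_mem _, rfl, by simp⟩
  smul_mem' := fun c {x} ⟨h₁, h₂, h₃, h₄, h₅⟩ =>
    ⟨Submodule.smul_mem _ c h₁, Submodule.smul_mem _ c h₂, Submodule.smul_mem _ c h₃,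
      by simp [h₄], by simp [h₅]⟩

variable {M B}

/-- Elements of degree one have square zero, so linear maps to them extend to exterior algebras. -/
theorem Cyl.sq_eq_zero {x : Cyl M B} (hx : x ∈ Cyl.gr M B 1) : x * x = 0 := by
  obtain ⟨h₁, h₂, h₃, h₄, h₅⟩ := hx
  refine Prod.ext (M.sq_eq_zero h₁) ?_
  have := B.poly_sq_eq_zero h₂
  have h' := B.poly_commute h₂ h₃
  ext1 i j
  fin_cases i <;> fin_cases j <;>
    simp [mul_apply, Fin.sum_univ_two, h₄, h₅, this, h']

theorem Cyl.one_mem : (1 : Cyl M B) ∈ Cyl.gr M B 0 := by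
  refine ⟨M.one_mem, ?_, ?_, ?_, ?_⟩
  · simpa using C_mem_polyIn B.one_mem
  · simp
  · simp
  · simp

theorem Cyl.mul_mem {n : ℕ} {x y : Cyl M B} (hx : x ∈ Cyl.gr M B 1) (hy : y ∈ Cyl.gr M B n) :
    x * y ∈ Cyl.gr M B (n + 1) := by
  obtain ⟨h₁, h₂, h₃, h₄, h₅⟩ := hx
  obtain ⟨k₁, k₂, k₃, k₄, k₅⟩ := hy
  refine ⟨?_, ?_, ?_, ?_, ?_⟩
  · have := SetLike.GradedMul.mul_mem (A := M.gr) h₁ k₁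
    rwa [add_comm] at this
  · have : (x * y).2 0 0 = x.2 0 0 * y.2 0 0 := by
      simp [mul_apply, Fin.sum_univ_two, k₄]
    rw [this]
    refine mul_mem_polyIn (fun a ha b hb => ?_) h₂ k₂
    have := SetLike.GradedMul.mul_mem (A := B.gr) ha hb
    rwa [add_comm] at this
  · have : (x * y).2 0 1 = x.2 0 0 * y.2 0 1 + x.2 0 1 * y.2 1 1 := by
      simp [mul_apply, Fin.sum_univ_two]
    rw [this]
    refine add_mem ?_ ?_
    · refine mul_mem_polyIn (fun a ha b hb => ?_) h₂ k₃
      cases n with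
      | zero => rw [(show b = 0 from hb), mul_zero]; exact zero_mem _
      | succ n =>
        have := SetLike.GradedMul.mul_mem (A := B.gr) ha hb
        rwa [add_comm] at this
    · rw [k₅]
      refine mul_mem_polyIn (fun a ha b hb => ?_) h₃ (Q := B.gr n) (fun i => ?_)
      · have := SetLike.GradedMul.mul_mem (A := B.gr) ha hb
        rw [Nat.zero_add] at this
        exact this
      · rw [show ((-1 : B.carrier[X]) ^ n) = Polynomial.C ((-1 : B.carrier) ^ n) by simp,
          Polynomial.coeff_C_mul]
        rcases neg_one_pow_eq_or B.carrier n with h | h <;> rw [h]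
        · rw [one_mul]; exact k₂ i
        · rw [neg_one_mul]; exact neg_mem (k₂ i)
  · simp [mul_apply, Fin.sum_univ_two, h₄, k₄]
  · simp only [Prod.snd_mul, mul_apply, Fin.sum_univ_two, h₄, k₄, h₅, k₅]
    rcases neg_one_pow_eq_or B.carrier[X] n with h | h <;> simp [pow_succ, h]

/-- `y` is the differential of `x` in `M × (B ⊗ (t, dt))`. -/
def Cyl.IsDiff (x y : Cyl M B) : Prop :=
  y.1 = M.d x.1 ∧ y.2 0 0 = mapPoly B.d (x.2 0 0) ∧
    y.2 0 1 = mapPoly B.d (x.2 0 1) + Polynomial.derivative (x.2 1 1) ∧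
    y.2 1 1 = -mapPoly B.d (x.2 1 1)

theorem Cyl.isDiff_one : Cyl.IsDiff (1 : Cyl M B) 0 := by
  have h := mapPoly_C B.d (1 : B.carrier)
  rw [B.d_one, map_zero, map_one] at h
  exact ⟨M.d_one.symm, by simpa using h.symm, by simp, by simpa using h⟩

theorem Cyl.IsDiff.add {x x' y y' : Cyl M B} (h : Cyl.IsDiff x y) (h' : Cyl.IsDiff x' y') :
    Cyl.IsDiff (x + x') (y + y') := by
  obtain ⟨h₁, h₂, h₃, h₄⟩ := h
  obtain ⟨k₁, k₂, k₃, k₄⟩ := h'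
  refine ⟨?_, ?_, ?_, ?_⟩
  · simp [h₁, k₁]
  · simp [h₂, k₂]
  · simp only [Prod.snd_add, Matrix.add_apply, h₃, k₃, map_add]; abel
  · simp only [Prod.snd_add, Matrix.add_apply, h₄, k₄, map_add]; abel

theorem Cyl.IsDiff.smul {x y : Cyl M B} (c : ℂ) (h : Cyl.IsDiff x y) :
    Cyl.IsDiff (c • x) (c • y) := by
  obtain ⟨h₁, h₂, h₃, h₄⟩ := h
  refine ⟨?_, ?_, ?_, ?_⟩
  · simp [h₁]
  · simp [h₂]
  · simp [h₃]
  · simp [h₄]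

theorem Cyl.IsDiff.mul {x y x' y' : Cyl M B} (hx : x ∈ Cyl.gr M B 1) (h : Cyl.IsDiff x x')
    (h' : Cyl.IsDiff y y') (hx' : x'.2 1 0 = 0) (hy : y.2 1 0 = 0) (hy' : y'.2 1 0 = 0) :
    Cyl.IsDiff (x * y) (x' * y - x * y') := by
  obtain ⟨a₁, a₂, a₃, a₄, a₅⟩ := hx
  obtain ⟨h₁, h₂, h₃, h₄⟩ := h
  obtain ⟨k₁, k₂, k₃, k₄⟩ := h'
  refine ⟨?_, ?_, ?_, ?_⟩
  · simp [M.leibniz 1 _ a₁, h₁, k₁, sub_eq_add_neg]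
  · simp only [Prod.snd_sub, Prod.snd_mul, Matrix.sub_apply, mul_apply, Fin.sum_univ_two,
      hy, hy', mul_zero, add_zero, h₂, k₂, B.mapPoly_d_mul a₂]
    noncomm_ring
  · simp only [Prod.snd_sub, Prod.snd_mul, Matrix.sub_apply, mul_apply, Fin.sum_univ_two,
      a₄, zero_mul, zero_add, h₂, h₃, k₃, k₄, a₅, map_add, B.mapPoly_d_mul a₂,
      B.mapPoly_d_mul a₃, Polynomial.derivative_mul, pow_one, pow_zero, one_mul,
      map_neg, neg_mul]
    noncomm_ring
  · simp only [Prod.snd_sub, Prod.snd_mul, Matrix.sub_apply, mul_apply, Fin.sum_univ_two,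
      a₄, hx', zero_mul, zero_add, h₄, k₄, a₅, pow_one, one_mul, neg_mul, map_neg,
      B.mapPoly_d_mul a₂]
    noncomm_ring

end Cylinder

/-! ### Lifting homomorphisms from `1`-minimal algebras -/

section MinimalAlgebras

variable {k : Type v} [Field k]

namespace DGA.IsOneMinimal

variable {N : DGA.{u} k} {Vs : ℕ → Submodule k N.carrier} (hN : N.IsOneMinimal Vs)

include hN

theorem adjoin_gr_one : Algebra.adjoin k (N.gr 1 : Set N.carrier) = ⊤ := by
  obtain ⟨e, he⟩ := hN.free
  have htop : (⊤ : Subalgebra k N.carrier) = (⊤ : Subalgebra k _).map e.toAlgHom := by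
    rw [Algebra.map_top]; exact ((AlgHom.range_eq_top e.toAlgHom).2 e.surjective).symm
  rw [eq_top_iff, htop, ← CliffordAlgebra.adjoin_range_ι, AlgHom.map_adjoin]
  refine Algebra.adjoin_mono ?_
  rintro _ ⟨_, ⟨x, rfl⟩, rfl⟩
  have : e (ExteriorAlgebra.ι k x) = x := he x
  exact this ▸ x.2

theorem induction {S : Submodule k N.carrier} (h1 : 1 ∈ S)
    (hmul : ∀ x ∈ N.gr 1, ∀ y ∈ S, x * y ∈ S) (y : N.carrier) : y ∈ S := by
  have h := adjoin_le_of_mul_left (k := k) (s := (N.gr 1 : Set N.carrier)) h1 hmul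
  rw [hN.adjoin_gr_one] at h
  exact h (Algebra.mem_top (R := k) : y ∈ (⊤ : Subalgebra k N.carrier))

/-- A `1`-minimal algebra is generated in degree one. -/
theorem gr_eq_pow (n : ℕ) : N.gr n = N.gr 1 ^ n := by
  have hle : ∀ m, N.gr 1 ^ m ≤ N.gr m := by
    intro m
    induction m with
    | zero =>
      rw [pow_zero, Submodule.one_le]
      exact N.one_mem
    | succ m ih =>
      rw [pow_succ, Submodule.mul_le]
      exact fun x hx y hy => SetLike.GradedMul.mul_mem (A := N.gr) (ih hx) hy
  refine le_antisymm (fun x hx => ?_) (hle n)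
  have htop : x ∈ ⨆ m, N.gr 1 ^ m := by
    refine hN.induction (S := ⨆ m, N.gr 1 ^ m) ?_ ?_ x
    · exact mem_iSup_of_mem 0 (by rw [pow_zero]; exact Submodule.one_le.1 le_rfl)
    · intro y hy z hz
      refine (iSup_le fun m w hw => ?_ : (⨆ m, N.gr 1 ^ m) ≤
        (⨆ m, N.gr 1 ^ m).comap (mulLeft k y)) hz
      refine mem_iSup_of_mem (m + 1) ?_
      rw [pow_succ']
      exact Submodule.mul_mem_mul hy hw
  have key : ∀ y ∈ ⨆ m, N.gr 1 ^ m, (DirectSum.decompose N.gr y n : N.carrier) ∈ N.gr 1 ^ n := by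
    intro y hy
    induction hy using iSup_induction' with
    | mem m y hy =>
      by_cases h : m = n
      · subst h; rwa [DirectSum.decompose_of_mem_same _ (hle m hy)]
      · rw [DirectSum.decompose_of_mem_ne _ (hle m hy) h]; exact zero_mem _
    | zero => simp
    | add x y _ _ hx hy =>
      rw [DirectSum.decompose_add, DirectSum.add_apply, Submodule.coe_add]
      exact add_mem hx hy
  have := key x htop
  rwa [DirectSum.decompose_of_mem_same _ hx] at this

theorem gr_zero {x : N.carrier} (hx : x ∈ N.gr 0) : ∃ c : k, x = algebraMap k _ c := by
  rw [hN.gr_eq_pow, pow_zero, Submodule.mem_one] at hx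
  obtain ⟨c, hc⟩ := hx
  exact ⟨c, hc.symm⟩

theorem d_gr_zero {x : N.carrier} (hx : x ∈ N.gr 0) : N.d x = 0 := by
  obtain ⟨c, rfl⟩ := hN.gr_zero hx
  rw [Algebra.algebraMap_eq_smul_one, map_smul, N.d_one, smul_zero]

theorem Vs_le (i : ℕ) : Vs i ≤ N.gr 1 := hN.iSup_eq ▸ le_iSup Vs i

/-- The universal property of the exterior algebra. -/
theorem exists_algHom_of_linear {T : Type*} [Ring T] [Algebra k T] (L : N.gr 1 →ₗ[k] T)
    (hL : ∀ x, L x * L x = 0) : ∃ F : N.carrier →ₐ[k] T, ∀ x : N.gr 1, F x = L x := by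
  obtain ⟨e, he⟩ := hN.free
  refine ⟨(ExteriorAlgebra.lift k ⟨L, hL⟩).comp e.symm.toAlgHom, fun x => ?_⟩
  have hv : e.symm (x : N.carrier) = ExteriorAlgebra.ι k x := by
    rw [AlgEquiv.symm_apply_eq, he]
  change ExteriorAlgebra.lift k _ (e.symm (x : N.carrier)) = _
  rw [hv, ExteriorAlgebra.lift_ι_apply]

/-- Algebra homomorphisms out of a `1`-minimal algebra are constructed on the subspaces `Vs i`. -/
theorem exists_algHom {T : Type*} [Ring T] [Algebra k T] (P : Submodule k T)
    (hP : ∀ x ∈ P, x * x = 0) (ℓ : ∀ i, Vs i →ₗ[k] T) (hℓ : ∀ i v, ℓ i v ∈ P) :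
    ∃ F : N.carrier →ₐ[k] T, (∀ i (v : Vs i), F v = ℓ i v) ∧ ∀ x ∈ N.gr 1, F x ∈ P := by
  obtain ⟨g, hg⟩ : ∃ g : N.carrier →ₗ[k] DirectSum ℕ fun i => Vs i,
      g ∘ₗ DirectSum.coeLinearMap Vs = LinearMap.id :=
    LinearMap.exists_leftInverse_of_injective (V := DirectSum ℕ fun i => Vs i) _
      (by
        rw [eq_bot_iff]
        intro x hx
        exact hN.indep.dfinsupp_lsum_injective (hx.trans (map_zero _).symm))
  let L : N.gr 1 →ₗ[k] T := DirectSum.toModule k ℕ T ℓ ∘ₗ g ∘ₗ (N.gr 1).subtype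
  have hL : ∀ x, L x ∈ P := by
    intro x
    change DirectSum.toModule k ℕ T ℓ (g x) ∈ P
    generalize g x = z
    induction z using DirectSum.induction_on with
    | zero => simp
    | of i v =>
      have h : DirectSum.toModule k ℕ T ℓ (DirectSum.lof k ℕ (fun i => Vs i) i v) = ℓ i v := by
        rw [DirectSum.toModule_lof]
      exact (congrArg (fun z => z ∈ P) h).mpr (hℓ i v)
    | add x y hx hy => rw [map_add]; exact add_mem hx hy
  obtain ⟨F, hF⟩ := hN.exists_algHom_of_linear L fun x => hP _ (hL x)
  refine ⟨F, fun i v => ?_, fun x hx => (hF ⟨x, hx⟩).symm ▸ hL _⟩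
  refine (hF ⟨v, hN.Vs_le i v.2⟩).trans ?_
  change DirectSum.toModule k ℕ T ℓ (g v) = _
  have : g v = DirectSum.lof k ℕ (fun i => Vs i) i v := by
    conv_lhs => rw [← DirectSum.coeLinearMap_lof Vs i v]
    exact LinearMap.congr_fun hg _
  rw [this, DirectSum.toModule_lof]

end DGA.IsOneMinimal

end MinimalAlgebras

section Lifting

variable {N M B : DGA.{u} ℂ} {Vs : ℕ → Submodule ℂ N.carrier} (hN : N.IsOneMinimal Vs)
  {f : N.carrier →ₐ[ℂ] B.carrier} {g : M.carrier →ₐ[ℂ] B.carrier}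
  (hf : DGA.IsMorphism N B f) (hg : DGA.IsOneQuasiIso M B g) {C : Submodule ℂ B.carrier}

/-- The part of `Vs` with index below `i`, as a set of generators. -/
def belowSet (Vs : ℕ → Submodule ℂ N.carrier) (i : ℕ) : Set N.carrier :=
  ⋃ j ∈ Set.Iio i, (Vs j : Set N.carrier)

variable (f g C) in
/-- The condition on the value `τ` of the canonical lift `N → M × (B ⊗ (t, dt))` at an element `v`
of degree one, given the value `τ'` at `d v`. -/
def cylRel : Submodule ℂ (N.carrier × Cyl M B × Cyl M B) where
  carrier := {p | p.2.1 ∈ Cyl.gr M B 1 ∧ M.d p.2.1.1 = p.2.2.1 ∧ ∃ b ∈ C,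
    B.d b = f p.1 - g p.2.1.1 - (polyIntegral (p.2.2.2 0 1)).eval 1 ∧
    p.2.1.2 0 0 = Polynomial.C (f p.1) - polyIntegral (p.2.2.2 0 1) -
      Polynomial.C (B.d b) * Polynomial.X ∧ p.2.1.2 0 1 = -Polynomial.C b}
  add_mem' := by
    rintro x y ⟨h₁, h₂, b, hb, h₃, h₄, h₅⟩ ⟨k₁, k₂, c, hc, k₃, k₄, k₅⟩
    refine ⟨add_mem h₁ k₁, by simp [h₂, k₂], b + c, add_mem hb hc, ?_, ?_, ?_⟩
    · simp only [map_add, h₃, k₃, Prod.snd_add, Prod.fst_add, Matrix.add_apply, polyIntegral_add,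
        Polynomial.eval_add]
      abel
    · simp only [map_add, h₄, k₄, Prod.snd_add, Prod.fst_add, Matrix.add_apply, polyIntegral_add,
        add_mul]
      abel
    · simp only [h₅, k₅, Prod.snd_add, Prod.fst_add, Matrix.add_apply, map_add]
      abel
  zero_mem' := ⟨zero_mem _, by simp, 0, zero_mem _, by simp, by simp, by simp⟩
  smul_mem' := by
    rintro r x ⟨h₁, h₂, b, hb, h₃, h₄, h₅⟩
    refine ⟨Submodule.smul_mem _ r h₁, by simp [h₂], r • b, Submodule.smul_mem _ r hb, ?_, ?_, ?_⟩
    · simp only [map_smul, h₃, Prod.smul_snd, Prod.smul_fst, Matrix.smul_apply, polyIntegral_smul,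
        eval_one_smul, smul_sub]
    · simp only [map_smul, h₄, Prod.smul_snd, Prod.smul_fst, Matrix.smul_apply, polyIntegral_smul,
        smul_sub, ← Polynomial.smul_C, smul_mul_assoc]
    · simp only [h₅, Prod.smul_snd, Prod.smul_fst, Matrix.smul_apply, ← Polynomial.smul_C, smul_neg]

theorem mem_cylRel {v : N.carrier} {τ τ' : Cyl M B} : (v, τ, τ') ∈ cylRel f g C ↔
    τ ∈ Cyl.gr M B 1 ∧ M.d τ.1 = τ'.1 ∧ ∃ b ∈ C,
    B.d b = f v - g τ.1 - (polyIntegral (τ'.2 0 1)).eval 1 ∧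
    τ.2 0 0 = Polynomial.C (f v) - polyIntegral (τ'.2 0 1) - Polynomial.C (B.d b) * Polynomial.X ∧
    τ.2 0 1 = -Polynomial.C b := Iff.rfl

include hN in
theorem map_mem_cylGr {F : N.carrier →ₐ[ℂ] Cyl M B} (hF : ∀ x ∈ N.gr 1, F x ∈ Cyl.gr M B 1) (n : ℕ)
    {x : N.carrier} (hx : x ∈ N.gr n) : F x ∈ Cyl.gr M B n := by
  have : ∀ n, N.gr 1 ^ n ≤ (Cyl.gr M B n).comap F.toLinearMap := by
    intro n
    induction n with
    | zero =>
      rw [pow_zero, Submodule.one_le, mem_comap, AlgHom.toLinearMap_apply, map_one]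
      exact Cyl.one_mem
    | succ n ih =>
      rw [pow_succ', Submodule.mul_le]
      intro a ha b hb
      rw [mem_comap, AlgHom.toLinearMap_apply, map_mul]
      exact Cyl.mul_mem (hF a ha) (ih hb)
  rw [hN.gr_eq_pow] at hx
  exact this n hx

include hN in
/-- The image consists of upper triangular matrices. -/
theorem map_lower_eq_zero {F : N.carrier →ₐ[ℂ] Cyl M B} (hF : ∀ x ∈ N.gr 1, F x ∈ Cyl.gr M B 1)
    (x : N.carrier) : (F x).2 1 0 = 0 := by
  let S : Submodule ℂ N.carrier :=
    { carrier := {x | (F x).2 1 0 = 0}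
      add_mem' := fun {a b} ha hb => by
        rw [Set.mem_ofPred_eq] at *
        simp [ha, hb]
      zero_mem' := by simp
      smul_mem' := fun c a ha => by
        rw [Set.mem_ofPred_eq] at *
        simp [ha] }
  refine hN.induction (S := S) ?_ ?_ x
  · change (F 1).2 1 0 = 0
    simp
  · intro a ha b hb
    change (F (a * b)).2 1 0 = 0
    have hb : (F b).2 1 0 = 0 := hb
    have ha : (F a).2 1 0 = 0 := (hF a ha).2.2.2.1
    simp [mul_apply, Fin.sum_univ_two, ha, hb]

variable (Vs f g C) in
/-- The homomorphism `F` satisfies the recursive condition on the first `i` of the subspaces. -/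
structure IsPartialLift (F : N.carrier →ₐ[ℂ] Cyl M B) (i : ℕ) : Prop where
  map_gr : ∀ x ∈ N.gr 1, F x ∈ Cyl.gr M B 1
  rel : ∀ j < i, ∀ v ∈ Vs j, (v, F v, F (N.d v)) ∈ cylRel f g C

/-- Compatibility of a homomorphism `N → M × (B ⊗ (t, dt))` with the differentials and with the
evaluations at `t = 0` and `t = 1`, at the element `x`. -/
structure CylCompat (f : N.carrier →ₐ[ℂ] B.carrier) (g : M.carrier →ₐ[ℂ] B.carrier)
    (F : N.carrier →ₐ[ℂ] Cyl M B) (x : N.carrier) : Prop where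
  diff : Cyl.IsDiff (F x) (F (N.d x))
  zero : ((F x).2 0 0).coeff 0 = f x
  one : ((F x).2 0 0).eval 1 = g (F x).1

include hf in
/-- The recursive condition at `v` and compatibility at `d v` give compatibility at `v`. -/
theorem CylCompat.of_rel {F : N.carrier →ₐ[ℂ] Cyl M B} {v : N.carrier}
    (h : (v, F v, F (N.d v)) ∈ cylRel f g C) (h₂ : F (N.d v) ∈ Cyl.gr M B 2)
    (hd : CylCompat f g F (N.d v)) : CylCompat f g F v := by
  obtain ⟨h₁, hdm, b, hb, e₁, e₂, e₃⟩ := mem_cylRel.1 h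
  obtain ⟨-, -, -, -, k₅⟩ := h₂
  obtain ⟨-, -, -, -, h₅⟩ := h₁
  obtain ⟨-, -, l₃, -⟩ := hd.diff
  simp only [N.d_d, map_zero, Prod.snd_zero, Matrix.zero_apply] at l₃
  have k₅' : (F (N.d v)).2 1 1 = (F (N.d v)).2 0 0 := by simpa using k₅
  have hint : mapPoly B.d (polyIntegral ((F (N.d v)).2 0 1)) =
      Polynomial.C (f (N.d v)) - (F (N.d v)).2 0 0 := by
    rw [mapPoly_polyIntegral, eq_neg_of_add_eq_zero_left l₃.symm, k₅',
      show -Polynomial.derivative ((F (N.d v)).2 0 0) =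
        (-1 : ℂ) • Polynomial.derivative ((F (N.d v)).2 0 0) by simp,
      polyIntegral_smul, polyIntegral_derivative, hd.zero]
    simp
  have h00 : (F (N.d v)).2 0 0 = mapPoly B.d ((F v).2 0 0) := by
    rw [e₂, map_sub, map_sub, hint, mapPoly_C, mapPoly_C_mul_X, B.d_d, hf.map_d]
    simp
  have h11 : (F v).2 1 1 = -(F v).2 0 0 := by simpa using h₅
  refine ⟨⟨hdm.symm, h00, ?_, ?_⟩, ?_, ?_⟩
  · rw [h11, e₂, e₃, map_neg, mapPoly_C]
    simp
  · rw [k₅', h11, h00]; simp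
  · rw [e₂]; simp [coeff_polyIntegral_zero]
  · rw [e₂]
    simp only [Polynomial.eval_sub, Polynomial.eval_C, Polynomial.eval_mul_X, mul_one, e₁]
    abel

/-- The elements at which a homomorphism is compatible with differentials and evaluations. -/
def compatSubmodule (f : N.carrier →ₐ[ℂ] B.carrier) (g : M.carrier →ₐ[ℂ] B.carrier)
    (F : N.carrier →ₐ[ℂ] Cyl M B) : Submodule ℂ N.carrier where
  carrier := {x | CylCompat f g F x}
  add_mem' {a b} ha hb := by
    rw [Set.mem_ofPred_eq] at *
    refine ⟨by simpa only [map_add] using ha.diff.add hb.diff, ?_, ?_⟩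
    · simp [ha.zero, hb.zero]
    · simp [ha.one, hb.one]
  zero_mem' := by
    rw [Set.mem_ofPred_eq]
    refine ⟨by simpa using (Cyl.isDiff_one (M := M) (B := B)).smul 0, by simp, by simp⟩
  smul_mem' c a ha := by
    rw [Set.mem_ofPred_eq] at *
    refine ⟨by simpa only [map_smul] using ha.diff.smul c, ?_, ?_⟩
    · simp [ha.zero]
    · simp [ha.one]

theorem CylCompat.of_one {F : N.carrier →ₐ[ℂ] Cyl M B} : CylCompat f g F 1 :=
  ⟨by simpa [N.d_one] using Cyl.isDiff_one (M := M) (B := B), by simp, by simp⟩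

include hN in
theorem CylCompat.mul {F : N.carrier →ₐ[ℂ] Cyl M B} (hF : ∀ x ∈ N.gr 1, F x ∈ Cyl.gr M B 1)
    {x y : N.carrier} (hx : x ∈ N.gr 1) (h : CylCompat f g F x) (h' : CylCompat f g F y) :
    CylCompat f g F (x * y) := by
  have hl := map_lower_eq_zero hN hF
  refine ⟨?_, ?_, ?_⟩
  · have e : N.d (x * y) = N.d x * y - x * N.d y := by
      rw [N.leibniz 1 x hx]; simp [sub_eq_add_neg]
    rw [e, map_sub, map_mul, map_mul, map_mul]
    exact Cyl.IsDiff.mul (hF x hx) h.diff h'.diff (hl _) (hl _) (hl _)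
  · rw [map_mul, map_mul, ← h.zero, ← h'.zero, ← Polynomial.mul_coeff_zero]
    simp [mul_apply, Fin.sum_univ_two, hl y]
  · rw [map_mul, Prod.fst_mul, map_mul, ← h.one, ← h'.one, ← eval_one_mul]
    simp [mul_apply, Fin.sum_univ_two, hl y]

include hN hf in
theorem IsPartialLift.compat {F : N.carrier →ₐ[ℂ] Cyl M B} {i : ℕ}
    (hF : IsPartialLift Vs f g C F i) {x : N.carrier}
    (hx : x ∈ Algebra.adjoin ℂ (belowSet Vs i)) : CylCompat f g F x := by
  induction i using Nat.strong_induction_on generalizing x with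
  | _ i ih =>
    refine adjoin_le_of_mul_left (k := ℂ) (s := belowSet Vs i) (S := compatSubmodule f g F)
      CylCompat.of_one ?_ hx
    intro v hv y hy
    obtain ⟨j, hj, hvj⟩ : ∃ j < i, v ∈ Vs j := by simpa [belowSet] using hv
    have hv1 : v ∈ N.gr 1 := hN.Vs_le j hvj
    exact CylCompat.mul hN hF.map_gr hv1 (CylCompat.of_rel hf (hF.rel j hj v hvj)
      (map_mem_cylGr hN hF.map_gr 2 (N.d_mem 1 v hv1))
      (ih j hj ⟨hF.map_gr, fun l hl => hF.rel l (hl.trans hj)⟩ (hN.d_mem_adjoin j v hvj))) hy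

include hN hf in
theorem CylCompat.of_forall {F : N.carrier →ₐ[ℂ] Cyl M B} (hF : ∀ i, IsPartialLift Vs f g C F i)
    (x : N.carrier) : CylCompat f g F x := by
  have h1 : N.gr 1 ≤ compatSubmodule f g F := by
    rw [← hN.iSup_eq]
    exact iSup_le fun i v hv => CylCompat.of_rel hf ((hF (i + 1)).rel i (by omega) v hv)
      (map_mem_cylGr hN (hF 0).map_gr 2 (N.d_mem 1 v (hN.Vs_le i hv)))
      ((hF i).compat hN hf (hN.d_mem_adjoin i v hv))
  exact hN.induction (S := compatSubmodule f g F) CylCompat.of_one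
    (fun v hv y hy => CylCompat.mul hN (hF 0).map_gr hv (h1 hv) hy) x

theorem eq_on_adjoin {T : Type*} [Ring T] [Algebra ℂ T] {F F' : N.carrier →ₐ[ℂ] T}
    {s : Set N.carrier}
    (h : ∀ x ∈ s, F x = F' x) {x : N.carrier} (hx : x ∈ Algebra.adjoin ℂ s) : F x = F' x :=
  (Algebra.adjoin_le h : Algebra.adjoin ℂ s ≤ AlgHom.equalizer F F') hx

include hN hf hg in
/-- The recursive condition can be solved at every element of the next subspace: the obstruction
in `H²(M)` vanishes because it does so in `H²(B)`. -/
theorem IsPartialLift.exists_value (hC : IsSplitting B C) {F : N.carrier →ₐ[ℂ] Cyl M B} {i : ℕ}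
    (hF : IsPartialLift Vs f g C F i) {v : N.carrier} (hv : v ∈ Vs i) :
    ∃ τ, (v, τ, F (N.d v)) ∈ cylRel f g C := by
  have hv1 := hN.Vs_le i hv
  have hc := hF.compat hN hf (hN.d_mem_adjoin i v hv)
  have h2 := map_mem_cylGr hN hF.map_gr 2 (N.d_mem 1 v hv1)
  set τ' := F (N.d v) with hτ'
  obtain ⟨m₁, m₂, m₃, -, m₅⟩ := h2
  obtain ⟨l₁, -, l₃, -⟩ := hc.diff
  simp only [N.d_d, map_zero, Prod.snd_zero, Prod.fst_zero, Matrix.zero_apply] at l₁ l₃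
  have k₅' : τ'.2 1 1 = τ'.2 0 0 := by simpa using m₅
  have hint : mapPoly B.d (polyIntegral (τ'.2 0 1)) = Polynomial.C (f (N.d v)) - τ'.2 0 0 := by
    rw [mapPoly_polyIntegral, eq_neg_of_add_eq_zero_left l₃.symm, ← hτ', k₅',
      show -Polynomial.derivative (τ'.2 0 0) = (-1 : ℂ) • Polynomial.derivative (τ'.2 0 0) by simp,
      polyIntegral_smul, polyIntegral_derivative, hc.zero]
    simp
  set q := (polyIntegral (τ'.2 0 1)).eval 1 with hq
  have hq1 : q ∈ B.gr 1 := eval_one_mem (polyIntegral_mem m₃)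
  have hdq : B.d q = f (N.d v) - g τ'.1 := by
    rw [hq, ← eval_one_mapPoly, hint, Polynomial.eval_sub, Polynomial.eval_C, hc.one]
  have hfv : f v - q ∈ B.gr 1 := sub_mem (hf.map_gr 1 v hv1) hq1
  -- a primitive `m₀` in `M`, adjusted by a closed element to match `f v` up to exact elements
  obtain ⟨m₀, hm₀, hm₀d⟩ := hg.inj₂ τ'.1 m₁ l₁.symm
    ⟨f v - q, hfv, by rw [map_sub, hdq, ← hf.map_d]; abel⟩
  obtain ⟨m', hm', hm'd, b₀, hb₀, hb₀d⟩ := hg.surj₁ (f v - q - g m₀)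
    (sub_mem hfv (hg.map_gr 1 _ hm₀))
    (by rw [map_sub, map_sub, hdq, ← hf.map_d, ← hg.map_d, hm₀d]; abel)
  obtain ⟨b, hb, hbd⟩ := hC.surj b₀ hb₀
  have hdb : B.d b = f v - g (m₀ + m') - q := by
    rw [hbd, hb₀d, map_add]; abel
  refine ⟨(m₀ + m', !![Polynomial.C (f v) - polyIntegral (τ'.2 0 1) -
    Polynomial.C (B.d b) * Polynomial.X, -Polynomial.C b; 0,
      -(Polynomial.C (f v) - polyIntegral (τ'.2 0 1) - Polynomial.C (B.d b) * Polynomial.X)]),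
    mem_cylRel.2 ⟨⟨add_mem hm₀ hm', ?_, ?_, rfl, by simp⟩, by simp [hm₀d, hm'd], b, hb, hdb, rfl,
      rfl⟩⟩
  · exact sub_mem (sub_mem (C_mem_polyIn (hf.map_gr 1 v hv1)) (polyIntegral_mem m₃))
      (C_mul_X_mem_polyIn (B.d_mem 0 b (hC.le hb)))
  · exact neg_mem (C_mem_polyIn (hC.le hb))

include hN hf hg in
theorem IsPartialLift.exists_succ (hC : IsSplitting B C) {F : N.carrier →ₐ[ℂ] Cyl M B} {i : ℕ}
    (hF : IsPartialLift Vs f g C F i) : ∃ F' : N.carrier →ₐ[ℂ] Cyl M B,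
      IsPartialLift Vs f g C F' (i + 1) ∧ ∀ j < i, ∀ v ∈ Vs j, F' v = F v := by
  obtain ⟨ℓ, hℓ⟩ := exists_linearMap_of_relation
    ((cylRel f g C).comap (LinearMap.prod ((Vs i).subtype ∘ₗ LinearMap.fst ℂ _ _)
      (LinearMap.prod (LinearMap.snd ℂ _ _)
        (F.toLinearMap ∘ₗ N.d ∘ₗ (Vs i).subtype ∘ₗ LinearMap.fst ℂ (Vs i) (Cyl M B)))))
    (fun v => hF.exists_value hN hf hg hC v.2)
  have hℓ' : ∀ v : Vs i, ((v : N.carrier), ℓ v, F (N.d v)) ∈ cylRel f g C := hℓ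
  classical
  obtain ⟨F', hF', hF'1⟩ := hN.exists_algHom (Cyl.gr M B 1) (fun x => Cyl.sq_eq_zero)
    (fun j => if h : j = i then h ▸ ℓ else F.toLinearMap ∘ₗ (Vs j).subtype) (by
      intro j v
      by_cases h : j = i
      · subst h; simpa using (mem_cylRel.1 (hℓ' v)).1
      · simpa [h] using hF.map_gr v (hN.Vs_le j v.2))
  -- changing the value on `Vs i` does not affect `d v`, which lies below
  have hne : ∀ j ≠ i, ∀ v ∈ Vs j, F' v = F v := fun j hj v hv => by
    simpa [hj] using hF' j ⟨v, hv⟩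
  have hd : ∀ j ≤ i, ∀ v ∈ Vs j, F' (N.d v) = F (N.d v) := fun j hj v hv => by
    refine eq_on_adjoin (fun x hx => ?_) (hN.d_mem_adjoin j v hv)
    obtain ⟨l, hl, hxl⟩ : ∃ l < j, x ∈ Vs l := by simpa using hx
    exact hne l (by omega) x hxl
  refine ⟨F', ⟨hF'1, fun j hj v hv => ?_⟩, fun j hj => hne j hj.ne⟩
  rw [hd j (by omega) v hv]
  by_cases h : j = i
  · subst h
    have : F' v = ℓ ⟨v, hv⟩ := by simpa using hF' j ⟨v, hv⟩
    rw [this]; exact hℓ' ⟨v, hv⟩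
  · rw [hne j h v hv]; exact hF.rel j (by omega) v hv

include hN hf hg in
/-- The extensions to the successive subspaces glue to a homomorphism on all of `N`. -/
theorem exists_lift (hC : IsSplitting B C) :
    ∃ F : N.carrier →ₐ[ℂ] Cyl M B, ∀ i, IsPartialLift Vs f g C F i := by
  obtain ⟨F₀, -, hF₀⟩ := hN.exists_algHom (Cyl.gr M B 1) (fun x => Cyl.sq_eq_zero) (fun _ => 0)
    (fun _ _ => zero_mem _)
  let s : ∀ i, {F : N.carrier →ₐ[ℂ] Cyl M B // IsPartialLift Vs f g C F i} := fun i =>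
    Nat.rec ⟨F₀, hF₀, fun j hj => absurd hj (Nat.not_lt_zero j)⟩
      (fun i F => ⟨(F.2.exists_succ hN hf hg hC).choose,
        (F.2.exists_succ hN hf hg hC).choose_spec.1⟩) i
  have hs : ∀ i, ∀ j < i, ∀ v ∈ Vs j, (s (i + 1)).1 v = (s i).1 v := fun i =>
    ((s i).2.exists_succ hN hf hg hC).choose_spec.2
  have hs' : ∀ j n, ∀ v ∈ Vs j, (s (j + 1 + n)).1 v = (s (j + 1)).1 v := by
    intro j n v hv
    induction n with
    | zero => rfl
    | succ n ih => rw [← ih]; exact hs (j + 1 + n) j (by omega) v hv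
  obtain ⟨F, hF, hF1⟩ := hN.exists_algHom (Cyl.gr M B 1) (fun x => Cyl.sq_eq_zero)
    (fun i => (s (i + 1)).1.toLinearMap ∘ₗ (Vs i).subtype)
    (fun i v => (s (i + 1)).2.map_gr v (hN.Vs_le i v.2))
  have hF' : ∀ j i, j < i → ∀ v ∈ Vs j, F v = (s i).1 v := fun j i hji v hv => by
    obtain ⟨n, rfl⟩ := Nat.exists_eq_add_of_le (Nat.succ_le_of_lt hji)
    exact (hF j ⟨v, hv⟩).trans (hs' j n v hv).symm
  refine ⟨F, fun i => ⟨hF1, fun j hj v hv => ?_⟩⟩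
  rw [hF' j i hj v hv, eq_on_adjoin (F' := (s i).1) (fun x hx => ?_) (hN.d_mem_adjoin j v hv)]
  · exact (s i).2.rel j hj v hv
  · obtain ⟨l, hl, hxl⟩ : ∃ l < j, x ∈ Vs l := by simpa using hx
    exact hF' l i (by omega) x hxl

end Lifting

/-! ### The canonical isomorphism -/

section CanonicalIsomorphism

variable {N M B : DGA.{u} ℂ} {Vs : ℕ → Submodule ℂ N.carrier} {Vs' : ℕ → Submodule ℂ M.carrier}
  (hN : N.IsOneMinimal Vs) (hM : M.IsOneMinimal Vs')
  {f : N.carrier →ₐ[ℂ] B.carrier} {g : M.carrier →ₐ[ℂ] B.carrier}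
  (hf : DGA.IsOneQuasiIso N B f) (hg : DGA.IsOneQuasiIso M B g)

theorem DGA.decompose_map {A A' : DGA.{u} ℂ} {I : A.carrier →ₐ[ℂ] A'.carrier}
    (hI : ∀ n, ∀ x ∈ A.gr n, I x ∈ A'.gr n) (x : A.carrier) (n : ℕ) :
    (DirectSum.decompose A'.gr (I x) n : A'.carrier) = I (DirectSum.decompose A.gr x n) := by
  induction x using DirectSum.Decomposition.inductionOn A.gr with
  | zero => simp
  | @homogeneous i m =>
    by_cases h : i = n
    · subst h
      rw [DirectSum.decompose_of_mem_same _ (hI i m m.2), DirectSum.decompose_of_mem_same _ m.2]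
    · rw [DirectSum.decompose_of_mem_ne _ (hI i m m.2) h, DirectSum.decompose_of_mem_ne _ m.2 h,
        map_zero]
  | add x y hx hy =>
    simp only [map_add, DirectSum.decompose_add, DirectSum.add_apply, Submodule.coe_add, hx, hy]

include hM in
/-- A homomorphism of free graded commutative algebras which is injective on a space of generators
is injective on the subalgebra generated by it. -/
theorem eq_zero_of_adjoin {I : N.carrier →ₐ[ℂ] M.carrier} (hI : ∀ x ∈ N.gr 1, I x ∈ M.gr 1)
    {U : Submodule ℂ N.carrier} (hU : U ≤ N.gr 1) (hinj : ∀ x ∈ U, I x = 0 → x = 0)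
    {x : N.carrier} (hx : x ∈ Algebra.adjoin ℂ (U : Set N.carrier)) (h0 : I x = 0) : x = 0 := by
  let I₁ : U →ₗ[ℂ] M.gr 1 := (I.toLinearMap ∘ₗ U.subtype).codRestrict _ fun x => hI x (hU x.2)
  obtain ⟨r, hr⟩ := I₁.exists_leftInverse_of_injective (by
    rw [LinearMap.ker_eq_bot']
    intro x hx
    exact Subtype.ext (hinj x x.2 (congrArg Subtype.val hx)))
  obtain ⟨R, hR⟩ := hM.exists_algHom_of_linear (U.subtype ∘ₗ r) fun y =>
    N.sq_eq_zero (hU (r y).2)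
  have := eq_on_adjoin (F := R.comp I) (F' := AlgHom.id ℂ _) (fun y hy => ?_) hx
  · rw [AlgHom.comp_apply, h0, map_zero] at this
    exact this.symm
  · have h1 : I y = I₁ ⟨y, hy⟩ := rfl
    rw [AlgHom.comp_apply, h1, hR]
    change ((r ∘ₗ I₁) ⟨y, hy⟩ : U).1 = y
    rw [hr]; rfl

/-- For a closed element `x`, the forms `f x` and `g (F x)` are cohomologous. -/
theorem exists_primitive {F : N.carrier →ₐ[ℂ] Cyl M B} {x : N.carrier} {n : ℕ}
    (hx : F x ∈ Cyl.gr M B (n + 1)) (h : CylCompat f g F x) (hd : N.d x = 0) :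
    ∃ z ∈ B.gr n, g (F x).1 - f x = B.d z := by
  obtain ⟨-, -, h₃, -⟩ := h.diff
  obtain ⟨-, -, k₃, -, k₅⟩ := hx
  rw [hd, map_zero, k₅] at h₃
  have hz : (polyIntegral ((F x).2 0 1)).eval 1 ∈ B.gr n := eval_one_mem (polyIntegral_mem k₃)
  have e : ((F x).2 0 0).eval 1 - ((F x).2 0 0).coeff 0 =
      (polyIntegral (Polynomial.derivative ((F x).2 0 0))).eval 1 := by
    rw [polyIntegral_derivative]; simp
  rw [← h.one, ← h.zero, e]
  have h₃' := eq_neg_of_add_eq_zero_right h₃.symm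
  rcases neg_one_pow_eq_or B.carrier[X] (n + 1) with hs | hs <;> rw [hs] at h₃'
  · refine ⟨-_, neg_mem hz, ?_⟩
    rw [one_mul] at h₃'
    rw [h₃', map_neg, ← eval_one_mapPoly, mapPoly_polyIntegral, ← neg_one_smul ℂ (mapPoly _ _),
      polyIntegral_smul, eval_one_smul, neg_one_smul]
  · refine ⟨_, hz, ?_⟩
    rw [neg_one_mul, Polynomial.derivative_neg, neg_inj] at h₃'
    rw [h₃', ← eval_one_mapPoly, mapPoly_polyIntegral]

section

variable {F : N.carrier →ₐ[ℂ] Cyl M B} (hF : ∀ x ∈ N.gr 1, F x ∈ Cyl.gr M B 1)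
  (hc : ∀ x, CylCompat f g F x)

include hN hM hf hF hc

/-- By induction on the stages: the differential of a kernel element vanishes by the induction
hypothesis, so the element is exact by injectivity on `H¹`, hence zero as `N⁰` is constant. -/
theorem fst_injective : Function.Injective fun x => (F x).1 := by
  let I : N.carrier →ₐ[ℂ] M.carrier := (AlgHom.fst ℂ _ _).comp F
  have hI : ∀ x ∈ N.gr 1, I x ∈ M.gr 1 := fun x hx => (hF x hx).1
  have hId : ∀ x, I (N.d x) = M.d (I x) := fun x => (hc x).diff.1
  have hstage : ∀ i, ∀ x ∈ ⨆ j ∈ Set.Iio i, Vs j, I x = 0 → x = 0 := by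
    intro i
    induction i with
    | zero => intro x hx _; simpa using hx
    | succ i ih =>
      intro x hx hx0
      have hle : (⨆ j ∈ Set.Iio (i + 1), Vs j) ≤ N.gr 1 := iSup₂_le fun j _ => hN.Vs_le j
      have hdx : N.d x ∈ Algebra.adjoin ℂ ((⨆ j ∈ Set.Iio i, Vs j : Submodule ℂ N.carrier) :
          Set N.carrier) := by
        refine (iSup₂_le fun j hj v hv => ?_ : (⨆ j ∈ Set.Iio (i + 1), Vs j) ≤
          (Subalgebra.toSubmodule (Algebra.adjoin ℂ ((⨆ j ∈ Set.Iio i, Vs j :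
            Submodule ℂ N.carrier) : Set N.carrier))).comap N.d) hx
        refine Algebra.adjoin_mono (fun y hy => ?_) (hN.d_mem_adjoin j v hv)
        obtain ⟨l, hl, hyl⟩ : ∃ l < j, y ∈ Vs l := by simpa using hy
        exact mem_iSup_of_mem l (mem_iSup_of_mem
          (show l < i from lt_of_lt_of_le hl (Nat.lt_succ_iff.1 hj)) hyl)
      have hd0 : N.d x = 0 := eq_zero_of_adjoin hM hI (iSup₂_le fun j _ => hN.Vs_le j) ih hdx
        (by rw [hId, hx0, map_zero])
      obtain ⟨z, hz, hzx⟩ := exists_primitive (map_mem_cylGr hN hF 1 (hle hx)) (hc x) hd0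
      obtain ⟨y, hy, hyx⟩ := hf.inj₁ x (hle hx) hd0 ⟨-z, neg_mem hz, by
        rw [map_neg, ← hzx, show (F x).1 = 0 from hx0]; simp⟩
      rw [← hyx, hN.d_gr_zero hy]
  have h1 : ∀ x ∈ N.gr 1, I x = 0 → x = 0 := by
    intro x hx
    obtain ⟨i, hi⟩ : ∃ i, x ∈ ⨆ j ∈ Set.Iio i, Vs j := by
      rw [← hN.iSup_eq] at hx
      induction hx using iSup_induction' with
      | mem i y hy => exact ⟨i + 1, mem_iSup_of_mem i (mem_iSup_of_mem
          (Nat.lt_succ_self i) hy)⟩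
      | zero => exact ⟨0, zero_mem _⟩
      | add y z _ _ hy hz =>
        obtain ⟨i, hi⟩ := hy
        obtain ⟨j, hj⟩ := hz
        have hmono : ∀ a b : ℕ, a ≤ b → (⨆ j ∈ Set.Iio a, Vs j) ≤ ⨆ j ∈ Set.Iio b, Vs j :=
          fun a b hab => biSup_mono fun j hj => lt_of_lt_of_le hj hab
        exact ⟨max i j, add_mem (hmono _ _ (le_max_left _ _) hi) (hmono _ _ (le_max_right _ _) hj)⟩
    exact hstage i x hi
  refine (injective_iff_map_eq_zero I).2 fun x hx => ?_
  exact eq_zero_of_adjoin hM hI le_rfl h1 (hN.adjoin_gr_one ▸ Algebra.mem_top) hx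

theorem mem_gr_iff_fst (n : ℕ) (x : N.carrier) : x ∈ N.gr n ↔ (F x).1 ∈ M.gr n := by
  let I : N.carrier →ₐ[ℂ] M.carrier := (AlgHom.fst ℂ _ _).comp F
  have hI : ∀ n, ∀ x ∈ N.gr n, I x ∈ M.gr n := fun n x hx => (map_mem_cylGr hN hF n hx).1
  refine ⟨hI n x, fun h => ?_⟩
  have h' := DGA.decompose_map hI x n
  rw [DirectSum.decompose_of_mem_same _ (show I x ∈ M.gr n from h)] at h'
  have := fst_injective hN hM hf hF hc h'
  rw [this]
  exact SetLike.coe_mem _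

include hg in
/-- By induction on the stages: the differential of a generator of `M` is in the image, injectivity
on `H²` gives a preimage up to a closed element, and surjectivity on `H¹` corrects it. -/
theorem fst_surjective : Function.Surjective fun x => (F x).1 := by
  let I : N.carrier →ₐ[ℂ] M.carrier := (AlgHom.fst ℂ _ _).comp F
  have hI : ∀ x ∈ N.gr 1, I x ∈ M.gr 1 := fun x hx => (hF x hx).1
  have hId : ∀ x, I (N.d x) = M.d (I x) := fun x => (hc x).diff.1
  have hinj : Function.Injective I := fst_injective hN hM hf hF hc
  have hstage : ∀ i, ∀ m ∈ Vs' i, ∃ x ∈ N.gr 1, I x = m := by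
    intro i
    induction i using Nat.strong_induction_on with
    | _ i ih =>
      intro m hm
      have hm1 := hM.Vs_le i hm
      obtain ⟨w, hw⟩ : ∃ w, I w = M.d m := by
        refine (Algebra.adjoin_le fun y hy => ?_ : Algebra.adjoin ℂ _ ≤ I.range)
          (hM.d_mem_adjoin i m hm)
        obtain ⟨l, hl, hyl⟩ : ∃ l < i, y ∈ Vs' l := by simpa using hy
        obtain ⟨x, -, hx⟩ := ih l hl y hyl
        exact ⟨x, hx⟩
      have hw2 : w ∈ N.gr 2 := (mem_gr_iff_fst hN hM hf hF hc 2 w).2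
        (show I w ∈ M.gr 2 from hw ▸ M.d_mem 1 m hm1)
      have hdw : N.d w = 0 := hinj (by rw [hId, hw, M.d_d, map_zero])
      obtain ⟨z, hz, hzw⟩ := exists_primitive (map_mem_cylGr hN hF 2 hw2) (hc w) hdw
      -- `x` solves the equation up to the closed element `I x - m`, whose class comes from `N`
      obtain ⟨x, hx, hxw⟩ := hf.inj₂ w hw2 hdw ⟨g m - z, sub_mem (hg.map_gr 1 m hm1) hz, by
        rw [map_sub, ← hzw, ← hg.map_d, ← hw]
        change g (F w).1 - _ = _
        abel⟩
      have hxm : I x - m ∈ M.gr 1 := sub_mem (hI x hx) hm1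
      have hdxm : M.d (I x - m) = 0 := by rw [map_sub, ← hId, hxw, hw, sub_self]
      obtain ⟨y, hy, hdy, z', hz', hzy⟩ := hf.surj₁ (g (I x - m)) (hg.map_gr 1 _ hxm)
        (by rw [← hg.map_d, hdxm, map_zero])
      obtain ⟨z'', hz'', hzy'⟩ := exists_primitive (map_mem_cylGr hN hF 1 hy) (hc y) hdy
      obtain ⟨u, hu, hux⟩ := hg.inj₁ (I x - m - I y) (sub_mem hxm (hI y hy))
        (by rw [map_sub, hdxm, ← hId, hdy, map_zero, sub_zero])
        ⟨z' - z'', sub_mem hz' hz'', by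
          rw [map_sub, hzy, ← hzy', map_sub g (I x - m) (I y)]
          change _ = _ - g (F y).1
          abel⟩
      refine ⟨x - y, sub_mem hx hy, ?_⟩
      rw [hM.d_gr_zero hu] at hux
      rw [map_sub]
      have h := sub_eq_zero.1 hux.symm
      rw [← h]; abel
  have htop : I.range = ⊤ := by
    rw [eq_top_iff, ← hM.adjoin_gr_one]
    refine Algebra.adjoin_le fun m hm => ?_
    have hle : M.gr 1 ≤ Subalgebra.toSubmodule I.range := by
      rw [← hM.iSup_eq]
      refine iSup_le fun i m hm => ?_
      obtain ⟨x, -, hx⟩ := hstage i m hm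
      exact ⟨x, hx⟩
    exact hle hm
  exact (AlgHom.range_eq_top I).1 htop

end

include hN hM hf hg in
/-- Two `1`-minimal models of `B` are canonically isomorphic once a complement `C` of the closed
elements of `B⁰` is chosen. -/
theorem exists_canonicalIso {C : Submodule ℂ B.carrier} (hC : IsSplitting B C) :
    ∃ (I : N.carrier ≃ₐ[ℂ] M.carrier) (H : Homotopy N B (RingHom.id ℂ) f fun x => g (I x)),
      (∀ n x, x ∈ N.gr n ↔ I x ∈ M.gr n) ∧ (∀ x, I (N.d x) = M.d (I x)) ∧
      ∀ i, ∀ v ∈ Vs i, ∃ b ∈ C, B.d b = f v - g (I v) - (polyIntegral (H.β (N.d v))).eval 1 ∧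
        H.α v = Polynomial.C (f v) - polyIntegral (H.β (N.d v)) -
          Polynomial.C (B.d b) * Polynomial.X ∧ H.β v = -Polynomial.C b := by
  obtain ⟨F, hFp⟩ := exists_lift hN hf.toIsMorphism hg hC
  have hF := (hFp 0).map_gr
  have hc := CylCompat.of_forall hN hf.toIsMorphism hFp
  have hgr : ∀ n x, x ∈ N.gr n → F x ∈ Cyl.gr M B n := fun n x hx => map_mem_cylGr hN hF n hx
  have hl := map_lower_eq_zero hN hF
  let I : N.carrier ≃ₐ[ℂ] M.carrier := AlgEquiv.ofBijective ((AlgHom.fst ℂ _ _).comp F)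
    ⟨fst_injective hN hM hf hF hc, fst_surjective hN hM hf hg hF hc⟩
  have hIF : ∀ x, I x = (F x).1 := fun _ => rfl
  let H : Homotopy N B (RingHom.id ℂ) f fun x => g (I x) :=
    { α := Matrix.entryLinearMap ℂ B.carrier[X] 0 0 ∘ₗ LinearMap.snd ℂ M.carrier _ ∘ₗ F.toLinearMap
      β := Matrix.entryLinearMap ℂ B.carrier[X] 0 1 ∘ₗ LinearMap.snd ℂ M.carrier _ ∘ₗ F.toLinearMap
      α_gr := fun n x hx i => (hgr n x hx).2.1 i
      β_gr := fun n x hx i => (hgr (n + 1) x hx).2.2.1 i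
      β_gr_zero := fun x hx => Polynomial.ext fun i => (hgr 0 x hx).2.2.1 i
      α_one := by
        change (F 1).2 0 0 = 1
        simp
      α_mul := fun x y => by
        change (F (x * y)).2 0 0 = (F x).2 0 0 * (F y).2 0 0
        simp [mul_apply, Fin.sum_univ_two, hl y]
      β_mul := fun n x y hy => by
        change (F (x * y)).2 0 1 =
          (F x).2 0 0 * (F y).2 0 1 + (-1) ^ n * ((F x).2 0 1 * (F y).2 0 0)
        simp only [map_mul, Prod.snd_mul, mul_apply, Fin.sum_univ_two,
          (hgr n y hy).2.2.2.2]
        rcases neg_one_pow_eq_or B.carrier[X] n with h | h <;> simp [h]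
      α_d := fun x i => by
        change ((F (N.d x)).2 0 0).coeff i = B.d (((F x).2 0 0).coeff i)
        rw [(hc x).diff.2.1, coeff_mapPoly]
      β_d := fun n x hx i => by
        change ((F (N.d x)).2 0 1).coeff i = B.d (((F x).2 0 1).coeff i) +
          (-1) ^ n * (Polynomial.derivative ((F x).2 0 0)).coeff i
        rw [(hc x).diff.2.2.1, Polynomial.coeff_add, coeff_mapPoly, (hgr n x hx).2.2.2.2]
        rcases neg_one_pow_eq_or B.carrier n with h | h
        · rw [h, show ((-1 : B.carrier[X]) ^ n) = Polynomial.C ((-1 : B.carrier) ^ n) by simp, h]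
          simp
        · rw [h, show ((-1 : B.carrier[X]) ^ n) = Polynomial.C ((-1 : B.carrier) ^ n) by simp, h]
          simp
      at_zero := fun x => by
        change ((F x).2 0 0).eval 0 = f x
        rw [← Polynomial.coeff_zero_eq_eval_zero, (hc x).zero]
      at_one := fun x => (hc x).one }
  refine ⟨I, H, fun n x => mem_gr_iff_fst hN hM hf hF hc n x, fun x => (hc x).diff.1,
    fun i v hv => ?_⟩
  obtain ⟨-, -, b, hb, h₁, h₂, h₃⟩ := mem_cylRel.1 ((hFp (i + 1)).rel i (by omega) v hv)
  exact ⟨b, hb, h₁, h₂, h₃⟩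

end CanonicalIsomorphism

/-! ### Complexification of differential graded algebras -/

section ComplexifiedDGA

/-- Two `ℂ`-linear maps on a complexification agree when they do so on the rational elements. -/
theorem linearMap_ext_one_tmul {V W : Type*} [AddCommGroup V] [Module K V] [AddCommGroup W]
    [Module ℂ W] {f g : ℂ ⊗[K] V →ₗ[ℂ] W} (h : ∀ v, f (1 ⊗ₜ v) = g (1 ⊗ₜ v)) : f = g := by
  refine LinearMap.ext fun x => ?_
  induction x using induction_on with
  | zero => simp
  | add x y hx hy => simp only [map_add, hx, hy]
  | tmul c v =>
    have : c ⊗ₜ[K] v = c • ((1 : ℂ) ⊗ₜ[K] v) := by rw [smul_tmul', smul_eq_mul, mul_one]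
    rw [this, map_smul, map_smul, h]

theorem baseChange_induction {V W : Type*} [AddCommGroup V] [Module K V] [AddCommGroup W]
    [Module ℂ W] {P : Submodule K V} {f g : ℂ ⊗[K] V →ₗ[ℂ] W}
    (h : ∀ v ∈ P, f (1 ⊗ₜ v) = g (1 ⊗ₜ v)) {x : ℂ ⊗[K] V} (hx : x ∈ P.baseChange ℂ) :
    f x = g x := by
  have : P.baseChange ℂ ≤ LinearMap.eqLocus f g := by
    rw [baseChange_eq_span, span_le]
    rintro _ ⟨v, hv, rfl⟩
    exact h v hv
  exact this hx

/-- The complexification of a differential graded algebra over `K`. -/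
abbrev DGA.complexify (A : DGA.{u} K) : DGA.{u} ℂ where
  carrier := ℂ ⊗[K] A.carrier
  gr n := (A.gr n).baseChange ℂ
  graded := GradedAlgebra.baseChange A.gr
  d := A.d.baseChange ℂ
  d_mem n x hx := VMHS.baseChange_mem (A.d_mem n) hx
  d_d x := by
    have : A.d.baseChange ℂ ∘ₗ A.d.baseChange ℂ = 0 :=
      linearMap_ext_one_tmul fun v => by simp [A.d_d]
    exact LinearMap.congr_fun this x
  comm p q x hx y hy := by
    refine baseChange_induction (P := A.gr q) (f := (LinearMap.mul ℂ (ℂ ⊗[K] A.carrier)).flip x)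
      (g := mulLeft ℂ ((-1 : ℂ ⊗[K] A.carrier) ^ (p * q)) ∘ₗ
        LinearMap.mul ℂ (ℂ ⊗[K] A.carrier) x) (fun w hw => ?_) hy
    refine baseChange_induction (P := A.gr p)
      (f := LinearMap.mul ℂ (ℂ ⊗[K] A.carrier) (1 ⊗ₜ w))
      (g := mulLeft ℂ ((-1 : ℂ ⊗[K] A.carrier) ^ (p * q)) ∘ₗ
        (LinearMap.mul ℂ (ℂ ⊗[K] A.carrier)).flip (1 ⊗ₜ w)) (fun v hv => ?_) hx
    have := A.comm p q v hv w hw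
    rcases neg_one_pow_eq_or ℤ (p * q) with h | h <;>
    · have h1 := congrArg (Int.cast : ℤ → A.carrier) h
      have h2 := congrArg (Int.cast : ℤ → ℂ ⊗[K] A.carrier) h
      push_cast at h1 h2
      simp [h2, this, h1, tmul_neg]
  leibniz p x hx y := by
    refine baseChange_induction (P := A.gr p)
      (f := A.d.baseChange ℂ ∘ₗ (LinearMap.mul ℂ (ℂ ⊗[K] A.carrier)).flip y)
      (g := (LinearMap.mul ℂ (ℂ ⊗[K] A.carrier)).flip y ∘ₗ A.d.baseChange ℂ +
        mulLeft ℂ ((-1 : ℂ ⊗[K] A.carrier) ^ p) ∘ₗ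
        (LinearMap.mul ℂ (ℂ ⊗[K] A.carrier)).flip (A.d.baseChange ℂ y)) (fun v hv => ?_) hx
    have key : A.d.baseChange ℂ ∘ₗ LinearMap.mul ℂ (ℂ ⊗[K] A.carrier) (1 ⊗ₜ v) =
        LinearMap.mul ℂ (ℂ ⊗[K] A.carrier) (1 ⊗ₜ A.d v) +
        mulLeft ℂ ((-1 : ℂ ⊗[K] A.carrier) ^ p) ∘ₗ
        LinearMap.mul ℂ (ℂ ⊗[K] A.carrier) (1 ⊗ₜ v) ∘ₗ A.d.baseChange ℂ := by
      refine linearMap_ext_one_tmul fun w => ?_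
      have := A.leibniz p v hv w
      rcases neg_one_pow_eq_or ℤ p with h | h <;>
      · have h1 := congrArg (Int.cast : ℤ → A.carrier) h
        have h2 := congrArg (Int.cast : ℤ → ℂ ⊗[K] A.carrier) h
        push_cast at h1 h2
        simp [h2, this, h1, tmul_neg, tmul_add]
    have := LinearMap.congr_fun key y
    simpa using this
  one_ne_zero h := by
    have h' : (1 : ℂ) ⊗ₜ[K] (1 : A.carrier) ∈ (⊥ : Submodule K A.carrier).baseChange ℂ := by
      rw [← Algebra.TensorProduct.one_def, h]; exact zero_mem _
    exact A.one_ne_zero (one_tmul_mem_baseChange.1 h')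
  connected x hx hdx := by
    have h : x ∈ (A.gr 0 ⊓ LinearMap.ker A.d).baseChange ℂ := by
      rw [baseChange_inf, baseChange_ker]; exact ⟨hx, hdx⟩
    have h' : (A.gr 0 ⊓ LinearMap.ker A.d).baseChange ℂ ≤
        LinearMap.range (Algebra.linearMap ℂ (ℂ ⊗[K] A.carrier)) := by
      rw [baseChange_eq_span, span_le]
      rintro _ ⟨v, hv, rfl⟩
      obtain ⟨c, rfl⟩ := A.connected v hv.1 hv.2
      refine ⟨algebraMap K ℂ c, ?_⟩
      change algebraMap K ℂ c ⊗ₜ[K] (1 : A.carrier) = 1 ⊗ₜ (algebraMap K A.carrier c)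
      rw [Algebra.algebraMap_eq_smul_one, Algebra.algebraMap_eq_smul_one, smul_tmul]
    obtain ⟨c, rfl⟩ := h' h
    exact ⟨c, rfl⟩

namespace DGA

theorem coboundaries_complexify (A : DGA.{u} K) (n : ℕ) :
    A.complexify.coboundaries n = (A.coboundaries n).baseChange ℂ := by
  cases n with
  | zero => exact (baseChange_bot (A := ℂ)).symm
  | succ n => exact (baseChange_map _ _).symm

variable {A B : DGA.{u} K} {f : A.carrier →ₐ[K] B.carrier}

/-- The complexification of a homomorphism of algebras. -/
abbrev cxHom (f : A.carrier →ₐ[K] B.carrier) :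
    A.complexify.carrier →ₐ[ℂ] B.complexify.carrier :=
  Algebra.TensorProduct.map (AlgHom.id ℂ ℂ) f

theorem cxHom_toLinearMap : (cxHom f).toLinearMap = f.toLinearMap.baseChange ℂ :=
  linearMap_ext_one_tmul fun v => by
    change (1 : ℂ) ⊗ₜ[K] f v = _
    simp

theorem InjOnH.complexify {n : ℕ} (h : InjOnH A B f n) :
    InjOnH A.complexify B.complexify (cxHom f) n := by
  intro x hx hdx hfx
  rw [coboundaries_complexify] at hfx ⊢
  refine baseChange_mono (P := (A.gr n ⊓ LinearMap.ker A.d) ⊓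
    (B.coboundaries n).comap f.toLinearMap) (fun v hv => h v hv.1.1 hv.1.2 hv.2) ?_
  rw [baseChange_inf, baseChange_inf, baseChange_ker, baseChange_comap, ← cxHom_toLinearMap]
  exact ⟨⟨hx, hdx⟩, hfx⟩

theorem SurjOnH.complexify {n : ℕ} (h : SurjOnH A B f n) :
    SurjOnH A.complexify B.complexify (cxHom f) n := by
  intro y hy hdy
  have hle : B.gr n ⊓ LinearMap.ker B.d ≤
      (A.gr n ⊓ LinearMap.ker A.d).map f.toLinearMap ⊔ B.coboundaries n := fun v hv => by
    obtain ⟨x, hx, hdx, hvx⟩ := h v hv.1 hv.2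
    exact mem_sup.2 ⟨f x, ⟨x, ⟨hx, hdx⟩, rfl⟩, _, hvx, by abel⟩
  have h' := baseChange_mono (L := ℂ) hle
  rw [baseChange_inf, baseChange_ker, baseChange_sup, baseChange_map, baseChange_inf,
    baseChange_ker, ← coboundaries_complexify, ← cxHom_toLinearMap] at h'
  obtain ⟨_, ⟨x, hx, rfl⟩, z, hz, rfl⟩ := mem_sup.1 (h' ⟨hy, hdy⟩)
  refine ⟨x, hx.1, hx.2, ?_⟩
  rw [AlgHom.toLinearMap_apply, add_sub_cancel_left]
  exact hz

theorem IsOneQuasiIso.complexify (h : IsOneQuasiIso A B f) :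
    IsOneQuasiIso A.complexify B.complexify (cxHom f) where
  map_gr n x hx := by
    have := VMHS.baseChange_mem (f := f.toLinearMap) (h.map_gr n) hx
    rwa [← cxHom_toLinearMap] at this
  map_d x := by
    have : (cxHom f).toLinearMap ∘ₗ A.d.baseChange ℂ =
        B.d.baseChange ℂ ∘ₗ (cxHom f).toLinearMap := by
      rw [cxHom_toLinearMap]
      exact linearMap_ext_one_tmul fun v => by simp [h.map_d]
    exact LinearMap.congr_fun this x
  inj₀ := h.inj₀.complexify
  surj₀ := h.surj₀.complexify
  inj₁ := h.inj₁.complexify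
  surj₁ := h.surj₁.complexify
  inj₂ := h.inj₂.complexify

theorem baseChange_iSup {V : Type*} {ι : Sort*} [AddCommGroup V] [Module K V]
    (P : ι → Submodule K V) :
    (⨆ i, P i).baseChange ℂ = ⨆ i, (P i).baseChange ℂ := by
  apply le_antisymm
  · rw [baseChange_eq_span, span_le]
    rintro _ ⟨v, hv, rfl⟩
    change (1 : ℂ) ⊗ₜ[K] v ∈ ⨆ i, (P i).baseChange ℂ
    induction hv using iSup_induction' with
    | mem i y hy => exact mem_iSup_of_mem i (tmul_mem_baseChange_of_mem 1 hy)
    | zero => simp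
    | add y z _ _ hy hz => rw [tmul_add]; exact add_mem hy hz
  · exact iSup_le fun i => baseChange_mono (le_iSup P i)

theorem iSupIndep_baseChange {V ι : Type*} [AddCommGroup V] [Module K V] {P : ι → Submodule K V}
    (h : iSupIndep P) : iSupIndep fun i => (P i).baseChange ℂ := by
  intro i
  have h' : (⨆ j, ⨆ _ : j ≠ i, (P j).baseChange ℂ) = (⨆ j, ⨆ _ : j ≠ i, P j).baseChange ℂ := by
    rw [baseChange_iSup]
    exact iSup_congr fun j => (baseChange_iSup _).symm
  rw [h', disjoint_iff, ← baseChange_inf, disjoint_iff.1 (h i), baseChange_bot]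

/-- The complexification of a `1`-minimal algebra is `1`-minimal. -/
theorem IsOneMinimal.complexify {Vs : ℕ → Submodule K A.carrier} (h : A.IsOneMinimal Vs) :
    A.complexify.IsOneMinimal fun i => (Vs i).baseChange ℂ where
  free := by
    let G : Submodule ℂ (ℂ ⊗[K] A.carrier) := (A.gr 1).baseChange ℂ
    let P : ExteriorAlgebra ℂ G →ₐ[ℂ] A.complexify.carrier :=
      ExteriorAlgebra.lift ℂ ⟨G.subtype, fun x => DGA.sq_eq_zero (M := A.complexify) x.2⟩
    have hP : ∀ x : G, P (ExteriorAlgebra.ι ℂ x) = x := fun x => ExteriorAlgebra.lift_ι_apply ..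
    let r : A.gr 1 →ₗ[K] G :=
      { toFun := fun x => ⟨1 ⊗ₜ x.1, tmul_mem_baseChange_of_mem 1 x.2⟩
        map_add' := fun x y => Subtype.ext (tmul_add _ _ _)
        map_smul' := fun c x => Subtype.ext (tmul_smul _ _ _) }
    obtain ⟨q, hq⟩ := h.exists_algHom_of_linear (T := ExteriorAlgebra ℂ G)
      ((ExteriorAlgebra.ι ℂ).restrictScalars K ∘ₗ r) (fun x => ExteriorAlgebra.ι_sq_zero (r x))
    let Q : ℂ ⊗[K] A.carrier →ₐ[ℂ] ExteriorAlgebra ℂ G :=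
      Algebra.TensorProduct.lift (Algebra.ofId ℂ _) q fun c x => (Algebra.commutes c (q x) :)
    have hQ : ∀ x : A.carrier, Q (1 ⊗ₜ x) = q x := fun x => by
      refine (Algebra.TensorProduct.lift_tmul _ _ _ _ _).trans ?_
      rw [map_one, one_mul]
    have hPq : ∀ x : A.carrier, P (q x) = (1 : ℂ) ⊗ₜ[K] x := by
      intro x
      refine h.induction (S := LinearMap.eqLocus
        ((P.toLinearMap.restrictScalars K) ∘ₗ q.toLinearMap)
        (TensorProduct.mk K ℂ A.carrier 1)) ?_ ?_ x
      · change P (q 1) = (1 : ℂ) ⊗ₜ[K] (1 : A.carrier)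
        rw [map_one, map_one]; rfl
      · intro x hx y hy
        change P (q (x * y)) = (1 : ℂ) ⊗ₜ[K] (x * y)
        have hy' : P (q y) = (1 : ℂ) ⊗ₜ[K] y := hy
        have hx' : P (q x) = (1 : ℂ) ⊗ₜ[K] x := by
          rw [hq ⟨x, hx⟩]; exact hP _
        rw [map_mul, map_mul, hx', hy']
        exact (Algebra.TensorProduct.tmul_mul_tmul _ _ _ _).trans (by rw [one_mul])
    have hPQ : P.comp Q = AlgHom.id ℂ _ := by
      refine AlgHom.toLinearMap_injective (linearMap_ext_one_tmul fun x => ?_)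
      change P (Q (1 ⊗ₜ x)) = (1 : ℂ) ⊗ₜ[K] x
      rw [hQ, hPq]
    have hQP : Q.comp P = AlgHom.id ℂ _ := by
      refine ExteriorAlgebra.hom_ext (LinearMap.ext fun x => ?_)
      change Q (P (ExteriorAlgebra.ι ℂ x)) = ExteriorAlgebra.ι ℂ x
      rw [hP]
      have key : ∀ y ∈ G, ∃ z : G, z.1 = y ∧ Q y = ExteriorAlgebra.ι ℂ z := by
        intro y hy
        rw [show G = (A.gr 1).baseChange ℂ from rfl, baseChange_eq_span] at hy
        induction hy using Submodule.span_induction with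
        | mem y hy =>
          obtain ⟨v, hv, rfl⟩ := hy
          exact ⟨r ⟨v, hv⟩, rfl, (hQ v).trans (hq ⟨v, hv⟩)⟩
        | zero => exact ⟨0, rfl, by rw [map_zero, map_zero]⟩
        | add y z _ _ h1 h2 =>
          obtain ⟨y', rfl, hy⟩ := h1
          obtain ⟨z', rfl, hz⟩ := h2
          exact ⟨y' + z', rfl, by rw [map_add, map_add, hy, hz]⟩
        | smul c y _ h1 =>
          obtain ⟨y', rfl, hy⟩ := h1
          exact ⟨c • y', rfl, by rw [map_smul, map_smul, hy]⟩
      obtain ⟨z, hz, hQz⟩ := key x.1 x.2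
      obtain rfl := Subtype.ext hz
      exact hQz
    exact ⟨AlgEquiv.ofAlgHom P Q hPQ hQP, hP⟩
  indep := iSupIndep_baseChange h.indep
  iSup_eq := by rw [← baseChange_iSup, h.iSup_eq]
  d_mem_adjoin i x hx := by
    have h' : (Vs i).baseChange ℂ ≤ (Subalgebra.toSubmodule (Algebra.adjoin ℂ
        (⋃ j ∈ Set.Iio i, ((Vs j).baseChange ℂ : Set A.complexify.carrier)))).comap
          (A.d.baseChange ℂ) := by
      rw [baseChange_eq_span, span_le]
      rintro _ ⟨v, hv, rfl⟩
      have h1 : Algebra.adjoin K (⋃ j ∈ Set.Iio i, (Vs j : Set A.carrier)) ≤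
          ((Algebra.adjoin ℂ (⋃ j ∈ Set.Iio i,
            ((Vs j).baseChange ℂ : Set A.complexify.carrier))).restrictScalars K).comap
            (Algebra.TensorProduct.includeRight : A.carrier →ₐ[K] ℂ ⊗[K] A.carrier) := by
        refine Algebra.adjoin_le fun y hy => Algebra.subset_adjoin ?_
        simp only [Set.mem_iUnion] at hy ⊢
        obtain ⟨j, hj, hy⟩ := hy
        exact ⟨j, hj, tmul_mem_baseChange_of_mem 1 hy⟩
      have := h1 (h.d_mem_adjoin i v hv)
      exact this
    exact h' hx

end DGA

/-! ### The comparison map of a mixed Hodge diagram -/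

namespace MixedHodgeDiagram

variable (D)

theorem _root_.NonabelianHodge.WeightFiltration.dW_mono {k : Type v} [Field k] {A : DGA.{u} k}
    (𝒲 : WeightFiltration A) {l m : ℤ} (h : l ≤ m) (n : ℕ) : 𝒲.dW l n ≤ 𝒲.dW m n := by
  cases n with
  | zero => exact le_rfl
  | succ n => exact map_mono (𝒲.mono n h)

theorem _root_.NonabelianHodge.WeightFiltration.dW_le {k : Type v} [Field k] {A : DGA.{u} k}
    (𝒲 : WeightFiltration A) (l : ℤ) (n : ℕ) : 𝒲.dW l n ≤ A.coboundaries n := by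
  cases n with
  | zero => exact le_rfl
  | succ n => exact map_mono (𝒲.le_gr l n)

theorem _root_.NonabelianHodge.WeightFiltration.d_dW {k : Type v} [Field k] {A : DGA.{u} k}
    (𝒲 : WeightFiltration A) {l : ℤ} {n : ℕ} {x : A.carrier} (h : x ∈ 𝒲.dW l n) : A.d x = 0 := by
  cases n with
  | zero => rw [show x = 0 from h, map_zero]
  | succ n => obtain ⟨y, -, rfl⟩ := h; exact A.d_d y

theorem mem_cycles_baseChange {l : ℤ} {n : ℕ} {x : ℂ ⊗[K] D.A.carrier} :
    x ∈ (D.WA.cycles l n).baseChange ℂ ↔ x ∈ (D.WA.W l n).baseChange ℂ ∧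
      D.A.d.baseChange ℂ x ∈ (D.WA.W (l - 1) (n + 1)).baseChange ℂ := by
  rw [WeightFiltration.cycles, baseChange_inf, baseChange_comap]; rfl

/-- The mapping cone of `ι` on `W_l / W_{l-1}` is acyclic. -/
theorem cone_acyclic_gr (n : ℕ) (l : ℤ) {x : ℂ ⊗[K] D.A.carrier} {y : D.B.carrier}
    (hx : x ∈ (D.WA.W l (n + 1)).baseChange ℂ) (hy : y ∈ D.WB.W l n)
    (hdx : D.A.d.baseChange ℂ x = 0) (hxy : D.ι x = D.B.d y) :
    ∃ u ∈ (D.WA.W l n).baseChange ℂ,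
      x - D.A.d.baseChange ℂ u ∈ (D.WA.W (l - 1) (n + 1)).baseChange ℂ ∧
      ∃ v ∈ D.WB.dW l n, y - D.ι u - v ∈ D.WB.W (l - 1) n := by
  have hx1 : x ∈ (D.WA.boundaries l (n + 1)).baseChange ℂ := by
    rw [← D.inj_E₁]
    refine ⟨D.mem_cycles_baseChange.2 ⟨hx, by rw [hdx]; exact zero_mem _⟩, ?_⟩
    change D.ι x ∈ D.WB.boundaries l (n + 1)
    rw [hxy]
    exact mem_sup_right ⟨y, hy, rfl⟩
  rw [WeightFiltration.boundaries, baseChange_sup] at hx1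
  obtain ⟨w, hw, z, hz, rfl⟩ := mem_sup.1 hx1
  rw [WeightFiltration.dW, baseChange_map] at hz
  obtain ⟨u₀, hu₀, rfl⟩ := hz
  have hc : y - D.ι u₀ ∈ D.WB.cycles l n := by
    refine ⟨sub_mem hy (D.ι_W l n hu₀), ?_⟩
    change D.B.d (y - D.ι u₀) ∈ D.WB.W (l - 1) (n + 1)
    rw [map_sub, ← hxy, ← D.ι_d, map_add, add_sub_cancel_right]
    exact D.ι_W _ _ hw
  rw [← D.surj_E₁] at hc
  obtain ⟨_, ⟨u₁, hu₁, rfl⟩, z, hz, hyz⟩ := mem_sup.1 hc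
  obtain ⟨w', hw', v, hv, rfl⟩ := mem_sup.1 hz
  obtain ⟨hu₁, hdu₁⟩ := D.mem_cycles_baseChange.1 hu₁
  refine ⟨u₀ + u₁, add_mem hu₀ hu₁, ?_, v, hv, ?_⟩
  · rw [map_add, show w + D.A.d.baseChange ℂ u₀ - (D.A.d.baseChange ℂ u₀ + D.A.d.baseChange ℂ u₁) =
      w - D.A.d.baseChange ℂ u₁ by abel]
    exact sub_mem hw hdu₁
  · have : y - D.ι (u₀ + u₁) - v = w' := by
      rw [map_add, ← sub_sub, ← hyz, AlgHom.toLinearMap_apply]; abel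
    rw [this]; exact hw'

/-- If `x` is a cocycle of `W_l A_ℂ` and `ι x` is the coboundary of `y` in `W_l B`, then `x` is the
coboundary of some `u` in `W_l A_ℂ` such that `y - ι u` is a coboundary in `W_l B`.  In other
words the mapping cone of `ι` on `W_l` is acyclic. -/
theorem cone_acyclic (n : ℕ) (m : ℕ) : ∀ x ∈ (D.WA.W ((m : ℤ) - 1) (n + 1)).baseChange ℂ,
    ∀ y ∈ D.WB.W ((m : ℤ) - 1) n, D.A.d.baseChange ℂ x = 0 → D.ι x = D.B.d y →
    ∃ u ∈ (D.WA.W ((m : ℤ) - 1) n).baseChange ℂ, D.A.d.baseChange ℂ u = x ∧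
      y - D.ι u ∈ D.WB.dW ((m : ℤ) - 1) n := by
  induction m with
  | zero =>
    intro x hx y hy _ _
    rw [show ((0 : ℕ) : ℤ) - 1 = -1 by simp] at *
    rw [D.WA_neg, baseChange_bot] at hx
    rw [D.WB_neg] at hy
    obtain rfl : x = 0 := hx
    obtain rfl : y = 0 := hy
    exact ⟨0, zero_mem _, map_zero _, by rw [map_zero, sub_zero]; exact zero_mem _⟩
  | succ m ih =>
    intro x hx y hy hdx hxy
    rw [show ((m + 1 : ℕ) : ℤ) - 1 = m by push_cast; ring] at *
    obtain ⟨u, hu, hxu, v, hv, hyv⟩ := D.cone_acyclic_gr n m hx hy hdx hxy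
    obtain ⟨u', hu', hxu', hyu'⟩ := ih _ hxu _ hyv (by
        have := D.A.complexify.d_d u
        rw [map_sub, hdx, this, sub_zero]) (by
        rw [map_sub, map_sub, map_sub, D.WB.d_dW hv, D.ι_d, hxy, sub_zero])
    refine ⟨u + u', add_mem hu (baseChange_mono (D.WA.mono n (by omega)) hu'), ?_, ?_⟩
    · rw [map_add, hxu', add_sub_cancel]
    · have := add_mem (D.WB.dW_mono (l := (m : ℤ) - 1) (m := m) (by omega) n hyu') hv
      rwa [show y - D.ι u - v - D.ι u' + v = y - D.ι (u + u') by rw [map_add]; abel] at this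

/-- In degree zero nothing is exact, so that injectivity on `E₁` lowers the weight until it is
negative. -/
theorem eq_zero_of_degree_zero (m : ℕ) : ∀ x ∈ (D.WA.W ((m : ℤ) - 1) 0).baseChange ℂ,
    D.A.d.baseChange ℂ x = 0 → D.ι x = 0 → x = 0 := by
  induction m with
  | zero =>
    intro x hx _ _
    rw [show ((0 : ℕ) : ℤ) - 1 = -1 by simp, D.WA_neg, baseChange_bot] at hx
    exact hx
  | succ m ih =>
    intro x hx hdx hxy
    rw [show ((m + 1 : ℕ) : ℤ) - 1 = m by push_cast; ring] at *
    refine ih x ?_ hdx hxy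
    have hx1 : x ∈ (D.WA.boundaries m 0).baseChange ℂ := by
      rw [← D.inj_E₁]
      refine ⟨D.mem_cycles_baseChange.2 ⟨hx, by rw [hdx]; exact zero_mem _⟩, ?_⟩
      change D.ι x ∈ D.WB.boundaries m 0
      rw [hxy]; exact zero_mem _
    rw [WeightFiltration.boundaries] at hx1
    exact baseChange_mono (sup_le le_rfl bot_le) hx1

theorem exists_mem_W (n : ℕ) {x : ℂ ⊗[K] D.A.carrier} (hx : x ∈ (D.A.gr n).baseChange ℂ) :
    ∃ m : ℕ, x ∈ (D.WA.W ((m : ℤ) - 1) n).baseChange ℂ := by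
  rw [baseChange_eq_span] at hx
  have hm : ∀ a b : ℕ, a ≤ b → (D.WA.W ((a : ℤ) - 1) n).baseChange ℂ ≤
      (D.WA.W ((b : ℤ) - 1) n).baseChange ℂ :=
    fun a b hab => baseChange_mono (D.WA.mono n (by omega))
  induction hx using Submodule.span_induction with
  | mem y hy =>
    obtain ⟨v, hv, rfl⟩ := hy
    obtain ⟨i, hi⟩ := D.WA.exhaustive n v hv
    exact ⟨(i + 1).toNat, tmul_mem_baseChange_of_mem 1 (D.WA.mono n (by omega) hi)⟩
  | zero => exact ⟨0, zero_mem _⟩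
  | add y z _ _ h1 h2 =>
    obtain ⟨a, ha⟩ := h1
    obtain ⟨b, hb⟩ := h2
    exact ⟨max a b, add_mem (hm _ _ (le_max_left _ _) ha) (hm _ _ (le_max_right _ _) hb)⟩
  | smul c y _ h1 => exact h1.imp fun m h => Submodule.smul_mem _ c h

theorem exists_mem_WB (n : ℕ) {x : D.B.carrier} (hx : x ∈ D.B.gr n) :
    ∃ m : ℕ, x ∈ D.WB.W ((m : ℤ) - 1) n := by
  obtain ⟨i, hi⟩ := D.WB.exhaustive n x hx
  exact ⟨(i + 1).toNat, D.WB.mono n (by omega) hi⟩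

theorem ι_injOnH (n : ℕ) : DGA.InjOnH D.A.complexify D.B D.ι n := by
  intro x hx hdx hfx
  obtain ⟨a, ha⟩ := D.exists_mem_W n hx
  cases n with
  | zero => exact D.eq_zero_of_degree_zero a x ha hdx hfx
  | succ n =>
    obtain ⟨y, hy, hyx⟩ := hfx
    obtain ⟨b, hb⟩ := D.exists_mem_WB n hy
    obtain ⟨z, hz, hzx, -⟩ := D.cone_acyclic n (max a b) x
      (baseChange_mono (D.WA.mono _ (by have := le_max_left a b; omega)) ha) y
      (D.WB.mono _ (by have := le_max_right a b; omega) hb) hdx hyx.symm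
    exact ⟨z, baseChange_mono (D.WA.le_gr _ n) hz, hzx⟩

theorem ι_surjOnH (n : ℕ) : DGA.SurjOnH D.A.complexify D.B D.ι n := by
  intro y hy hdy
  obtain ⟨b, hb⟩ := D.exists_mem_WB n hy
  obtain ⟨z, hz, hzx, h⟩ := D.cone_acyclic n b 0 (zero_mem _) y hb (map_zero _)
    (by rw [hdy, map_zero])
  exact ⟨z, baseChange_mono (D.WA.le_gr _ n) hz, hzx, D.WB.dW_le _ n h⟩

/-- The map `ι` of a mixed Hodge diagram is a quasi-isomorphism. -/
theorem ι_oneQuasiIso : DGA.IsOneQuasiIso D.A.complexify D.B D.ι where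
  map_gr n x hx := by
    obtain ⟨m, hm⟩ := D.exists_mem_W n hx
    exact D.WB.le_gr _ n (D.ι_W _ n hm)
  map_d := D.ι_d
  inj₀ := D.ι_injOnH 0
  surj₀ := D.ι_surjOnH 0
  inj₁ := D.ι_injOnH 1
  surj₁ := D.ι_surjOnH 1
  inj₂ := D.ι_injOnH 2

end MixedHodgeDiagram

theorem DGA.IsMorphism.map_coboundaries {k : Type v} [Field k] {A B : DGA.{u} k}
    {f : A.carrier →ₐ[k] B.carrier} (hf : DGA.IsMorphism A B f) (n : ℕ) {x : A.carrier}
    (hx : x ∈ A.coboundaries n) : f x ∈ B.coboundaries n := by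
  cases n with
  | zero => rw [show x = 0 from hx, map_zero]; exact zero_mem _
  | succ n =>
    obtain ⟨y, hy, rfl⟩ := hx
    exact ⟨f y, hf.map_gr n y hy, (hf.map_d y).symm⟩

theorem DGA.SurjOnH.comp {k : Type v} [Field k] {A B C : DGA.{u} k}
    {f : A.carrier →ₐ[k] B.carrier} {g : B.carrier →ₐ[k] C.carrier} {n : ℕ}
    (hg' : DGA.IsMorphism B C g) (hf : DGA.SurjOnH A B f n) (hg : DGA.SurjOnH B C g n) :
    DGA.SurjOnH A C (g.comp f) n := by
  intro y hy hdy
  obtain ⟨x, hx, hdx, hyx⟩ := hg y hy hdy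
  obtain ⟨z, hz, hdz, hxz⟩ := hf x hx hdx
  refine ⟨z, hz, hdz, ?_⟩
  have h := add_mem hyx (hg'.map_coboundaries n hxz)
  rwa [map_sub, sub_add_sub_cancel] at h

theorem DGA.IsOneQuasiIso.comp {k : Type v} [Field k] {A B C : DGA.{u} k}
    {f : A.carrier →ₐ[k] B.carrier} {g : B.carrier →ₐ[k] C.carrier}
    (hf : DGA.IsOneQuasiIso A B f) (hg : DGA.IsOneQuasiIso B C g) :
    DGA.IsOneQuasiIso A C (g.comp f) where
  map_gr n x hx := hg.map_gr n _ (hf.map_gr n x hx)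
  map_d x := by rw [AlgHom.comp_apply, hf.map_d, hg.map_d]; rfl
  inj₀ x hx hdx h := hf.inj₀ x hx hdx
    (hg.inj₀ (f x) (hf.map_gr 0 x hx) (by rw [← hf.map_d, hdx, map_zero]) h)
  inj₁ x hx hdx h := hf.inj₁ x hx hdx
    (hg.inj₁ (f x) (hf.map_gr 1 x hx) (by rw [← hf.map_d, hdx, map_zero]) h)
  inj₂ x hx hdx h := hf.inj₂ x hx hdx
    (hg.inj₂ (f x) (hf.map_gr 2 x hx) (by rw [← hf.map_d, hdx, map_zero]) h)
  surj₀ := hf.surj₀.comp hg.toIsMorphism hg.surj₀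
  surj₁ := hf.surj₁.comp hg.toIsMorphism hg.surj₁

/-- The canonical isomorphism and homotopy exist: `M_ℂ` is a `1`-minimal model of `B` as well. -/
theorem nonempty_canonicalIso {D : MixedHodgeDiagram K} (ℳ : FilteredModel D)
    (𝒩 : BigradedModel D) {C : Submodule ℂ D.B.carrier} (hC : IsSplitting D.B C) :
    Nonempty (CanonicalIso ℳ 𝒩 C) := by
  obtain ⟨Vs, hVs⟩ := ℳ.minimal
  obtain ⟨I, H, h₁, h₂, h₃⟩ := exists_canonicalIso 𝒩.canonical.toIsOneMinimal hVs.complexify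
    𝒩.quasiIso (ℳ.quasiIso.complexify.comp D.ι_oneQuasiIso) hC
  exact ⟨⟨I, h₁, h₂, H, h₃⟩⟩

end ComplexifiedDGA

/-! ### Parallel transport along a homotopy -/

section Forms

variable {k : Type v} [Field k] {A B : Type u} [Ring A] [Algebra k A] [Ring B] [Algebra k B]
  {V₁ V₂ V₃ : Type*} [AddCommGroup V₁] [Module k V₁] [AddCommGroup V₂] [Module k V₂]
  [AddCommGroup V₃] [Module k V₃] {M N : Type*} [AddCommGroup M] [Module k M] [AddCommGroup N]
  [Module k N]

/-- Induction on elements of `P ⊗ Q`. -/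
theorem tens_induction {P : Submodule k M} {Q : Submodule k N}
    {p : (t : M ⊗[k] N) → t ∈ tens k P Q → Prop}
    (mem : ∀ x (hx : x ∈ P) y (hy : y ∈ Q), p (x ⊗ₜ y) (tmul_mem_tens hx hy))
    (zero : p 0 (zero_mem _))
    (add : ∀ x y hx hy, p x hx → p y hy → p (x + y) (add_mem hx hy))
    {t : M ⊗[k] N} (ht : t ∈ tens k P Q) : p t ht := by
  refine iSup_induction' (fun s : P => Q.map (TensorProduct.mk k M N s))
    (motive := p) ?_ zero add ht
  rintro s _ ⟨y, hy, rfl⟩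
  exact mem s s.2 y hy

theorem neg_wedge (x : A ⊗[k] (V₂ →ₗ[k] V₃))
    (y : A ⊗[k] (V₁ →ₗ[k] V₂)) : wedge (-x) y = -wedge x y :=
  eq_neg_of_add_eq_zero_left (by rw [← add_wedge, neg_add_cancel, zero_wedge])

theorem mapForm_neg (f : A →ₗ[k] B)
    (x : A ⊗[k] (V₁ →ₗ[k] V₂)) : mapForm (-f) x = -mapForm f x := by
  rw [mapForm, LinearMap.rTensor_neg]; rfl

theorem mapForm_wedge_const (δ : A →ₗ[k] B) (x : A ⊗[k] (V₂ →ₗ[k] V₃)) (f : V₁ →ₗ[k] V₂) :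
    mapForm δ (wedge x (1 ⊗ₜ f)) = wedge (mapForm δ x) (1 ⊗ₜ f) := by
  induction x using induction_on with
  | zero => simp
  | add x y hx hy => simp only [map_add, add_wedge, hx, hy]
  | tmul a f => simp

theorem mapForm_const_wedge (δ : A →ₗ[k] B) (f : V₂ →ₗ[k] V₃) (x : A ⊗[k] (V₁ →ₗ[k] V₂)) :
    mapForm δ (wedge (1 ⊗ₜ f) x) = wedge (1 ⊗ₜ f) (mapForm δ x) := by
  induction x using induction_on with
  | zero => simp
  | add x y hx hy => simp only [map_add, wedge_add, hx, hy]
  | tmul a f => simp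

/-- A product rule for scalars gives one for forms with values in spaces of linear maps. -/
theorem mapForm_wedge_of_mul {P P' : Submodule k A} {δ f₁ f₂ g₁ g₂ : A →ₗ[k] B}
    (h : ∀ x ∈ P, ∀ y ∈ P', δ (x * y) = f₁ x * g₁ y + f₂ x * g₂ y)
    {x : A ⊗[k] (V₂ →ₗ[k] V₃)} {y : A ⊗[k] (V₁ →ₗ[k] V₂)}
    (hx : x ∈ tens k P ⊤) (hy : y ∈ tens k P' ⊤) :
    mapForm δ (wedge x y) = wedge (mapForm f₁ x) (mapForm g₁ y) +
      wedge (mapForm f₂ x) (mapForm g₂ y) := by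
  induction hx using tens_induction with
  | mem a ha f _ =>
    induction hy using tens_induction with
    | mem b hb g _ =>
      simp only [wedge_tmul, mapForm_tmul, h a ha b hb,
        add_tmul]
    | zero => simp
    | add y z _ _ h1 h2 => simp only [wedge_add, map_add, h1, h2]; abel
  | zero => simp
  | add y z _ _ h1 h2 => simp only [add_wedge, map_add, h1, h2]; abel

theorem tens_mono {P P' : Submodule k M} {Q Q' : Submodule k N} (h : P ≤ P') (h' : Q ≤ Q') :
    tens k P Q ≤ tens k P' Q' := Submodule.map₂_le_map₂ h h'

theorem tens_bot (P : Submodule k M) : tens k P (⊥ : Submodule k N) = ⊥ :=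
  Submodule.map₂_bot_right _ _

theorem mem_tens_top (x : M ⊗[k] N) : x ∈ tens k (⊤ : Submodule k M) (⊤ : Submodule k N) := by
  rw [tens, TensorProduct.map₂_mk_top_top_eq_top]; trivial

theorem filtHom_eq_bot {W₁ : ℤ → Submodule k V₁} {W₂ : ℤ → Submodule k V₂} {a b : ℤ}
    (h₁ : W₁ a = ⊤) (h₂ : W₂ b = ⊥) : filtHom W₁ W₂ (b - a) = ⊥ := by
  rw [eq_bot_iff]
  intro f hf
  refine LinearMap.ext fun x => ?_
  have := hf a (show x ∈ W₁ a from h₁ ▸ Submodule.mem_top)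
  rw [add_sub_cancel, h₂] at this
  exact this

theorem filtHom_eq_top {W₁ : ℤ → Submodule k V₁} {W₂ : ℤ → Submodule k V₂} {a b : ℤ}
    (h : Monotone W₁) (h' : Monotone W₂)
    (h₁ : W₁ a = ⊥) (h₂ : W₂ b = ⊤) : filtHom W₁ W₂ (b - a) = ⊤ := by
  rw [eq_top_iff]
  intro f _ i x hx
  by_cases hi : i ≤ a
  · have hx' : x = 0 := (Submodule.mem_bot k).1 (h₁ ▸ h hi hx)
    rw [hx']; exact zero_mem _
  · have : W₂ b ≤ W₂ (i + (b - a)) := h' (by omega)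
    exact this (h₂ ▸ Submodule.mem_top)

theorem filtHom_mono {W₁ : ℤ → Submodule k V₁} {W₂ : ℤ → Submodule k V₂} (h : Monotone W₂) :
    Monotone (filtHom W₁ W₂) := fun _ _ hmn _ hf i _ hx => h (by omega) (hf i hx)

end Forms

section Transport

variable {B : Type u} [Ring B] [Algebra ℂ B]

/-- `∫₀ᵗ` as a linear map. -/
def polyIntegralₗ : B[X] →ₗ[ℂ] B[X] where
  toFun := polyIntegral
  map_add' := polyIntegral_add
  map_smul' := polyIntegral_smul

/-- The derivative as a linear map over `ℂ`. -/
abbrev polyDeriv : B[X] →ₗ[ℂ] B[X] := Polynomial.derivative.restrictScalars ℂ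

/-- Evaluation as a linear map over `ℂ`. -/
abbrev polyEval (b : B) : B[X] →ₗ[ℂ] B := (Polynomial.leval b).restrictScalars ℂ

/-- The constant polynomials, as an algebra homomorphism over `ℂ`. -/
def polyC : B →ₐ[ℂ] B[X] := Polynomial.CAlgHom

/-- Evaluation at a central element as an algebra homomorphism; the coefficients need not
commute. -/
def evalCentral (b : B) (hb : ∀ x, Commute x b) : B[X] →ₐ[ℂ] B where
  toRingHom := Polynomial.eval₂RingHom' (RingHom.id B) b hb
  commutes' c := by
    change Polynomial.eval₂ (RingHom.id B) b (algebraMap ℂ B[X] c) = _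
    rw [Polynomial.algebraMap_apply]
    simp

theorem evalCentral_toLinearMap (b : B) (hb : ∀ x, Commute x b) :
    (evalCentral b hb).toLinearMap = polyEval b :=
  LinearMap.ext fun p => (Polynomial.eval₂_id (p := p) (x := b))

variable {V V₁ V₂ : Type*} [AddCommGroup V] [Module ℂ V] [AddCommGroup V₁] [Module ℂ V₁]
  [AddCommGroup V₂] [Module ℂ V₂]
  {W : ℤ → Submodule ℂ V} {W₁ : ℤ → Submodule ℂ V₁} {W₂ : ℤ → Submodule ℂ V₂}

/-- The fundamental theorem of calculus. -/
theorem mapForm_integral_derivative (u : B[X] ⊗[ℂ] (V₁ →ₗ[ℂ] V₂)) :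
    mapForm polyIntegralₗ (mapForm polyDeriv u) =
      u - mapForm polyC.toLinearMap (mapForm (polyEval 0) u) := by
  induction u using induction_on with
  | zero => simp
  | add x y hx hy => simp only [map_add, hx, hy]; abel
  | tmul p f =>
    simp only [mapForm_tmul, ← sub_tmul]
    congr 1
    change polyIntegral (Polynomial.derivative p) = p - Polynomial.C (p.eval 0)
    rw [polyIntegral_derivative, Polynomial.coeff_zero_eq_eval_zero]

theorem mapForm_derivative_integral (u : B[X] ⊗[ℂ] (V₁ →ₗ[ℂ] V₂)) :
    mapForm polyDeriv (mapForm polyIntegralₗ u) = u := by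
  rw [mapForm_comp, show polyDeriv ∘ₗ polyIntegralₗ = (LinearMap.id : B[X] →ₗ[ℂ] B[X]) from
    LinearMap.ext derivative_polyIntegral]
  simp [mapForm]

theorem mapForm_eval_zero_integral (u : B[X] ⊗[ℂ] (V₁ →ₗ[ℂ] V₂)) :
    mapForm (polyEval 0) (mapForm polyIntegralₗ u) = 0 := by
  rw [mapForm_comp, show polyEval 0 ∘ₗ polyIntegralₗ = (0 : B[X] →ₗ[ℂ] B) from
    LinearMap.ext fun p => by
      change (polyIntegral p).eval 0 = 0
      rw [← Polynomial.coeff_zero_eq_eval_zero, coeff_polyIntegral_zero]]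
  simp [mapForm]

/-- The equation `∂u/∂t = u β` with `β` nilpotent and `u(0) = 0` has no nonzero solution. -/
theorem eq_zero_of_derivative_eq (hm₁ : Monotone W₁) (hm₂ : Monotone W₂) (hb₁ : ∃ n, W₁ n = ⊥)
    (ht₁ : ∃ n, W₁ n = ⊤) (hb₂ : ∃ n, W₂ n = ⊥) (ht₂ : ∃ n, W₂ n = ⊤)
    {β : B[X] ⊗[ℂ] (V₁ →ₗ[ℂ] V₁)} (hβ : β ∈ tens ℂ ⊤ (filtHom W₁ W₁ (-1)))
    {u : B[X] ⊗[ℂ] (V₁ →ₗ[ℂ] V₂)} (hu : mapForm polyDeriv u = wedge u β)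
    (h0 : mapForm (polyEval 0) u = 0) : u = 0 := by
  obtain ⟨a, ha⟩ := hb₁
  obtain ⟨b, hb⟩ := ht₁
  obtain ⟨c, hc⟩ := hb₂
  obtain ⟨d, hd⟩ := ht₂
  have hI : u = mapForm polyIntegralₗ (wedge u β) := by
    rw [← hu, mapForm_integral_derivative, h0, map_zero, sub_zero]
  -- each application of the integral equation lowers the filtration by one
  have key : ∀ k : ℕ, u ∈ tens ℂ ⊤ (filtHom W₁ W₂ (d - a - k)) := by
    intro k
    induction k with
    | zero =>
      rw [Nat.cast_zero, sub_zero, filtHom_eq_top hm₁ hm₂ ha hd]; exact mem_tens_top u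
    | succ k ih =>
      rw [hI]
      refine mapForm_mem (P := ⊤) (fun _ _ => Submodule.mem_top) ?_
      exact wedge_mem (P := ⊤) (P' := ⊤) (P'' := ⊤) (fun _ _ _ _ => Submodule.mem_top)
        (fun f hf g hg => VMHS.filtHom_comp (by push_cast; ring) hf hg) ih hβ
  have h1 := key (d - a - (c - b)).toNat
  have h2 := tens_mono (le_refl ⊤) (filtHom_mono (W₁ := W₁) hm₂
    (show d - a - ((d - a - (c - b)).toNat : ℤ) ≤ c - b by omega)) h1
  rw [filtHom_eq_bot hb hc, tens_bot] at h2
  exact h2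

/-- The `k`-th term of the iterated integral expansion of the solution of `∂g/∂t = g β`. -/
def transportTerm (β : B[X] ⊗[ℂ] (V →ₗ[ℂ] V)) : ℕ → B[X] ⊗[ℂ] (V →ₗ[ℂ] V)
  | 0 => 1 ⊗ₜ LinearMap.id
  | k + 1 => mapForm polyIntegralₗ (wedge (transportTerm β k) β)

theorem transportTerm_mem {P : Submodule ℂ B} (hP : ∀ x ∈ P, ∀ y ∈ P, x * y ∈ P)
    {β : B[X] ⊗[ℂ] (V →ₗ[ℂ] V)} (hβ : β ∈ tens ℂ (polyIn P) (filtHom W W (-1))) (k : ℕ) :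
    transportTerm β (k + 1) ∈ tens ℂ (polyIn P) (filtHom W W (-(k + 1))) := by
  induction k with
  | zero =>
    refine mapForm_mem (fun _ => polyIntegral_mem) ?_
    rw [transportTerm, one_wedge, Nat.cast_zero, zero_add]
    exact hβ
  | succ k ih =>
    refine mapForm_mem (fun _ => polyIntegral_mem) ?_
    exact wedge_mem (fun _ hx _ hy => mul_mem_polyIn hP hx hy)
      (fun f hf g hg => VMHS.filtHom_comp (by push_cast; ring) hf hg) ih hβ

/-- The equation `∂g/∂t = g β`, `g(0) = 1` with `β` nilpotent has a polynomial solution; the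
coefficients of `g - 1` lie in every subspace closed under products which contains those of `β`. -/
theorem exists_transport (hm : Monotone W) (hb : ∃ n, W n = ⊥) (ht : ∃ n, W n = ⊤)
    {β : B[X] ⊗[ℂ] (V →ₗ[ℂ] V)} {P₀ : Submodule ℂ B}
    (hβ : β ∈ tens ℂ (polyIn P₀) (filtHom W W (-1))) :
    ∃ g : B[X] ⊗[ℂ] (V →ₗ[ℂ] V), mapForm polyDeriv g = wedge g β ∧
      mapForm (polyEval 0) g = 1 ⊗ₜ LinearMap.id ∧
      ∀ P : Submodule ℂ B, (∀ x ∈ P, ∀ y ∈ P, x * y ∈ P) →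
        β ∈ tens ℂ (polyIn P) (filtHom W W (-1)) →
        g - 1 ⊗ₜ LinearMap.id ∈ tens ℂ (polyIn P) (filtHom W W (-1)) := by
  obtain ⟨a, ha⟩ := hb
  obtain ⟨b, hb⟩ := ht
  have hbig : ∃ n : ℕ, transportTerm β (n + 1) = 0 := by
    refine ⟨(b - a).toNat, ?_⟩
    have h1 := transportTerm_mem (P := ⊤) (W := W) (fun _ _ _ _ => Submodule.mem_top)
      (tens_mono (show polyIn P₀ ≤ polyIn ⊤ from fun _ _ _ => Submodule.mem_top) le_rfl hβ)
      (b - a).toNat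
    have h2 := tens_mono (le_refl _) (filtHom_mono (W₁ := W) hm
      (show -(((b - a).toNat : ℤ) + 1) ≤ a - b by omega)) h1
    rw [filtHom_eq_bot hb ha, tens_bot] at h2
    exact h2
  obtain ⟨n, hn⟩ := hbig
  refine ⟨∑ k ∈ Finset.range (n + 1), transportTerm β k, ?_, ?_, fun P hP hβP => ?_⟩
  · have h1 : mapForm polyDeriv (transportTerm β 0) = 0 := by
      simp [transportTerm, mapForm_tmul]
    have h2 : ∀ k, mapForm polyDeriv (transportTerm β (k + 1)) = wedge (transportTerm β k) β :=
      fun k => mapForm_derivative_integral _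
    have h3 : wedge (transportTerm β n) β = 0 := by rw [← h2, hn, map_zero]
    have h4 : wedge (∑ k ∈ Finset.range (n + 1), transportTerm β k) β =
        ∑ k ∈ Finset.range (n + 1), wedge (transportTerm β k) β :=
      map_sum ((TensorProduct.map₂ (LinearMap.mul ℂ B[X]) (LinearMap.llcomp ℂ V V V)).flip β) _ _
    rw [h4, Finset.sum_range_succ', Finset.sum_range_succ, map_add, h1, h3, add_zero, add_zero,
      map_sum]
    exact sum_congr rfl fun k _ => h2 k
  · have h1 : ∀ k, mapForm (polyEval 0) (transportTerm β (k + 1)) = 0 :=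
      fun k => mapForm_eval_zero_integral _
    rw [Finset.sum_range_succ', map_add, map_sum, sum_eq_zero fun k _ => h1 k, zero_add,
      transportTerm, mapForm_tmul]
    simp
  · rw [Finset.sum_range_succ', transportTerm, add_sub_cancel_right]
    exact sum_mem fun k _ => tens_mono le_rfl (filtHom_mono hm (by omega))
      (transportTerm_mem hP hβP k)

/-- Parallel transport commutes with constant linear maps intertwining the connections. -/
theorem transport_natural (hm₁ : Monotone W₁) (hm₂ : Monotone W₂) (hb₁ : ∃ n, W₁ n = ⊥)
    (ht₁ : ∃ n, W₁ n = ⊤) (hb₂ : ∃ n, W₂ n = ⊥) (ht₂ : ∃ n, W₂ n = ⊤)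
    {β₁ g₁ : B[X] ⊗[ℂ] (V₁ →ₗ[ℂ] V₁)} {β₂ g₂ : B[X] ⊗[ℂ] (V₂ →ₗ[ℂ] V₂)} {F : V₁ →ₗ[ℂ] V₂}
    (hβ : β₁ ∈ tens ℂ ⊤ (filtHom W₁ W₁ (-1))) (hF : wedge β₂ (1 ⊗ₜ F) = wedge (1 ⊗ₜ F) β₁)
    (hg₁ : mapForm polyDeriv g₁ = wedge g₁ β₁) (hg₂ : mapForm polyDeriv g₂ = wedge g₂ β₂)
    (h₁ : mapForm (polyEval 0) g₁ = 1 ⊗ₜ LinearMap.id)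
    (h₂ : mapForm (polyEval 0) g₂ = 1 ⊗ₜ LinearMap.id) :
    wedge (mapForm (polyEval 1) g₂) (1 ⊗ₜ F) = wedge (1 ⊗ₜ F) (mapForm (polyEval 1) g₁) := by
  have hu : wedge g₂ (1 ⊗ₜ F) - wedge (1 ⊗ₜ F) g₁ = 0 := by
    refine eq_zero_of_derivative_eq hm₁ hm₂ hb₁ ht₁ hb₂ ht₂ hβ ?_ ?_
    · rw [map_sub, mapForm_wedge_const, mapForm_const_wedge, hg₁, hg₂, wedge_assoc, hF, sub_wedge,
        wedge_assoc, wedge_assoc]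
    · rw [map_sub, mapForm_wedge_const, mapForm_const_wedge, h₁, h₂, one_wedge, wedge_one, sub_self]
  have h := congrArg (mapForm (polyEval 1)) (sub_eq_zero.1 hu)
  rwa [mapForm_wedge_const, mapForm_const_wedge] at h

variable {N B : DGA.{u} ℂ} {f₀ f₁ : N.carrier → B.carrier} (H : Homotopy N B (RingHom.id ℂ) f₀ f₁)

/-- The parallel transport of a flat form along a homotopy is a flat gauge transformation between
the two ends: the defect `u = dg + α(0) g - g α` solves `∂u/∂t = u β`, `u(0) = 0`. -/
theorem transport_flat (hm : Monotone W) (hb : ∃ n, W n = ⊥) (ht : ∃ n, W n = ⊤)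
    {Ω : N.carrier ⊗[ℂ] (V →ₗ[ℂ] V)} (hΩ : Ω ∈ tens ℂ (N.gr 1) (filtHom W W (-1)))
    (mc : dForm N Ω + wedge Ω Ω = 0) {g : B.carrier[X] ⊗[ℂ] (V →ₗ[ℂ] V)}
    (hg : mapForm polyDeriv g = wedge g (mapForm H.β Ω))
    (hg0 : mapForm (polyEval 0) g = 1 ⊗ₜ LinearMap.id)
    (hgr : g ∈ tens ℂ (polyIn (B.gr 0)) ⊤) :
    covD B (mapForm (polyEval 1) (mapForm H.α Ω)) (mapForm (polyEval 0) (mapForm H.α Ω))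
      (mapForm (polyEval 1) g) = 0 := by
  let α := mapForm H.α Ω
  let β := mapForm H.β Ω
  let α₀ := mapForm polyC.toLinearMap (mapForm (polyEval 0) α)
  have hΩ' : Ω ∈ tens ℂ (N.gr 1) ⊤ := tens_mono le_rfl le_top hΩ
  have hβ : β ∈ tens ℂ (polyIn (B.gr 0)) (filtHom W W (-1)) := mapForm_mem (H.β_gr 0) hΩ
  have hβ' : β ∈ tens ℂ ⊤ (filtHom W W (-1)) := tens_mono le_top le_rfl hβ
  -- the Maurer–Cartan equation of `α + β dt`
  have mcβ : mapForm (mapPoly B.d) β - mapForm polyDeriv α + wedge α β - wedge β α = 0 := by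
    have h1 : mapForm H.β (dForm N Ω) = mapForm (mapPoly B.d) β - mapForm polyDeriv α := by
      have : ∀ x ∈ tens ℂ (N.gr 1) (⊤ : Submodule ℂ (V →ₗ[ℂ] V)), mapForm H.β (dForm N x) =
          mapForm (mapPoly B.d) (mapForm H.β x) - mapForm polyDeriv (mapForm H.α x) := by
        intro x hx
        induction hx using tens_induction with
        | mem a ha f _ =>
          simp only [dForm_tmul, mapForm_tmul, ← sub_tmul]
          congr 1
          ext i
          rw [H.β_d 1 a ha, Polynomial.coeff_sub, coeff_mapPoly]
          simp [sub_eq_add_neg]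
        | zero => simp
        | add x y _ _ h1 h2 => simp only [map_add, h1, h2]; abel
      exact this Ω hΩ'
    have h2 : mapForm H.β (wedge Ω Ω) = wedge α β - wedge β α := by
      rw [mapForm_wedge_of_mul (P := ⊤) (P' := N.gr 1) (f₁ := H.α) (g₁ := H.β) (f₂ := -H.β)
        (g₂ := H.α) (fun x _ y hy => by
          rw [H.β_mul 1 x y hy]; simp) (tens_mono le_top le_rfl hΩ') hΩ', sub_eq_add_neg]
      congr 1
      rw [mapForm_neg, neg_wedge]
    rw [add_sub_assoc, ← h1, ← h2, ← map_add, mc, map_zero]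
  let u := mapForm (mapPoly B.d) g + wedge α₀ g - wedge g α
  have hdg : mapForm polyDeriv (mapForm (mapPoly B.d) g) =
      wedge (mapForm (mapPoly B.d) g) β + wedge g (mapForm (mapPoly B.d) β) := by
    rw [mapForm_comp, show polyDeriv ∘ₗ mapPoly B.d = mapPoly B.d ∘ₗ polyDeriv from
      LinearMap.ext fun p => (mapPoly_derivative B.d p).symm, ← mapForm_comp, hg,
      mapForm_wedge_of_mul (P := polyIn (B.gr 0)) (P' := ⊤) (f₁ := mapPoly B.d)
        (g₁ := LinearMap.id) (f₂ := LinearMap.id) (g₂ := mapPoly B.d) (fun x hx y _ => by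
          rw [B.mapPoly_d_mul hx]; simp) hgr (mem_tens_top _)]
    simp [mapForm, β]
  have hleib : ∀ x y : B.carrier[X] ⊗[ℂ] (V →ₗ[ℂ] V), mapForm polyDeriv (wedge x y) =
      wedge (mapForm polyDeriv x) y + wedge x (mapForm polyDeriv y) := by
    intro x y
    rw [mapForm_wedge_of_mul (P := ⊤) (P' := ⊤) (f₁ := polyDeriv)
        (g₁ := LinearMap.id) (f₂ := LinearMap.id) (g₂ := polyDeriv) (fun x hx y _ => by
          simp [Polynomial.derivative_mul]) (mem_tens_top _) (mem_tens_top _)]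
    simp [mapForm]
  have hα₀ : mapForm polyDeriv α₀ = 0 := by
    rw [mapForm_comp, show polyDeriv ∘ₗ (polyC (B := B.carrier)).toLinearMap = 0 from
      LinearMap.ext fun b => Polynomial.derivative_C]
    simp [mapForm]
  have hu : mapForm polyDeriv u = wedge u β := by
    have e : mapForm polyDeriv α = mapForm (mapPoly B.d) β + wedge α β - wedge β α := by
      rw [← sub_eq_zero, ← neg_eq_zero, ← mcβ]; abel
    simp only [u, map_add, map_sub, hdg, hleib, hα₀, hg, e, zero_wedge, add_wedge, sub_wedge,
      wedge_add, wedge_sub, wedge_assoc]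
    simp only [show mapForm H.β Ω = β from rfl]
    abel
  have e1 : ∀ b, mapForm (polyEval b) α₀ = mapForm (polyEval 0) α := fun b => by
    rw [mapForm_comp, show polyEval b ∘ₗ (polyC (B := B.carrier)).toLinearMap = LinearMap.id from
      LinearMap.ext fun b => Polynomial.eval_C]
    simp [mapForm]
  have e2 : ∀ b, (∀ x, Commute x b) → ∀ x y : B.carrier[X] ⊗[ℂ] (V →ₗ[ℂ] V),
      mapForm (polyEval b) (wedge x y) =
        wedge (mapForm (polyEval b) x) (mapForm (polyEval b) y) := fun b hb x y => by
    rw [← evalCentral_toLinearMap b hb]; exact mapForm_wedge (evalCentral b hb) x y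
  have hu0 : mapForm (polyEval 0) u = 0 := by
    have e0 : mapForm (polyEval 0) (mapForm (mapPoly B.d) g) = 0 := by
      rw [mapForm_comp, show polyEval 0 ∘ₗ mapPoly B.d = B.d ∘ₗ polyEval 0 from
        LinearMap.ext fun p => by
          change (mapPoly B.d p).eval 0 = B.d (p.eval 0)
          rw [← Polynomial.coeff_zero_eq_eval_zero, ← Polynomial.coeff_zero_eq_eval_zero,
            coeff_mapPoly], ← mapForm_comp, hg0, mapForm_tmul, B.d_one]
      simp
    simp only [u, map_add, map_sub, e0, e2 0 Commute.zero_right, e1, hg0, wedge_one, one_wedge]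
    abel
  have hzero : u = 0 := eq_zero_of_derivative_eq hm hm hb ht hb ht hβ' hu hu0
  have h := congrArg (mapForm (polyEval 1)) hzero
  have e0 : mapForm (polyEval 1) (mapForm (mapPoly B.d) g) = dForm B (mapForm (polyEval 1) g) := by
    rw [mapForm_comp, dForm, mapForm_comp, show polyEval 1 ∘ₗ mapPoly B.d = B.d ∘ₗ polyEval 1 from
      LinearMap.ext fun p => eval_one_mapPoly B.d p]
  simp only [u, map_add, map_sub, e0, e2 1 Commute.one_right, e1, map_zero] at h
  exact h

end Transport

section CanonicalTransport

variable (J : CanonicalIso ℳ 𝒩 C)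

/-- The homotopy starts at `ψ(ℐ⁻¹Ω)`. -/
theorem eval_zero_form (R : PreRep ℳ.M) :
    mapForm (polyEval 0) (mapForm J.H.α (J.form R)) = formB J R := by
  rw [mapForm_comp, show polyEval 0 ∘ₗ J.H.α = 𝒩.ψ.toLinearMap from LinearMap.ext J.H.at_zero]
  rfl

theorem cxForm_mapForm (R : PreRep ℳ.M) :
    mapForm (Algebra.TensorProduct.map (AlgHom.id ℂ ℂ) ℳ.φ).toLinearMap (cxForm K R.Ω) =
      cxForm K (formA R) := by
  have : ∀ x : ℳ.M.carrier ⊗[K] (R.X.V →ₗ[K] R.X.V),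
      mapForm (Algebra.TensorProduct.map (AlgHom.id ℂ ℂ) ℳ.φ).toLinearMap (cxForm K x) =
        cxForm K (mapForm ℳ.φ.toLinearMap x) := fun x => by
    induction x using induction_on with
    | zero => simp
    | add x y hx hy => simp only [map_add, hx, hy]
    | tmul a f => simp
  exact this R.Ω

/-- The homotopy ends at `ιφ(Ω)`. -/
theorem eval_one_form (R : PreRep ℳ.M) :
    mapForm (polyEval 1) (mapForm J.H.α (J.form R)) = D.ιForm (formA R) := by
  have h : polyEval 1 ∘ₗ J.H.α = D.ι.toLinearMap ∘ₗ
      (Algebra.TensorProduct.map (AlgHom.id ℂ ℂ) ℳ.φ).toLinearMap ∘ₗ J.I.toLinearMap :=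
    LinearMap.ext J.H.at_one
  have h' : mapForm J.I.toLinearMap (J.form R) = cxForm K R.Ω := by
    rw [CanonicalIso.form, mapForm_comp]
    have : J.I.toLinearMap ∘ₗ J.I.symm.toLinearMap = LinearMap.id :=
      LinearMap.ext fun x => J.I.apply_symm_apply x
    rw [this]; simp [mapForm]
  rw [mapForm_comp, h, ← mapForm_comp, ← mapForm_comp, h', cxForm_mapForm]
  rfl

/-- The coefficients of `dt` lie in `C` by the recursive formula. -/
theorem β_mem_of_canonical : 𝒩.N.gr 1 ≤ (polyIn C).comap J.H.β := by
  rw [← 𝒩.canonical.iSup_eq]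
  refine iSup_le fun i v hv => ?_
  obtain ⟨b, hb, -, -, h⟩ := J.canonical i v hv
  change J.H.β v ∈ polyIn C
  rw [h]
  exact neg_mem (C_mem_polyIn hb)

/-- The representations in `W_{-1} End(V)` on mixed Hodge structures `V`, without any condition on
the Hodge filtrations. -/
structure IsUnipotentRep (R : PreRep ℳ.M) : Prop where
  isMHS : isMHS K R.X
  weight : R.Ω ∈ tens K (ℳ.M.gr 1) (filtHom R.X.W R.X.W (-1))
  maurerCartan : dForm ℳ.M R.Ω + wedge R.Ω R.Ω = 0

theorem isUnipotentRep (R : HodgeRep J) : IsUnipotentRep R.obj :=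
  ⟨R.property.isMHS, R.property.weight, R.property.maurerCartan⟩

theorem IsUnipotentRep.form_weight {R : PreRep ℳ.M} (hR : IsUnipotentRep R) :
    J.form R ∈ tens ℂ (𝒩.N.gr 1) (filtHom R.X.WC R.X.WC (-1)) :=
  mapForm_mem (P := (ℳ.M.gr 1).baseChange ℂ)
    (fun x hx => (J.I_gr 1 _).2 (by simpa using hx)) (cxForm_mem R.X hR.weight)

theorem dForm_form (R : PreRep ℳ.M) : dForm 𝒩.N (J.form R) =
    mapForm (J.I.symm : _ →ₐ[ℂ] 𝒩.N.carrier).toLinearMap (cxForm K (dForm ℳ.M R.Ω)) := by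
  have h : ∀ x : ℳ.M.carrier ⊗[K] (R.X.V →ₗ[K] R.X.V),
      dForm 𝒩.N (mapForm J.I.symm.toLinearMap (cxForm K x)) =
        mapForm J.I.symm.toLinearMap (cxForm K (dForm ℳ.M x)) := fun x => by
    induction x using induction_on with
    | zero => simp
    | add x y hx hy => simp only [map_add, hx, hy]
    | tmul a g =>
      have : 𝒩.N.d (J.I.symm (1 ⊗ₜ a)) = J.I.symm (1 ⊗ₜ ℳ.M.d a) := by
        rw [AlgEquiv.eq_symm_apply, J.I_d]; simp
      simp [this]
  exact h R.Ω

theorem IsUnipotentRep.form_maurerCartan {R : PreRep ℳ.M} (hR : IsUnipotentRep R) :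
    dForm 𝒩.N (J.form R) + wedge (J.form R) (J.form R) = 0 := by
  have h := congrArg (fun x => mapForm (J.I.symm : _ →ₐ[ℂ] 𝒩.N.carrier).toLinearMap (cxForm K x))
    hR.maurerCartan
  simp only [map_add, map_zero, cxForm_wedge, mapForm_wedge, ← dForm_form J R] at h
  exact h

theorem β_mem {R : PreRep ℳ.M} (hR : IsUnipotentRep R) {P : Submodule ℂ D.B.carrier}
    (hP : 𝒩.N.gr 1 ≤ (polyIn P).comap J.H.β) :
    mapForm J.H.β (J.form R) ∈ tens ℂ (polyIn P) (filtHom R.X.WC R.X.WC (-1)) :=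
  mapForm_mem (f := J.H.β) (P := 𝒩.N.gr 1) (P' := polyIn P) hP (hR.form_weight J)

theorem gr_one_le_comap_β : 𝒩.N.gr 1 ≤ (polyIn (D.B.gr 0)).comap J.H.β :=
  fun x hx => J.H.β_gr 0 x hx

theorem DGA.mul_mem_gr_zero {k : Type v} [Field k] (A : DGA.{u} k) :
    ∀ x ∈ A.gr 0, ∀ y ∈ A.gr 0, x * y ∈ A.gr 0 := fun x hx y hy => by
  have := SetLike.GradedMul.mul_mem (A := A.gr) hx hy
  rwa [add_zero] at this

theorem exists_transport_rep {R : PreRep ℳ.M} (hR : IsUnipotentRep R) :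
    ∃ g : D.B.carrier[X] ⊗[ℂ] (R.X.VC →ₗ[ℂ] R.X.VC),
      mapForm polyDeriv g = wedge g (mapForm J.H.β (J.form R)) ∧
      mapForm (polyEval 0) g = 1 ⊗ₜ LinearMap.id ∧
      ∀ P : Submodule ℂ D.B.carrier, (∀ x ∈ P, ∀ y ∈ P, x * y ∈ P) →
        𝒩.N.gr 1 ≤ (polyIn P).comap J.H.β →
        g - 1 ⊗ₜ LinearMap.id ∈ tens ℂ (polyIn P) (filtHom R.X.WC R.X.WC (-1)) := by
  obtain ⟨g, h₁, h₂, h₃⟩ := exists_transport (BifilteredSpace.WC_mono R.X)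
    (BifilteredSpace.exists_WC_eq_bot hR.isMHS)
    (BifilteredSpace.exists_WC_eq_top hR.isMHS) (β_mem J hR (gr_one_le_comap_β J))
  exact ⟨g, h₁, h₂, fun P hP hP' => h₃ P hP (β_mem J hR hP')⟩

theorem transport_sub_one_mem {R : PreRep ℳ.M}
    {g : D.B.carrier[X] ⊗[ℂ] (R.X.VC →ₗ[ℂ] R.X.VC)} {P : Submodule ℂ D.B.carrier}
    (hg : g - 1 ⊗ₜ LinearMap.id ∈ tens ℂ (polyIn P) (filtHom R.X.WC R.X.WC (-1))) :
    mapForm (polyEval 1) g - 1 ⊗ₜ LinearMap.id ∈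
      tens ℂ P (filtHom R.X.WC R.X.WC (-1)) := by
  have h := mapForm_mem (f := polyEval 1) (P := polyIn P) (P' := P) (fun x hx => eval_one_mem hx) hg
  have h1 : polyEval (1 : D.B.carrier) 1 = 1 := Polynomial.eval_one
  rwa [map_sub, mapForm_tmul, h1] at h

theorem transport_flat_rep {R : PreRep ℳ.M} (hR : IsUnipotentRep R)
    {g : D.B.carrier[X] ⊗[ℂ] (R.X.VC →ₗ[ℂ] R.X.VC)}
    (hg : mapForm polyDeriv g = wedge g (mapForm J.H.β (J.form R)))
    (hg0 : mapForm (polyEval 0) g = 1 ⊗ₜ LinearMap.id)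
    (hg1 : g - 1 ⊗ₜ LinearMap.id ∈
      tens ℂ (polyIn (D.B.gr 0)) (filtHom R.X.WC R.X.WC (-1))) :
    covD D.B (D.ιForm (formA R)) (formB J R) (mapForm (polyEval 1) g) = 0 := by
  have hgr0 : g ∈ tens ℂ (polyIn (D.B.gr 0)) ⊤ := by
    have h1 := tens_mono le_rfl le_top hg1
    have h2 : (1 : D.B.carrier[X]) ⊗ₜ[ℂ] (LinearMap.id : R.X.VC →ₗ[ℂ] R.X.VC) ∈
        tens ℂ (polyIn (D.B.gr 0)) ⊤ :=
      tmul_mem_tens (C_mem_polyIn D.B.one_mem) Submodule.mem_top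
    have h3 := add_mem h1 h2
    rwa [sub_add_cancel] at h3
  have h := transport_flat J.H (BifilteredSpace.WC_mono R.X)
    (BifilteredSpace.exists_WC_eq_bot hR.isMHS)
    (BifilteredSpace.exists_WC_eq_top hR.isMHS) (hR.form_weight J)
    (hR.form_maurerCartan J) hg hg0 hgr0
  rwa [eval_zero_form, eval_one_form] at h

/-- The parallel transport `a_Ω`, with its weights, its flatness and, if `C` is closed under
products, its values in `C`. -/
theorem exists_isParallelTransport {R : PreRep ℳ.M} (hR : IsUnipotentRep R) :
    ∃ a, IsParallelTransport J R a ∧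
      (a - 1 ⊗ₜ LinearMap.id ∈ tens ℂ (D.B.gr 0) (filtHom R.X.WC R.X.WC (-1))) ∧
      covD D.B (D.ιForm (formA R)) (formB J R) a = 0 ∧
      ((∀ x ∈ C, ∀ y ∈ C, x * y ∈ C) →
        a - 1 ⊗ₜ LinearMap.id ∈ tens ℂ C (filtHom R.X.WC R.X.WC (-1))) := by
  obtain ⟨g, hg, hg0, hgP⟩ := exists_transport_rep J hR
  have h0 := hgP _ D.B.mul_mem_gr_zero (gr_one_le_comap_β J)
  refine ⟨mapForm (polyEval 1) g, ?_, ?_, ?_, ?_⟩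
  · exact ⟨g, hg, hg0, rfl⟩
  · exact transport_sub_one_mem h0
  · exact transport_flat_rep J hR hg hg0 h0
  · exact fun hC => transport_sub_one_mem (hgP _ hC (β_mem_of_canonical J))

theorem isParallelTransport_natural {R S : PreRep ℳ.M} (hR : IsUnipotentRep R)
    (hS : IsUnipotentRep S) {F : R.X.VC →ₗ[ℂ] S.X.VC}
    (hF : wedge (J.form S) (1 ⊗ₜ F) = wedge (1 ⊗ₜ F) (J.form R))
    {a : D.B.carrier ⊗[ℂ] (R.X.VC →ₗ[ℂ] R.X.VC)} {b : D.B.carrier ⊗[ℂ] (S.X.VC →ₗ[ℂ] S.X.VC)}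
    (ha : IsParallelTransport J R a) (hb : IsParallelTransport J S b) :
    wedge b (1 ⊗ₜ F) = wedge (1 ⊗ₜ F) a := by
  obtain ⟨g, hg, hg0, rfl⟩ := ha
  obtain ⟨g', hg', hg0', rfl⟩ := hb
  have hF := congrArg (mapForm J.H.β) hF
  rw [mapForm_wedge_const, mapForm_const_wedge] at hF
  exact transport_natural (BifilteredSpace.WC_mono R.X) (BifilteredSpace.WC_mono S.X)
    (BifilteredSpace.exists_WC_eq_bot hR.isMHS) (BifilteredSpace.exists_WC_eq_top hR.isMHS)
    (BifilteredSpace.exists_WC_eq_bot hS.isMHS) (BifilteredSpace.exists_WC_eq_top hS.isMHS)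
    (tens_mono le_top le_rfl (β_mem J hR (gr_one_le_comap_β J))) hF hg hg' hg0 hg0'

/-- The parallel transports along the canonical homotopy. -/
theorem exists_transports : ∃ T : Transport J, (∀ x ∈ C, ∀ y ∈ C, x * y ∈ C) → ∀ R : HodgeRep J,
    T.a R - 1 ⊗ₜ LinearMap.id ∈ tens ℂ C (filtHom R.obj.X.WC R.obj.X.WC (-1)) := by
  choose a ha hw hf hC using fun R : HodgeRep J =>
    exists_isParallelTransport J (isUnipotentRep J R)
  exact ⟨⟨a, ha, hw, hf, fun {R S} f => isParallelTransport_natural J (isUnipotentRep J R)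
    (isUnipotentRep J S) (form_hom J f.hom) (ha _) (ha _)⟩,
    fun h R => hC R h⟩

end CanonicalTransport

/-! ### Strictness of the Hodge filtration of the bigraded model -/

section Strictness

/-- Homotopic maps agree on closed elements of degree one up to coboundaries. -/
theorem Homotopy.exists_primitive {N B : DGA.{u} ℂ} {σ : ℂ →+* ℂ} {f₀ f₁ : N.carrier → B.carrier}
    (H : Homotopy N B σ f₀ f₁) {x : N.carrier} (hx : x ∈ N.gr 1) (hd : N.d x = 0) :
    ∃ v ∈ B.gr 0, f₁ x - f₀ x = B.d v := by
  refine ⟨(polyIntegral (H.β x)).eval 1,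
    eval_one_mem (polyIntegral_mem (P := B.gr 0) (H.β_gr 0 x hx)), ?_⟩
  have h : Polynomial.derivative (H.α x) = mapPoly B.d (H.β x) := by
    ext i
    have := H.β_d 1 x hx i
    rw [hd, map_zero, Polynomial.coeff_zero] at this
    rw [coeff_mapPoly, ← sub_eq_zero, ← neg_eq_zero, this]
    simp [sub_eq_add_neg]
  rw [← eval_one_mapPoly, mapPoly_polyIntegral, ← h, polyIntegral_derivative, ← H.at_zero,
    ← H.at_one, Polynomial.coeff_zero_eq_eval_zero]
  simp

namespace BigradedModel

variable (𝒩)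

/-- The projections of `N` onto the parts of the bigrading. -/
theorem exists_projections : ∃ p : ℕ × ℕ → 𝒩.N.carrier →ₗ[ℂ] 𝒩.N.carrier,
    (∀ s x, p s x ∈ 𝒩.big s) ∧ (∀ s, ∀ x ∈ 𝒩.big s, p s x = x) ∧
    (∀ s t, s ≠ t → ∀ x ∈ 𝒩.big t, p s x = 0) ∧
    (∀ x, ∃ S : Finset (ℕ × ℕ), (∀ s ∉ S, p s x = 0) ∧ x = ∑ s ∈ S, p s x) ∧
    (∀ s n, ∀ x ∈ 𝒩.N.gr n, p s x ∈ 𝒩.N.gr n) ∧ ∀ s x, p s (𝒩.N.d x) = 𝒩.N.d (p s x) := by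
  classical
  let _ : DirectSum.Decomposition 𝒩.big := 𝒩.isInternal.chooseDecomposition
  let p : ℕ × ℕ → 𝒩.N.carrier →ₗ[ℂ] 𝒩.N.carrier := fun s =>
    (𝒩.big s).subtype ∘ₗ DirectSum.component ℂ _ _ s ∘ₗ
      (DirectSum.decomposeLinearEquiv 𝒩.big).toLinearMap
  have hp : ∀ s x, p s x = (DirectSum.decompose 𝒩.big x s : 𝒩.N.carrier) := fun s x => rfl
  have h₁ : ∀ s, ∀ x ∈ 𝒩.big s, p s x = x := fun s x hx => by
    rw [hp, DirectSum.decompose_of_mem_same _ hx]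
  have h₂ : ∀ s t, s ≠ t → ∀ x ∈ 𝒩.big t, p s x = 0 := fun s t h x hx => by
    rw [hp, DirectSum.decompose_of_mem_ne _ hx h.symm]
  have hmem : ∀ s x, p s x ∈ 𝒩.big s := fun s x => by rw [hp]; exact SetLike.coe_mem _
  have hsum : ∀ x, ∃ S : Finset (ℕ × ℕ), (∀ s ∉ S, p s x = 0) ∧ x = ∑ s ∈ S, p s x := fun x =>
    ⟨(DirectSum.decompose 𝒩.big x).support, fun s hs => by
      rw [hp, DFinsupp.notMem_support_iff.1 hs]; rfl,
      (DirectSum.sum_support_decompose 𝒩.big x).symm⟩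
  refine ⟨p, hmem, h₁, h₂, hsum, fun s n x hx => ?_, fun s x => ?_⟩
  · obtain ⟨S, hS, hxS⟩ := hsum x
    have h3 : p s (DirectSum.decompose 𝒩.N.gr x n : 𝒩.N.carrier) =
        (DirectSum.decompose 𝒩.N.gr (p s x) n : 𝒩.N.carrier) := by
      conv_lhs => rw [hxS]
      rw [DirectSum.decompose_sum, DFinsupp.finsetSum_apply, AddSubmonoidClass.coe_finsetSum,
        map_sum]
      by_cases hs : s ∈ S
      · rw [Finset.sum_eq_single_of_mem s hs fun t _ ht =>
          h₂ s t ht.symm _ (𝒩.big_homogeneous t _ (hmem t x) n)]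
        exact h₁ s _ (𝒩.big_homogeneous s _ (hmem s x) n)
      · rw [sum_eq_zero fun t ht => h₂ s t (fun h => hs (h ▸ ht)) _
          (𝒩.big_homogeneous t _ (hmem t x) n), hS s hs]
        simp
    rw [DirectSum.decompose_of_mem_same _ hx] at h3
    rw [h3]; exact SetLike.coe_mem _
  · obtain ⟨S, hS, hxS⟩ := hsum x
    conv_lhs => rw [hxS]
    rw [map_sum, map_sum]
    by_cases hs : s ∈ S
    · rw [Finset.sum_eq_single_of_mem s hs fun t _ ht =>
        h₂ s t ht.symm _ (𝒩.big_d t _ (hmem t x))]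
      exact h₁ s _ (𝒩.big_d s _ (hmem s x))
    · rw [sum_eq_zero fun t ht => h₂ s t (fun h => hs (h ▸ ht)) _
        (𝒩.big_d t _ (hmem t x)), hS s hs, map_zero]

/-- The Hodge filtration of `N` in all degrees: `F^r Nⁿ = ⨁_{P ≥ r} (Nⁿ)^{P,Q}`. -/
def FN (r : ℤ) (n : ℕ) : Submodule ℂ 𝒩.N.carrier :=
  ⨆ s : ℕ × ℕ, ⨆ _ : r ≤ s.1, 𝒩.big s ⊓ 𝒩.N.gr n

theorem mem_FN {r : ℤ} {n : ℕ} {s : ℕ × ℕ} (hs : r ≤ s.1) {x : 𝒩.N.carrier} (hx : x ∈ 𝒩.big s)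
    (hx' : x ∈ 𝒩.N.gr n) : x ∈ 𝒩.FN r n :=
  mem_iSup_of_mem s (mem_iSup_of_mem hs ⟨hx, hx'⟩)

theorem FN_le {r : ℤ} {n : ℕ} {P : Submodule ℂ 𝒩.N.carrier}
    (h : ∀ s : ℕ × ℕ, r ≤ s.1 → ∀ x ∈ 𝒩.big s, x ∈ 𝒩.N.gr n → x ∈ P) : 𝒩.FN r n ≤ P :=
  iSup_le fun s => iSup_le fun hs x hx => h s hs x hx.1 hx.2

theorem FN_anti (n : ℕ) : Antitone fun r => 𝒩.FN r n := fun _ _ h =>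
  𝒩.FN_le fun _ hs _ hx hx' => 𝒩.mem_FN (h.trans hs) hx hx'

theorem FN_mul (p q : ℤ) (m n : ℕ) : ∀ x ∈ 𝒩.FN p m, ∀ y ∈ 𝒩.FN q n,
    x * y ∈ 𝒩.FN (p + q) (m + n) := by
  intro x hx y hy
  have h1 : 𝒩.FN p m ≤ (𝒩.FN (p + q) (m + n)).comap (LinearMap.mulRight ℂ y) := by
    refine 𝒩.FN_le fun s hs x hx hx' => ?_
    have h2 : 𝒩.FN q n ≤ (𝒩.FN (p + q) (m + n)).comap (mulLeft ℂ x) :=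
      𝒩.FN_le fun t ht y hy hy' => 𝒩.mem_FN (s := s + t) (add_le_add hs ht)
        (𝒩.big_mul s t x hx y hy) (SetLike.GradedMul.mul_mem hx' hy')
    exact h2 hy
  exact h1 hx

end BigradedModel

namespace MixedHodgeDiagram

variable (hW : ∀ i, ∀ x ∈ D.B.gr 0, D.B.d x ∈ D.WB.W i 1 → ∃ y ∈ D.WB.W i 0, D.B.d y = D.B.d x)

include hW

/-- If an element of `F^s B¹` is cohomologous to an element of `W_l`, then it is so by a
coboundary from `F^s B⁰`. -/
theorem exists_hodge_correction {s l : ℤ} {u z : D.B.carrier} (hu : u ∈ D.FB.F s 1)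
    (hz : z ∈ D.B.gr 0) (huz : u - D.B.d z ∈ D.WB.W l 1) :
    ∃ z' ∈ D.FB.F s 0, u - D.B.d z' ∈ D.WB.W l 1 := by
  obtain ⟨i, hi⟩ := D.WB.exhaustive 1 u (D.FB.le_gr s 1 hu)
  have key : ∀ (k : ℕ) (u z : D.B.carrier), u ∈ D.FB.F s 1 → z ∈ D.B.gr 0 →
      u - D.B.d z ∈ D.WB.W l 1 → u ∈ D.WB.W (l + k) 1 →
      ∃ z' ∈ D.FB.F s 0, u - D.B.d z' ∈ D.WB.W l 1 := by
    intro k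
    induction k with
    | zero =>
      intro u z _ _ _ hk
      exact ⟨0, zero_mem _, by simpa using hk⟩
    | succ k ih =>
      intro u z hu hz huz hk
      have hdz : D.B.d z ∈ D.WB.W (l + (k + 1 : ℕ)) 1 := by
        have := sub_mem hk (D.WB.mono 1 (show l ≤ l + (k + 1 : ℕ) by omega) huz)
        rwa [sub_sub_cancel] at this
      obtain ⟨y, hy, hyz⟩ := hW _ z hz hdz
      have hlk : l ≤ l + ((k + 1 : ℕ) : ℤ) - 1 := by push_cast; omega
      have hb : u ∈ D.WB.boundaries (l + (k + 1 : ℕ)) 1 := by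
        rw [show u = (u - D.B.d z) + D.B.d z by abel]
        exact add_mem (mem_sup_left (D.WB.mono 1 hlk huz))
          (mem_sup_right (hyz ▸ ⟨y, hy, rfl⟩))
      obtain ⟨_, ⟨v, hv, rfl⟩, w, hw, hvw⟩ := mem_sup.1
        (D.strict_E₀ (l + (k + 1 : ℕ)) s 0 ⟨mem_sup_left ⟨hu, hk⟩, hb⟩)
      obtain ⟨z', hz', h⟩ := ih (u - D.B.d v) (z - v) (sub_mem hu (D.FB.d_mem s 0 v hv.1))
        (sub_mem hz (D.FB.le_gr s 0 hv.1))
        (by rw [map_sub, sub_sub_sub_cancel_right]; exact huz)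
        (by rw [← hvw, add_sub_cancel_left]
            rwa [show l + ((k + 1 : ℕ) : ℤ) - 1 = l + k by push_cast; ring] at hw)
      exact ⟨v + z', add_mem hv.1 hz', by rwa [map_add, ← sub_sub]⟩
  exact key (i - l).toNat u z hu hz huz (D.WB.mono 1 (by omega) hi)

/-- A closed element of `W_l A¹_ℂ` lies in the `p`-th step of the Hodge filtration of `E₁` if it is
cohomologous in `B` to an element of `F^p + W_{l-1}`. -/
theorem mem_hodge_E₁ {p l : ℤ} {c : ℂ ⊗[K] D.A.carrier} (hc : c ∈ (D.WA.W l 1).baseChange ℂ)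
    (hdc : D.A.d.baseChange ℂ c = 0) {u w z : D.B.carrier} (hu : u ∈ D.FB.F p 1)
    (hw : w ∈ D.WB.W (l - 1) 1) (hz : z ∈ D.B.gr 0) (h : D.ι c = u + w + D.B.d z) :
    c ∈ (D.WA.cycles l 1).baseChange ℂ ⊓
      ((D.FB.F p 1 ⊓ D.WB.cycles l 1) ⊔ D.WB.boundaries l 1).comap D.ι.toLinearMap := by
  have hιc := D.ι_W l 1 hc
  have hwl : w ∈ D.WB.W l 1 := D.WB.mono 1 (by omega) hw
  obtain ⟨z', hz', huz⟩ := exists_hodge_correction hW (z := -z) hu (neg_mem hz) (l := l) (by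
    rw [map_neg, sub_neg_eq_add, show u + D.B.d z = D.ι c - w by rw [h]; abel]
    exact sub_mem hιc hwl)
  obtain ⟨y, hy, hyz⟩ := hW l (z + z') (add_mem hz (D.FB.le_gr p 0 hz')) (by
    rw [map_add, show D.B.d z + D.B.d z' = D.ι c - w - (u - D.B.d z') by rw [h]; abel]
    exact sub_mem (sub_mem hιc hwl) huz)
  refine ⟨D.mem_cycles_baseChange.2 ⟨hc, by rw [hdc]; exact zero_mem _⟩, ?_⟩
  change D.ι c ∈ (D.FB.F p 1 ⊓ D.WB.cycles l 1) ⊔ D.WB.boundaries l 1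
  have hdu : D.B.d u = -D.B.d w := by
    have := congrArg D.B.d h
    rw [← D.ι_d, hdc, map_zero, map_add, map_add, D.B.d_d, add_zero] at this
    exact eq_neg_of_add_eq_zero_left this.symm
  refine mem_sup.2 ⟨u - D.B.d z', ⟨sub_mem hu (D.FB.d_mem p 0 z' hz'), huz, ?_⟩,
    w + D.B.d y, add_mem (mem_sup_left hw) (mem_sup_right ⟨y, hy, rfl⟩), ?_⟩
  · change D.B.d _ ∈ D.WB.W (l - 1) (1 + 1)
    rw [map_sub, D.B.d_d, sub_zero, hdu]
    exact neg_mem (D.WB.d_mem _ _ w hw)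
  · rw [hyz, h, map_add]; abel

end MixedHodgeDiagram

namespace BigradedModel

variable (𝒩)
  (hW : ∀ i, ∀ x ∈ D.B.gr 0, D.B.d x ∈ D.WB.W i 1 → ∃ y ∈ D.WB.W i 0, D.B.d y = D.B.d x)

/-- The Hodge filtration on the cycles of weight `l` and degree one. -/
abbrev _root_.NonabelianHodge.MixedHodgeDiagram.G₁ (D : MixedHodgeDiagram K)
    (l p : ℤ) : Submodule ℂ (ℂ ⊗[K] D.A.carrier) :=
  (D.WA.cycles l 1).baseChange ℂ ⊓
    ((D.FB.F p 1 ⊓ D.WB.cycles l 1) ⊔ D.WB.boundaries l 1).comap D.ι.toLinearMap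

theorem hodge_G₁ (D : MixedHodgeDiagram K) (l : ℤ) :
    IsHodgeStructure K ((D.WA.cycles l 1).baseChange ℂ) ((D.WA.boundaries l 1).baseChange ℂ)
      (D.G₁ l) (1 + l) := D.hodge_E₁ l 1

include hW

/-- The image under `ψ''` of a closed element of type `(P, Q)`, moved into weight `l` by an exact
form, lies in `F^P`, as the homotopy `H` identifies its class with that of the image under `ψ`. -/
theorem mem_G₁ {P Q : ℕ} {x : 𝒩.N.carrier} (hx : x ∈ 𝒩.big (P, Q)) (hx' : x ∈ 𝒩.N.gr 1)
    (hd : 𝒩.N.d x = 0) {z : ℂ ⊗[K] D.A.carrier} (hz : z ∈ (D.A.gr 0).baseChange ℂ) {l : ℤ}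
    (hl : 𝒩.ψ'' x - D.A.d.baseChange ℂ z ∈ (D.WA.W l 1).baseChange ℂ) :
    𝒩.ψ'' x - D.A.d.baseChange ℂ z ∈ D.G₁ l P := by
  obtain ⟨v, hv, hvx⟩ := 𝒩.H.exists_primitive hx' hd
  have hιz := D.ι_oneQuasiIso.map_gr 0 z hz
  refine D.mem_hodge_E₁ hW hl (by
      rw [map_sub, ← 𝒩.ψ''_d, hd, map_zero, zero_sub, neg_eq_zero]; exact D.A.complexify.d_d z)
    (𝒩.ψ_big P Q 1 x ⟨hx, hx'⟩).2 (zero_mem _) (neg_mem (add_mem hv hιz)) ?_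
  rw [map_sub, D.ι_d, map_neg, map_add, ← hvx]; abel

/-- The conjugate of the image under `ψ''` of a closed element of type `(P, Q)` lies in `F^q`, by
the homotopy `H'`; the terms of `ψ'` of lower Hodge level have weight below `l`. -/
theorem conj_mem_G₁ {P Q : ℕ} {x : 𝒩.N.carrier} (hx : x ∈ 𝒩.big (P, Q)) (hx' : x ∈ 𝒩.N.gr 1)
    (hd : 𝒩.N.d x = 0) {z : ℂ ⊗[K] D.A.carrier} (hz : z ∈ (D.A.gr 0).baseChange ℂ) {l q : ℤ}
    (hl : 𝒩.ψ'' x - D.A.d.baseChange ℂ z ∈ (D.WA.W l 1).baseChange ℂ) (hq : q ≤ Q)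
    (hq' : ∀ i : ℕ, 2 ≤ i → l - 1 < (P + Q - i : ℤ) - 1 → q ≤ Q - i + 1) :
    conjC K _ (𝒩.ψ'' x - D.A.d.baseChange ℂ z) ∈ D.G₁ l q := by
  obtain ⟨v, hv, hvx⟩ := 𝒩.H'.exists_primitive hx' hd
  have hιz := D.ι_oneQuasiIso.map_gr 0 _ (conjC_mem_baseChange hz)
  have hmem : 𝒩.ψ' x ∈ D.FB.F q 1 ⊔ D.WB.W (l - 1) 1 := by
    have h := 𝒩.ψ'_big P Q 1 x ⟨hx, hx'⟩
    revert h
    generalize 𝒩.ψ' x = y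
    revert y
    refine sup_le (c := D.FB.F q 1 ⊔ D.WB.W (l - 1) 1) ?_ (iSup_le fun i => iSup_le fun hi => ?_)
    · exact inf_le_right.trans ((D.FB.anti 1 hq).trans le_sup_left)
    · by_cases h : l - 1 < (P + Q - i : ℤ) - 1
      · exact inf_le_right.trans ((D.FB.anti 1 (hq' i hi h)).trans le_sup_left)
      · exact inf_le_left.trans ((D.WB.mono 1 (by push_cast; omega)).trans le_sup_right)
  obtain ⟨u, hu, w, hw, huw⟩ := mem_sup.1 hmem
  have e : conjC K _ (𝒩.ψ'' x - D.A.d.baseChange ℂ z) =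
      conjC K _ (𝒩.ψ'' x) - D.A.d.baseChange ℂ (conjC K _ z) := by
    rw [map_sub, conjC_baseChange]
  refine D.mem_hodge_E₁ hW (conjC_mem_baseChange hl) ?_ hu hw (neg_mem (add_mem hv hιz)) ?_
  · rw [← conjC_baseChange, map_sub, ← 𝒩.ψ''_d, hd, map_zero, zero_sub,
      show D.A.d.baseChange ℂ (D.A.d.baseChange ℂ z) = 0 from D.A.complexify.d_d z,
      neg_zero, map_zero]
  · rw [e, map_sub, D.ι_d, map_neg, map_add, ← hvx, huw]; abel

/-- A closed element of type `(P, Q)` whose class has weight less than `P + Q` vanishes. -/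
theorem eq_zero_of_weight_lt {P Q : ℕ} {x : 𝒩.N.carrier} (hx : x ∈ 𝒩.big (P, Q))
    (hx' : x ∈ 𝒩.N.gr 1) (hd : 𝒩.N.d x = 0) (m : ℕ) :
    (m : ℤ) ≤ P + Q → ∀ z ∈ (D.A.gr 0).baseChange ℂ,
      𝒩.ψ'' x - D.A.d.baseChange ℂ z ∈ (D.WA.W ((m : ℤ) - 2) 1).baseChange ℂ → x = 0 := by
  induction m with
  | zero =>
    intro _ z hz h
    have h0 : (D.WA.W (((0 : ℕ) : ℤ) - 2) 1) ≤ ⊥ := by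
      rw [← D.WA_neg 1]; exact D.WA.mono 1 (by simp)
    have h1 := baseChange_mono (L := ℂ) h0 h
    rw [baseChange_bot] at h1
    have h2 : 𝒩.ψ'' x = D.A.d.baseChange ℂ z := sub_eq_zero.1 h1
    obtain ⟨v, hv, hvx⟩ := 𝒩.H.exists_primitive hx' hd
    obtain ⟨y, hy, hyx⟩ := 𝒩.quasiIso.inj₁ x hx' hd ⟨v + D.ι z,
      add_mem hv (D.ι_oneQuasiIso.map_gr 0 z hz), by
        rw [map_add, ← hvx, ← D.ι_d, h2]; abel⟩
    rw [← hyx, 𝒩.canonical.toIsOneMinimal.d_gr_zero hy]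
  | succ m ih =>
    intro hm z hz h
    have h1 := 𝒩.mem_G₁ hW hx hx' hd hz h
    have h2 := 𝒩.conj_mem_G₁ hW hx hx' hd hz (q := m + 1 - P) h (by push_cast at hm; omega)
      (fun i _ hi => by push_cast at hi; omega)
    have h3 := (hodge_G₁ D _).mem_bot (by push_cast; omega) h1 h2
    rw [WeightFiltration.boundaries, baseChange_sup] at h3
    obtain ⟨w, hw, y, hy, hwy⟩ := mem_sup.1 h3
    rw [WeightFiltration.dW, baseChange_map] at hy
    obtain ⟨z', hz', rfl⟩ := hy
    refine ih (by push_cast at hm; omega) (z + z')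
      (add_mem hz (baseChange_mono (D.WA.le_gr _ 0) hz')) ?_
    rw [map_add, ← sub_sub, ← hwy, add_sub_cancel_right]
    rwa [show ((m + 1 : ℕ) : ℤ) - 2 - 1 = m - 2 by push_cast; ring] at hw

/-- Strictness of `ψ` on `H¹`: a closed element of `N¹` without components of type `(P, Q)` with
`P ≥ r`, whose class in `H¹(B)` lies in the `r`-th step of the Hodge filtration, vanishes.  By
descending induction on the weight, since in the top weight the components have types `(P, Q)` with
`P < r` in a Hodge structure, while their sum lies in `F^r`. -/
theorem eq_zero_of_mem_hodge {p : ℕ × ℕ → 𝒩.N.carrier →ₗ[ℂ] 𝒩.N.carrier}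
    (hp : ∀ s x, p s x ∈ 𝒩.big s) (hp₁ : ∀ s, ∀ x ∈ 𝒩.big s, p s x = x)
    (hp₂ : ∀ s t, s ≠ t → ∀ x ∈ 𝒩.big t, p s x = 0)
    (hsum : ∀ x, ∃ S : Finset (ℕ × ℕ), (∀ s ∉ S, p s x = 0) ∧ x = ∑ s ∈ S, p s x)
    (hgr : ∀ s n, ∀ x ∈ 𝒩.N.gr n, p s x ∈ 𝒩.N.gr n) (hpd : ∀ s x, p s (𝒩.N.d x) = 𝒩.N.d (p s x))
    {r : ℤ} (n : ℕ) : ∀ x ∈ 𝒩.N.gr 1, 𝒩.N.d x = 0 → (∀ s, r ≤ s.1 → p s x = 0) →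
    (∀ s, n ≤ s.1 + s.2 → p s x = 0) → (∃ z ∈ D.B.gr 0, 𝒩.ψ x + D.B.d z ∈ D.FB.F r 1) → x = 0 := by
  have hd : ∀ s x, 𝒩.N.d x = 0 → 𝒩.N.d (p s x) = 0 := fun s x hx => by rw [← hpd, hx, map_zero]
  induction n with
  | zero =>
    intro x _ _ _ h _
    obtain ⟨S, -, hS⟩ := hsum x
    rw [hS]
    exact sum_eq_zero fun s _ => h s (Nat.zero_le _)
  | succ n ih =>
    intro x hx hdx hr hn hz
    refine ih x hx hdx hr (fun s hs => ?_) hz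
    by_cases hsn : n + 1 ≤ s.1 + s.2
    · exact hn s hsn
    have hs' : s.1 + s.2 = n := by omega
    let y : ℤ → 𝒩.N.carrier := fun j => p (j.toNat, n - j.toNat) x
    let l : ℤ := n - 1
    have hψ : ∀ t x, x ∈ 𝒩.N.gr 1 → 𝒩.ψ'' (p t x) ∈ (D.WA.W ((t.1 : ℤ) + t.2 - 1) 1).baseChange ℂ :=
      fun t x hx => by simpa using 𝒩.ψ''_big t.1 t.2 1 (p t x) ⟨hp t x, hgr t 1 x hx⟩
    have hyW : ∀ j ∈ Finset.Icc (0 : ℤ) n,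
        𝒩.ψ'' (y j) - D.A.d.baseChange ℂ 0 ∈ (D.WA.W l 1).baseChange ℂ := fun j hj => by
      rw [mem_Icc] at hj
      rw [map_zero, sub_zero]
      exact baseChange_mono (D.WA.mono 1 (by
        change (j.toNat : ℤ) + ((n - j.toNat : ℕ) : ℤ) - 1 ≤ n - 1; omega))
        (hψ (j.toNat, n - j.toNat) x hx)
    have hG : ∀ j ∈ Finset.Icc (0 : ℤ) n, 𝒩.ψ'' (y j) ∈ D.G₁ l j := fun j hj => by
      have := 𝒩.mem_G₁ hW (hp _ x) (hgr _ 1 x hx) (hd _ x hdx) (zero_mem _) (hyW j hj)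
      rw [map_zero, sub_zero] at this
      rwa [Int.toNat_of_nonneg (mem_Icc.1 hj).1] at this
    have hG' : ∀ j ∈ Finset.Icc (0 : ℤ) n,
        conjC K _ (𝒩.ψ'' (y j)) ∈ D.G₁ l (n - j) := fun j hj => by
      have h0 := mem_Icc.1 hj
      have := 𝒩.conj_mem_G₁ hW (hp _ x) (hgr _ 1 x hx) (hd _ x hdx) (zero_mem _) (q := n - j)
        (hyW j hj) (by omega) (fun i hi h => by simp only [l] at h; omega)
      rwa [map_zero, sub_zero] at this
    -- the sum of the components of weight `n`
    let xn := ∑ j ∈ Finset.Icc (0 : ℤ) n, y j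
    have hxn : xn ∈ 𝒩.N.gr 1 := sum_mem fun j _ => hgr _ 1 x hx
    have hpxn : ∀ t : ℕ × ℕ, n ≤ t.1 + t.2 → p t (x - xn) = 0 := fun t ht => by
      rw [map_sub, map_sum]
      by_cases htn : t.1 + t.2 = n
      · rw [Finset.sum_eq_single (t.1 : ℤ)]
        · have : y t.1 = p t x := by
            change p ((t.1 : ℤ).toNat, n - (t.1 : ℤ).toNat) x = p t x
            congr 2
            ext
            · simp
            · simp; omega
          rw [this, hp₁ t _ (hp t x), sub_self]
        · intro j hj hjt
          refine hp₂ _ _ (fun h => hjt ?_) _ (hp _ x)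
          have := congrArg Prod.fst h
          have h0 := (mem_Icc.1 hj).1
          simp only at this
          omega
        · intro h
          exact absurd (mem_Icc.2 ⟨by omega, by omega⟩) h
      · rw [hn t (by omega), sum_eq_zero, sub_zero]
        intro j hj
        refine hp₂ _ _ (fun h => htn ?_) _ (hp _ x)
        have h0 := mem_Icc.1 hj
        rw [h]; simp only; omega
    have hlow : 𝒩.ψ'' (x - xn) ∈ (D.WA.W (l - 1) 1).baseChange ℂ := by
      obtain ⟨S, -, hS⟩ := hsum (x - xn)
      rw [hS, map_sum]
      refine sum_mem fun t _ => ?_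
      by_cases ht : n ≤ t.1 + t.2
      · rw [hpxn t ht, map_zero]; exact zero_mem _
      · exact baseChange_mono (D.WA.mono 1 (by simp only [l]; omega))
          (hψ t _ (sub_mem hx hxn))
    have hbot : ∑ j ∈ Finset.Icc (0 : ℤ) n, 𝒩.ψ'' (y j) ∈ (D.WA.boundaries l 1).baseChange ℂ := by
      have hsumW : ∑ j ∈ Finset.Icc (0 : ℤ) n, 𝒩.ψ'' (y j) ∈ (D.WA.W l 1).baseChange ℂ :=
        sum_mem fun j hj => by simpa using hyW j hj
      obtain ⟨z, hz, hzr⟩ := hz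
      obtain ⟨v, hv, hvx⟩ := 𝒩.H.exists_primitive hx hdx
      refine (hodge_G₁ D l).mem_bot (p := r) (q := n - r + 1) (by simp only [l]; omega) ?_ ?_
      · refine D.mem_hodge_E₁ hW hsumW ?_ hzr (neg_mem (D.ι_W _ _ hlow))
          (neg_mem (add_mem hz hv)) ?_
        · rw [map_sum]
          exact sum_eq_zero fun j _ => by rw [← 𝒩.ψ''_d, hd _ x hdx, map_zero]
        · rw [← map_sum, AlgHom.toLinearMap_apply, map_neg, map_add, ← hvx, map_sub, map_sub]; abel
      · rw [map_sum]
        refine sum_mem fun j hj => ?_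
        by_cases hjr : r ≤ j
        · have : y j = 0 := hr _ (by have := (mem_Icc.1 hj).1; simp only; omega)
          rw [this, map_zero, map_zero]; exact zero_mem _
        · exact (hodge_G₁ D l).anti (by omega) (hG' j hj)
    have hj : (s.1 : ℤ) ∈ Finset.Icc (0 : ℤ) n := mem_Icc.2 ⟨by omega, by omega⟩
    -- hence each component of weight `n` vanishes in `E₁`, and so its class has lower weight
    have hb := (hodge_G₁ D l).mem_bot_of_sum_mem _ (fun j => 𝒩.ψ'' (y j)) hG
      (fun j hj => by rw [show 1 + l - j = n - j by simp only [l]; ring]; exact hG' j hj) hbot _ hj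
    have hys : y s.1 = p s x := by
      change p ((s.1 : ℤ).toNat, n - (s.1 : ℤ).toNat) x = p s x
      congr 2
      ext
      · simp
      · simp; omega
    simp only [hys] at hb
    rw [WeightFiltration.boundaries, baseChange_sup] at hb
    obtain ⟨w, hw, y', hy', hwy⟩ := mem_sup.1 hb
    rw [WeightFiltration.dW, baseChange_map] at hy'
    obtain ⟨z', hz', rfl⟩ := hy'
    refine 𝒩.eq_zero_of_weight_lt hW (P := s.1) (Q := s.2) (hp s x) (hgr s 1 x hx) (hd s x hdx) n
      (by omega) z' (baseChange_mono (D.WA.le_gr _ 0) hz') ?_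
    rw [← hwy, add_sub_cancel_right]
    rwa [show l - 1 = (n : ℤ) - 2 by simp only [l]; ring] at hw

/-- The model `ψ : N → B` is strictly compatible with the Hodge filtrations in the sense needed
for lifting flat connections. -/
theorem isGaugePair (hF : ∀ p, ∀ x ∈ D.B.gr 0, D.B.d x ∈ D.FB.F p 1 →
      ∃ y ∈ D.FB.F p 0, D.B.d y = D.B.d x) :
    IsGaugePair 𝒩.N D.B 𝒩.ψ 𝒩.FN D.FB.F := by
  obtain ⟨p, hp, hp₁, hp₂, hsum, hgr, hpd⟩ := 𝒩.exists_projections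
  refine { map_d := 𝒩.quasiIso.map_d
           le_M := fun r n => 𝒩.FN_le fun _ _ _ _ h => h
           le_A := D.FB.le_gr
           d_M := fun r n => 𝒩.FN_le (P := (𝒩.FN r (n + 1)).comap 𝒩.N.d) fun s hs x hx hx' =>
             𝒩.mem_FN hs (𝒩.big_d s x hx) (𝒩.N.d_mem n x hx')
           d_A := D.FB.d_mem
           one_A := D.FB.one_mem
           mul_M := 𝒩.FN_mul
           mul_A := D.FB.mul_mem
           map_F := fun r n => 𝒩.FN_le (P := (D.FB.F r n).comap 𝒩.ψ.toLinearMap)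
             fun s hs x hx hx' => D.FB.anti n hs (𝒩.ψ_big s.1 s.2 n x ⟨hx, hx'⟩).2
           lift₁ := fun r y hy hdy => ?_
           lift₂ := fun r x hx hdx hz => ?_ }
  · obtain ⟨x, hx, hdx, z, hz, hzx⟩ := 𝒩.quasiIso.surj₁ y (D.FB.le_gr r 1 hy) hdy
    obtain ⟨S, hS, hxS⟩ := hsum x
    let x' := ∑ s ∈ S with r ≤ (s.1 : ℤ), p s x
    have hx' : x' ∈ 𝒩.FN r 1 := sum_mem fun s hs =>
      𝒩.mem_FN (mem_filter.1 hs).2 (hp s x) (hgr s 1 x hx)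
    have hx'1 : x' ∈ 𝒩.N.gr 1 := sum_mem fun s _ => hgr s 1 x hx
    have hdx' : 𝒩.N.d x' = 0 := by
      rw [map_sum]; exact sum_eq_zero fun s _ => by rw [← hpd, hdx, map_zero]
    have hψx' : 𝒩.ψ x' ∈ D.FB.F r 1 := by
      rw [map_sum]
      exact sum_mem fun s hs => D.FB.anti 1 (mem_filter.1 hs).2
        (𝒩.ψ_big s.1 s.2 1 _ ⟨hp s x, hgr s 1 x hx⟩).2
    have hpx' : ∀ s, r ≤ s.1 → p s (x - x') = 0 := fun s hs => by
      rw [map_sub, map_sum]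
      by_cases hsS : s ∈ S
      · rw [Finset.sum_eq_single_of_mem s (mem_filter.2 ⟨hsS, hs⟩)
          fun t _ ht => hp₂ s t ht.symm _ (hp t x), hp₁ s _ (hp s x), sub_self]
      · rw [hS s hsS, sum_eq_zero, sub_zero]
        exact fun t ht => hp₂ s t (fun h => hsS (h ▸ (mem_filter.1 ht).1)) _ (hp t x)
    obtain ⟨S', hS', -⟩ := hsum (x - x')
    have hxx : x - x' = 0 := by
      refine 𝒩.eq_zero_of_mem_hodge hW hp hp₁ hp₂ hsum hgr hpd
        (S'.sup (fun s => s.1 + s.2) + 1) _ (sub_mem hx hx'1)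
        (by rw [map_sub, hdx, hdx', sub_zero]) hpx' (fun s hs => ?_) ⟨z, hz, ?_⟩
      · refine hS' s fun h => ?_
        have := Finset.le_sup (f := fun s : ℕ × ℕ => s.1 + s.2) h
        change s.1 + s.2 ≤ _ at this
        omega
      · rw [map_sub, hzx, show 𝒩.ψ x - 𝒩.ψ x' + (y - 𝒩.ψ x) = y - 𝒩.ψ x' by abel]
        exact sub_mem hy hψx'
    rw [sub_eq_zero.1 hxx] at hzx
    obtain ⟨z', hz', hzz⟩ := hF r z hz (by rw [hzx]; exact sub_mem hy hψx')
    exact ⟨x', hx', hdx', z', hz', by rw [hzz, hzx]; abel⟩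
  · obtain ⟨z, hz, hzx⟩ := hz
    have hx2 : x ∈ 𝒩.N.gr 2 := 𝒩.FN_le (fun _ _ _ _ h => h) hx
    obtain ⟨y, hy, rfl⟩ := 𝒩.quasiIso.inj₂ x hx2 hdx ⟨z, hz, hzx.symm⟩
    obtain ⟨S, hS, hyS⟩ := hsum y
    refine ⟨∑ s ∈ S with r ≤ (s.1 : ℤ), p s y, sum_mem fun s hs =>
      𝒩.mem_FN (mem_filter.1 hs).2 (hp s y) (hgr s 1 y hy), ?_⟩
    have hlow : ∀ s : ℕ × ℕ, ¬ r ≤ s.1 → p s (𝒩.N.d y) = 0 := fun s hs => by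
      have : 𝒩.FN r 2 ≤ LinearMap.ker (p s) := 𝒩.FN_le fun t ht x hx _ =>
        hp₂ s t (fun h => hs (h ▸ ht)) x hx
      exact this hx
    conv_rhs => rw [hyS]
    rw [map_sum, map_sum, Finset.sum_filter]
    refine sum_congr rfl fun s _ => ?_
    split_ifs with h
    · rfl
    · rw [← hpd, hlow s h]

end BigradedModel

end Strictness

/-! ### Flat forms with values in linear maps -/

section HodgeBasis

/-- The complexification of a mixed Hodge structure has a basis adapted to both filtrations. -/
theorem BifilteredSpace.exists_hodge_basis {X : BifilteredSpace K} (hX : isMHS K X) :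
    ∃ (n : ℕ) (b : Module.Basis (Fin n) ℂ X.VC) (t : Fin n → ℤ × ℤ),
      IsAdapted b (fun i => (t i).1 + (t i).2) X.WC ∧
      IsAdapted b (fun i => -(t i).1) fun m => X.F (-m) := by
  have htop : ⨆ s, X.deligne s = ⊤ := by
    obtain ⟨n, hn⟩ := exists_WC_eq_top hX
    rw [eq_top_iff, ← hn, WC_eq_deligne hX]
    exact iSup₂_le fun s _ => le_iSup X.deligne s
  obtain ⟨n, b, t, -, h⟩ := exists_basis_of_iSupIndep X.deligne (iSupIndep_deligne hX) htop
  refine ⟨n, b, t, fun m x => ?_, fun m x => ?_⟩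
  · rw [WC_eq_deligne hX, h]; rfl
  · change x ∈ X.F (-m) ↔ _
    rw [F_eq_deligne hX, h]
    exact forall₂_congr fun i _ => by simp only [Set.mem_ofPred_eq]; omega

/-- A vector space with an adapted basis for the weight filtration. -/
theorem BifilteredSpace.exists_weight_basis {X : BifilteredSpace K} (hX : isMHS K X) :
    ∃ (n : ℕ) (b : Module.Basis (Fin n) K X.V) (w : Fin n → ℤ), IsAdapted b w X.W :=
  exists_adapted_basis X.W X.W_mono hX.1 hX.2.1

end HodgeBasis

section FlatForms

variable {k : Type v} [Field k] {A : Type u} [Ring A] [Algebra k A] {V V₁ V₂ : Type*}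
  [AddCommGroup V] [Module k V] [AddCommGroup V₁] [Module k V₁] [AddCommGroup V₂] [Module k V₂]

theorem one_tmul_mem_tens {P : Submodule k A}
    {Q : Submodule k V} {x : A} (hx : x ≠ 0) {v : V} (h : x ⊗ₜ[k] v ∈ tens k P Q) : v ∈ Q := by
  obtain ⟨θ, -, hθ⟩ := exists_dual_of_notMem (k := k) (P := ⊥) (x := x) (by simpa using hx)
  have := (mem_tens_iff.1 h).1 θ
  rw [slice_tmul] at this
  exact (Q.smul_mem_iff hθ).1 this

theorem one_tmul_injective {x : A} (hx : x ≠ 0) {v w : V}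
    (h : x ⊗ₜ[k] v = x ⊗ₜ[k] w) : v = w := by
  obtain ⟨θ, -, hθ⟩ := exists_dual_of_notMem (k := k) (P := ⊥) (x := x) (by simpa using hx)
  have := congrArg (slice θ) h
  rw [slice_tmul, slice_tmul] at this
  exact smul_right_injective V hθ this

section Bases

variable {ι ι₁ ι₂ : Type*} [Fintype ι] [Fintype ι₁] [Fintype ι₂] [DecidableEq ι] [DecidableEq ι₁]
  [DecidableEq ι₂] {e : Module.Basis ι k V} {e₁ : Module.Basis ι₁ k V₁} {e₂ : Module.Basis ι₂ k V₂}
  {w : ι → ℤ} {w₁ : ι₁ → ℤ} {w₂ : ι₂ → ℤ} {W : ℤ → Submodule k V} {W₁ : ℤ → Submodule k V₁}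
  {W₂ : ℤ → Submodule k V₂}

theorem toMat_mem {P : Submodule k A}
    {Q : Submodule k (V₁ →ₗ[k] V₂)} {x : A ⊗[k] (V₁ →ₗ[k] V₂)} (hx : x ∈ tens k P Q) (i : ι₂)
    (j : ι₁) : toMat e₁ e₂ x i j ∈ P :=
  (tens_le (fun y hy f _ => by
    change toMat e₁ e₂ (y ⊗ₜ f) i j ∈ P
    rw [toMat_tmul]; exact P.smul_mem _ hy) : tens k P Q ≤ P.comap (entry e₁ e₂ i j)) hx

theorem toMat_maurerCartan {A : DGA.{u} k} {x : A.carrier ⊗[k] (V →ₗ[k] V)} :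
    dForm A x + wedge x x = 0 ↔
      (toMat e e x).map A.d + toMat e e x * toMat e e x = 0 := by
  rw [← (toMat_injective (A := A.carrier) e e).eq_iff, map_add, map_zero, toMat_wedge e e e, dForm,
    toMat_mapForm]

theorem toMat_covD {A : DGA.{u} k} {x₁ : A.carrier ⊗[k] (V₁ →ₗ[k] V₁)}
    {x₂ : A.carrier ⊗[k] (V₂ →ₗ[k] V₂)} {b : A.carrier ⊗[k] (V₁ →ₗ[k] V₂)} :
    covD A x₁ x₂ b = 0 ↔ (toMat e₁ e₂ b).map A.d + toMat e₂ e₂ x₂ * toMat e₁ e₂ b -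
      toMat e₁ e₂ b * toMat e₁ e₁ x₁ = 0 := by
  rw [← (toMat_injective (A := A.carrier) e₁ e₂).eq_iff, map_zero, covD, map_sub, map_add,
    toMat_wedge e₁ e₂ e₂, toMat_wedge e₁ e₁ e₂, dForm, toMat_mapForm]

theorem toMat_eq_zero {P : Submodule k A}
    (hW : IsAdapted e w W) {x : A ⊗[k] (V →ₗ[k] V)} (hx : x ∈ tens k P (filtHom W W (-1)))
    (i j : ι) (hij : w j ≤ w i) : toMat e e x i j = 0 :=
  ((mem_tens_filtHom_iff hW hW).1 hx i j).2 (by omega)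

theorem mem_tens_of_toMat {P : Submodule k A}
    (hW : IsAdapted e w W) {x : A ⊗[k] (V →ₗ[k] V)} (hx : ∀ i j, toMat e e x i j ∈ P)
    (h0 : ∀ i j, w j ≤ w i → toMat e e x i j = 0) : x ∈ tens k P (filtHom W W (-1)) :=
  (mem_tens_filtHom_iff hW hW).2 fun i j => ⟨hx i j, fun h => h0 i j (by omega)⟩

/-- Flat sections of the pullback along a `1`-quasi-isomorphism of unipotent flat connections are
constant. -/
theorem exists_const_of_covD_eq_zero {M A : DGA.{u} k} {f : M.carrier →ₐ[k] A.carrier}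
    (hinj : DGA.InjOnH M A f 1) (hM : ∀ x ∈ M.gr 0, ∃ c : k, x = algebraMap k _ c)
    (h₁ : IsAdapted e₁ w₁ W₁) (h₂ : IsAdapted e₂ w₂ W₂)
    {Ω₁ : M.carrier ⊗[k] (V₁ →ₗ[k] V₁)} {Ω₂ : M.carrier ⊗[k] (V₂ →ₗ[k] V₂)}
    (hΩ₁ : Ω₁ ∈ tens k (M.gr 1) (filtHom W₁ W₁ (-1)))
    (hΩ₂ : Ω₂ ∈ tens k (M.gr 1) (filtHom W₂ W₂ (-1)))
    (mc₁ : dForm M Ω₁ + wedge Ω₁ Ω₁ = 0) (mc₂ : dForm M Ω₂ + wedge Ω₂ Ω₂ = 0)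
    {b : A.carrier ⊗[k] (V₁ →ₗ[k] V₂)} {Q : Submodule k (V₁ →ₗ[k] V₂)}
    (hb : b ∈ tens k (A.gr 0) Q)
    (hflat : covD A (mapForm f.toLinearMap Ω₁) (mapForm f.toLinearMap Ω₂) b = 0) :
    ∃ c : V₁ →ₗ[k] V₂, b = 1 ⊗ₜ c ∧ wedge Ω₂ (1 ⊗ₜ c) = wedge (1 ⊗ₜ c) Ω₁ := by
  rw [toMat_covD (e₁ := e₁) (e₂ := e₂), toMat_mapForm, toMat_mapForm] at hflat
  obtain ⟨c, hc, hc'⟩ := exists_const_of_flat (w₁ := w₁) (w₂ := w₂) hinj hM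
    (toMat_mem hΩ₁) (toMat_mem hΩ₂) (toMat_eq_zero h₁ hΩ₁) (toMat_eq_zero h₂ hΩ₂)
    (toMat_maurerCartan.1 mc₁) (toMat_maurerCartan.1 mc₂) (toMat_mem hb) hflat
  refine ⟨Matrix.toLin e₁ e₂ c, toMat_injective e₁ e₂ ?_, toMat_injective e₁ e₂ ?_⟩
  · rw [toMat_one_tmul, LinearMap.toMatrix_toLin, hc]
  · rw [toMat_wedge e₁ e₂ e₂, toMat_wedge e₁ e₁ e₂, toMat_one_tmul, LinearMap.toMatrix_toLin]
    exact hc'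

/-- Unipotent gauge transformations have unipotent inverses, with entries in the same subspaces. -/
theorem exists_unipotent_inverse_form {A : DGA.{u} k} (hW : IsAdapted e w W)
    (P : ι → ι → Submodule k A.carrier) (hP : ∀ i j, P i j ≤ A.gr 0) (hone : ∀ i, 1 ∈ P i i)
    (hmul : ∀ i l j, ∀ x ∈ P i l, ∀ y ∈ P l j, x * y ∈ P i j) {b : A.carrier ⊗[k] (V →ₗ[k] V)}
    (hb : b - 1 ⊗ₜ LinearMap.id ∈ tens k (A.gr 0) (filtHom W W (-1)))
    (hbP : ∀ i j, toMat e e b i j ∈ P i j) :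
    ∃ c : A.carrier ⊗[k] (V →ₗ[k] V),
      (c - 1 ⊗ₜ LinearMap.id ∈ tens k (A.gr 0) (filtHom W W (-1))) ∧
      (∀ i j, toMat e e c i j ∈ P i j) ∧
      wedge b c = 1 ⊗ₜ LinearMap.id ∧ wedge c b = 1 ⊗ₜ LinearMap.id := by
  obtain ⟨c, hc, hc₀, hbc, hcb⟩ := exists_unipotent_inverse w (fun i j => (P i j).toAddSubgroup)
    hone hmul (b := toMat e e b) hbP fun i j hij => by
      have := toMat_eq_zero hW hb i j hij
      rwa [map_sub, toMat_one, Matrix.sub_apply, sub_eq_zero] at this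
  refine ⟨ofMat e e c, mem_tens_of_toMat hW (fun i j => ?_) fun i j hij => ?_, fun i j => ?_,
    toMat_injective e e ?_, toMat_injective e e ?_⟩
  · rw [map_sub, toMat_ofMat, toMat_one, Matrix.sub_apply]
    refine sub_mem (hP i j (hc i j)) ?_
    by_cases h : i = j
    · subst h; rw [Matrix.one_apply_eq]; exact A.one_mem
    · rw [one_apply_ne h]; exact zero_mem _
  · rw [map_sub, toMat_ofMat, toMat_one, Matrix.sub_apply, hc₀ i j hij, sub_self]
  · rw [toMat_ofMat]; exact hc i j
  · rw [toMat_wedge e e e, toMat_ofMat, hbc, toMat_one]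
  · rw [toMat_wedge e e e, toMat_ofMat, hcb, toMat_one]

/-- The inverse of a flat gauge transformation is flat. -/
theorem covD_inverse {A : DGA.{u} k} {ω₁ : A.carrier ⊗[k] (V₁ →ₗ[k] V₁)}
    {ω₂ : A.carrier ⊗[k] (V₂ →ₗ[k] V₂)} {b : A.carrier ⊗[k] (V₁ →ₗ[k] V₂)}
    {c : A.carrier ⊗[k] (V₂ →ₗ[k] V₁)} {Q : Submodule k (V₂ →ₗ[k] V₁)}
    (hc : c ∈ tens k (A.gr 0) Q) (hbc : wedge b c = 1 ⊗ₜ LinearMap.id)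
    (hcb : wedge c b = 1 ⊗ₜ LinearMap.id) (hflat : covD A ω₁ ω₂ b = 0) : covD A ω₂ ω₁ c = 0 := by
  have h : covD A ω₁ ω₁ (wedge c b) = 0 := by
    rw [hcb]; exact covD_one_tmul A (by rw [wedge_one, one_wedge])
  rw [covD_wedge A hc, hflat, wedge_zero, add_zero] at h
  have h' := congrArg (fun x => wedge x c) h
  simpa only [wedge_assoc, hbc, wedge_one, zero_wedge] using h'

/-- A unipotent flat connection on `A` is equivalent to the image of one on `M`, under a unipotent
gauge transformation which is compatible with the filtrations. -/
theorem IsGaugePair.exists_gauge_form {M A : DGA.{u} k} {f : M.carrier →ₐ[k] A.carrier}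
    {FM : ℤ → ℕ → Submodule k M.carrier} {FA : ℤ → ℕ → Submodule k A.carrier}
    (h : IsGaugePair M A f FM FA) (hW : IsAdapted e w W) (t : ι → ℤ)
    {ω : A.carrier ⊗[k] (V →ₗ[k] V)} (hω : ω ∈ tens k (A.gr 1) (filtHom W W (-1)))
    (hωF : ∀ i j, toMat e e ω i j ∈ FA (t j - t i) 1) (mc : dForm A ω + wedge ω ω = 0) :
    ∃ (Ω : M.carrier ⊗[k] (V →ₗ[k] V)) (b c : A.carrier ⊗[k] (V →ₗ[k] V)),
      (Ω ∈ tens k (M.gr 1) (filtHom W W (-1))) ∧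
      (∀ i j, toMat e e Ω i j ∈ FM (t j - t i) 1) ∧
      dForm M Ω + wedge Ω Ω = 0 ∧
      (b - 1 ⊗ₜ LinearMap.id ∈ tens k (A.gr 0) (filtHom W W (-1))) ∧
      (∀ i j, toMat e e b i j ∈ FA (t j - t i) 0) ∧
      covD A ω (mapForm f.toLinearMap Ω) b = 0 ∧
      (c - 1 ⊗ₜ LinearMap.id ∈ tens k (A.gr 0) (filtHom W W (-1))) ∧
      (∀ i j, toMat e e c i j ∈ FA (t j - t i) 0) ∧
      wedge b c = 1 ⊗ₜ LinearMap.id ∧ wedge c b = 1 ⊗ₜ LinearMap.id := by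
  obtain ⟨Ω, b, hΩ, hΩ₀, mc', hb, hb₀, hflat⟩ := h.exists_gauge w t hωF (toMat_eq_zero hW hω)
    (toMat_maurerCartan.1 mc)
  have hb1 : ofMat e e b - 1 ⊗ₜ LinearMap.id ∈ tens k (A.gr 0) (filtHom W W (-1)) := by
    refine mem_tens_of_toMat hW (fun i j => ?_) fun i j hij => ?_
    · rw [map_sub, toMat_ofMat, toMat_one, Matrix.sub_apply]
      refine sub_mem (h.le_A _ _ (hb i j)) ?_
      by_cases h' : i = j
      · subst h'; rw [Matrix.one_apply_eq]; exact A.one_mem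
      · rw [one_apply_ne h']; exact zero_mem _
    · rw [map_sub, toMat_ofMat, toMat_one, Matrix.sub_apply, hb₀ i j hij, sub_self]
  have hbF : ∀ i j, toMat e e (ofMat e e b) i j ∈ FA (t j - t i) 0 := fun i j => by
    rw [toMat_ofMat]; exact hb i j
  obtain ⟨c, hc, hcF, hbc, hcb⟩ := exists_unipotent_inverse_form hW (fun i j => FA (t j - t i) 0)
    (fun i j => h.le_A _ _) (fun i => by rw [sub_self]; exact h.one_A)
    (fun i l j x hx y hy => by
      have := h.mul_A _ _ _ _ x hx y hy
      rwa [show t l - t i + (t j - t l) = t j - t i by ring] at this) hb1 hbF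
  refine ⟨ofMat e e Ω, ofMat e e b, c, ?_, fun i j => ?_, ?_, hb1, hbF, ?_, hc, hcF, hbc, hcb⟩
  · exact mem_tens_of_toMat hW (fun i j => by rw [toMat_ofMat]; exact h.le_M _ _ (hΩ i j))
      fun i j hij => by rw [toMat_ofMat]; exact hΩ₀ i j hij
  · rw [toMat_ofMat]; exact hΩ i j
  · rw [toMat_maurerCartan (e := e), toMat_ofMat]; exact mc'
  · rw [toMat_covD (e₁ := e) (e₂ := e), toMat_mapForm, toMat_ofMat, toMat_ofMat]; exact hflat

end Bases

/-- Every `1`-quasi-isomorphism lifts flat connections if the filtrations are trivial. -/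
theorem DGA.IsOneQuasiIso.isGaugePair {M A : DGA.{u} k} {f : M.carrier →ₐ[k] A.carrier}
    (h : M.IsOneQuasiIso A f) :
    IsGaugePair M A f (fun _ n => M.gr n) (fun _ n => A.gr n) where
  map_d := h.map_d
  le_M _ _ := le_rfl
  le_A _ _ := le_rfl
  d_M _ := M.d_mem
  d_A _ := A.d_mem
  one_A := A.one_mem
  mul_M _ _ _ _ _ hx _ hy := SetLike.GradedMul.mul_mem hx hy
  mul_A _ _ _ _ _ hx _ hy := SetLike.GradedMul.mul_mem hx hy
  map_F _ := h.map_gr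
  lift₁ _ y hy hd := by
    obtain ⟨x, hx, hdx, z, hz, hzx⟩ := h.surj₁ y hy hd
    exact ⟨x, hx, hdx, z, hz, by rw [hzx]; abel⟩
  lift₂ _ x hx hd hz := by
    obtain ⟨z, hz, hzx⟩ := hz
    obtain ⟨y, hy, hyx⟩ := h.inj₂ x hx hd ⟨z, hz, hzx.symm⟩
    exact ⟨y, hy, hyx⟩

end FlatForms

/-! ### The functor `Φ` is an equivalence -/

section ConstantFactors

variable {k : Type*} [Field k] {A : Type u} [Ring A] [Algebra k A] {V₁ V₂ V₃ : Type*}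
  [AddCommGroup V₁] [Module k V₁] [AddCommGroup V₂] [Module k V₂] [AddCommGroup V₃] [Module k V₃]

theorem const_wedge_mem {P : Submodule k A} {Q : Submodule k (V₁ →ₗ[k] V₂)}
    {Q' : Submodule k (V₁ →ₗ[k] V₃)} {g : V₂ →ₗ[k] V₃} (h : ∀ f ∈ Q, g ∘ₗ f ∈ Q')
    {x : A ⊗[k] (V₁ →ₗ[k] V₂)} (hx : x ∈ tens k P Q) : wedge (1 ⊗ₜ g) x ∈ tens k P Q' := by
  induction hx using tens_induction with
  | mem a ha f hf => rw [wedge_tmul, one_mul]; exact tmul_mem_tens ha (h f hf)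
  | zero => rw [wedge_zero]; exact zero_mem _
  | add x y _ _ hx hy => rw [wedge_add]; exact add_mem hx hy

theorem wedge_const_mem {P : Submodule k A} {Q : Submodule k (V₂ →ₗ[k] V₃)}
    {Q' : Submodule k (V₁ →ₗ[k] V₃)} {g : V₁ →ₗ[k] V₂} (h : ∀ f ∈ Q, f ∘ₗ g ∈ Q')
    {x : A ⊗[k] (V₂ →ₗ[k] V₃)} (hx : x ∈ tens k P Q) : wedge x (1 ⊗ₜ g) ∈ tens k P Q' := by
  induction hx using tens_induction with
  | mem a ha f hf => rw [wedge_tmul, mul_one]; exact tmul_mem_tens ha (h f hf)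
  | zero => rw [zero_wedge]; exact zero_mem _
  | add x y _ _ hx hy => rw [add_wedge]; exact add_mem hx hy

theorem const_wedge_mem_iSup {P : ℤ → Submodule k A} {Q : ℤ → Submodule k (V₁ →ₗ[k] V₂)}
    {Q' : ℤ → Submodule k (V₁ →ₗ[k] V₃)} {g : V₂ →ₗ[k] V₃} (h : ∀ r, ∀ f ∈ Q r, g ∘ₗ f ∈ Q' r)
    {x : A ⊗[k] (V₁ →ₗ[k] V₂)} (hx : x ∈ ⨆ r, tens k (P r) (Q r)) :
    wedge (1 ⊗ₜ g) x ∈ ⨆ r, tens k (P r) (Q' r) := by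
  induction hx using iSup_induction' with
  | mem r x hx => exact mem_iSup_of_mem r (const_wedge_mem (h r) hx)
  | zero => rw [wedge_zero]; exact zero_mem _
  | add x y _ _ hx hy => rw [wedge_add]; exact add_mem hx hy

theorem wedge_const_mem_iSup {P : ℤ → Submodule k A} {Q : ℤ → Submodule k (V₂ →ₗ[k] V₃)}
    {Q' : ℤ → Submodule k (V₁ →ₗ[k] V₃)} {g : V₁ →ₗ[k] V₂} (h : ∀ r, ∀ f ∈ Q r, f ∘ₗ g ∈ Q' r)
    {x : A ⊗[k] (V₂ →ₗ[k] V₃)} (hx : x ∈ ⨆ r, tens k (P r) (Q r)) :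
    wedge x (1 ⊗ₜ g) ∈ ⨆ r, tens k (P r) (Q' r) := by
  induction hx using iSup_induction' with
  | mem r x hx => exact mem_iSup_of_mem r (wedge_const_mem (h r) hx)
  | zero => rw [zero_wedge]; exact zero_mem _
  | add x y _ _ hx hy => rw [add_wedge]; exact add_mem hx hy

end ConstantFactors

section Unipotent

variable {k : Type v} [Field k] {A : DGA.{u} k} {V : Type*} [AddCommGroup V] [Module k V]
  {W : ℤ → Submodule k V}

theorem unipotent_wedge (hW : Monotone W) {x y : A.carrier ⊗[k] (V →ₗ[k] V)}
    (hx : x - 1 ⊗ₜ LinearMap.id ∈ tens k (A.gr 0) (filtHom W W (-1)))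
    (hy : y - 1 ⊗ₜ LinearMap.id ∈ tens k (A.gr 0) (filtHom W W (-1))) :
    wedge x y - 1 ⊗ₜ LinearMap.id ∈ tens k (A.gr 0) (filtHom W W (-1)) := by
  have h : wedge x y - 1 ⊗ₜ LinearMap.id = wedge (x - 1 ⊗ₜ LinearMap.id) (y - 1 ⊗ₜ LinearMap.id) +
      (x - 1 ⊗ₜ LinearMap.id) + (y - 1 ⊗ₜ LinearMap.id) := by
    rw [wedge_sub, sub_wedge, sub_wedge, wedge_one, one_wedge, one_wedge]; abel
  rw [h]
  refine add_mem (add_mem ?_ hx) hy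
  exact tens_mono le_rfl (filtHom_mono hW (by omega)) (wedge_mem A.mul_mem_gr_zero
    (fun f hf g hg => VMHS.filtHom_comp (n := -2) (by norm_num) hf hg) hx hy)

theorem filtHom_zero_of_unipotent (hW : Monotone W) {x : A.carrier ⊗[k] (V →ₗ[k] V)}
    (hx : x - 1 ⊗ₜ LinearMap.id ∈ tens k (A.gr 0) (filtHom W W (-1))) :
    x ∈ tens k (A.gr 0) (filtHom W W 0) := by
  have h := add_mem (tens_mono le_rfl (filtHom_mono hW (show (-1 : ℤ) ≤ 0 by norm_num)) hx)
    (tmul_mem_tens A.one_mem (show LinearMap.id ∈ filtHom W W 0 from fun i v hv => by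
      rw [add_zero]; exact hv))
  rwa [sub_add_cancel] at h

/-- Membership in `∑ G r ⊗ F^{-r} Hom(V₁, V₂)` in terms of matrices. -/
theorem mem_iSup_hodge_iff {A : Type u} [Ring A] [Algebra k A] {V₁ V₂ : Type*} [AddCommGroup V₁]
    [Module k V₁] [AddCommGroup V₂] [Module k V₂] {ι₁ ι₂ : Type*} [Fintype ι₁] [Fintype ι₂]
    [DecidableEq ι₁] [DecidableEq ι₂] {b₁ : Module.Basis ι₁ k V₁} {b₂ : Module.Basis ι₂ k V₂}
    {p₁ : ι₁ → ℤ} {p₂ : ι₂ → ℤ} {F₁ : ℤ → Submodule k V₁} {F₂ : ℤ → Submodule k V₂}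
    (h₁ : IsAdapted b₁ (fun i => -p₁ i) fun m => F₁ (-m))
    (h₂ : IsAdapted b₂ (fun i => -p₂ i) fun m => F₂ (-m)) {G : ℤ → Submodule k A}
    (hG : Antitone G) {x : A ⊗[k] (V₁ →ₗ[k] V₂)} :
    x ∈ ⨆ r : ℤ, tens k (G r) (filtHom F₁ F₂ (-r)) ↔
      ∀ i j, toMat b₁ b₂ x i j ∈ G (p₁ j - p₂ i) := by
  simp only [filtHom_neg]
  rw [mem_iSup_tens_iff h₁ h₂ hG]
  simp only [neg_sub_neg]

end Unipotent

namespace MixedHodgeDiagram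

variable (D)

/-- `1 ∉ F¹`, since `1` is real and `H⁰` has weight zero. -/
theorem one_notMem_F : (1 : D.B.carrier) ∉ D.FB.F 1 0 := by
  intro h
  have h1 : (1 : ℂ ⊗[K] D.A.carrier) ∈ (D.WA.cycles 0 0).baseChange ℂ :=
    tmul_mem_baseChange_of_mem 1
      ⟨D.WA.one_mem, show D.A.d 1 ∈ D.WA.W (0 - 1) 1 by rw [D.A.d_one]; exact zero_mem _⟩
  have hG : (1 : ℂ ⊗[K] D.A.carrier) ∈ (D.WA.cycles 0 0).baseChange ℂ ⊓
      ((D.FB.F 1 0 ⊓ D.WB.cycles 0 0) ⊔ D.WB.boundaries 0 0).comap D.ι.toLinearMap := by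
    refine ⟨h1, mem_sup_left ?_⟩
    rw [AlgHom.toLinearMap_apply, map_one]
    exact ⟨h, D.WB.one_mem, show D.B.d 1 ∈ D.WB.W (0 - 1) 1 by rw [D.B.d_one]; exact zero_mem _⟩
  have hc : conjC K D.A.carrier 1 = 1 := by
    rw [Algebra.TensorProduct.one_def, conjC_tmul, map_one]
  have hb := (D.hodge_E₁ 0 0).mem_bot (p := 1) (q := 1) (by norm_num) hG (by rw [hc]; exact hG)
  rw [WeightFiltration.boundaries, WeightFiltration.dW, sup_bot_eq, zero_sub, D.WA_neg,
    baseChange_bot, Submodule.mem_bot] at hb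
  have := congrArg D.ι hb
  rw [map_one, map_zero] at this
  exact D.B.one_ne_zero this

theorem ιForm_unipotent {X : BifilteredSpace K} {x : D.A.carrier ⊗[K] (X.V →ₗ[K] X.V)}
    (h : x - 1 ⊗ₜ LinearMap.id ∈ tens K (D.A.gr 0) (filtHom X.W X.W (-1))) :
    D.ιForm x - 1 ⊗ₜ LinearMap.id ∈ tens ℂ (D.B.gr 0) (filtHom X.WC X.WC (-1)) := by
  have h' : D.ιForm (x - 1 ⊗ₜ LinearMap.id) ∈ tens ℂ (D.B.gr 0) (filtHom X.WC X.WC (-1)) :=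
    mapForm_mem (f := D.ι.toLinearMap) (P := (D.A.gr 0).baseChange ℂ) (P' := D.B.gr 0)
      (D.ι_oneQuasiIso.map_gr 0) (cxForm_mem X h)
  rw [ιForm, map_sub, map_sub] at h'
  have h1 := VMHS.ιForm_one_tmul (D := D) (LinearMap.id : X.V →ₗ[K] X.V)
  rw [baseChange_id] at h1
  rw [← h1]
  exact h'

theorem ιForm_covD {V₁ V₂ : Type u} [AddCommGroup V₁] [Module K V₁] [AddCommGroup V₂] [Module K V₂]
    {ω₁ : D.A.carrier ⊗[K] (V₁ →ₗ[K] V₁)} {ω₂ : D.A.carrier ⊗[K] (V₂ →ₗ[K] V₂)}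
    {b : D.A.carrier ⊗[K] (V₁ →ₗ[K] V₂)} (h : covD D.A ω₁ ω₂ b = 0) :
    covD D.B (D.ιForm ω₁) (D.ιForm ω₂) (D.ιForm b) = 0 := by
  have hd : D.ιForm (dForm D.A b) = dForm D.B (D.ιForm b) := by
    rw [ιForm, ιForm]
    induction b using induction_on with
    | zero => simp
    | add x y hx hy =>
      have h' : ∀ x : D.A.carrier ⊗[K] (V₁ →ₗ[K] V₂), mapForm D.ι.toLinearMap (cxForm K
        (dForm D.A x)) = dForm D.B (mapForm D.ι.toLinearMap (cxForm K x)) := fun x => by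
        induction x using induction_on with
        | zero => simp
        | add x y hx hy => simp only [map_add, hx, hy]
        | tmul a f =>
          have := D.ι_d (1 ⊗ₜ a)
          rw [baseChange_tmul] at this
          simp [this]
      exact h' _
    | tmul a f =>
      have := D.ι_d (1 ⊗ₜ a)
      rw [baseChange_tmul] at this
      simp [this]
  have h' : D.ιForm (dForm D.A b + wedge ω₂ b) = D.ιForm (wedge b ω₁) :=
    congrArg D.ιForm (sub_eq_zero.1 h)
  rw [VMHS.ιForm_add, hd, VMHS.ιForm_wedge, VMHS.ιForm_wedge] at h'
  exact sub_eq_zero.2 h'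

end MixedHodgeDiagram

namespace BifilteredSpace

/-- The bifiltered space with the Hodge filtration `f⁻¹(F)`. -/
abbrev twist (X : BifilteredSpace K) (f : X.VC →ₗ[ℂ] X.VC) : BifilteredSpace K where
  V := X.V
  W := X.W
  W_mono := X.W_mono
  F p := (X.F p).comap f
  F_anti _ _ h := comap_mono (X.F_anti h)

/-- Changing the Hodge filtration by an automorphism which is the identity on the graded pieces of
the weight filtration gives a mixed Hodge structure. -/
theorem isMHS_twist {X : BifilteredSpace K} (hX : isMHS K X) {f f₁ : X.VC →ₗ[ℂ] X.VC}
    (hf : f - LinearMap.id ∈ filtHom X.WC X.WC (-1))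
    (hf₁ : f₁ - LinearMap.id ∈ filtHom X.WC X.WC (-1))
    (h : ∀ x, f (f₁ x) = x) (h' : ∀ x, f₁ (f x) = x) : isMHS K (X.twist f) := by
  obtain ⟨g, -⟩ := exists_deligneGrading hX
  have hlow : ∀ {e : X.VC →ₗ[ℂ] X.VC}, e - LinearMap.id ∈ filtHom X.WC X.WC (-1) → ∀ n,
      ∀ x ∈ X.WC n, e x - x ∈ X.WC (n - 1) := fun he n x hx => he n hx
  have hmem : ∀ {e : X.VC →ₗ[ℂ] X.VC}, e - LinearMap.id ∈ filtHom X.WC X.WC (-1) → ∀ n,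
      ∀ x ∈ X.WC n, e x ∈ X.WC n := fun he n x hx => by
    have := add_mem (X.WC_mono (show n - 1 ≤ n by omega) (hlow he n x hx)) hx
    rwa [sub_add_cancel] at this
  have h0 : ∀ x, f₁ x = 0 ↔ x = 0 := fun x =>
    ⟨fun hx => by rw [← h x, hx, map_zero], fun hx => by rw [hx, map_zero]⟩
  have hW : ∀ n x, x ∈ X.WC n ↔ f x ∈ X.WC n := fun n x =>
    ⟨hmem hf n x, fun hx => by have := hmem hf₁ n _ hx; rwa [h'] at this⟩
  refine HodgeGrading.isMHS (X := X.twist f)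
    { π := fun s => f₁ ∘ₗ g.π s ∘ₗ f
      S := g.S
      sum := fun x => ?_
      orth := fun s t x => ?_
      mem_W := fun n x => ?_
      mem_F := fun p x => ?_
      conj := fun s t x hst hne => ?_ }
  · have := congrArg f₁ (g.sum (f x))
    rwa [map_sum, h'] at this
  · change f₁ (g.π s (f (f₁ (g.π t (f x))))) = if s = t then f₁ (g.π t (f x)) else 0
    rw [h, g.orth]
    split_ifs
    · rfl
    · rw [map_zero]
  · refine (hW n x).trans ((g.mem_W n _).trans (forall₂_congr fun s _ => ?_))
    exact (h0 _).symm
  · refine (g.mem_F p (f x)).trans (forall₂_congr fun s _ => ?_)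
    exact (h0 _).symm
  · change f₁ (g.π t (f (conjC K X.V (f₁ (g.π s (f x)))))) = 0
    rw [h0]
    -- modulo weights below the weight of `s`, `f` and its inverse act as the identity
    have hy : g.π s (f x) ∈ X.WC (s.1 + s.2) := g.π_mem_W le_rfl _
    have h1 := conjC_mem_WC (hlow hf₁ _ _ hy)
    rw [map_sub] at h1
    have h2 := hlow hf _ _ (conjC_mem_WC (hmem hf₁ _ _ hy))
    have h3 := (g.mem_W _ _).1 (add_mem h2 h1) t (by omega)
    rw [sub_add_sub_cancel, map_sub, g.conj s t _ hst hne, sub_zero] at h3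
    exact h3

end BifilteredSpace

section FullyFaithful

open BifilteredSpace

variable (J : CanonicalIso ℳ 𝒩 C)

namespace PreRep

variable {M : DGA.{u} K} {V V₁ V₂ : Type u} [AddCommGroup V] [Module K V]
  [AddCommGroup V₁] [Module K V₁] [AddCommGroup V₂] [Module K V₂]

theorem post_eq_wedge (f : V₁ →ₗ[K] V₂) (x : M.carrier ⊗[K] (V →ₗ[K] V₁)) :
    post f x = wedge (1 ⊗ₜ f) x := by
  induction x using induction_on with
  | zero => simp
  | add x y hx hy => simp only [map_add, wedge_add, hx, hy]
  | tmul a g => rw [wedge_tmul, one_mul]; rfl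

theorem pre_eq_wedge (f : V₁ →ₗ[K] V₂) (x : M.carrier ⊗[K] (V₂ →ₗ[K] V)) :
    pre f x = wedge x (1 ⊗ₜ f) := by
  induction x using induction_on with
  | zero => simp
  | add x y hx hy => simp only [map_add, add_wedge, hx, hy]
  | tmul a g => rw [wedge_tmul, mul_one]; rfl

end PreRep

theorem form_comm {R S : PreRep ℳ.M} {f : R.X.V →ₗ[K] S.X.V}
    (h : wedge S.Ω (1 ⊗ₜ f) = wedge (1 ⊗ₜ f) R.Ω) :
    wedge (J.form S) (1 ⊗ₜ f.baseChange ℂ) = wedge (1 ⊗ₜ f.baseChange ℂ) (J.form R) := by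
  have h := congrArg (mapForm (J.I.symm : _ →ₐ[ℂ] 𝒩.N.carrier).toLinearMap)
    (congrArg (cxForm K) h)
  rw [cxForm_wedge, cxForm_wedge, mapForm_wedge, mapForm_wedge, cxForm_tmul, mapForm_tmul,
    ← Algebra.TensorProduct.one_def, AlgHom.toLinearMap_apply, map_one] at h
  exact h

theorem filtHom_zero_of_one_tmul {B : DGA.{u} ℂ} {FB : HodgeFiltration B}
    (h1 : (1 : B.carrier) ∉ FB.F 1 0) {X Y : BifilteredSpace K} (hX : isMHS K X) (hY : isMHS K Y)
    {f : X.VC →ₗ[ℂ] Y.VC}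
    (h : (1 : B.carrier) ⊗ₜ[ℂ] f ∈ ⨆ r : ℤ, tens ℂ (FB.F r 0) (filtHom X.F Y.F (-r))) :
    f ∈ filtHom X.F Y.F 0 := by
  obtain ⟨n, b₁, t₁, -, h₁⟩ := exists_hodge_basis hX
  obtain ⟨m, b₂, t₂, -, h₂⟩ := exists_hodge_basis hY
  rw [mem_iSup_hodge_iff h₁ h₂ (FB.anti 0)] at h
  rw [← neg_zero, filtHom_neg]
  refine (mem_filtHom_iff h₁ h₂).2 fun i j hij => ?_
  by_contra hlt
  have h0 := h i j
  rw [toMat_tmul] at h0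
  exact h1 (FB.anti 0 (by omega) ((Submodule.smul_mem_iff _ hij).1 h0))

/-- Compatible morphisms of the pulled back variations come from morphisms of representations. -/
theorem exists_hom_of_isHom (T : Transport J) {R S : HodgeRep J}
    {b : D.A.carrier ⊗[K] (R.obj.X.V →ₗ[K] S.obj.X.V)}
    {b' : D.B.carrier ⊗[ℂ] (R.obj.X.VC →ₗ[ℂ] S.obj.X.VC)}
    (h : VMHS.IsHom (PhiObj T R) (PhiObj T S) b b') :
    ∃ f : R ⟶ S, b = 1 ⊗ₜ lin f.hom.f ∧ b' = 1 ⊗ₜ (lin f.hom.f).baseChange ℂ := by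
  have hR := R.property
  have hS := S.property
  obtain ⟨Vs, hmin⟩ := ℳ.minimal
  obtain ⟨n, e₁, w₁, h₁⟩ := exists_weight_basis hR.isMHS
  obtain ⟨m, e₂, w₂, h₂⟩ := exists_weight_basis hS.isMHS
  obtain ⟨f, rfl, hf⟩ := exists_const_of_covD_eq_zero ℳ.quasiIso.inj₁ (fun x hx => hmin.gr_zero hx)
    h₁ h₂ hR.weight hS.weight hR.maurerCartan hS.maurerCartan h.weight h.flat
  obtain ⟨n, e₁, t₁, h₁, -⟩ := exists_hodge_basis hR.isMHS
  obtain ⟨m, e₂, t₂, h₂, -⟩ := exists_hodge_basis hS.isMHS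
  obtain ⟨f', rfl, hf'⟩ := exists_const_of_covD_eq_zero 𝒩.quasiIso.inj₁
    (fun x hx => 𝒩.canonical.gr_zero hx) h₁ h₂ (form_weight J R) (form_weight J S)
    (form_maurerCartan J R) (form_maurerCartan J S) h.weight' h.flat'
  -- the two maps agree because the transports are natural and invertible
  have hff : f.baseChange ℂ = f' := by
    have hnat := isParallelTransport_natural J (isUnipotentRep J R) (isUnipotentRep J S)
      (form_comm J hf) (T.isParallelTransport R) (T.isParallelTransport S)
    have hc : wedge (T.a S) (D.ιForm ((1 : D.A.carrier) ⊗ₜ[K] f)) = wedge (1 ⊗ₜ f') (T.a R) :=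
      h.comm
    rw [VMHS.ιForm_one_tmul] at hc
    obtain ⟨c, -, -, hac, -⟩ := exists_unipotent_inverse_form h₁ (fun _ _ => D.B.gr 0)
      (fun _ _ => le_rfl) (fun _ => D.B.one_mem) (fun _ _ _ => D.B.mul_mem_gr_zero) (T.weight R)
      (toMat_mem (filtHom_zero_of_unipotent (WC_mono R.obj.X) (T.weight R)))
    have h' := congrArg (fun x => wedge x c) (hnat.symm.trans hc)
    simp only [wedge_assoc] at h'
    rw [hac, wedge_one, wedge_one] at h'
    exact one_tmul_injective D.B.one_ne_zero h'
  subst hff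
  have hfW : f ∈ filtHom R.obj.X.W S.obj.X.W 0 := one_tmul_mem_tens D.A.one_ne_zero h.weight
  have hfF : f.baseChange ℂ ∈ filtHom R.obj.X.F S.obj.X.F 0 :=
    filtHom_zero_of_one_tmul D.one_notMem_F hR.isMHS hS.isMHS h.hodge'
  refine ⟨ObjectProperty.homMk ⟨mkHom f (fun i x hx => ?_) (fun i x hx => ?_), ?_⟩, rfl, rfl⟩
  · have := hfW i hx
    rwa [add_zero] at this
  · have := hfF i hx
    rwa [add_zero] at this
  · rw [PreRep.post_eq_wedge, PreRep.pre_eq_wedge]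
    exact hf.symm

/-- Both components of a morphism are constant, as flat sections over `1`-minimal models are, and
they agree because parallel transport is natural and invertible. -/
theorem Phi_full (T : Transport J) : (Phi T).Full where
  map_surjective {R S} h := by
    obtain ⟨f, hb, hb'⟩ := exists_hom_of_isHom J T (h.2 : VMHS.IsHom (PhiObj T R) (PhiObj T S)
      (VMHS.pair h).1 (VMHS.pair h).2)
    exact ⟨f, VMHS.hom_ext (Prod.ext hb.symm hb'.symm)⟩

theorem Phi_faithful (T : Transport J) : (Phi T).Faithful where
  map_injective {R S} f g h := by
    have h' := congrArg (fun x => (VMHS.pair x).1) h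
    exact ObjectProperty.hom_ext _ (PreRep.hom_ext (hom_ext
      (one_tmul_injective D.A.one_ne_zero h')))

end FullyFaithful

section EssSurj

open BifilteredSpace

/-- The inverse of an invertible morphism is compatible with the structure as soon as it is
compatible with the filtrations. -/
theorem VMHS.IsHom.inverse {x y : VMHS D} {b : D.A.carrier ⊗[K] (x.X.V →ₗ[K] y.X.V)}
    {b' : D.B.carrier ⊗[ℂ] (x.X.VC →ₗ[ℂ] y.X.VC)} (h : VMHS.IsHom x y b b')
    {c : D.A.carrier ⊗[K] (y.X.V →ₗ[K] x.X.V)} {c' : D.B.carrier ⊗[ℂ] (y.X.VC →ₗ[ℂ] x.X.VC)}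
    (hc : c ∈ tens K (D.A.gr 0) (filtHom y.X.W x.X.W 0))
    (hc' : c' ∈ tens ℂ (D.B.gr 0) (filtHom y.X.WC x.X.WC 0)) (hF : c' ∈ D.F₀ 0 y.X x.X)
    (hbc : wedge b c = 1 ⊗ₜ LinearMap.id) (hcb : wedge c b = 1 ⊗ₜ LinearMap.id)
    (hbc' : wedge b' c' = 1 ⊗ₜ LinearMap.id) (hcb' : wedge c' b' = 1 ⊗ₜ LinearMap.id) :
    VMHS.IsHom y x c c' where
  weight := hc
  flat := covD_inverse hc hbc hcb h.flat
  weight' := hc'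
  hodge' := hF
  flat' := covD_inverse hc' hbc' hcb' h.flat'
  comm := by
    have h1 := congrArg (fun u => wedge c' (wedge u (D.ιForm c))) h.comm
    have h2 : wedge (D.ιForm b) (D.ιForm c) = 1 ⊗ₜ LinearMap.id := by
      rw [← VMHS.ιForm_wedge, hbc, VMHS.ιForm_one_tmul, baseChange_id]
    simp only [wedge_assoc, h2, wedge_one] at h1
    rw [h1, ← wedge_assoc, hcb', one_wedge]

/-- An isomorphism of variations from a pair of mutually inverse morphisms. -/
def VMHS.mkIso {x y : VMHS D} {b : D.A.carrier ⊗[K] (x.X.V →ₗ[K] y.X.V)}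
    {b' : D.B.carrier ⊗[ℂ] (x.X.VC →ₗ[ℂ] y.X.VC)} (h : VMHS.IsHom x y b b')
    {c : D.A.carrier ⊗[K] (y.X.V →ₗ[K] x.X.V)} {c' : D.B.carrier ⊗[ℂ] (y.X.VC →ₗ[ℂ] x.X.VC)}
    (k : VMHS.IsHom y x c c')
    (hbc : wedge b c = 1 ⊗ₜ LinearMap.id) (hcb : wedge c b = 1 ⊗ₜ LinearMap.id)
    (hbc' : wedge b' c' = 1 ⊗ₜ LinearMap.id) (hcb' : wedge c' b' = 1 ⊗ₜ LinearMap.id) : x ≅ y where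
  hom := VMHS.mkHom h
  inv := VMHS.mkHom k
  hom_inv_id := VMHS.hom_ext (Prod.ext hcb hcb')
  inv_hom_id := VMHS.hom_ext (Prod.ext hbc hbc')

variable (J : CanonicalIso ℳ 𝒩 C)

/-- A flat unipotent gauge transformation between forms coming from `N` is constant. -/
theorem exists_const_of_unipotent_flat {X : BifilteredSpace K} (hX : isMHS K X)
    {Ω₁ Ω₂ : 𝒩.N.carrier ⊗[ℂ] (X.VC →ₗ[ℂ] X.VC)}
    (hΩ₁ : Ω₁ ∈ tens ℂ (𝒩.N.gr 1) (filtHom X.WC X.WC (-1)))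
    (hΩ₂ : Ω₂ ∈ tens ℂ (𝒩.N.gr 1) (filtHom X.WC X.WC (-1)))
    (mc₁ : dForm 𝒩.N Ω₁ + wedge Ω₁ Ω₁ = 0) (mc₂ : dForm 𝒩.N Ω₂ + wedge Ω₂ Ω₂ = 0)
    {c : D.B.carrier ⊗[ℂ] (X.VC →ₗ[ℂ] X.VC)}
    (hc : c - 1 ⊗ₜ LinearMap.id ∈ tens ℂ (D.B.gr 0) (filtHom X.WC X.WC (-1)))
    (hflat : covD D.B (mapForm 𝒩.ψ.toLinearMap Ω₁) (mapForm 𝒩.ψ.toLinearMap Ω₂) c = 0) :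
    ∃ f f₁ : X.VC →ₗ[ℂ] X.VC, c = 1 ⊗ₜ f ∧ wedge Ω₂ (1 ⊗ₜ f) = wedge (1 ⊗ₜ f) Ω₁ ∧
      f - LinearMap.id ∈ filtHom X.WC X.WC (-1) ∧ f₁ - LinearMap.id ∈ filtHom X.WC X.WC (-1) ∧
      f ∘ₗ f₁ = LinearMap.id ∧ f₁ ∘ₗ f = LinearMap.id := by
  obtain ⟨n, e, t, h, -⟩ := exists_hodge_basis hX
  have h0 := filtHom_zero_of_unipotent (WC_mono X) hc
  obtain ⟨c₁, hc₁, -, hcc₁, hc₁c⟩ := exists_unipotent_inverse_form h (fun _ _ => D.B.gr 0)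
      (fun _ _ => le_rfl) (fun _ => D.B.one_mem) (fun _ _ _ => D.B.mul_mem_gr_zero) hc
      (toMat_mem h0)
  have h0' := filtHom_zero_of_unipotent (WC_mono X) hc₁
  have hflat₁ := covD_inverse h0' hcc₁ hc₁c hflat
  obtain ⟨f, rfl, hf⟩ := exists_const_of_covD_eq_zero 𝒩.quasiIso.inj₁
    (fun x hx => 𝒩.canonical.gr_zero hx) h h hΩ₁ hΩ₂ mc₁ mc₂ h0 hflat
  obtain ⟨f₁, rfl, -⟩ := exists_const_of_covD_eq_zero 𝒩.quasiIso.inj₁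
    (fun x hx => 𝒩.canonical.gr_zero hx) h h hΩ₂ hΩ₁ mc₂ mc₁ h0' hflat₁
  rw [← tmul_sub] at hc hc₁
  rw [wedge_tmul, one_mul] at hcc₁ hc₁c
  exact ⟨f, f₁, rfl, hf, one_tmul_mem_tens D.B.one_ne_zero hc,
    one_tmul_mem_tens D.B.one_ne_zero hc₁, one_tmul_injective D.B.one_ne_zero hcc₁,
    one_tmul_injective D.B.one_ne_zero hc₁c⟩

/-- The representation on the twist of `X` by `f`, when `f` transforms the form `ℐ⁻¹Ω` into one
compatible with the Hodge filtration. -/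
theorem isHodgeRep_twist {X : BifilteredSpace K} {Ω : ℳ.M.carrier ⊗[K] (X.V →ₗ[K] X.V)}
    (hR : IsUnipotentRep (⟨X, Ω⟩ : PreRep ℳ.M)) {Ω' : 𝒩.N.carrier ⊗[ℂ] (X.VC →ₗ[ℂ] X.VC)}
    (hΩ' : Ω' ∈ ⨆ r : ℤ, tens ℂ (𝒩.F₁ r) (filtHom X.F X.F (-r))) {f f₁ : X.VC →ₗ[ℂ] X.VC}
    (hf : wedge Ω' (1 ⊗ₜ f) = wedge (1 ⊗ₜ f) (J.form ⟨X, Ω⟩))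
    (hfW : f - LinearMap.id ∈ filtHom X.WC X.WC (-1))
    (hfW₁ : f₁ - LinearMap.id ∈ filtHom X.WC X.WC (-1))
    (h₁ : f ∘ₗ f₁ = LinearMap.id) (h₂ : f₁ ∘ₗ f = LinearMap.id) :
    isRep J (⟨X.twist f, Ω⟩ : PreRep ℳ.M) where
  isMHS := isMHS_twist hR.isMHS hfW hfW₁ (LinearMap.congr_fun h₁) (LinearMap.congr_fun h₂)
  weight := hR.weight
  maurerCartan := hR.maurerCartan
  hodge := by
    have h : J.form ⟨X, Ω⟩ = wedge (1 ⊗ₜ f₁) (wedge Ω' (1 ⊗ₜ f)) := by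
      rw [hf, ← wedge_assoc, wedge_tmul, h₂, one_mul, one_wedge]
    have h' : wedge (1 ⊗ₜ f₁) (wedge Ω' (1 ⊗ₜ f)) ∈ ⨆ r : ℤ, tens ℂ (𝒩.F₁ r)
        (filtHom (X.twist f).F (X.twist f).F (-r)) := by
      have h0 : wedge Ω' (1 ⊗ₜ f) ∈ ⨆ r : ℤ, tens ℂ (𝒩.F₁ r) (filtHom (X.twist f).F X.F (-r)) :=
        wedge_const_mem_iSup (Q := fun r => filtHom X.F X.F (-r))
          (Q' := fun r => filtHom (X.twist f).F X.F (-r)) (g := f)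
          (fun r g hg i v hv => hg i hv) hΩ'
      refine const_wedge_mem_iSup (Q := fun r => filtHom (X.twist f).F X.F (-r))
        (Q' := fun r => filtHom (X.twist f).F (X.twist f).F (-r)) (g := f₁)
        (fun r g hg i v hv => ?_) h0
      change f (f₁ (g v)) ∈ X.F (i + -r)
      rw [show f (f₁ (g v)) = g v from LinearMap.congr_fun h₁ (g v)]
      exact hg i hv
    exact h ▸ h'

/-- Essential surjectivity.  Gauge transformations bring `ω` to `φ(Ω)` and, compatibly with `F`,
`ω'` to `ψ(Ω')`.  The comparison of the two along `a` and the parallel transport of `Ω` is a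
constant map `f`, and the representation is `Ω` on the space with the Hodge filtration twisted by
`f`. -/
theorem exists_iso_PhiObj (T : Transport J)
    (hW : ∀ i, ∀ x ∈ D.B.gr 0, D.B.d x ∈ D.WB.W i 1 → ∃ y ∈ D.WB.W i 0, D.B.d y = D.B.d x)
    (hF : ∀ p, ∀ x ∈ D.B.gr 0, D.B.d x ∈ D.FB.F p 1 → ∃ y ∈ D.FB.F p 0, D.B.d y = D.B.d x)
    (x : VMHS D) : ∃ R : HodgeRep J, Nonempty (x ≅ PhiObj T R) := by
  have hX := x.toMHS.property
  obtain ⟨n, e, w, he⟩ := exists_weight_basis hX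
  obtain ⟨Ω, b, b₁, hΩ, -, mc, hb, -, hbf, hb₁, -, hbb₁, hb₁b⟩ :=
    ℳ.quasiIso.isGaugePair.exists_gauge_form he (fun _ => 0) x.ω_weight (toMat_mem x.ω_weight)
      x.ω_maurerCartan
  have hR : IsUnipotentRep (⟨x.X, Ω⟩ : PreRep ℳ.M) := ⟨hX, hΩ, mc⟩
  obtain ⟨a, ha, haW, haf, -⟩ := exists_isParallelTransport J hR
  obtain ⟨m, e', t, he', het⟩ := exists_hodge_basis hX
  obtain ⟨Ω', b', b₁', hΩ', hΩF, mc', hb', hbF', hbf', hb₁', hbF₁', hbb₁', hb₁b'⟩ :=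
    (𝒩.isGaugePair hW hF).exists_gauge_form he' (fun i => (t i).1) x.ω'_weight
      ((mem_iSup_hodge_iff het het (D.FB.anti 1)).1 x.ω'_hodge) x.ω'_maurerCartan
  obtain ⟨α, hα, -, haα, hαa⟩ := exists_unipotent_inverse_form he' (fun _ _ => D.B.gr 0)
      (fun _ _ => le_rfl) (fun _ => D.B.one_mem) (fun _ _ _ => D.B.mul_mem_gr_zero) haW
      (toMat_mem (filtHom_zero_of_unipotent (WC_mono x.X) haW))
  have hα0 := filtHom_zero_of_unipotent (WC_mono x.X) hα
  have hb0 := filtHom_zero_of_unipotent x.X.W_mono hb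
  have hb₁0 := filtHom_zero_of_unipotent x.X.W_mono hb₁
  have hb0' := filtHom_zero_of_unipotent (WC_mono x.X) hb'
  have hb₁0' := filtHom_zero_of_unipotent (WC_mono x.X) hb₁'
  have hιb₁ := D.ιForm_unipotent hb₁
  have hιb₁0 := filtHom_zero_of_unipotent (WC_mono x.X) hιb₁
  have hxa0 := filtHom_zero_of_unipotent (WC_mono x.X) x.a_weight
  -- compare the two gauge transformations along the parallel transports
  have hcW := unipotent_wedge (WC_mono x.X) hb'
    (unipotent_wedge (WC_mono x.X) x.a_weight (unipotent_wedge (WC_mono x.X) hιb₁ hα))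
  have hcf : covD D.B (formB J ⟨x.X, Ω⟩) (mapForm 𝒩.ψ.toLinearMap Ω')
      (wedge b' (wedge x.a (wedge (D.ιForm b₁) α))) = 0 := by
    rw [covD_wedge D.B (ω₂ := x.ω') hb0', hbf', zero_wedge, zero_add,
      covD_wedge D.B (ω₂ := D.ιForm x.ω) hxa0, x.a_flat, zero_wedge, zero_add,
      covD_wedge D.B (ω₂ := D.ιForm (formA ⟨x.X, Ω⟩)) hιb₁0,
      show covD D.B (D.ιForm (formA ⟨x.X, Ω⟩)) (D.ιForm x.ω) (D.ιForm b₁) = 0 from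
        D.ιForm_covD (covD_inverse hb₁0 hbb₁ hb₁b hbf), zero_wedge, zero_add,
      covD_inverse hα0 haα hαa haf, wedge_zero, wedge_zero, wedge_zero]
  obtain ⟨f, f₁, hcf', hff, hfW, hfW₁, h₁, h₂⟩ := exists_const_of_unipotent_flat hX
    (hR.form_weight J) hΩ' (hR.form_maurerCartan J) mc' hcW hcf
  have hrep := isHodgeRep_twist J hR ((mem_iSup_hodge_iff het het (𝒩.FN_anti 1)).2 hΩF) hff hfW
    hfW₁ h₁ h₂
  let R : HodgeRep J := ⟨⟨x.X.twist f, Ω⟩, hrep⟩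
  -- the parallel transport depends only on `Ω` and the weight filtration
  have haT : T.a R = a := by
    have h := isParallelTransport_natural J hR (isUnipotentRep J R) (F := LinearMap.id)
      (by rw [one_wedge, wedge_one]; rfl) ha (T.isParallelTransport R)
    rwa [one_wedge, wedge_one] at h
  have hf0 : ∀ {g : x.X.VC →ₗ[ℂ] x.X.VC}, g - LinearMap.id ∈ filtHom x.X.WC x.X.WC (-1) →
      (1 : D.B.carrier) ⊗ₜ[ℂ] g ∈ tens ℂ (D.B.gr 0) (filtHom x.X.WC x.X.WC 0) := fun hg =>
    filtHom_zero_of_unipotent (WC_mono x.X) (by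
      rw [← tmul_sub]; exact tmul_mem_tens D.B.one_mem hg)
  have hff₁ : wedge ((1 : D.B.carrier) ⊗ₜ[ℂ] f) (1 ⊗ₜ f₁) = 1 ⊗ₜ LinearMap.id := by
    rw [wedge_tmul, h₁, one_mul]
  have hf₁f : wedge ((1 : D.B.carrier) ⊗ₜ[ℂ] f₁) (1 ⊗ₜ f) = 1 ⊗ₜ LinearMap.id := by
    rw [wedge_tmul, h₂, one_mul]
  have hbF : b' ∈ D.F₀ 0 x.X x.X := (mem_iSup_hodge_iff het het (D.FB.anti 0)).2 hbF'
  have hb₁F : b₁' ∈ D.F₀ 0 x.X x.X := (mem_iSup_hodge_iff het het (D.FB.anti 0)).2 hbF₁'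
  have hleft : wedge (wedge (1 ⊗ₜ f₁) b') (wedge b₁' (1 ⊗ₜ f)) = 1 ⊗ₜ LinearMap.id := by
    rw [wedge_assoc, ← wedge_assoc b', hbb₁', one_wedge, hf₁f]
  have hright : wedge (wedge b₁' (1 ⊗ₜ f)) (wedge (1 ⊗ₜ f₁) b') = 1 ⊗ₜ LinearMap.id := by
    rw [wedge_assoc, ← wedge_assoc (1 ⊗ₜ f), hff₁, one_wedge, hb₁b']
  have hhom : VMHS.IsHom x (PhiObj T R) b (wedge (1 ⊗ₜ f₁) b') := by
    refine ⟨hb0, hbf, VMHS.wedge_weight D.B (hf0 hfW₁) hb0', ?_, ?_, ?_⟩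
    · refine const_wedge_mem_iSup (Q := fun r => filtHom x.X.F x.X.F (-r))
        (Q' := fun r => filtHom x.X.F (x.X.twist f).F (-r)) (g := f₁)
        (fun r g hg i v hv => ?_) hbF
      change f (f₁ (g v)) ∈ x.X.F (i + -r)
      rw [show f (f₁ (g v)) = g v from LinearMap.congr_fun h₁ (g v)]
      exact hg i hv
    · rw [hcf'] at hcf
      change covD D.B x.ω' (formB J ⟨x.X, Ω⟩) (wedge (1 ⊗ₜ f₁) b') = 0
      rw [covD_wedge D.B (ω₂ := mapForm 𝒩.ψ.toLinearMap Ω') (hf0 hfW₁), hbf', wedge_zero, add_zero,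
        covD_inverse (hf0 hfW₁) hff₁ hf₁f hcf, zero_wedge]
    · change wedge (T.a R) (D.ιForm b) = wedge (wedge (1 ⊗ₜ f₁) b') x.a
      rw [haT]
      have h := congrArg (fun u => wedge (1 ⊗ₜ f₁) (wedge u (wedge a (D.ιForm b)))) hcf'
      have hb1 : wedge (D.ιForm b₁) (D.ιForm b) = 1 ⊗ₜ LinearMap.id := by
        rw [← VMHS.ιForm_wedge, hb₁b, VMHS.ιForm_one_tmul, baseChange_id]
      have hαa' : wedge α (wedge a (D.ιForm b)) = D.ιForm b := by
        rw [← wedge_assoc, hαa, one_wedge]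
      simp only [wedge_assoc, hαa', hb1, wedge_one] at h
      rw [← wedge_assoc (1 ⊗ₜ f₁) (1 ⊗ₜ f), hf₁f, one_wedge] at h
      rw [← h, wedge_assoc]
  have hinv : VMHS.IsHom (PhiObj T R) x b₁ (wedge b₁' (1 ⊗ₜ f)) :=
    hhom.inverse hb₁0 (VMHS.wedge_weight D.B hb₁0' (hf0 hfW))
      (wedge_const_mem_iSup (Q := fun r => filtHom x.X.F x.X.F (-r))
        (Q' := fun r => filtHom (x.X.twist f).F x.X.F (-r)) (g := f)
        (fun r g hg i v hv => hg i hv) hb₁F) hbb₁ hb₁b hleft hright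
  exact ⟨R, ⟨VMHS.mkIso hhom hinv hbb₁ hb₁b hleft hright⟩⟩

theorem Phi_isEquivalence (T : Transport J)
    (hW : ∀ i, ∀ x ∈ D.B.gr 0, D.B.d x ∈ D.WB.W i 1 → ∃ y ∈ D.WB.W i 0, D.B.d y = D.B.d x)
    (hF : ∀ p, ∀ x ∈ D.B.gr 0, D.B.d x ∈ D.FB.F p 1 → ∃ y ∈ D.FB.F p 0, D.B.d y = D.B.d x) :
    (Phi T).IsEquivalence where
  faithful := Phi_faithful J T
  full := Phi_full J T
  essSurj := ⟨fun x => by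
    obtain ⟨R, ⟨e⟩⟩ := exists_iso_PhiObj J T hW hF x
    exact ⟨R, ⟨e.symm⟩⟩⟩

end EssSurj

/-! ### Weights of representations -/

section Weights

open BifilteredSpace

/-- The entries of a flat unipotent form are determined, up to closed elements, by entries closer
to the diagonal; strictness of `d` thus gives the weights by induction. -/
theorem FilteredModel.entry_mem_weight (h : ∀ x ∈ ℳ.M.gr 1, ℳ.M.d x = 0 → x ∈ ℳ.WM.W 1 1)
    {n : ℕ} {w : Fin n → ℤ} {a : Matrix (Fin n) (Fin n) ℳ.M.carrier}
    (ha : ∀ i j, a i j ∈ ℳ.M.gr 1) (ha₀ : ∀ i j, w j ≤ w i → a i j = 0)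
    (mc : a.map ℳ.M.d + a * a = 0) (m : ℕ) :
    ∀ i j, w j - w i ≤ m → a i j ∈ ℳ.WM.W (w j - w i) 1 := by
  induction m with
  | zero => intro i j hij; rw [ha₀ i j (by simpa using hij)]; exact zero_mem _
  | succ m ih =>
    intro i j hij
    by_cases hlt : w j ≤ w i
    · rw [ha₀ i j hlt]; exact zero_mem _
    have hd : ℳ.M.d (a i j) ∈ ℳ.WM.W (w j - w i) (1 + 1) := by
      have h1 := congrFun (congrFun mc i) j
      rw [Matrix.add_apply, map_apply, Matrix.zero_apply] at h1
      rw [eq_neg_of_add_eq_zero_left h1, mul_apply]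
      refine neg_mem (sum_mem fun l _ => ?_)
      by_cases hl : w l ≤ w i
      · rw [ha₀ i l hl, zero_mul]; exact zero_mem _
      by_cases hl' : w j ≤ w l
      · rw [ha₀ l j hl', mul_zero]; exact zero_mem _
      have := ℳ.WM.mul_mem _ _ _ _ _ (ih i l (by push_cast at hij; omega)) _
        (ih l j (by push_cast at hij; omega))
      rwa [show w l - w i + (w j - w l) = w j - w i by ring] at this
    -- the entry differs from `y` by a closed element, of weight one by assumption
    obtain ⟨y, hy, hyd⟩ := ℳ.strict_d (w j - w i) 1 ⟨hd, a i j, ha i j, rfl⟩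
    have hc := h (a i j - y) (sub_mem (ha i j) (ℳ.WM.le_gr _ _ hy)) (by
      rw [map_sub, hyd, sub_self])
    have := add_mem (ℳ.WM.mono 1 (show (1 : ℤ) ≤ w j - w i by omega) hc) hy
    rwa [sub_add_cancel] at this

/-- If `H¹` has weight at most one, a representation is compatible with the weight filtrations. -/
theorem mem_weight_of_closed (h : ∀ x ∈ ℳ.M.gr 1, ℳ.M.d x = 0 → x ∈ ℳ.WM.W 1 1)
    {R : PreRep ℳ.M} (hR : IsUnipotentRep R) :
    R.Ω ∈ ⨆ k : ℤ, tens K (ℳ.WM.W k 1) (filtHom R.X.W R.X.W (-k)) := by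
  obtain ⟨n, e, w, he⟩ := exists_weight_basis hR.isMHS
  have h1 : R.Ω ∈ ⨆ k : ℤ, tens K (ℳ.WM.W (-k) 1) (filtHom R.X.W R.X.W k) := by
    refine (mem_iSup_tens_iff he he (G := fun k => ℳ.WM.W (-k) 1)
      (fun _ _ hab => ℳ.WM.mono 1 (neg_le_neg hab))).2 fun i j => ?_
    rw [neg_sub]
    exact ℳ.entry_mem_weight h (toMat_mem hR.weight) (toMat_eq_zero he hR.weight)
      (toMat_maurerCartan.1 hR.maurerCartan) (w j - w i).toNat i j (Int.self_le_toNat _)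
  refine (iSup_le fun k => ?_ : (⨆ k : ℤ, tens K (ℳ.WM.W (-k) 1) (filtHom R.X.W R.X.W k)) ≤ _) h1
  refine le_trans (le_of_eq ?_) (le_iSup _ (-k))
  rw [neg_neg]

end Weights

/-! ### Subobjects, quotients and products of mixed Hodge structures -/

namespace BifilteredSpace

variable {X Y : BifilteredSpace K} {V : Type u} [AddCommGroup V] [Module K V]
  [FiniteDimensional K V]

/-- The filtrations induced along a linear map to `X`. -/
abbrev sub (X : BifilteredSpace K) (j : V →ₗ[K] X.V) : BifilteredSpace K where
  V := V
  W n := (X.W n).comap j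
  W_mono _ _ h := comap_mono (X.W_mono h)
  F p := (X.F p).comap (j.baseChange ℂ)
  F_anti _ _ h := comap_mono (X.F_anti h)

/-- The filtrations induced along a linear map from `X`. -/
abbrev quot (X : BifilteredSpace K) (q : X.V →ₗ[K] V) : BifilteredSpace K where
  V := V
  W n := (X.W n).map q
  W_mono _ _ h := map_mono (X.W_mono h)
  F p := (X.F p).map (q.baseChange ℂ)
  F_anti _ _ h := map_mono (X.F_anti h)

theorem baseChange_leftInverse {V' : Type u} [AddCommGroup V'] [Module K V'] {f : V →ₗ[K] V'}
    {g : V' →ₗ[K] V} (h : g ∘ₗ f = LinearMap.id) (x : ℂ ⊗[K] V) :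
    g.baseChange ℂ (f.baseChange ℂ x) = x := by
  rw [← LinearMap.comp_apply, ← baseChange_comp, h, baseChange_id]; rfl

/-- A subspace whose complexification is stable under the Deligne splitting, with the induced
filtrations, is a mixed Hodge structure. -/
theorem isMHS_sub (g : X.HodgeGrading) {j : V →ₗ[K] X.V} (hj : Function.Injective j)
    (hg : ∀ s x, ∃ y, j.baseChange ℂ y = g.π s (j.baseChange ℂ x)) : isMHS K (X.sub j) := by
  obtain ⟨r, hr⟩ := j.exists_leftInverse_of_injective (LinearMap.ker_eq_bot.2 hj)
  have hjr : ∀ s x, j.baseChange ℂ (r.baseChange ℂ (g.π s (j.baseChange ℂ x))) =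
      g.π s (j.baseChange ℂ x) := fun s x => by
    obtain ⟨y, hy⟩ := hg s x
    rw [← hy, baseChange_leftInverse hr]
  have hinj : ∀ x, j.baseChange ℂ x = 0 ↔ x = 0 := fun x =>
    ⟨fun h => by rw [← baseChange_leftInverse hr x, h, map_zero], fun h => by rw [h, map_zero]⟩
  have hz : ∀ s x, r.baseChange ℂ (g.π s (j.baseChange ℂ x)) = 0 ↔ g.π s (j.baseChange ℂ x) = 0 :=
    fun s x => by rw [← hinj, hjr]
  refine HodgeGrading.isMHS (X := X.sub j)
    { π := fun s => r.baseChange ℂ ∘ₗ g.π s ∘ₗ j.baseChange ℂ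
      S := g.S
      sum := fun x => ?_
      orth := fun s t x => ?_
      mem_W := fun n x => ?_
      mem_F := fun p x => (g.mem_F p _).trans (forall₂_congr fun s _ => (hz s x).symm)
      conj := fun s t x hst hne => ?_ }
  · have := congrArg (r.baseChange ℂ) (g.sum (j.baseChange ℂ x))
    rwa [map_sum, baseChange_leftInverse hr] at this
  · simp only [LinearMap.comp_apply]
    rw [hjr, g.orth]
    split_ifs
    · rfl
    · rw [map_zero]
  · rw [WC, baseChange_comap]
    exact (g.mem_W n _).trans (forall₂_congr fun s _ => (hz s x).symm)
  · simp only [LinearMap.comp_apply]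
    rw [hz, ← conjC_baseChange, hjr, g.conj s t _ hst hne]

/-- A quotient by a subspace whose complexification is stable under the Deligne splitting, with
the induced filtrations, is a mixed Hodge structure. -/
theorem isMHS_quot (g : X.HodgeGrading) {q : X.V →ₗ[K] V} (hq : Function.Surjective q)
    (hg : ∀ s x, q.baseChange ℂ x = 0 → q.baseChange ℂ (g.π s x) = 0) : isMHS K (X.quot q) := by
  obtain ⟨r, hr⟩ := q.exists_rightInverse_of_surjective (LinearMap.range_eq_top.2 hq)
  have hrq : ∀ s x, q.baseChange ℂ (g.π s (r.baseChange ℂ (q.baseChange ℂ x))) =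
      q.baseChange ℂ (g.π s x) := fun s x => by
    rw [← sub_eq_zero, ← map_sub, ← map_sub]
    exact hg s _ (by rw [map_sub, baseChange_leftInverse hr, sub_self])
  have hmem : ∀ (P : Submodule ℂ X.VC) (T : ℤ × ℤ → Prop), (∀ s, ¬ T s → ∀ x, g.π s x ∈ P) →
      (∀ x, x ∈ P ↔ ∀ s, T s → g.π s x = 0) → ∀ y, y ∈ P.map (q.baseChange ℂ) ↔
        ∀ s, T s → q.baseChange ℂ (g.π s (r.baseChange ℂ y)) = 0 := by
    refine fun P T hT hP y => ⟨?_, fun h => ?_⟩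
    · rintro ⟨x, hx, rfl⟩ s hs
      rw [hrq, (hP x).1 hx s hs, map_zero]
    · have hy := congrArg (q.baseChange ℂ) (g.sum (r.baseChange ℂ y))
      rw [baseChange_leftInverse hr, map_sum] at hy
      rw [← hy]
      refine sum_mem fun s _ => ?_
      by_cases hs : T s
      · rw [h s hs]; exact zero_mem _
      · exact ⟨_, hT s hs _, rfl⟩
  refine HodgeGrading.isMHS (X := X.quot q)
    { π := fun s => q.baseChange ℂ ∘ₗ g.π s ∘ₗ r.baseChange ℂ
      S := g.S
      sum := fun x => ?_
      orth := fun s t x => ?_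
      mem_W := fun n x => ?_
      mem_F := fun p x => hmem _ (fun s => s.1 < p) (fun s hs => g.π_mem_F (not_lt.1 hs))
        (g.mem_F p) x
      conj := fun s t x hst hne => ?_ }
  · have := congrArg (q.baseChange ℂ) (g.sum (r.baseChange ℂ x))
    rwa [map_sum, baseChange_leftInverse hr] at this
  · simp only [LinearMap.comp_apply]
    rw [hrq, g.orth]
    split_ifs
    · rfl
    · rw [map_zero]
  · rw [WC, baseChange_map]
    exact hmem _ (fun s => n < s.1 + s.2) (fun s hs => g.π_mem_W (not_lt.1 hs)) (g.mem_W n) x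
  · simp only [LinearMap.comp_apply]
    rw [conjC_baseChange, hrq, g.conj s t _ hst hne, map_zero]

/-- Morphisms of mixed Hodge structures commute with the projections of the Deligne splittings. -/
theorem exists_gradings (hX : isMHS K X) (hY : isMHS K Y) :
    ∃ (g : X.HodgeGrading) (g' : Y.HodgeGrading), ∀ (f : X ⟶ Y) s x,
      (lin f).baseChange ℂ (g.π s x) = g'.π s ((lin f).baseChange ℂ x) := by
  obtain ⟨g, hg, hg₁⟩ := exists_deligneGrading hX
  obtain ⟨g', hg', hg₁'⟩ := exists_deligneGrading hY
  refine ⟨g, g', fun f s x => ?_⟩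
  have h : ∀ t, g'.π s ((lin f).baseChange ℂ (g.π t x)) =
      if s = t then (lin f).baseChange ℂ (g.π t x) else 0 := fun t => by
    have := hg₁' t _ (lin_deligne f (hg t x))
    rw [← this, g'.orth]
  have hs := congrArg (fun y => g'.π s ((lin f).baseChange ℂ y)) (g.sum x)
  simp only [map_sum, h] at hs
  rw [← hs, Finset.sum_ite_eq]
  split_ifs with hS
  · rfl
  · rw [g.π_eq_zero hS, map_zero]

/-- Morphisms of mixed Hodge structures are strictly compatible with the weight filtrations. -/
theorem mem_W_of_injective (hX : isMHS K X) (hY : isMHS K Y) {f : X ⟶ Y}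
    (hf : Function.Injective (lin f)) {n : ℤ} {x : X.V} (h : lin f x ∈ Y.W n) : x ∈ X.W n := by
  obtain ⟨g, g', hg⟩ := exists_gradings hX hY
  obtain ⟨r, hr⟩ := (lin f).exists_leftInverse_of_injective (LinearMap.ker_eq_bot.2 hf)
  rw [← one_tmul_mem_baseChange (L := ℂ)]
  change _ ∈ X.WC n
  rw [g.mem_W]
  intro s hs
  rw [← baseChange_leftInverse hr (g.π s _), hg, baseChange_tmul,
    (g'.mem_W n _).1 (tmul_mem_baseChange_of_mem 1 h) s hs, map_zero]

/-- Morphisms of mixed Hodge structures are strictly compatible with the Hodge filtrations. -/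
theorem mem_F_of_injective (hX : isMHS K X) (hY : isMHS K Y) {f : X ⟶ Y}
    (hf : Function.Injective (lin f)) {p : ℤ} {x : X.VC} (h : (lin f).baseChange ℂ x ∈ Y.F p) :
    x ∈ X.F p := by
  obtain ⟨g, g', hg⟩ := exists_gradings hX hY
  obtain ⟨r, hr⟩ := (lin f).exists_leftInverse_of_injective (LinearMap.ker_eq_bot.2 hf)
  rw [g.mem_F]
  intro s hs
  rw [← baseChange_leftInverse hr (g.π s _), hg, (g'.mem_F p _).1 h s hs, map_zero]

/-- A bijective morphism of mixed Hodge structures is an isomorphism. -/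
def isoOfBijective (hX : isMHS K X) (hY : isMHS K Y) (f : X ⟶ Y)
    (hf : Function.Bijective (lin f)) : X ≅ Y :=
  mkIso (LinearEquiv.ofBijective (lin f) hf) (fun _ _ h => lin_W f h)
    (fun n y hy => mem_W_of_injective hX hY hf.1 (by
      rwa [LinearEquiv.coe_coe, ← LinearEquiv.ofBijective_apply (lin f) (hf := hf),
        LinearEquiv.apply_symm_apply]))
    (fun _ _ h => lin_F f h)
    (fun p y hy => mem_F_of_injective hX hY hf.1 (by
      have h : lin f ∘ₗ (LinearEquiv.ofBijective (lin f) hf).symm.toLinearMap = LinearMap.id :=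
        LinearMap.ext (LinearEquiv.ofBijective (lin f) hf).apply_symm_apply
      rwa [baseChange_leftInverse h]))

/-- The product of two bifiltered spaces. -/
abbrev prod (X Y : BifilteredSpace K) : BifilteredSpace K where
  V := X.V × Y.V
  W n := (X.W n).comap (LinearMap.fst K X.V Y.V) ⊓ (Y.W n).comap (LinearMap.snd K X.V Y.V)
  W_mono _ _ h := inf_le_inf (comap_mono (X.W_mono h)) (comap_mono (Y.W_mono h))
  F p := (X.F p).comap ((LinearMap.fst K X.V Y.V).baseChange ℂ) ⊓
    (Y.F p).comap ((LinearMap.snd K X.V Y.V).baseChange ℂ)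
  F_anti _ _ h := inf_le_inf (comap_mono (X.F_anti h)) (comap_mono (Y.F_anti h))

/-- Direct sums of mixed Hodge structures. -/
theorem isMHS_prod (hX : isMHS K X) (hY : isMHS K Y) : isMHS K (X.prod Y) := by
  obtain ⟨g, -⟩ := exists_deligneGrading hX
  obtain ⟨g', -⟩ := exists_deligneGrading hY
  set p₁ := (LinearMap.fst K X.V Y.V).baseChange ℂ with hp₁
  set p₂ := (LinearMap.snd K X.V Y.V).baseChange ℂ with hp₂
  set i₁ := (LinearMap.inl K X.V Y.V).baseChange ℂ with hi₁
  set i₂ := (LinearMap.inr K X.V Y.V).baseChange ℂ with hi₂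
  have h₁₁ : ∀ x, p₁ (i₁ x) = x := baseChange_leftInverse (LinearMap.fst_comp_inl K X.V Y.V)
  have h₂₂ : ∀ x, p₂ (i₂ x) = x := baseChange_leftInverse (LinearMap.snd_comp_inr K X.V Y.V)
  have h₁₂ : ∀ x, p₁ (i₂ x) = 0 := fun x => by
    rw [hp₁, hi₂, ← LinearMap.comp_apply, ← baseChange_comp, LinearMap.fst_comp_inr,
      baseChange_zero]; rfl
  have h₂₁ : ∀ x, p₂ (i₁ x) = 0 := fun x => by
    rw [hp₂, hi₁, ← LinearMap.comp_apply, ← baseChange_comp, LinearMap.snd_comp_inl,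
      baseChange_zero]; rfl
  have hsum : ∀ x, i₁ (p₁ x) + i₂ (p₂ x) = x := fun x => by
    rw [hp₁, hp₂, hi₁, hi₂, ← LinearMap.comp_apply, ← LinearMap.comp_apply,
      ← baseChange_comp, ← baseChange_comp, ← LinearMap.add_apply,
      ← LinearMap.baseChange_add, show LinearMap.inl K X.V Y.V ∘ₗ LinearMap.fst K X.V Y.V +
        LinearMap.inr K X.V Y.V ∘ₗ LinearMap.snd K X.V Y.V = LinearMap.id from
        LinearMap.ext fun y => by simp, baseChange_id]; rfl
  have hz : ∀ u v, i₁ u + i₂ v = 0 ↔ u = 0 ∧ v = 0 := fun u v => by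
    refine ⟨fun h => ⟨?_, ?_⟩, fun h => by rw [h.1, h.2, map_zero, map_zero, add_zero]⟩
    · simpa [h₁₁, h₁₂] using congrArg p₁ h
    · simpa [h₂₂, h₂₁] using congrArg p₂ h
  refine HodgeGrading.isMHS (X := X.prod Y)
    { π := fun s => i₁ ∘ₗ g.π s ∘ₗ p₁ + i₂ ∘ₗ g'.π s ∘ₗ p₂
      S := g.S ∪ g'.S
      sum := fun x => ?_
      orth := fun s t x => ?_
      mem_W := fun n x => ?_
      mem_F := fun p x => ?_
      conj := fun s t x hst hne => ?_ }
  · simp only [LinearMap.add_apply, LinearMap.comp_apply, sum_add_distrib, ← map_sum]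
    rw [← Finset.sum_subset Finset.subset_union_left fun s _ hs => g.π_eq_zero hs _,
      ← Finset.sum_subset Finset.subset_union_right fun s _ hs => g'.π_eq_zero hs _, g.sum, g'.sum,
      hsum]
  · simp only [LinearMap.add_apply, LinearMap.comp_apply, map_add, h₁₁, h₁₂, h₂₁, h₂₂, map_zero,
      add_zero, zero_add, g.orth, g'.orth]
    split_ifs <;> simp
  · rw [WC, baseChange_inf, baseChange_comap, baseChange_comap]
    simp only [LinearMap.add_apply, LinearMap.comp_apply, hz]
    rw [Submodule.mem_inf, mem_comap, mem_comap]
    refine (and_congr (g.mem_W n _) (g'.mem_W n _)).trans ?_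
    exact ⟨fun h s hs => ⟨h.1 s hs, h.2 s hs⟩, fun h => ⟨fun s hs => (h s hs).1,
      fun s hs => (h s hs).2⟩⟩
  · simp only [LinearMap.add_apply, LinearMap.comp_apply, hz]
    refine (and_congr (g.mem_F p _) (g'.mem_F p _)).trans ?_
    exact ⟨fun h s hs => ⟨h.1 s hs, h.2 s hs⟩, fun h => ⟨fun s hs => (h s hs).1,
      fun s hs => (h s hs).2⟩⟩
  · simp only [LinearMap.add_apply, LinearMap.comp_apply]
    rw [hz, map_add]
    simp only [hi₁, hi₂, conjC_baseChange]
    simp only [← hi₁, ← hi₂, map_add, h₁₁, h₁₂, h₂₁, h₂₂, add_zero, zero_add]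
    exact ⟨g.conj s t _ hst hne, g'.conj s t _ hst hne⟩

end BifilteredSpace

/-! ### Duals of mixed Hodge structures -/

section DualSpace

variable {V : Type u} [AddCommGroup V] [Module K V] [FiniteDimensional K V]

/-- The complexification of the dual space is the dual of the complexification. -/
def dualC (V : Type u) [AddCommGroup V] [Module K V] [FiniteDimensional K V] :
    ℂ ⊗[K] Module.Dual K V ≃ₗ[ℂ] Module.Dual ℂ (ℂ ⊗[K] V) :=
  (TensorProduct.isBaseChange K V ℂ).toDualBaseChange

theorem dualC_tmul (c : ℂ) (φ : Module.Dual K V) (d : ℂ) (v : V) :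
    dualC V (c ⊗ₜ φ) (d ⊗ₜ v) = c * d * algebraMap K ℂ (φ v) := by
  have h := (TensorProduct.isBaseChange K V ℂ).toDualBaseChange_tmul c φ v
  have hd : d ⊗ₜ[K] v = d • TensorProduct.mk K ℂ V 1 v := by
    rw [TensorProduct.mk_apply, smul_tmul', smul_eq_mul, mul_one]
  rw [dualC, hd, map_smul, h, smul_eq_mul]
  ring

theorem dualC_conjC (ξ : ℂ ⊗[K] Module.Dual K V) (x : ℂ ⊗[K] V) :
    dualC V (conjC K _ ξ) (conjC K V x) = starRingEnd ℂ (dualC V ξ x) := by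
  induction ξ using induction_on with
  | zero => simp
  | add ξ η hξ hη => simp only [map_add, LinearMap.add_apply, hξ, hη]
  | tmul c φ =>
    induction x using induction_on with
    | zero => simp
    | add x y hx hy => simp only [map_add, hx, hy]
    | tmul d v =>
      have h : ∀ r : K, starRingEnd ℂ (algebraMap K ℂ r) = algebraMap K ℂ r := fun r =>
        Complex.conj_ofReal _
      simp only [conjC_tmul, dualC_tmul, map_mul, h]

theorem apply_dualC (θ : ℂ →ₗ[K] K) (ξ : ℂ ⊗[K] Module.Dual K V) (v : V) :
    θ (dualC V ξ (1 ⊗ₜ v)) = slice θ ξ v := by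
  induction ξ using induction_on with
  | zero => simp
  | add ξ η hξ hη => simp only [map_add, LinearMap.add_apply, hξ, hη]
  | tmul c φ =>
    rw [dualC_tmul, slice_tmul, mul_one, mul_comm, ← Algebra.smul_def, map_smul,
      LinearMap.smul_apply, smul_eq_mul, smul_eq_mul, mul_comm]

theorem mem_baseChange_dualAnnihilator {P : Submodule K V} {ξ : ℂ ⊗[K] Module.Dual K V} :
    ξ ∈ P.dualAnnihilator.baseChange ℂ ↔ ∀ x ∈ P.baseChange ℂ, dualC V ξ x = 0 := by
  have h : (∀ x ∈ P.baseChange ℂ, dualC V ξ x = 0) ↔ ∀ v ∈ P, dualC V ξ (1 ⊗ₜ v) = 0 := by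
    refine ⟨fun h v hv => h _ (tmul_mem_baseChange_of_mem 1 hv), fun h => ?_⟩
    change P.baseChange ℂ ≤ LinearMap.ker (dualC V ξ)
    rw [baseChange_eq_span, span_le]
    rintro _ ⟨v, hv, rfl⟩
    exact h v hv
  rw [h, mem_baseChange_iff]
  simp only [mem_dualAnnihilator, ← apply_dualC]
  exact ⟨fun h v hv => (Module.forall_dual_apply_eq_zero_iff K _).1 fun θ => h θ v hv,
    fun h θ v hv => by rw [h v hv, map_zero]⟩

theorem contractLeft_cxMul (ξ : ℂ ⊗[K] Module.Dual K V) (x : ℂ ⊗[K] V) :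
    (contractLeft K V).baseChange ℂ (cxMul K _ _ ξ x) = dualC V ξ x ⊗ₜ 1 := by
  induction ξ using induction_on with
  | zero => simp
  | add ξ η hξ hη => simp only [map_add, LinearMap.add_apply, add_tmul, hξ, hη]
  | tmul c φ =>
    induction x using induction_on with
    | zero => simp
    | add x y hx hy => simp only [map_add, add_tmul, hx, hy]
    | tmul d v =>
      rw [cxMul_tmul, baseChange_tmul, contractLeft_apply, dualC_tmul,
        mul_comm (c * d) (algebraMap K ℂ (φ v)), ← Algebra.smul_def, smul_tmul,
        smul_eq_mul, mul_one]

theorem sum_dualC_smul {ι : Type*} [Fintype ι] (b : Module.Basis ι K V)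
    (ξ : ℂ ⊗[K] Module.Dual K V) :
    ∑ i, dualC V ξ (1 ⊗ₜ b i) • ((1 : ℂ) ⊗ₜ[K] b.coord i) = ξ := by
  induction ξ using induction_on with
  | zero => simp
  | add ξ η hξ hη => simp only [map_add, LinearMap.add_apply, add_smul, sum_add_distrib, hξ,
      hη]
  | tmul c φ =>
    conv_rhs => rw [← b.sum_dual_apply_smul_coord φ, tmul_sum]
    refine sum_congr rfl fun i _ => ?_
    rw [dualC_tmul, mul_one, smul_tmul', smul_eq_mul, mul_one, mul_comm,
      ← Algebra.smul_def, smul_tmul]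

/-- The canonical element of `V ⊗ V*`, in terms of a basis of the complexification. -/
theorem one_tmul_coevaluation {ι : Type*} [Fintype ι]
    (e : Module.Basis ι ℂ (ℂ ⊗[K] V)) : (1 : ℂ) ⊗ₜ[K] coevaluation K V 1 =
      ∑ i, cxMul K V (Module.Dual K V) (e i) ((dualC V).symm (e.coord i)) := by
  rw [coevaluation_apply_one]
  set b := Module.Basis.ofVectorSpace K V
  rw [tmul_sum]
  have h1 : ∀ j, (1 : ℂ) ⊗ₜ[K] (b j ⊗ₜ[K] b.coord j) =
      ∑ i, e.coord i (1 ⊗ₜ b j) • cxMul K V (Module.Dual K V) (e i) (1 ⊗ₜ b.coord j) := fun j => by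
    have h2 : cxMul K V (Module.Dual K V) (1 ⊗ₜ b j) (1 ⊗ₜ b.coord j) =
        (1 : ℂ) ⊗ₜ[K] (b j ⊗ₜ[K] b.coord j) := by rw [cxMul_tmul, one_mul]
    rw [← h2]
    conv_lhs => rw [← e.sum_repr (1 ⊗ₜ b j)]
    rw [map_sum, LinearMap.sum_apply]
    exact sum_congr rfl fun i _ => by rw [map_smul, LinearMap.smul_apply]; rfl
  rw [sum_congr rfl fun j _ => h1 j, sum_comm]
  refine sum_congr rfl fun i _ => ?_
  conv_rhs => rw [← sum_dualC_smul b ((dualC V).symm (e.coord i))]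
  rw [map_sum]
  exact sum_congr rfl fun j _ => by rw [map_smul, LinearEquiv.apply_symm_apply]

theorem coevaluation_eq_sum {ι : Type*} [Fintype ι]
    (b : Module.Basis ι K V) : coevaluation K V 1 = ∑ i, b i ⊗ₜ[K] b.coord i := by
  rw [coevaluation_apply_one]
  set b' := Module.Basis.ofVectorSpace K V
  have h1 : ∀ j, b' j ⊗ₜ[K] b'.coord j =
      ∑ i, b.coord i (b' j) • (b i ⊗ₜ[K] b'.coord j) := fun j => by
    conv_lhs => rw [← b.sum_repr (b' j), sum_tmul]
    rfl
  rw [sum_congr rfl fun j _ => h1 j, sum_comm]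
  refine sum_congr rfl fun i _ => ?_
  conv_rhs => rw [← b'.sum_dual_apply_smul_coord (b.coord i), tmul_sum]
  exact sum_congr rfl fun j _ => (tmul_smul _ _ _).symm

/-- The canonical element of `V ⊗ V*` is invariant under `f ⊗ 1 - 1 ⊗ f*`. -/
theorem map_coevaluation (f : V →ₗ[K] V) :
    TensorProduct.map f LinearMap.id (coevaluation K V 1) =
      TensorProduct.map LinearMap.id f.dualMap (coevaluation K V 1) := by
  rw [coevaluation_apply_one]
  set b := Module.Basis.ofVectorSpace K V
  simp only [map_sum, TensorProduct.map_tmul, LinearMap.id_apply]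
  have h1 : ∀ j, f (b j) ⊗ₜ[K] b.coord j = ∑ i, b.coord i (f (b j)) • (b i ⊗ₜ[K] b.coord j) :=
      fun j => by
    conv_lhs => rw [← b.sum_repr (f (b j)), sum_tmul]
    rfl
  rw [sum_congr rfl fun j _ => h1 j, sum_comm]
  refine sum_congr rfl fun i _ => ?_
  rw [← b.sum_dual_apply_smul_coord (f.dualMap (b.coord i)), tmul_sum]
  exact sum_congr rfl fun j _ => (tmul_smul _ _ _).symm

end DualSpace

namespace BifilteredSpace

/-- The dual space, with `W_n V* = (W_{-n-1} V)^⊥` and `F^p V* = (F^{1-p} V)^⊥`. -/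
abbrev dual (X : BifilteredSpace K) : BifilteredSpace K where
  V := Module.Dual K X.V
  W n := (X.W (-n - 1)).dualAnnihilator
  W_mono _ _ h := Submodule.dualAnnihilator_anti (X.W_mono (by omega))
  F p := (X.F (1 - p)).dualAnnihilator.comap (dualC X.V).toLinearMap
  F_anti _ _ h := comap_mono (Submodule.dualAnnihilator_anti (X.F_anti (by omega)))

variable {X : BifilteredSpace K}

theorem mem_dual_F {p : ℤ} {ξ : ℂ ⊗[K] Module.Dual K X.V} :
    ξ ∈ X.dual.F p ↔ ∀ x ∈ X.F (1 - p), dualC X.V ξ x = 0 := by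
  rw [mem_comap, mem_dualAnnihilator]; rfl

theorem mem_dual_WC {n : ℤ} {ξ : ℂ ⊗[K] Module.Dual K X.V} :
    ξ ∈ X.dual.WC n ↔ ∀ x ∈ X.WC (-n - 1), dualC X.V ξ x = 0 := mem_baseChange_dualAnnihilator

/-- The splitting of the dual is the dual splitting, with the types negated. -/
theorem isMHS_dual (hX : isMHS K X) : isMHS K X.dual := by
  obtain ⟨g, -⟩ := exists_deligneGrading hX
  have hτ : ∀ s ξ x, dualC X.V ((dualC X.V).symm ((g.π (-s)).dualMap (dualC X.V ξ))) x =
      dualC X.V ξ (g.π (-s) x) := fun s ξ x => by rw [LinearEquiv.apply_symm_apply]; rfl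
  have hext : ∀ ξ η : ℂ ⊗[K] Module.Dual K X.V,
      (∀ x, dualC X.V ξ x = dualC X.V η x) → ξ = η := fun ξ η h =>
    (dualC X.V).injective (LinearMap.ext h)
  have hz : ∀ s ξ, (dualC X.V).symm ((g.π (-s)).dualMap (dualC X.V ξ)) = 0 ↔
      ∀ x, dualC X.V ξ (g.π (-s) x) = 0 := fun s ξ =>
    ⟨fun h x => by rw [← hτ, h, map_zero]; rfl, fun h => hext _ _ fun x => by
      rw [hτ, h, map_zero]; rfl⟩
  have hmem : ∀ (P : Submodule ℂ X.VC) (T : ℤ × ℤ → Prop), (∀ s, T s → ∀ x, g.π (-s) x ∈ P) →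
      (∀ x ∈ P, ∀ s, ¬ T s → g.π (-s) x = 0) → ∀ ξ, (∀ x ∈ P, dualC X.V ξ x = 0) ↔
        ∀ s, T s → (dualC X.V).symm ((g.π (-s)).dualMap (dualC X.V ξ)) = 0 := by
    refine fun P T hT hP ξ => ⟨fun h s hs => (hz _ _).2 fun x => h _ (hT s hs x),
      fun h x hx => ?_⟩
    rw [← g.sum x, map_sum]
    refine sum_eq_zero fun s _ => ?_
    by_cases hs : T (-s)
    · simpa using (hz _ _).1 (h _ hs) x
    · have := hP x hx _ hs
      rw [neg_neg] at this
      rw [this, map_zero]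
  refine HodgeGrading.isMHS (X := X.dual)
    { π := fun s => (dualC X.V).symm.toLinearMap ∘ₗ (g.π (-s)).dualMap ∘ₗ (dualC X.V).toLinearMap
      S := g.S.map (Equiv.neg _).toEmbedding
      sum := fun ξ => hext _ _ fun x => ?_
      orth := fun s t ξ => hext _ _ fun x => ?_
      mem_W := fun n ξ => mem_dual_WC.trans (hmem _ (fun s => n < s.1 + s.2)
        (fun s hs x => g.π_mem_W (by simp only [Prod.fst_neg, Prod.snd_neg]; omega) x)
        (fun x hx s hs => (g.mem_W _ _).1 hx _ (by
          simp only [Prod.fst_neg, Prod.snd_neg]; omega)) ξ)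
      mem_F := fun p ξ => mem_dual_F.trans (hmem _ (fun s => s.1 < p)
        (fun s hs x => g.π_mem_F (by simp only [Prod.fst_neg]; omega) x)
        (fun x hx s hs => (g.mem_F _ _).1 hx _ (by simp only [Prod.fst_neg]; omega)) ξ)
      conj := fun s t ξ hst hne => (hz _ _).2 fun x => ?_ }
  · rw [Finset.sum_map, map_sum, LinearMap.sum_apply]
    simp only [LinearMap.comp_apply, LinearEquiv.coe_coe, Equiv.coe_toEmbedding, Equiv.neg_apply,
      neg_neg]
    simp only [LinearEquiv.apply_symm_apply, LinearMap.dualMap_apply]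
    rw [← map_sum, g.sum]
  · simp only [LinearMap.comp_apply, LinearEquiv.coe_coe, hτ, g.orth, neg_inj]
    by_cases h : s = t
    · subst h; rw [if_pos rfl, if_pos rfl, hτ]
    · rw [if_neg h, if_neg (Ne.symm h), map_zero, map_zero]; rfl
  · simp only [LinearMap.comp_apply, LinearEquiv.coe_coe]
    rw [← conjC_conjC (g.π (-t) x), dualC_conjC, hτ, ← conjC_conjC x,
      g.conj (-t) (-s) (conjC K X.V (conjC K X.V x)) (by
        simp only [Prod.fst_neg, Prod.snd_neg]; omega) (fun h => hne (by
        simp only [Prod.ext_iff, Prod.fst_neg, Prod.snd_neg, Prod.fst_swap, Prod.snd_swap,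
          neg_inj] at h ⊢
        exact ⟨h.2.symm, h.1.symm⟩)), map_zero, map_zero]

/-- The evaluation `V* ⊗ V → K`. -/
def ev (X : BifilteredSpace K) : X.dual ⊗ X ⟶ 𝟙_ (BifilteredSpace K) :=
  mkHom (X := tensor X.dual X) (Y := unit) (contractLeft K X.V)
    (fun n => by
      change tensW X.dual X n ≤ ((unit (K := K)).W n).comap (contractLeft K X.V)
      refine tensW_le fun i j h φ hφ x hx => ?_
      by_cases hn : 0 ≤ n
      · rw [show (unit (K := K)).W n = ⊤ from if_pos hn]; trivial
      · rw [mem_comap, contractLeft_apply, (mem_dualAnnihilator φ).1 hφ x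
          (X.W_mono (by omega) hx)]
        exact zero_mem _)
    (fun p => by
      change tensF X.dual X p ≤ ((unit (K := K)).F p).comap ((contractLeft K X.V).baseChange ℂ)
      refine tensF_le fun i j h ξ hξ x hx => ?_
      by_cases hp : p ≤ 0
      · rw [show (unit (K := K)).F p = ⊤ from if_pos hp]; trivial
      · rw [mem_comap, contractLeft_cxMul, mem_dual_F.1 hξ x (X.F_anti (by omega) hx),
          zero_tmul]
        exact zero_mem _)

/-- The coevaluation `K → V ⊗ V*`. -/
def coev (hX : isMHS K X) : 𝟙_ (BifilteredSpace K) ⟶ X ⊗ X.dual :=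
  mkHom (X := unit) (Y := tensor X X.dual) (coevaluation K X.V)
    (fun n x hx => by
      by_cases hn : 0 ≤ n
      · have h1 : coevaluation K X.V 1 ∈ tensW X X.dual n := by
          obtain ⟨m, b, w, hb⟩ := exists_weight_basis hX
          rw [coevaluation_eq_sum b]
          refine sum_mem fun i _ => (tensor X X.dual).W_mono hn
            (tmul_mem_tensW (i := w i) (j := -w i) (by omega) (hb.mem i)
              ((mem_dualAnnihilator _).2 fun y hy => ?_))
          by_contra h0
          have := (hb _ y).1 hy i h0
          omega
        rw [show x = x • (1 : K) by simp, map_smul]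
        exact Submodule.smul_mem _ _ h1
      · rw [unit_W_of_lt hn hx, map_zero]; exact zero_mem _)
    (fun p x hx => by
      by_cases hp : p ≤ 0
      · have h1 : (1 : ℂ) ⊗ₜ[K] coevaluation K X.V 1 ∈ tensF X X.dual p := by
          obtain ⟨m, b, t, -, hb⟩ := exists_hodge_basis hX
          rw [one_tmul_coevaluation b]
          refine sum_mem fun i _ => (tensor X X.dual).F_anti hp
            (cxMul_mem_tensF (i := (t i).1) (j := -(t i).1) (by omega) ?_
              (mem_dual_F.2 fun y hy => ?_))
          · have := hb.mem i
            change b i ∈ X.F (- -(t i).1) at this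
            rwa [neg_neg] at this
          · rw [LinearEquiv.apply_symm_apply]
            by_contra h0
            have h2 : y ∈ X.F (- (-(1 - -(t i).1))) := by rwa [neg_neg]
            have := (hb _ y).1 h2 i h0
            simp only at this
            omega
        clear hx
        induction x using induction_on with
        | zero => rw [map_zero]; exact zero_mem _
        | add x y hx hy => rw [map_add]; exact add_mem hx hy
        | tmul c r =>
          rw [baseChange_tmul, show r = r • (1 : K) by simp, map_smul,
            tmul_smul, show c = c • (1 : ℂ) by simp, ← smul_tmul']
          exact Submodule.smul_of_tower_mem _ r (Submodule.smul_mem _ c h1)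
      · rw [unit_F_of_lt hp hx, map_zero]; exact zero_mem _)

end BifilteredSpace

/-! ### Operations on representations -/

section Curvature

variable {k : Type v} [Field k] {A : DGA.{u} k} {V V' : Type*} [AddCommGroup V] [Module k V]
  [AddCommGroup V'] [Module k V']

/-- A linear map which intertwines two connections intertwines their curvatures. -/
theorem const_wedge_curvature {f : V →ₗ[k] V'} {x : A.carrier ⊗[k] (V →ₗ[k] V)}
    {y : A.carrier ⊗[k] (V' →ₗ[k] V')} (h : wedge y (1 ⊗ₜ f) = wedge (1 ⊗ₜ f) x) :
    wedge (1 ⊗ₜ f) (dForm A x + wedge x x) = wedge (dForm A y + wedge y y) (1 ⊗ₜ f) := by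
  rw [wedge_add, add_wedge, ← wedge_assoc, ← h, wedge_assoc, ← h, wedge_assoc]
  congr 1
  change wedge (1 ⊗ₜ f) (mapForm A.d x) = wedge (mapForm A.d y) (1 ⊗ₜ f)
  rw [← mapForm_const_wedge, ← mapForm_wedge_const, h]

variable {V₁ V₂ V₁' V₂' : Type*} [AddCommGroup V₁] [Module k V₁] [AddCommGroup V₂] [Module k V₂]
  [AddCommGroup V₁'] [Module k V₁'] [AddCommGroup V₂'] [Module k V₂']

variable {M H H' : Type*} [AddCommGroup M] [Module k M] [AddCommGroup H] [Module k H]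
  [AddCommGroup H'] [Module k H']

theorem lTensor_mem_tens {P : Submodule k M} {Q : Submodule k H}
    {Q' : Submodule k H'} {T : H →ₗ[k] H'} (hT : ∀ x ∈ Q, T x ∈ Q') {x : M ⊗[k] H}
    (hx : x ∈ tens k P Q) : T.lTensor M x ∈ tens k P Q' := by
  have h : tens k P Q ≤ (tens k P Q').comap (T.lTensor M) :=
    tens_le fun a ha y hy => tmul_mem_tens ha (hT y hy)
  exact h hx

theorem lTensor_mem_iSup {P : ℤ → Submodule k M} {Q : ℤ → Submodule k H}
    {Q' : ℤ → Submodule k H'} {T : H →ₗ[k] H'} (hT : ∀ r, ∀ x ∈ Q r, T x ∈ Q' r) {x : M ⊗[k] H}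
    (hx : x ∈ ⨆ r, tens k (P r) (Q r)) : T.lTensor M x ∈ ⨆ r, tens k (P r) (Q' r) := by
  have h : ⨆ r, tens k (P r) (Q r) ≤ (⨆ r, tens k (P r) (Q' r)).comap (T.lTensor M) :=
    iSup_le fun r x hx => mem_iSup_of_mem r (lTensor_mem_tens (hT r) hx)
  exact h hx

theorem dForm_lTensor (T : (V₁ →ₗ[k] V₂) →ₗ[k] (V₁' →ₗ[k] V₂'))
    (x : A.carrier ⊗[k] (V₁ →ₗ[k] V₂)) :
    dForm A (T.lTensor _ x) = T.lTensor _ (dForm A x) := by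
  induction x using induction_on with
  | zero => simp
  | add x y hx hy => simp only [map_add, hx, hy]
  | tmul a f => simp

theorem lTensor_wedge {T : (V →ₗ[k] V) →ₗ[k] (V' →ₗ[k] V')}
    (hT : ∀ f g, T (f ∘ₗ g) = T f ∘ₗ T g) (x y : A.carrier ⊗[k] (V →ₗ[k] V)) :
    wedge (T.lTensor _ x) (T.lTensor _ y) = T.lTensor _ (wedge x y) := by
  induction x using induction_on with
  | zero => simp
  | add x x' hx hx' => simp only [map_add, add_wedge, hx, hx']
  | tmul a f =>
    induction y using induction_on with
    | zero => simp
    | add y y' hy hy' => simp only [map_add, wedge_add, hy, hy']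
    | tmul b g => simp [hT]

/-- Forms of degree one with values in commuting subalgebras anticommute. -/
theorem lTensor_wedge_swap {T : (V₁ →ₗ[k] V₁) →ₗ[k] (V →ₗ[k] V)}
    {S : (V₂ →ₗ[k] V₂) →ₗ[k] (V →ₗ[k] V)} (hTS : ∀ f g, T f ∘ₗ S g = S g ∘ₗ T f)
    {x : A.carrier ⊗[k] (V₁ →ₗ[k] V₁)} {y : A.carrier ⊗[k] (V₂ →ₗ[k] V₂)}
    (hx : x ∈ tens k (A.gr 1) ⊤) (hy : y ∈ tens k (A.gr 1) ⊤) :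
    wedge (T.lTensor _ x) (S.lTensor _ y) + wedge (S.lTensor _ y) (T.lTensor _ x) = 0 := by
  induction hx using tens_induction with
  | mem a ha f _ =>
    induction hy using tens_induction with
    | mem b hb g _ =>
      have := A.comm 1 1 a ha b hb
      simp only [LinearMap.lTensor_tmul, wedge_tmul, hTS, this]
      rw [← add_tmul]
      simp
    | zero => simp
    | add y y' _ _ hy hy' =>
      simp only [map_add, wedge_add, add_wedge]
      rw [add_add_add_comm, hy, hy', add_zero]
  | zero => simp
  | add x x' _ _ hx hx' =>
    simp only [map_add, wedge_add, add_wedge]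
    rw [add_add_add_comm, hx, hx', add_zero]

/-- In degree one, an antihomomorphism with a sign behaves like a homomorphism. -/
theorem lTensor_wedge_anti {T : (V →ₗ[k] V) →ₗ[k] (V' →ₗ[k] V')}
    (hT : ∀ f g, T f ∘ₗ T g = -T (g ∘ₗ f)) {x y : A.carrier ⊗[k] (V →ₗ[k] V)}
    (hx : x ∈ tens k (A.gr 1) ⊤) (hy : y ∈ tens k (A.gr 1) ⊤) :
    wedge (T.lTensor _ x) (T.lTensor _ y) = T.lTensor _ (wedge y x) := by
  induction hx using tens_induction with
  | mem a ha f _ =>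
    induction hy using tens_induction with
    | mem b hb g _ =>
      have := A.comm 1 1 a ha b hb
      simp [hT, this, neg_tmul, tmul_neg]
    | zero => simp
    | add y y' _ _ hy hy' => simp only [map_add, wedge_add, add_wedge, hy, hy']
  | zero => simp
  | add x x' _ _ hx hx' => simp only [map_add, wedge_add, add_wedge, hx, hx']

end Curvature

section Operations

open BifilteredSpace

variable (J : CanonicalIso ℳ 𝒩 C) {V V' : Type u} [AddCommGroup V] [Module K V]
  [AddCommGroup V'] [Module K V']

theorem lTensor_form {T : (V →ₗ[K] V) →ₗ[K] (V' →ₗ[K] V')}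
    {T' : (ℂ ⊗[K] V →ₗ[ℂ] ℂ ⊗[K] V) →ₗ[ℂ] (ℂ ⊗[K] V' →ₗ[ℂ] ℂ ⊗[K] V')}
    (h : ∀ f, T' (f.baseChange ℂ) = (T f).baseChange ℂ) (x : ℳ.M.carrier ⊗[K] (V →ₗ[K] V)) :
    mapForm J.I.symm.toLinearMap (cxForm K (T.lTensor _ x)) =
      T'.lTensor _ (mapForm J.I.symm.toLinearMap (cxForm K x)) := by
  induction x using induction_on with
  | zero => simp
  | add x y hx hy => simp only [map_add, hx, hy]
  | tmul a f => simp [h]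

theorem isHodgeRep_unit : isRep J (PreRep.unit (M := ℳ.M)) where
  isMHS := isMHS_unit
  weight := zero_mem _
  maurerCartan := by rw [map_zero, wedge_zero, add_zero]
  hodge := by
    rw [CanonicalIso.form, map_zero, map_zero]
    exact zero_mem _

variable (V V') in
/-- The bilinear map `(f, g) ↦ f ⊗ g` on endomorphisms of complexifications. -/
def cxMapBilinear : (ℂ ⊗[K] V →ₗ[ℂ] ℂ ⊗[K] V) →ₗ[ℂ] (ℂ ⊗[K] V' →ₗ[ℂ] ℂ ⊗[K] V') →ₗ[ℂ]
    (ℂ ⊗[K] (V ⊗[K] V') →ₗ[ℂ] ℂ ⊗[K] (V ⊗[K] V')) :=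
  (mapBilinear (RingHom.id ℂ) _ _ _ _).compr₂
    (TensorProduct.AlgebraTensorModule.distribBaseChange K ℂ V V').symm.conj.toLinearMap

theorem cxMap_baseChange (f : V →ₗ[K] V) (g : V' →ₗ[K] V') :
    cxMap (f.baseChange ℂ) (g.baseChange ℂ) = (TensorProduct.map f g).baseChange ℂ :=
  LinearMap.ext fun z => by
    induction z using cxMul_induction with
    | h₀ => simp
    | h₁ x y => rw [cxMap_cxMul, baseChange_cxMul]
    | h₂ x y hx hy => simp only [map_add, hx, hy]

/-- In the Maurer–Cartan equation of `Ω ⊗ 1 + 1 ⊗ Ω'` the mixed terms cancel. -/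
theorem isHodgeRep_tensor {R S : PreRep ℳ.M} (hR : isRep J R) (hS : isRep J S) :
    isRep J (PreRep.tensor R S) where
  isMHS := isMHS_tensor hR.isMHS hS.isMHS
  weight := by
    refine add_mem (lTensor_mem_tens (fun f hf i => ?_) hR.weight)
      (lTensor_mem_tens (fun f hf i => ?_) hS.weight)
    · exact tensW_le fun a b h x hx y hy => tmul_mem_tensW (i := a + -1) (j := b) (by omega)
        (hf a hx) hy
    · exact tensW_le fun a b h x hx y hy => tmul_mem_tensW (i := a) (j := b + -1) (by omega)
        hx (hf b hy)
  maurerCartan := by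
    let T := (mapBilinear (RingHom.id K) R.X.V S.X.V R.X.V S.X.V).flip LinearMap.id
    let T' := mapBilinear (RingHom.id K) R.X.V S.X.V R.X.V S.X.V LinearMap.id
    have hc := lTensor_wedge_swap (A := ℳ.M) (T := T) (S := T')
      (fun f g => ext' fun x y => by simp [T, T']) (tens_mono le_rfl le_top hR.weight)
      (tens_mono le_rfl le_top hS.weight)
    have hl := lTensor_wedge (A := ℳ.M) (T := T) (fun f g => ext' fun x y => by simp [T]) R.Ω R.Ω
    have hr := lTensor_wedge (A := ℳ.M) (T := T') (fun f g => ext' fun x y => by simp [T']) S.Ω S.Ω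
    change dForm ℳ.M (T.lTensor _ R.Ω + T'.lTensor _ S.Ω) + wedge (T.lTensor _ R.Ω +
      T'.lTensor _ S.Ω) (T.lTensor _ R.Ω + T'.lTensor _ S.Ω) = 0
    rw [map_add, dForm_lTensor, dForm_lTensor, wedge_add, add_wedge, add_wedge, hl, hr]
    have e₁ := congrArg (T.lTensor ℳ.M.carrier) hR.maurerCartan
    have e₂ := congrArg (T'.lTensor ℳ.M.carrier) hS.maurerCartan
    rw [map_add, map_zero] at e₁ e₂
    have e₃ := congrArg₂ (· + ·) (congrArg₂ (· + ·) e₁ e₂) hc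
    simp only [add_zero] at e₃
    rw [← e₃]
    abel
  hodge := by
    have h₁ := lTensor_form J (T := (mapBilinear (RingHom.id K) R.X.V S.X.V R.X.V S.X.V).flip
      LinearMap.id) (T' := (cxMapBilinear R.X.V S.X.V).flip LinearMap.id) (fun f => by
        rw [LinearMap.flip_apply, LinearMap.flip_apply, mapBilinear_apply, ← cxMap_baseChange,
          baseChange_id]; rfl) R.Ω
    have h₂ := lTensor_form J (T := mapBilinear (RingHom.id K) R.X.V S.X.V R.X.V S.X.V
      LinearMap.id) (T' := cxMapBilinear R.X.V S.X.V LinearMap.id) (fun f => by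
        rw [mapBilinear_apply, ← cxMap_baseChange, baseChange_id]; rfl) S.Ω
    have h : J.form (PreRep.tensor R S) = mapForm J.I.symm.toLinearMap (cxForm K
        (PreRep.rT (V := S.X.V) LinearMap.id R.Ω)) + mapForm J.I.symm.toLinearMap (cxForm K
        (PreRep.lT (V := R.X.V) LinearMap.id S.Ω)) := by
      rw [← map_add, ← map_add]; rfl
    rw [h.trans (congrArg₂ (· + ·) h₁ h₂)]
    refine add_mem (lTensor_mem_iSup (Q := fun r => filtHom R.X.F R.X.F (-r))
        (Q' := fun r => filtHom (tensor R.X S.X).F (tensor R.X S.X).F (-r))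
        (fun r f hf i => ?_) hR.hodge)
      (lTensor_mem_iSup (Q := fun r => filtHom S.X.F S.X.F (-r))
        (Q' := fun r => filtHom (tensor R.X S.X).F (tensor R.X S.X).F (-r))
        (fun r f hf i => ?_) hS.hodge)
    · refine tensF_le fun a b h x hx y hy => ?_
      change cxMap f LinearMap.id (cxMul K R.X.V S.X.V x y) ∈ tensF R.X S.X (i + -r)
      rw [cxMap_cxMul]
      exact cxMul_mem_tensF (i := a + -r) (j := b) (by omega) (hf a hx) hy
    · refine tensF_le fun a b h x hx y hy => ?_
      change cxMap LinearMap.id f (cxMul K R.X.V S.X.V x y) ∈ tensF R.X S.X (i + -r)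
      rw [cxMap_cxMul]
      exact cxMul_mem_tensF (i := a) (j := b + -r) (by omega) hx (hf b hy)

theorem isMonoidal_isRep : (isRep J).IsMonoidal where
  prop_unit := isHodgeRep_unit J
  prop_tensor _ _ := isHodgeRep_tensor J

/-- The representation `f ↦ -f*` of endomorphisms on the dual space. -/
def dualEnd {k V : Type*} [Field k] [AddCommGroup V] [Module k V] :
    (V →ₗ[k] V) →ₗ[k] (Module.Dual k V →ₗ[k] Module.Dual k V) where
  toFun f := -f.dualMap
  map_add' f g := LinearMap.ext fun φ => LinearMap.ext fun x => by simp [add_comm]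
  map_smul' c f := LinearMap.ext fun φ => LinearMap.ext fun x => by simp

theorem dualEnd_apply {k V : Type*} [Field k] [AddCommGroup V] [Module k V] (f : V →ₗ[k] V)
    (φ : Module.Dual k V) (x : V) : dualEnd f φ x = -φ (f x) := rfl

/-- The dual representation, with `-Ω*`. -/
abbrev PreRep.dual {M : DGA.{u} K} (R : PreRep M) : PreRep M where
  X := R.X.dual
  Ω := (dualEnd (k := K) (V := R.X.V)).lTensor _ R.Ω

/-- `f ↦ -f*` on the complexification of the dual space. -/
def cxDual (V : Type u) [AddCommGroup V] [Module K V] [FiniteDimensional K V] :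
    (ℂ ⊗[K] V →ₗ[ℂ] ℂ ⊗[K] V) →ₗ[ℂ]
      (ℂ ⊗[K] Module.Dual K V →ₗ[ℂ] ℂ ⊗[K] Module.Dual K V) :=
  (dualC V).symm.conj.toLinearMap ∘ₗ dualEnd

theorem dualC_cxDual {V : Type u} [AddCommGroup V] [Module K V] [FiniteDimensional K V]
    (f : ℂ ⊗[K] V →ₗ[ℂ] ℂ ⊗[K] V) (ξ : ℂ ⊗[K] Module.Dual K V) (x : ℂ ⊗[K] V) :
    dualC V (cxDual V f ξ) x = -dualC V ξ (f x) := by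
  simp [cxDual, LinearEquiv.conj_apply, dualEnd_apply]

theorem cxDual_baseChange {V : Type u} [AddCommGroup V] [Module K V] [FiniteDimensional K V]
    (f : V →ₗ[K] V) : cxDual V (f.baseChange ℂ) = (dualEnd f).baseChange ℂ := by
  refine LinearMap.ext fun ξ => (dualC V).injective (LinearMap.ext fun x => ?_)
  rw [dualC_cxDual]
  induction ξ using induction_on with
  | zero => simp
  | add ξ η hξ hη =>
    simp only [map_add, LinearMap.add_apply, neg_add, hξ, hη]
  | tmul c φ =>
    induction x using induction_on with
    | zero => simp
    | add x y hx hy => simp only [map_add, neg_add, hx, hy]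
    | tmul d v =>
      simp [dualC_tmul, dualEnd_apply]

theorem isHodgeRep_dual {R : PreRep ℳ.M} (hR : isRep J R) : isRep J R.dual where
  isMHS := isMHS_dual hR.isMHS
  weight := lTensor_mem_tens (fun f hf i φ hφ => by
    refine (mem_dualAnnihilator _).2 fun x hx => ?_
    have h := hf _ hx
    change -(φ (f x)) = 0
    rw [(mem_dualAnnihilator _).1 hφ (f x) (R.X.W_mono (by omega) h), neg_zero])
    hR.weight
  maurerCartan := by
    have h₁ := tens_mono le_rfl le_top hR.weight
    have hw := lTensor_wedge_anti (A := ℳ.M) (T := dualEnd (k := K) (V := R.X.V)) (fun f g =>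
      LinearMap.ext fun φ => LinearMap.ext fun x => by simp [dualEnd_apply]) h₁ h₁
    have hd := dForm_lTensor (A := ℳ.M) (dualEnd (k := K) (V := R.X.V)) R.Ω
    change dForm ℳ.M (dualEnd.lTensor _ R.Ω) + wedge (dualEnd.lTensor _ R.Ω)
      (dualEnd.lTensor _ R.Ω) = 0
    rw [hd, hw, ← map_add, hR.maurerCartan, map_zero]
  hodge := by
    have h : J.form R.dual = (cxDual R.X.V).lTensor _ (J.form R) :=
      lTensor_form J (fun f => cxDual_baseChange f) R.Ω
    rw [h]
    refine lTensor_mem_iSup (Q := fun r => filtHom R.X.F R.X.F (-r))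
      (Q' := fun r => filtHom R.X.dual.F R.X.dual.F (-r)) (fun r f hf i ξ hξ => ?_) hR.hodge
    rw [mem_comap]
    refine mem_dual_F.2 fun x hx => ?_
    rw [dualC_cxDual, mem_dual_F.1 hξ (f x) (R.X.F_anti (by omega) (hf _ hx)), neg_zero]

end Operations

/-! ### Subobjects, quotients and sums of representations -/

section SliceWedge

variable {k : Type*} [Field k] {A : Type u} [Ring A] [Algebra k A] {V₁ V₂ V₃ : Type*}
  [AddCommGroup V₁] [Module k V₁] [AddCommGroup V₂] [Module k V₂] [AddCommGroup V₃] [Module k V₃]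

theorem slice_wedge_const (θ : A →ₗ[k] k) (x : A ⊗[k] (V₂ →ₗ[k] V₃)) (f : V₁ →ₗ[k] V₂) :
    slice θ (wedge x (1 ⊗ₜ f)) = slice θ x ∘ₗ f := by
  induction x using induction_on with
  | zero => simp
  | add x y hx hy => simp only [map_add, add_wedge, hx, hy, LinearMap.add_comp]
  | tmul a g => simp [LinearMap.smul_comp]

theorem slice_const_wedge (θ : A →ₗ[k] k) (f : V₂ →ₗ[k] V₃) (x : A ⊗[k] (V₁ →ₗ[k] V₂)) :
    slice θ (wedge (1 ⊗ₜ f) x) = f ∘ₗ slice θ x := by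
  induction x using induction_on with
  | zero => simp
  | add x y hx hy => simp only [map_add, wedge_add, hx, hy, LinearMap.comp_add]
  | tmul a g => simp [LinearMap.comp_smul]

/-- A map commuting with the forms commutes with their contractions. -/
theorem slice_intertwine {x : A ⊗[k] (V₁ →ₗ[k] V₁)} {y : A ⊗[k] (V₂ →ₗ[k] V₂)} {f : V₁ →ₗ[k] V₂}
    (h : wedge y (1 ⊗ₜ f) = wedge (1 ⊗ₜ f) x) (θ : A →ₗ[k] k) (v : V₁) :
    f (slice θ x v) = slice θ y (f v) := by
  have := congrArg (fun z : A ⊗[k] (V₁ →ₗ[k] V₂) => slice θ z v) h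
  simpa [slice_wedge_const, slice_const_wedge] using this.symm

end SliceWedge

section SubQuot

open BifilteredSpace

variable (J : CanonicalIso ℳ 𝒩 C)

theorem BigradedModel.F₁_anti (𝒩 : BigradedModel D) : Antitone 𝒩.F₁ := fun _ _ h =>
  iSup_mono fun _ => iSup_mono' fun hs => ⟨h.trans hs, le_rfl⟩

/-- Compatibility with the Hodge filtrations in terms of contractions. -/
theorem form_mem_iff {R : PreRep ℳ.M} (hR : isMHS K R.X) :
    J.form R ∈ (⨆ r : ℤ, tens ℂ (𝒩.F₁ r) (filtHom R.X.F R.X.F (-r))) ↔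
      ∀ r, ∀ θ : 𝒩.N.carrier →ₗ[ℂ] ℂ, (∀ y ∈ 𝒩.F₁ r, θ y = 0) →
        ∀ p, ∀ x ∈ R.X.F p, slice θ (J.form R) x ∈ R.X.F (p - r + 1) := by
  obtain ⟨n, b₁, t₁, -, h₁⟩ := exists_hodge_basis hR
  simp only [filtHom_neg]
  rw [mem_iSup_tens_iff_slice h₁ h₁ 𝒩.F₁_anti]
  refine forall₃_congr fun r θ _ => ⟨fun h p x hx => ?_, fun h i x hx => ?_⟩
  · have := h (-p) (by simpa using hx)
    simp only [mem_comap] at this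
    rwa [show -(-p + (r - 1)) = p - r + 1 by ring] at this
  · have := h _ x hx
    simp only [mem_comap]
    rwa [show -(i + (r - 1)) = -i - r + 1 by ring]

/-- A mixed Hodge structure which embeds strictly and equivariantly into representations is a
representation. -/
theorem isHodgeRep_of_jointly_injective {R S₁ S₂ : PreRep ℳ.M} (hR : isMHS K R.X)
    (h₁ : isRep J S₁) (h₂ : isRep J S₂) {f₁ : R.X.V →ₗ[K] S₁.X.V} {f₂ : R.X.V →ₗ[K] S₂.X.V}
    (hf : ∀ v, f₁ v = 0 → f₂ v = 0 → v = 0)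
    (hW : ∀ n x, x ∈ R.X.W n ↔ f₁ x ∈ S₁.X.W n ∧ f₂ x ∈ S₂.X.W n)
    (hF : ∀ p x, x ∈ R.X.F p ↔ f₁.baseChange ℂ x ∈ S₁.X.F p ∧ f₂.baseChange ℂ x ∈ S₂.X.F p)
    (hc₁ : wedge S₁.Ω (1 ⊗ₜ f₁) = wedge (1 ⊗ₜ f₁) R.Ω)
    (hc₂ : wedge S₂.Ω (1 ⊗ₜ f₂) = wedge (1 ⊗ₜ f₂) R.Ω) : isRep J R where
  isMHS := hR
  weight := by
    have w₁ := mem_tens_iff.1 h₁.weight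
    have w₂ := mem_tens_iff.1 h₂.weight
    refine mem_tens_iff.2 ⟨fun θ i x hx => ?_, fun θ hθ => LinearMap.ext fun v => hf _ ?_ ?_⟩
    · rw [hW] at hx
      rw [mem_comap, hW, slice_intertwine hc₁, slice_intertwine hc₂]
      exact ⟨w₁.1 θ i hx.1, w₂.1 θ i hx.2⟩
    · rw [slice_intertwine hc₁, w₁.2 θ hθ]; rfl
    · rw [slice_intertwine hc₂, w₂.2 θ hθ]; rfl
  maurerCartan := by
    refine eq_zero_of_slice fun θ => LinearMap.ext fun v => hf _ ?_ ?_
    · have := const_wedge_curvature hc₁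
      rw [h₁.maurerCartan, zero_wedge] at this
      rw [← LinearMap.comp_apply, ← slice_const_wedge, this, map_zero]; rfl
    · have := const_wedge_curvature hc₂
      rw [h₂.maurerCartan, zero_wedge] at this
      rw [← LinearMap.comp_apply, ← slice_const_wedge, this, map_zero]; rfl
  hodge := by
    have c₁ := form_comm J hc₁
    have c₂ := form_comm J hc₂
    have g₁ := (form_mem_iff J h₁.isMHS).1 h₁.hodge
    have g₂ := (form_mem_iff J h₂.isMHS).1 h₂.hodge
    refine (form_mem_iff J hR).2 fun r θ hθ p x hx => ?_
    rw [hF] at hx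
    rw [hF, slice_intertwine c₁, slice_intertwine c₂]
    exact ⟨g₁ r θ hθ p _ hx.1, g₂ r θ hθ p _ hx.2⟩

/-- A mixed Hodge structure which is a strict equivariant quotient of a representation is a
representation. -/
theorem isHodgeRep_of_surjective {R S : PreRep ℳ.M} (hR : isMHS K R.X) (hS : isRep J S)
    {q : S.X.V →ₗ[K] R.X.V} (hq : Function.Surjective q)
    (hW : ∀ n, R.X.W n = (S.X.W n).map q) (hF : ∀ p, R.X.F p = (S.X.F p).map (q.baseChange ℂ))
    (hc : wedge R.Ω (1 ⊗ₜ q) = wedge (1 ⊗ₜ q) S.Ω) : isRep J R where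
  isMHS := hR
  weight := by
    have w := mem_tens_iff.1 hS.weight
    refine mem_tens_iff.2 ⟨fun θ i x hx => ?_, fun θ hθ => LinearMap.ext fun v => ?_⟩
    · rw [hW] at hx
      obtain ⟨x, hx, rfl⟩ := hx
      rw [mem_comap, hW, ← slice_intertwine hc]
      exact ⟨_, w.1 θ i hx, rfl⟩
    · obtain ⟨v, rfl⟩ := hq v
      rw [← slice_intertwine hc, w.2 θ hθ, LinearMap.zero_apply, map_zero, LinearMap.zero_apply]
  maurerCartan := by
    refine eq_zero_of_slice fun θ => LinearMap.ext fun v => ?_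
    obtain ⟨v, rfl⟩ := hq v
    have := const_wedge_curvature hc
    rw [hS.maurerCartan, wedge_zero] at this
    rw [← LinearMap.comp_apply, ← slice_wedge_const, ← this, map_zero]; rfl
  hodge := by
    have c := form_comm J hc
    have g := (form_mem_iff J hS.isMHS).1 hS.hodge
    refine (form_mem_iff J hR).2 fun r θ hθ p x hx => ?_
    rw [hF] at hx
    obtain ⟨x, hx, rfl⟩ := hx
    rw [hF, ← slice_intertwine c]
    exact ⟨_, g r θ hθ p _ hx, rfl⟩

namespace PreRep

variable {M : DGA.{u} K}

/-- The representation on a subspace; `r` is a retraction. -/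
abbrev sub (R : PreRep M) {V : Type u} [AddCommGroup V] [Module K V]
    [FiniteDimensional K V] (j : V →ₗ[K] R.X.V) (r : R.X.V →ₗ[K] V) : PreRep M where
  X := R.X.sub j
  Ω := post r (pre j R.Ω)

/-- The representation on a quotient space; `σ` is a section. -/
abbrev quot (R : PreRep M) {V : Type u} [AddCommGroup V] [Module K V]
    [FiniteDimensional K V] (q : R.X.V →ₗ[K] V) (σ : V →ₗ[K] R.X.V) : PreRep M where
  X := R.X.quot q
  Ω := post q (pre σ R.Ω)

/-- The direct sum of two representations. -/
abbrev prod (R S : PreRep M) : PreRep M where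
  X := R.X.prod S.X
  Ω := post (LinearMap.inl K R.X.V S.X.V) (pre (LinearMap.fst K R.X.V S.X.V) R.Ω) +
    post (LinearMap.inr K R.X.V S.X.V) (pre (LinearMap.snd K R.X.V S.X.V) S.Ω)

theorem sub_comm {R : PreRep M} {V : Type u} [AddCommGroup V] [Module K V]
    [FiniteDimensional K V] {j : V →ₗ[K] R.X.V} {r : R.X.V →ₗ[K] V} (h : r ∘ₗ j = LinearMap.id)
    (hj : ∀ θ v, ∃ w, slice θ R.Ω (j v) = j w) :
    post j (R.sub j r).Ω = pre j R.Ω := by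
  refine eq_of_slice fun θ => LinearMap.ext fun v => ?_
  obtain ⟨w, hw⟩ := hj θ v
  change slice θ (post j (post r (pre j R.Ω))) v = _
  simp only [post_eq_wedge, pre_eq_wedge, slice_const_wedge, slice_wedge_const,
    LinearMap.comp_apply, hw]
  rw [← LinearMap.comp_apply r, h, LinearMap.id_apply]

theorem quot_comm {R : PreRep M} {V : Type u} [AddCommGroup V] [Module K V]
    [FiniteDimensional K V] {q : R.X.V →ₗ[K] V} {σ : V →ₗ[K] R.X.V} (h : q ∘ₗ σ = LinearMap.id)
    (hq : ∀ θ v, q v = 0 → q (slice θ R.Ω v) = 0) :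
    post q R.Ω = pre q (R.quot q σ).Ω := by
  refine eq_of_slice fun θ => LinearMap.ext fun v => ?_
  change _ = slice θ (pre q (post q (pre σ R.Ω))) v
  simp only [post_eq_wedge, pre_eq_wedge, slice_const_wedge, slice_wedge_const,
    LinearMap.comp_apply]
  rw [← sub_eq_zero, ← map_sub, ← map_sub]
  refine hq θ _ ?_
  rw [map_sub, ← LinearMap.comp_apply q, h, LinearMap.id_apply, sub_self]

theorem prod_fst (R S : PreRep M) : post (LinearMap.fst K R.X.V S.X.V) (R.prod S).Ω =
    pre (LinearMap.fst K R.X.V S.X.V) R.Ω := by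
  refine eq_of_slice fun θ => LinearMap.ext fun v => ?_
  change slice θ (post _ (_ + _)) v = _
  simp [post_eq_wedge, pre_eq_wedge, slice_const_wedge, slice_wedge_const]

theorem prod_snd (R S : PreRep M) : post (LinearMap.snd K R.X.V S.X.V) (R.prod S).Ω =
    pre (LinearMap.snd K R.X.V S.X.V) S.Ω := by
  refine eq_of_slice fun θ => LinearMap.ext fun v => ?_
  change slice θ (post _ (_ + _)) v = _
  simp [post_eq_wedge, pre_eq_wedge, slice_const_wedge, slice_wedge_const]

theorem prod_inl (R S : PreRep M) : post (LinearMap.inl K R.X.V S.X.V) R.Ω =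
    pre (LinearMap.inl K R.X.V S.X.V) (R.prod S).Ω := by
  refine eq_of_slice fun θ => LinearMap.ext fun v => ?_
  change _ = slice θ (pre _ (_ + _)) v
  simp [post_eq_wedge, pre_eq_wedge, slice_const_wedge, slice_wedge_const]

theorem prod_inr (R S : PreRep M) : post (LinearMap.inr K R.X.V S.X.V) S.Ω =
    pre (LinearMap.inr K R.X.V S.X.V) (R.prod S).Ω := by
  refine eq_of_slice fun θ => LinearMap.ext fun v => ?_
  change _ = slice θ (pre _ (_ + _)) v
  simp [post_eq_wedge, pre_eq_wedge, slice_const_wedge, slice_wedge_const]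

end PreRep

theorem isHodgeRep_prod {R S : PreRep ℳ.M} (hR : isRep J R) (hS : isRep J S) :
    isRep J (R.prod S) :=
  isHodgeRep_of_jointly_injective J (isMHS_prod hR.isMHS hS.isMHS) hR hS
    (f₁ := LinearMap.fst K R.X.V S.X.V) (f₂ := LinearMap.snd K R.X.V S.X.V)
    (fun _ h₁ h₂ => Prod.ext h₁ h₂) (fun _ _ => Iff.rfl) (fun _ _ => Iff.rfl)
    (by rw [← PreRep.pre_eq_wedge, ← PreRep.post_eq_wedge]; exact (PreRep.prod_fst R S).symm)
    (by rw [← PreRep.pre_eq_wedge, ← PreRep.post_eq_wedge]; exact (PreRep.prod_snd R S).symm)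

end SubQuot

/-! ### Abelian categories of spaces with structure -/

section Criterion

open CategoryTheory.Limits

variable {k : Type u} [Field k] {𝒞 : Type*} [Category* 𝒞] [Preadditive 𝒞]

/-- A category of vector spaces with extra structure, given by its forgetful functor `U`, in which
the kernels, cokernels and direct sums of vector spaces carry the structure. -/
structure IsConcreteAbelian (U : 𝒞 ⥤ ModuleCat.{u} k) : Prop where
  faithful : U.Faithful
  additive : U.Additive
  reflectsIso : U.ReflectsIsomorphisms
  nonempty : Nonempty 𝒞
  hasBinaryBiproducts : HasBinaryBiproducts 𝒞
  kernel : ∀ {X Y : 𝒞} (f : X ⟶ Y), ∃ (Z : 𝒞) (i : Z ⟶ X), i ≫ f = 0 ∧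
    Function.Injective (U.map i).hom ∧
    (∀ x, (U.map f).hom x = 0 → ∃ z, (U.map i).hom z = x) ∧
    ∀ (W : 𝒞) (g : W ⟶ X), g ≫ f = 0 → ∃ l, l ≫ i = g
  cokernel : ∀ {X Y : 𝒞} (f : X ⟶ Y), ∃ (Z : 𝒞) (q : Y ⟶ Z), f ≫ q = 0 ∧
    Function.Surjective (U.map q).hom ∧
    (∀ y, (U.map q).hom y = 0 → ∃ x, (U.map f).hom x = y) ∧
    ∀ (W : 𝒞) (g : Y ⟶ W), f ≫ g = 0 → ∃ l, q ≫ l = g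

namespace IsConcreteAbelian

variable {U : 𝒞 ⥤ ModuleCat.{u} k} (h : IsConcreteAbelian U)

include h

theorem exists_kernel {X Y : 𝒞} (f : X ⟶ Y) : ∃ (Z : 𝒞) (i : Z ⟶ X) (w : i ≫ f = 0)
    (_ : IsLimit (KernelFork.ofι i w)), PreservesLimit (parallelPair f 0) U := by
  have := h.faithful
  have := h.additive
  obtain ⟨Z, i, w, hi, hker, hl⟩ := h.kernel f
  have hmono : Mono (U.map i) := (ModuleCat.mono_iff_injective _).2 hi
  have : Mono i := U.mono_of_mono_map hmono
  choose l hl using hl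
  have hlim : IsLimit (KernelFork.ofι i w) :=
    KernelFork.IsLimit.ofι' i w fun g hg => ⟨l _ g hg, hl _ g hg⟩
  refine ⟨Z, i, w, hlim, preservesLimit_of_preserves_limit_cone hlim ?_⟩
  have hex : (ShortComplex.mk (U.map i) (U.map f)
      (by rw [← U.map_comp, w, U.map_zero])).Exact := by
    rw [ShortComplex.moduleCat_exact_iff]
    exact hker
  refine (KernelFork.isLimitMapConeEquiv _ U).symm ?_
  exact hex.fIsKernel

theorem exists_cokernel {X Y : 𝒞} (f : X ⟶ Y) : ∃ (Z : 𝒞) (q : Y ⟶ Z) (w : f ≫ q = 0)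
    (_ : IsColimit (CokernelCofork.ofπ q w)), PreservesColimit (parallelPair f 0) U := by
  have := h.faithful
  have := h.additive
  obtain ⟨Z, q, w, hq, hker, hl⟩ := h.cokernel f
  have hepi : Epi (U.map q) := (ModuleCat.epi_iff_surjective _).2 hq
  have : Epi q := U.epi_of_epi_map hepi
  choose l hl using hl
  have hlim : IsColimit (CokernelCofork.ofπ q w) :=
    CokernelCofork.IsColimit.ofπ' q w fun g hg => ⟨l _ g hg, hl _ g hg⟩
  refine ⟨Z, q, w, hlim, preservesColimit_of_preserves_colimit_cocone hlim ?_⟩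
  have hex : (ShortComplex.mk (U.map f) (U.map q)
      (by rw [← U.map_comp, w, U.map_zero])).Exact := by
    rw [ShortComplex.moduleCat_exact_iff]
    exact hker
  refine (CokernelCofork.isColimitMapCoconeEquiv _ U).symm ?_
  exact hex.gIsCokernel

theorem hasKernels : HasKernels 𝒞 where
  has_limit f := by
    obtain ⟨Z, i, w, hl, -⟩ := h.exists_kernel f
    exact ⟨⟨_, hl⟩⟩

theorem hasCokernels : HasCokernels 𝒞 where
  has_colimit f := by
    obtain ⟨Z, i, w, hl, -⟩ := h.exists_cokernel f
    exact ⟨⟨_, hl⟩⟩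

theorem hasZeroObject : HasZeroObject 𝒞 := by
  have := h.faithful
  have := h.additive
  obtain ⟨X⟩ := h.nonempty
  obtain ⟨Z, i, w, hi, -⟩ := h.kernel (𝟙 X)
  have hmono : Mono (U.map i) := (ModuleCat.mono_iff_injective _).2 hi
  have : Mono i := U.mono_of_mono_map hmono
  rw [Category.comp_id] at w
  exact ⟨Z, (IsZero.iff_id_eq_zero Z).2 (by rw [← cancel_mono i, w, comp_zero, comp_zero])⟩

theorem hasFiniteProducts : HasFiniteProducts 𝒞 :=
  have := h.hasZeroObject
  have := h.hasBinaryBiproducts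
  hasFiniteProducts_of_has_binary_and_terminal

/-- Such a category is abelian, because the comparison of coimage and image can be tested on
vector spaces. -/
abbrev abelian : Abelian 𝒞 :=
  have := h.hasKernels
  have := h.hasCokernels
  have := h.hasFiniteProducts
  have : ∀ {X Y : 𝒞} (f : X ⟶ Y), IsIso (Abelian.coimageImageComparison f) := by
    intro X Y f
    have := h.additive
    have := h.reflectsIso
    have : ∀ {X Y : 𝒞} (f : X ⟶ Y), PreservesLimit (parallelPair f 0) U := fun f =>
      (h.exists_kernel f).choose_spec.choose_spec.choose_spec.choose_spec
    have : ∀ {X Y : 𝒞} (f : X ⟶ Y), PreservesColimit (parallelPair f 0) U := fun f =>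
      (h.exists_cokernel f).choose_spec.choose_spec.choose_spec.choose_spec
    have : IsIso (U.map (Abelian.coimageImageComparison f)) := by
      rw [Arrow.isIso_iff_isIso_of_isIso (Abelian.PreservesCoimageImageComparison.iso U f).hom]
      infer_instance
    exact isIso_of_reflects_iso _ U
  Abelian.ofCoimageImageComparisonIsIso

theorem preservesFiniteLimits : PreservesFiniteLimits U := by
  let _ := h.abelian
  have := h.additive
  have : ∀ {X Y : 𝒞} (f : X ⟶ Y), PreservesLimit (parallelPair f 0) U := fun f =>
    (h.exists_kernel f).choose_spec.choose_spec.choose_spec.choose_spec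
  exact U.preservesFiniteLimits_of_preservesKernels

theorem preservesFiniteColimits : PreservesFiniteColimits U := by
  let _ := h.abelian
  have := h.additive
  have : ∀ {X Y : 𝒞} (f : X ⟶ Y), PreservesColimit (parallelPair f 0) U := fun f =>
    (h.exists_cokernel f).choose_spec.choose_spec.choose_spec.choose_spec
  exact U.preservesFiniteColimits_of_preservesCokernels

omit [Preadditive 𝒞] h in
theorem _root_.CategoryTheory.Functor.preservesFiniteLimits_of_comp {ℬ : Type*} [Category* ℬ]
    [Preadditive ℬ] {V : ℬ ⥤ ModuleCat.{u} k} (hV : IsConcreteAbelian V) (F : 𝒞 ⥤ ℬ)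
    (hF : PreservesFiniteLimits (F ⋙ V)) : PreservesFiniteLimits F where
  preservesFiniteLimits J _ _ := by
    let _ := hV.abelian
    have := hV.preservesFiniteLimits
    have := hV.reflectsIso
    have : ReflectsLimitsOfShape J V := reflectsLimitsOfShape_of_reflectsIsomorphisms
    exact preservesLimitsOfShape_of_reflects_of_preserves F V

omit [Preadditive 𝒞] h in
theorem _root_.CategoryTheory.Functor.preservesFiniteColimits_of_comp {ℬ : Type*} [Category* ℬ]
    [Preadditive ℬ] {V : ℬ ⥤ ModuleCat.{u} k} (hV : IsConcreteAbelian V) (F : 𝒞 ⥤ ℬ)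
    (hF : PreservesFiniteColimits (F ⋙ V)) : PreservesFiniteColimits F where
  preservesFiniteColimits J _ _ := by
    let _ := hV.abelian
    have := hV.preservesFiniteColimits
    have := hV.reflectsIso
    have : ReflectsColimitsOfShape J V := reflectsColimitsOfShape_of_reflectsIsomorphisms
    exact preservesColimitsOfShape_of_reflects_of_preserves F V

end IsConcreteAbelian

end Criterion

/-! ### Mixed Hodge structures and representations form abelian categories -/

section AbelianMHS

open BifilteredSpace CategoryTheory.Limits

namespace BifilteredSpace

variable {X Y Z : BifilteredSpace K} {V : Type u} [AddCommGroup V] [Module K V]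
  [FiniteDimensional K V]

theorem lin_add (f g : X ⟶ Y) : lin (f + g) = lin f + lin g := rfl
theorem lin_smul (c : K) (f : X ⟶ Y) : lin (c • f) = c • lin f := rfl
theorem lin_zero : lin (0 : X ⟶ Y) = 0 := rfl

/-- The inclusion of a subspace with the induced filtrations. -/
def subι (X : BifilteredSpace K) (j : V →ₗ[K] X.V) : X.sub j ⟶ X :=
  mkHom (X := X.sub j) j (fun _ _ h => h) (fun _ _ h => h)

/-- The projection to a quotient with the induced filtrations. -/
def quotπ (X : BifilteredSpace K) (q : X.V →ₗ[K] V) : X ⟶ X.quot q :=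
  mkHom (Y := X.quot q) q (fun _ _ h => ⟨_, h, rfl⟩) (fun _ _ h => ⟨_, h, rfl⟩)

/-- A factorization through a subspace with the induced filtrations. -/
def subLift {j : V →ₗ[K] X.V} (g : Y ⟶ X) (l : Y.V →ₗ[K] V) (h : j ∘ₗ l = lin g) : Y ⟶ X.sub j :=
  mkHom (Y := X.sub j) l
    (fun n y hy => by
      rw [mem_comap, ← LinearMap.comp_apply, h]
      exact lin_W g hy)
    (fun p y hy => by
      rw [mem_comap, ← LinearMap.comp_apply, ← baseChange_comp, h]
      exact lin_F g hy)

/-- A factorization through a quotient with the induced filtrations. -/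
def quotDesc {q : X.V →ₗ[K] V} (g : X ⟶ Y) (l : V →ₗ[K] Y.V) (h : l ∘ₗ q = lin g) :
    X.quot q ⟶ Y :=
  mkHom (X := X.quot q) l
    (fun n y hy => by
      obtain ⟨x, hx, rfl⟩ := hy
      rw [← LinearMap.comp_apply, h]
      exact lin_W g hx)
    (fun p y hy => by
      obtain ⟨x, hx, rfl⟩ := hy
      rw [← LinearMap.comp_apply, ← baseChange_comp, h]
      exact lin_F g hx)

/-- The kernel of a morphism of mixed Hodge structures is a mixed Hodge structure. -/
theorem isMHS_ker (hX : isMHS K X) (hY : isMHS K Y) (f : X ⟶ Y) :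
    isMHS K (X.sub (LinearMap.ker (lin f)).subtype) := by
  obtain ⟨g, g', hg⟩ := exists_gradings hX hY
  refine isMHS_sub g (Subtype.val_injective) fun s x => ?_
  have h : g.π s ((LinearMap.ker (lin f)).subtype.baseChange ℂ x) ∈
      (LinearMap.ker (lin f)).baseChange ℂ := by
    have h₀ : (lin f).baseChange ℂ ((LinearMap.ker (lin f)).subtype.baseChange ℂ x) = 0 := by
      rw [← LinearMap.comp_apply, ← baseChange_comp, LinearMap.comp_ker_subtype,
        baseChange_zero, LinearMap.zero_apply]
    rw [baseChange_ker, LinearMap.mem_ker, hg, h₀, map_zero]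
  exact h

/-- The cokernel of a morphism of mixed Hodge structures is a mixed Hodge structure. -/
theorem isMHS_coker (hX : isMHS K X) (hY : isMHS K Y) (f : X ⟶ Y) :
    isMHS K (Y.quot (LinearMap.range (lin f)).mkQ) := by
  obtain ⟨g, g', hg⟩ := exists_gradings hX hY
  refine isMHS_quot g' (mkQ_surjective _) fun s y hy => ?_
  have h : y ∈ LinearMap.ker ((LinearMap.range (lin f)).mkQ.baseChange ℂ) := hy
  rw [← baseChange_ker, Submodule.ker_mkQ, LinearMap.range_eq_map, baseChange_map,
    baseChange_top] at h
  obtain ⟨x, -, rfl⟩ := h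
  rw [← hg, ← LinearMap.comp_apply, ← baseChange_comp, LinearMap.range_mkQ_comp,
    baseChange_zero, LinearMap.zero_apply]

/-- The projections and inclusions of the direct sum. -/
def prodFst (X Y : BifilteredSpace K) : X.prod Y ⟶ X :=
  mkHom (X := X.prod Y) (LinearMap.fst K X.V Y.V) (fun _ _ h => h.1) (fun _ _ h => h.1)

/-- The second projection of the direct sum. -/
def prodSnd (X Y : BifilteredSpace K) : X.prod Y ⟶ Y :=
  mkHom (X := X.prod Y) (LinearMap.snd K X.V Y.V) (fun _ _ h => h.2) (fun _ _ h => h.2)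

/-- The first inclusion of the direct sum. -/
def prodInl (X Y : BifilteredSpace K) : X ⟶ X.prod Y :=
  mkHom (Y := X.prod Y) (LinearMap.inl K X.V Y.V) (fun n _ h => ⟨h, zero_mem (Y.W n)⟩)
      fun p x h => by
    refine ⟨?_, ?_⟩
    · rw [SetLike.mem_coe, mem_comap, ← LinearMap.comp_apply, ← baseChange_comp,
        LinearMap.fst_comp_inl, baseChange_id]
      exact h
    · rw [SetLike.mem_coe, mem_comap, ← LinearMap.comp_apply, ← baseChange_comp,
        LinearMap.snd_comp_inl, baseChange_zero]
      exact zero_mem _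

/-- The second inclusion of the direct sum. -/
def prodInr (X Y : BifilteredSpace K) : Y ⟶ X.prod Y :=
  mkHom (Y := X.prod Y) (LinearMap.inr K X.V Y.V) (fun n _ h => ⟨zero_mem (X.W n), h⟩)
      fun p x h => by
    refine ⟨?_, ?_⟩
    · rw [SetLike.mem_coe, mem_comap, ← LinearMap.comp_apply, ← baseChange_comp,
        LinearMap.fst_comp_inr, baseChange_zero]
      exact zero_mem _
    · rw [SetLike.mem_coe, mem_comap, ← LinearMap.comp_apply, ← baseChange_comp,
        LinearMap.snd_comp_inr, baseChange_id]
      exact h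

theorem inl_fst_add_inr_snd (V V' : Type u) [AddCommGroup V] [Module K V] [AddCommGroup V']
    [Module K V'] : LinearMap.inl K V V' ∘ₗ LinearMap.fst K V V' +
      LinearMap.inr K V V' ∘ₗ LinearMap.snd K V V' = LinearMap.id :=
  LinearMap.ext fun x => by simp

instance : (forget (K := K)).Additive where
  map_add := rfl

end BifilteredSpace

theorem mhs_hom_ext {X Y : MHS K} {f g : X ⟶ Y} (h : lin f.hom = lin g.hom) : f = g :=
  ObjectProperty.hom_ext _ (hom_ext h)

/-- The forgetful functor from mixed Hodge structures to vector spaces. -/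
def forgetMHS (K : Type u) [Field K] [Algebra K ℝ] : MHS K ⥤ ModuleCat.{u} K :=
  (isMHS K).ι ⋙ forget

theorem isConcreteAbelian_forgetMHS : IsConcreteAbelian (forgetMHS K) where
  faithful := inferInstanceAs ((isMHS K).ι ⋙ forget).Faithful
  additive := inferInstanceAs ((isMHS K).ι ⋙ forget).Additive
  reflectsIso := ⟨fun {X Y} f hf => by
    have hb : Function.Bijective (lin f.hom) := ConcreteCategory.bijective_of_isIso
      ((forgetMHS K).map f)
    exact (ObjectProperty.isoMk _ (isoOfBijective X.property Y.property f.hom hb)).isIso_hom⟩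
  nonempty := ⟨⟨_, isMHS_unit⟩⟩
  hasBinaryBiproducts := ⟨fun X Y => hasBinaryBiproduct_of_total
    { pt := ⟨_, isMHS_prod X.property Y.property⟩
      fst := ObjectProperty.homMk (prodFst X.obj Y.obj)
      snd := ObjectProperty.homMk (prodSnd X.obj Y.obj)
      inl := ObjectProperty.homMk (prodInl X.obj Y.obj)
      inr := ObjectProperty.homMk (prodInr X.obj Y.obj)
      inl_fst := mhs_hom_ext (LinearMap.fst_comp_inl _ _ _)
      inl_snd := mhs_hom_ext (LinearMap.snd_comp_inl _ _ _)
      inr_fst := mhs_hom_ext (LinearMap.fst_comp_inr _ _ _)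
      inr_snd := mhs_hom_ext (LinearMap.snd_comp_inr _ _ _) }
    (mhs_hom_ext (inl_fst_add_inr_snd _ _))⟩
  kernel {X Y} f := by
    refine ⟨⟨_, isMHS_ker X.property Y.property f.hom⟩, ObjectProperty.homMk (subι X.obj _),
      mhs_hom_ext (LinearMap.comp_ker_subtype _), Subtype.val_injective,
      fun x hx => ⟨⟨x, hx⟩, rfl⟩, fun W g hg => ?_⟩
    have hg' : lin f.hom ∘ₗ lin g.hom = 0 := congrArg (fun m => lin m.hom) hg
    exact ⟨ObjectProperty.homMk (subLift g.hom ((lin g.hom).codRestrict _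
      fun x => LinearMap.congr_fun hg' x) rfl), rfl⟩
  cokernel {X Y} f := by
    refine ⟨⟨_, isMHS_coker X.property Y.property f.hom⟩, ObjectProperty.homMk (quotπ Y.obj _),
      mhs_hom_ext (LinearMap.range_mkQ_comp _), mkQ_surjective _,
      fun y hy => (Submodule.Quotient.mk_eq_zero _).1 hy, fun W g hg => ?_⟩
    have hg' : lin g.hom ∘ₗ lin f.hom = 0 := congrArg (fun m => lin m.hom) hg
    exact ⟨ObjectProperty.homMk (quotDesc g.hom (Submodule.liftQ _ (lin g.hom)
      (LinearMap.range_le_ker_iff.2 hg')) (liftQ_mkQ _ _ _)),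
      mhs_hom_ext (liftQ_mkQ _ _ _)⟩

end AbelianMHS

section AbelianRep

open BifilteredSpace CategoryTheory.Limits

namespace PreRep

variable {M : DGA.{u} K} {R S : PreRep M}

/-- The morphisms of representations, as a subspace of the morphisms of bifiltered spaces. -/
def homs (R S : PreRep M) : Submodule K (R.X ⟶ S.X) where
  carrier := {f | post (lin f) R.Ω = pre (lin f) S.Ω}
  add_mem' {f g} hf hg := by
    rw [Set.mem_ofPred_eq, post_eq_wedge, pre_eq_wedge] at hf hg ⊢
    rw [lin_add, tmul_add, add_wedge, wedge_add, hf, hg]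
  zero_mem' := by
    rw [Set.mem_ofPred_eq, post_eq_wedge, pre_eq_wedge, lin_zero, tmul_zero,
      zero_wedge, wedge_zero]
  smul_mem' c f hf := by
    rw [Set.mem_ofPred_eq, post_eq_wedge, pre_eq_wedge] at hf ⊢
    rw [lin_smul, tmul_smul, smul_wedge, wedge_smul, hf]

/-- The identification of `R ⟶ S` with `homs R S`. -/
def homEquiv (R S : PreRep M) : (R ⟶ S) ≃ homs R S where
  toFun f := ⟨f.f, f.comm⟩
  invFun f := ⟨f.1, f.2⟩
  left_inv _ := rfl
  right_inv _ := rfl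

instance : Preadditive (PreRep M) where
  homGroup R S := (homEquiv R S).addCommGroup
  add_comp _ _ _ _ _ _ := hom_ext (Preadditive.add_comp _ _ _ _ _ _)
  comp_add _ _ _ _ _ _ := hom_ext (Preadditive.comp_add _ _ _ _ _ _)

instance : Linear K (PreRep M) where
  homModule R S := (homEquiv R S).module K
  smul_comp _ _ _ _ _ _ := hom_ext (Linear.smul_comp _ _ _ _ _ _)
  comp_smul _ _ _ _ _ _ := hom_ext (Linear.comp_smul _ _ _ _ _ _)

instance : (forget (M := M)).Additive where
  map_add := rfl

theorem comm_iff {V V' : Type u} [AddCommGroup V] [Module K V] [AddCommGroup V'] [Module K V']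
    {f : V →ₗ[K] V'} {x : M.carrier ⊗[K] (V →ₗ[K] V)} {y : M.carrier ⊗[K] (V' →ₗ[K] V')} :
    post f x = pre f y ↔ ∀ θ v, f (slice θ x v) = slice θ y (f v) := by
  rw [post_eq_wedge, pre_eq_wedge]
  exact ⟨fun h => slice_intertwine h.symm, fun h => eq_of_slice fun θ => LinearMap.ext fun v => by
    rw [slice_const_wedge, slice_wedge_const]
    exact h θ v⟩

end PreRep

variable (J : CanonicalIso ℳ 𝒩 C)

variable {J} in
theorem rep_hom_ext {R S : HodgeRep J} {f g : R ⟶ S} (h : lin f.hom.f = lin g.hom.f) : f = g :=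
  ObjectProperty.hom_ext _ (PreRep.hom_ext (hom_ext h))

/-- The kernel of the underlying linear map, with the induced structure, is a kernel. -/
theorem exists_rep_kernel {R S : HodgeRep J} (f : R ⟶ S) : ∃ (Z : HodgeRep J) (i : Z ⟶ R),
    i ≫ f = 0 ∧ Function.Injective (lin i.hom.f) ∧
    (∀ x, lin f.hom.f x = 0 → ∃ z, lin i.hom.f z = x) ∧
    ∀ (W : HodgeRep J) (g : W ⟶ R), g ≫ f = 0 → ∃ l, l ≫ i = g := by
  set j := (LinearMap.ker (lin f.hom.f)).subtype with hj
  obtain ⟨r, hr⟩ := j.exists_leftInverse_of_injective (Submodule.ker_subtype _)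
  have hjc : PreRep.post j (R.obj.sub j r).Ω = PreRep.pre j R.obj.Ω :=
    PreRep.sub_comm hr fun θ v => ⟨⟨slice θ R.obj.Ω v, by
      rw [LinearMap.mem_ker, PreRep.comm_iff.1 f.hom.comm, LinearMap.mem_ker.1 v.2, map_zero]⟩, rfl⟩
  have hc : wedge R.obj.Ω (1 ⊗ₜ j) = wedge (1 ⊗ₜ j) (R.obj.sub j r).Ω := by
    rw [← PreRep.pre_eq_wedge, ← PreRep.post_eq_wedge, hjc]
  have hZ : isRep J (R.obj.sub j r) := isHodgeRep_of_jointly_injective J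
    (isMHS_ker R.property.isMHS S.property.isMHS f.hom.f) R.property R.property
    (fun v h _ => Subtype.ext h) (fun _ _ => (and_self_iff).symm) (fun _ _ => and_self_iff.symm)
    hc hc
  refine ⟨⟨_, hZ⟩, ObjectProperty.homMk ⟨subι R.obj.X j, hjc⟩,
    rep_hom_ext (LinearMap.comp_ker_subtype _),
    Subtype.val_injective, fun x hx => ⟨⟨x, hx⟩, rfl⟩, fun W g hg => ?_⟩
  have hg' : lin f.hom.f ∘ₗ lin g.hom.f = 0 := congrArg (fun m => lin m.hom.f) hg
  refine ⟨ObjectProperty.homMk ⟨subLift g.hom.f ((lin g.hom.f).codRestrict _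
    fun x => LinearMap.congr_fun hg' x) rfl, PreRep.comm_iff.2 fun θ v => Subtype.ext ?_⟩, rfl⟩
  exact (PreRep.comm_iff.1 g.hom.comm θ v).trans (PreRep.comm_iff.1 hjc θ
    ⟨lin g.hom.f v, LinearMap.congr_fun hg' v⟩).symm

/-- The cokernel of the underlying linear map, with the induced structure, is a cokernel. -/
theorem exists_rep_cokernel {R S : HodgeRep J} (f : R ⟶ S) : ∃ (Z : HodgeRep J) (q : S ⟶ Z),
    f ≫ q = 0 ∧ Function.Surjective (lin q.hom.f) ∧
    (∀ y, lin q.hom.f y = 0 → ∃ x, lin f.hom.f x = y) ∧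
    ∀ (W : HodgeRep J) (g : S ⟶ W), f ≫ g = 0 → ∃ l, q ≫ l = g := by
  set q := (LinearMap.range (lin f.hom.f)).mkQ with hq
  obtain ⟨σ, hσ⟩ := q.exists_rightInverse_of_surjective (Submodule.range_mkQ _)
  have hqc : PreRep.post q S.obj.Ω = PreRep.pre q (S.obj.quot q σ).Ω :=
    PreRep.quot_comm hσ fun θ v hv => by
      obtain ⟨u, rfl⟩ := (Submodule.Quotient.mk_eq_zero _).1 hv
      rw [← PreRep.comm_iff.1 f.hom.comm]
      exact (Submodule.Quotient.mk_eq_zero _).2 ⟨_, rfl⟩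
  have hc : wedge (S.obj.quot q σ).Ω (1 ⊗ₜ q) = wedge (1 ⊗ₜ q) S.obj.Ω := by
    rw [← PreRep.pre_eq_wedge, ← PreRep.post_eq_wedge, hqc]
  have hZ : isRep J (S.obj.quot q σ) := isHodgeRep_of_surjective J
    (isMHS_coker R.property.isMHS S.property.isMHS f.hom.f) S.property
    (mkQ_surjective _) (fun _ => rfl) (fun _ => rfl) hc
  refine ⟨⟨_, hZ⟩, ObjectProperty.homMk ⟨quotπ S.obj.X q, hqc⟩,
    rep_hom_ext (LinearMap.range_mkQ_comp _),
    mkQ_surjective _, fun y hy => (Submodule.Quotient.mk_eq_zero _).1 hy,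
    fun W g hg => ?_⟩
  have hg' : lin g.hom.f ∘ₗ lin f.hom.f = 0 := congrArg (fun m => lin m.hom.f) hg
  have hl : Submodule.liftQ _ (lin g.hom.f) (LinearMap.range_le_ker_iff.2 hg') ∘ₗ q =
    lin g.hom.f := liftQ_mkQ _ _ _
  refine ⟨ObjectProperty.homMk ⟨quotDesc g.hom.f _ hl, PreRep.comm_iff.2 fun θ v => ?_⟩,
    rep_hom_ext hl⟩
  obtain ⟨v, rfl⟩ := mkQ_surjective _ v
  have h₁ := PreRep.comm_iff.1 hqc θ v
  have h₂ := PreRep.comm_iff.1 g.hom.comm θ v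
  rw [← hl] at h₂
  exact (congrArg _ h₁.symm).trans h₂

theorem isConcreteAbelian_forgetRep : IsConcreteAbelian (forgetRep J ⋙ forgetMHS K) where
  faithful := inferInstanceAs ((isRep J).ι ⋙ PreRep.forget ⋙ forget).Faithful
  additive := inferInstanceAs ((isRep J).ι ⋙ PreRep.forget ⋙ forget).Additive
  reflectsIso := ⟨fun {R S} f hf => by
    have hb : Function.Bijective (lin f.hom.f) := ConcreteCategory.bijective_of_isIso
      ((forgetRep J ⋙ forgetMHS K).map f)
    exact (ObjectProperty.isoMk (isRep J) (PreRep.mkIso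
      (isoOfBijective R.property.isMHS S.property.isMHS f.hom.f hb) f.hom.comm)).isIso_hom⟩
  nonempty := ⟨⟨_, isHodgeRep_unit J⟩⟩
  hasBinaryBiproducts := ⟨fun R S => hasBinaryBiproduct_of_total
    { pt := ⟨_, isHodgeRep_prod J R.property S.property⟩
      fst := ObjectProperty.homMk ⟨prodFst R.obj.X S.obj.X, PreRep.prod_fst _ _⟩
      snd := ObjectProperty.homMk ⟨prodSnd R.obj.X S.obj.X, PreRep.prod_snd _ _⟩
      inl := ObjectProperty.homMk ⟨prodInl R.obj.X S.obj.X, PreRep.prod_inl _ _⟩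
      inr := ObjectProperty.homMk ⟨prodInr R.obj.X S.obj.X, PreRep.prod_inr _ _⟩
      inl_fst := rep_hom_ext (LinearMap.fst_comp_inl _ _ _)
      inl_snd := rep_hom_ext (LinearMap.snd_comp_inl _ _ _)
      inr_fst := rep_hom_ext (LinearMap.fst_comp_inr _ _ _)
      inr_snd := rep_hom_ext (LinearMap.snd_comp_inr _ _ _) }
    (rep_hom_ext (inl_fst_add_inr_snd _ _))⟩
  kernel := exists_rep_kernel J
  cokernel := exists_rep_cokernel J

end AbelianRep

/-! ### The tensor category of representations -/

section RepTensor

open BifilteredSpace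

namespace PreRep

variable {M : DGA.{u} K}

instance : MonoidalPreadditive (PreRep M) where
  whiskerLeft_zero := hom_ext (BifilteredSpace.hom_ext (ext' fun x _ => tmul_zero _ x))
  zero_whiskerRight := hom_ext (BifilteredSpace.hom_ext (ext' fun _ y => zero_tmul _ y))
  whiskerLeft_add f g := hom_ext (BifilteredSpace.hom_ext (ext' fun x y =>
    tmul_add x (lin f.f y) (lin g.f y)))
  add_whiskerRight f g := hom_ext (BifilteredSpace.hom_ext (ext' fun x y =>
    add_tmul (lin f.f x) (lin g.f x) y))

instance : MonoidalLinear K (PreRep M) where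
  whiskerLeft_smul _ _ _ c f := hom_ext (BifilteredSpace.hom_ext (ext' fun x y =>
    tmul_smul c x (lin f.f y)))
  smul_whiskerRight _ _ _ _ _ := hom_ext (BifilteredSpace.hom_ext (ext' fun _ _ => rfl))

theorem slice_tensor (R S : PreRep M) (θ : M.carrier →ₗ[K] K) (z : R.X.V ⊗[K] S.X.V) :
    slice θ (R ⊗ S).Ω z = TensorProduct.map (slice θ R.Ω) LinearMap.id z +
      TensorProduct.map LinearMap.id (slice θ S.Ω) z := by
  change slice θ (rT (V := S.X.V) LinearMap.id R.Ω + lT (V := R.X.V) LinearMap.id S.Ω) z = _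
  rw [map_add, rT, lT, slice_lTensor, slice_lTensor]
  rfl

/-- The evaluation `R* ⊗ R → 1`. -/
def ev (R : PreRep M) : R.dual ⊗ R ⟶ 𝟙_ (PreRep M) where
  f := BifilteredSpace.ev R.X
  comm := comm_iff.2 fun θ z => by
    change contractLeft K R.X.V (slice θ (R.dual ⊗ R).Ω z) =
      slice θ (0 : M.carrier ⊗[K] (K →ₗ[K] K)) _
    rw [slice_tensor, map_zero, LinearMap.zero_apply]
    change contractLeft K R.X.V
      (TensorProduct.map (slice θ (dualEnd.lTensor _ R.Ω)) LinearMap.id z +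
      TensorProduct.map LinearMap.id (slice θ R.Ω) z) = 0
    rw [slice_lTensor]
    induction z using induction_on with
    | zero => simp
    | add x y hx hy =>
      simp only [map_add] at hx hy ⊢
      rw [add_add_add_comm, hx, hy, add_zero]
    | tmul φ x => simp [dualEnd_apply]

theorem slice_coevaluation (R : PreRep M) (θ : M.carrier →ₗ[K] K) (z : K) :
    slice θ (R ⊗ R.dual).Ω (coevaluation K R.X.V z) = 0 := by
  have h : ∀ w, TensorProduct.map (LinearMap.id : R.X.V →ₗ[K] R.X.V)
      (slice θ (dualEnd.lTensor _ R.Ω)) w =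
        -TensorProduct.map LinearMap.id (slice θ R.Ω).dualMap w := fun w => by
    rw [slice_lTensor]
    induction w using induction_on with
    | zero => simp
    | add x y hx hy => rw [map_add, map_add, hx, hy, neg_add]
    | tmul x φ =>
      rw [TensorProduct.map_tmul, TensorProduct.map_tmul, ← tmul_neg]
      rfl
  have h₁ : TensorProduct.map (slice θ R.Ω) LinearMap.id (coevaluation K R.X.V z) =
      TensorProduct.map LinearMap.id (slice θ R.Ω).dualMap (coevaluation K R.X.V z) := by
    have hz : coevaluation K R.X.V z = z • coevaluation K R.X.V 1 := by
      rw [← map_smul, smul_eq_mul, mul_one]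
    rw [hz, map_smul, map_smul, map_coevaluation]
  refine (slice_tensor R R.dual θ _).trans ?_
  exact (congrArg₂ (· + ·) h₁ (h _)).trans (add_neg_cancel _)

/-- The coevaluation `1 → R ⊗ R*`. -/
def coev {R : PreRep M} (hR : isMHS K R.X) : 𝟙_ (PreRep M) ⟶ R ⊗ R.dual where
  f := BifilteredSpace.coev hR
  comm := comm_iff.2 fun θ z => by
    have h₀ : slice θ (𝟙_ (PreRep M)).Ω z = 0 := by
      change slice θ (0 : M.carrier ⊗[K] (K →ₗ[K] K)) z = 0
      rw [map_zero, LinearMap.zero_apply]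
    rw [h₀, map_zero]
    exact (slice_coevaluation R θ z).symm

end PreRep

variable (J : CanonicalIso ℳ 𝒩 C)

section Rigid

variable [(isRep J).IsMonoidal]

/-- The duality between a representation and its dual. -/
@[reducible]
def exactPairingDual (R : HodgeRep J) :
    ExactPairing R ⟨R.obj.dual, isHodgeRep_dual J R.property⟩ where
  coevaluation' := ObjectProperty.homMk (PreRep.coev R.property.isMHS)
  evaluation' := ObjectProperty.homMk (PreRep.ev R.obj)
  coevaluation_evaluation' := rep_hom_ext (ext' fun φ c => LinearMap.congr_fun
    (contractLeft_assoc_coevaluation K R.obj.X.V) (φ ⊗ₜ c))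
  evaluation_coevaluation' := rep_hom_ext (ext' fun c x => LinearMap.congr_fun
    (contractLeft_assoc_coevaluation' K R.obj.X.V) (c ⊗ₜ x))

/-- Representations form a rigid category. -/
@[reducible]
def rigidHodgeRep : RigidCategory (HodgeRep J) :=
  let _ : RightRigidCategory (HodgeRep J) :=
    { rightDual := fun R =>
        { rightDual := ⟨R.obj.dual, isHodgeRep_dual J R.property⟩
          exact := exactPairingDual J R } }
  BraidedCategory.rigidCategoryOfRightRigidCategory

end Rigid

theorem isHodgeRep_zero {X : BifilteredSpace K} (hX : isMHS K X) :
    isRep J (⟨X, 0⟩ : PreRep ℳ.M) where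
  isMHS := hX
  weight := zero_mem _
  maurerCartan := by rw [map_zero, wedge_zero, add_zero]
  hodge := by
    rw [CanonicalIso.form, map_zero, map_zero]
    exact zero_mem _

/-- The representations with `Ω = 0`. -/
def κRep : MHS K ⥤ HodgeRep J where
  obj V := ⟨⟨V.obj, 0⟩, isHodgeRep_zero J V.property⟩
  map f := ObjectProperty.homMk ⟨f.hom, by rw [map_zero, map_zero]⟩

theorem κRep_comp_forgetRep : κRep J ⋙ forgetRep J = 𝟭 (MHS K) := rfl

section Braided

variable [(isMHS K).IsMonoidal] [(isRep J).IsMonoidal]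

instance : (forgetRep J).Monoidal :=
  Functor.CoreMonoidal.toMonoidal
    { εIso := Iso.refl _
      μIso := fun _ _ => Iso.refl _
      μIso_hom_natural_left := fun _ _ => mhs_hom_ext (ext' fun _ _ => rfl)
      μIso_hom_natural_right := fun _ _ => mhs_hom_ext (ext' fun _ _ => rfl)
      associativity := fun _ _ _ => mhs_hom_ext (TensorProduct.ext_threefold fun _ _ _ => rfl)
      left_unitality := fun _ => mhs_hom_ext (ext' fun _ _ => rfl)
      right_unitality := fun _ => mhs_hom_ext (ext' fun _ _ => rfl) }

instance : (forgetRep J).Braided where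
  braided _ _ := mhs_hom_ext (ext' fun _ _ => rfl)

/-- The comparison of tensor products of representations with `Ω = 0`. -/
def κRepμIso (V V' : MHS K) :
    (κRep J).obj V ⊗ (κRep J).obj V' ≅ (κRep J).obj (V ⊗ V') :=
  ObjectProperty.isoMk _ (PreRep.mkIso (Iso.refl _) (by
    change PreRep.post LinearMap.id (PreRep.rT LinearMap.id 0 + PreRep.lT LinearMap.id 0) =
      PreRep.pre LinearMap.id 0
    rw [map_zero, map_zero, map_zero, add_zero, map_zero]))

instance : (κRep J).Monoidal :=
  Functor.CoreMonoidal.toMonoidal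
    { εIso := Iso.refl _
      μIso := κRepμIso J
      μIso_hom_natural_left := fun _ _ => rep_hom_ext (ext' fun _ _ => rfl)
      μIso_hom_natural_right := fun _ _ => rep_hom_ext (ext' fun _ _ => rfl)
      associativity := fun _ _ _ => rep_hom_ext (TensorProduct.ext_threefold fun _ _ _ => rfl)
      left_unitality := fun _ => rep_hom_ext (ext' fun _ _ => rfl)
      right_unitality := fun _ => rep_hom_ext (ext' fun _ _ => rfl) }

instance : (κRep J).Braided where
  braided _ _ := rep_hom_ext (ext' fun _ _ => rfl)

theorem isMonoidal_κRep_forgetRep :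
    NatTrans.IsMonoidal (F₁ := κRep J ⋙ forgetRep J) (F₂ := 𝟭 (MHS K)) (𝟙 (𝟭 (MHS K))) where
  unit := mhs_hom_ext (LinearMap.ext fun _ => rfl)
  tensor _ _ := mhs_hom_ext (ext' fun _ _ => rfl)

end Braided

end RepTensor

/-! ### Transport of structure along an equivalence with a strict section -/

section MonoidalSection

variable {𝒜 𝒞 𝒟 : Type*} [Category* 𝒜] [Category* 𝒞] [Category* 𝒟] (e : 𝒞 ≌ 𝒟)
  {k₀ : 𝒜 ⥤ 𝒞} {k : 𝒜 ⥤ 𝒟} (α : k₀ ⋙ e.functor ≅ k) (h : k ⋙ e.inverse = k₀)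

/-- The equality `k ⋙ e.inverse = k₀`, as a natural isomorphism, is built from `α` and the unit. -/
theorem eqToHom_eq_of_map (hm : ∀ a, e.functor.map ((eqToHom h).app a) =
    e.counit.app (k.obj a) ≫ α.inv.app a) :
    eqToHom h = Functor.whiskerRight α.inv e.inverse ≫
      (Functor.associator k₀ e.functor e.inverse).hom ≫
        Functor.whiskerLeft k₀ e.unitIso.inv ≫ k₀.rightUnitor.hom := by
  ext a
  refine e.functor.map_injective ((hm a).trans ?_)
  simp

variable [MonoidalCategory 𝒜] [BraidedCategory 𝒜] [MonoidalCategory 𝒞] [BraidedCategory 𝒞]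
  [MonoidalCategory 𝒟] [BraidedCategory 𝒟] [e.functor.Braided] [e.inverse.Braided] [k₀.Braided]

include α in
/-- The tensor structure of `k` is transported along `α`; the equality `k ⋙ e.inverse = k₀` is then
an isomorphism of tensor functors. -/
theorem exists_braided_of_equivalence (hu : NatTrans.IsMonoidal e.unitIso.hom)
    (hm : ∀ a, e.functor.map ((eqToHom h).app a) = e.counit.app (k.obj a) ≫ α.inv.app a) :
    ∃ _ : k.Braided, NatTrans.IsMonoidal (eqToHom h) := by
  let i₁ : k.Monoidal := Functor.Monoidal.transport α
  have hα : NatTrans.IsMonoidal α.hom := Functor.Monoidal.natTransIsMonoidal_of_transport α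
  let i₂ : k.LaxBraided := Functor.LaxBraided.ofNatIso α
  let i₃ : k.Braided := { i₁, i₂ with }
  refine ⟨i₃, ?_⟩
  rw [eqToHom_eq_of_map e α h hm]
  infer_instance

end MonoidalSection

section StrictSection

open CategoryTheory.Monoidal

variable {𝒜 𝒞 𝒟 : Type*} [Category* 𝒜] [Category* 𝒞] [Category* 𝒟] (F : 𝒞 ⥤ 𝒟) [F.IsEquivalence]
  {k₀ : 𝒜 ⥤ 𝒞} {k : 𝒜 ⥤ 𝒟} (α : k₀ ⋙ F ≅ k)

open Classical in
/-- Preimages of objects under `F`, chosen to be `k₀ a` on the objects of the form `k a`. -/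
def strictPreimage (d : 𝒟) : (c : 𝒞) × (F.obj c ≅ d) :=
  if h : ∃ a, k.obj a = d then ⟨k₀.obj h.choose, α.app h.choose ≪≫ eqToIso h.choose_spec⟩
  else ⟨F.objPreimage d, F.objObjPreimageIso d⟩

theorem strictPreimage_obj (hk : Function.Injective k.obj) (a : 𝒜) :
    strictPreimage F α (k.obj a) = ⟨k₀.obj a, α.app a⟩ := by
  have h : ∃ b, k.obj b = k.obj a := ⟨a, rfl⟩
  rw [strictPreimage, dif_pos h]
  have : ∀ b (hb : k.obj b = k.obj a), (⟨k₀.obj b, α.app b ≪≫ eqToIso hb⟩ :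
      (c : 𝒞) × (F.obj c ≅ k.obj a)) = ⟨k₀.obj a, α.app a⟩ := fun b hb => by
    obtain rfl := hk hb
    rw [eqToIso_refl, Iso.trans_refl]
  exact this _ h.choose_spec

/-- The quasi-inverse of `F` defined by the chosen preimages. -/
def strictInverse : 𝒟 ⥤ 𝒞 where
  obj d := (strictPreimage F α d).1
  map {d d'} f := F.preimage ((strictPreimage F α d).2.hom ≫ f ≫ (strictPreimage F α d').2.inv)
  map_id d := F.map_injective (by simp)
  map_comp f g := F.map_injective (by simp)

/-- The equivalence formed by `F` and `strictInverse`. -/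
def strictEquivalence : 𝒞 ≌ 𝒟 where
  functor := F
  inverse := strictInverse F α
  unitIso := NatIso.ofComponents (fun c => F.preimageIso (strictPreimage F α (F.obj c)).2.symm)
    fun f => F.map_injective (by simp [strictInverse])
  counitIso := NatIso.ofComponents (fun d => (strictPreimage F α d).2)
    fun f => by simp [strictInverse]
  functor_unitIso_comp c := by
    change F.map (F.preimageIso _).hom ≫ (strictPreimage F α (F.obj c)).2.hom = _
    simp [Functor.preimageIso]

theorem map_eqToHom_of_eq {a : 𝒜} {p : (c : 𝒞) × (F.obj c ≅ k.obj a)}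
    (hp : p = ⟨k₀.obj a, α.app a⟩) (h : p.1 = k₀.obj a) :
    F.map (eqToHom h) = p.2.hom ≫ α.inv.app a := by
  subst hp; simp

theorem comp_strictInverse (hk : Function.Injective k.obj) : k ⋙ strictInverse F α = k₀ := by
  have h : ∀ a, (strictPreimage F α (k.obj a)).1 = k₀.obj a := fun a =>
    congrArg Sigma.fst (strictPreimage_obj F α hk a)
  have hm : ∀ a, F.map (eqToHom (h a)) = (strictPreimage F α (k.obj a)).2.hom ≫ α.inv.app a :=
    fun a => map_eqToHom_of_eq F α (strictPreimage_obj F α hk a) (h a)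
  refine CategoryTheory.Functor.ext h fun a a' f => F.map_injective ?_
  change F.map (F.preimage ((strictPreimage F α (k.obj a)).2.hom ≫ k.map f ≫
    (strictPreimage F α (k.obj a')).2.inv)) = F.map (eqToHom (h a) ≫ k₀.map f ≫ eqToHom (h a').symm)
  rw [← cancel_mono (F.map (eqToHom (h a'))), ← F.map_comp (_ ≫ _), Category.assoc, Category.assoc,
    eqToHom_trans, eqToHom_refl, Category.comp_id, F.map_comp, hm, hm, F.map_preimage]
  simp only [Category.assoc, Iso.inv_hom_id_assoc]
  exact congrArg (_ ≫ ·) (α.inv.naturality f)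

variable [MonoidalCategory 𝒜] [BraidedCategory 𝒜] [MonoidalCategory 𝒞] [SymmetricCategory 𝒞]
  [k₀.Braided]

include α in
/-- If `k ≅ k₀ ⋙ F` is injective on objects, `F` is an equivalence and `k₀` is a symmetric tensor
functor, then the target of `F` has a symmetric tensor structure for which `F`, `k` and a
quasi-inverse of `F` are symmetric tensor functors, with `k` followed by the quasi-inverse equal
to `k₀`. -/
theorem exists_symmetric_of_equivalence (hk : Function.Injective k.obj) :
    ∃ (_ : MonoidalCategory 𝒟) (_ : SymmetricCategory 𝒟), Nonempty F.Braided ∧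
      ∃ e : 𝒞 ≌ 𝒟, e.functor = F ∧ ∃ (_ : e.inverse.Braided) (_ : k.Braided)
        (h : k ⋙ e.inverse = k₀), NatTrans.IsMonoidal (eqToHom h) := by
  let e := strictEquivalence F α
  have h : k ⋙ e.inverse = k₀ := comp_strictInverse F α hk
  obtain ⟨i, hi⟩ := exists_braided_of_equivalence (equivalenceTransported e) α h
    (inferInstanceAs (NatTrans.IsMonoidal (equivalenceTransported e).unit)) fun a => by
      rw [eqToHom_app]
      exact map_eqToHom_of_eq F α (strictPreimage_obj F α hk a)
        (congrArg Sigma.fst (strictPreimage_obj F α hk a))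
  exact ⟨Transported.instMonoidalCategory e, Transported.instSymmetricCategory e,
    ⟨(inferInstance : (equivalenceTransported e).functor.Braided)⟩, e, rfl,
    (inferInstance : (equivalenceTransported e).inverse.Braided), i, h, hi⟩

end StrictSection

/-! ### The non-abelian mixed Hodge structure on the category of variations -/

section ExistsNMHS

open BifilteredSpace CategoryTheory.Limits

variable {J : CanonicalIso ℳ 𝒩 C} (T : Transport J) {V V' : Type u} [AddCommGroup V] [Module K V]
  [AddCommGroup V'] [Module K V']

theorem one_tmul_smul {A : Type u} [Ring A] [Algebra K A] (c : K) (f : V →ₗ[K] V') :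
    (1 : A) ⊗ₜ[K] (c • f) = c • ((1 : A) ⊗ₜ[K] f) :=
  tmul_smul c 1 f

theorem one_tmul_smul_baseChange {A : Type u} [Ring A] [Algebra ℂ A] (c : K) (f : V →ₗ[K] V') :
    (1 : A) ⊗ₜ[ℂ] (c • f).baseChange ℂ = algebraMap K ℂ c • ((1 : A) ⊗ₜ[ℂ] f.baseChange ℂ) := by
  rw [LinearMap.baseChange_smul, ← algebraMap_smul ℂ c (f.baseChange ℂ), tmul_smul]

theorem one_tmul_add_baseChange {A : Type u} [Ring A] [Algebra ℂ A] (f g : V →ₗ[K] V') :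
    (1 : A) ⊗ₜ[ℂ] (f + g).baseChange ℂ =
      (1 : A) ⊗ₜ[ℂ] f.baseChange ℂ + (1 : A) ⊗ₜ[ℂ] g.baseChange ℂ := by
  rw [LinearMap.baseChange_add, tmul_add]

instance : (Phi T).Additive where
  map_add {_ _ f g} := VMHS.hom_ext (Prod.ext (tmul_add _ (lin f.hom.f) (lin g.hom.f))
    (one_tmul_add_baseChange (lin f.hom.f) (lin g.hom.f)))

instance : (Phi T).Linear K where
  map_smul f c := VMHS.hom_ext (Prod.ext (one_tmul_smul c (lin f.hom.f))
    (one_tmul_smul_baseChange c (lin f.hom.f)))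

instance : (κ D).Additive where
  map_add {_ _ f g} := VMHS.hom_ext (Prod.ext (tmul_add _ (lin f.hom) (lin g.hom))
    (one_tmul_add_baseChange (lin f.hom) (lin g.hom)))

instance : (κ D).Linear K where
  map_smul f c := VMHS.hom_ext (Prod.ext (one_tmul_smul c (lin f.hom))
    (one_tmul_smul_baseChange c (lin f.hom)))

theorem formA_κRep (V : MHS K) : formA ((κRep J).obj V).obj = 0 :=
  map_zero (mapForm ℳ.φ.toLinearMap)

theorem form_κRep (V : MHS K) : J.form ((κRep J).obj V).obj = 0 := by
  change mapForm _ (cxForm K 0) = 0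
  rw [map_zero, map_zero]

theorem formB_κRep (V : MHS K) : formB J ((κRep J).obj V).obj = 0 := by
  rw [formB, form_κRep, map_zero]

/-- The transport of the zero connection is the identity. -/
theorem transport_κRep (V : MHS K) : T.a ((κRep J).obj V) = 1 ⊗ₜ LinearMap.id := by
  have hR := isUnipotentRep J ((κRep J).obj V)
  have h1 : IsParallelTransport J ((κRep J).obj V).obj (1 ⊗ₜ LinearMap.id) := by
    refine ⟨1 ⊗ₜ LinearMap.id, ?_, ?_, ?_⟩
    · rw [form_κRep, map_zero, wedge_zero]; simp
    · simp
    · simp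
  have h := isParallelTransport_natural J hR hR (F := LinearMap.id)
    (by rw [wedge_one, one_wedge]) h1 (T.isParallelTransport _)
  rwa [wedge_one, one_wedge] at h

namespace VMHS

theorem pair_comp_of_const {x y z : VMHS D} {m : x ⟶ y} {n : y ⟶ z} {f : x.X ⟶ y.X}
    {g : y.X ⟶ z.X} (hm : pair m = (1 ⊗ₜ lin f, 1 ⊗ₜ (lin f).baseChange ℂ))
    (hn : pair n = (1 ⊗ₜ lin g, 1 ⊗ₜ (lin g).baseChange ℂ)) :
    pair (m ≫ n) = (1 ⊗ₜ lin (f ≫ g), 1 ⊗ₜ (lin (f ≫ g)).baseChange ℂ) := by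
  rw [pair_comp, hm, hn, lin_comp, baseChange_comp, wedge_tmul, wedge_tmul, one_mul,
    one_mul]

theorem one_tmul_conj {k A : Type*} [Field k] [Ring A] [Algebra k A] {V V' : Type*}
    [AddCommGroup V] [Module k V] [AddCommGroup V'] [Module k V'] {f : V →ₗ[k] V'}
    {g : V' →ₗ[k] V} (hfg : f ∘ₗ g = LinearMap.id) (hgf : g ∘ₗ f = LinearMap.id)
    {x : A ⊗[k] (V →ₗ[k] V)} {y : A ⊗[k] (V' →ₗ[k] V')}
    (h : wedge y (1 ⊗ₜ f) = wedge (1 ⊗ₜ f) x) : wedge x (1 ⊗ₜ g) = wedge (1 ⊗ₜ g) y := by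
  have h₁ : wedge (1 ⊗ₜ g) (1 ⊗ₜ f) = (1 ⊗ₜ LinearMap.id : A ⊗[k] (V →ₗ[k] V)) := by
    rw [wedge_tmul, one_mul, hgf]
  have h₂ : wedge (1 ⊗ₜ f) (1 ⊗ₜ g) = (1 ⊗ₜ LinearMap.id : A ⊗[k] (V' →ₗ[k] V')) := by
    rw [wedge_tmul, one_mul, hfg]
  have h₃ := congrArg (fun z => wedge (wedge (1 ⊗ₜ g) z) (1 ⊗ₜ g)) h
  simp only [wedge_assoc] at h₃
  rw [h₂, wedge_one, ← wedge_assoc (1 ⊗ₜ g), h₁, one_wedge] at h₃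
  exact h₃.symm

/-- A constant isomorphism of variations. -/
def constIso {x y : VMHS D} (f : x.X ≅ y.X)
    (h : wedge y.ω (1 ⊗ₜ lin f.hom) = wedge (1 ⊗ₜ lin f.hom) x.ω)
    (h' : wedge y.ω' (1 ⊗ₜ (lin f.hom).baseChange ℂ) =
      wedge (1 ⊗ₜ (lin f.hom).baseChange ℂ) x.ω')
    (ha : wedge y.a (1 ⊗ₜ (lin f.hom).baseChange ℂ) =
      wedge (1 ⊗ₜ (lin f.hom).baseChange ℂ) x.a) : x ≅ y :=
  have hfg : lin f.hom ∘ₗ lin f.inv = LinearMap.id := by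
    rw [← lin_comp, f.inv_hom_id, lin_id]
  have hgf : lin f.inv ∘ₗ lin f.hom = LinearMap.id := by
    rw [← lin_comp, f.hom_inv_id, lin_id]
  have hfg' : (lin f.hom).baseChange ℂ ∘ₗ (lin f.inv).baseChange ℂ = LinearMap.id := by
    rw [← baseChange_comp, hfg, baseChange_id]
  have hgf' : (lin f.inv).baseChange ℂ ∘ₗ (lin f.hom).baseChange ℂ = LinearMap.id := by
    rw [← baseChange_comp, hgf, baseChange_id]
  { hom := const f.hom h h' ha
    inv := const f.inv (one_tmul_conj hfg hgf h) (one_tmul_conj hfg' hgf' h')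
      (one_tmul_conj hfg' hgf' ha)
    hom_inv_id := hom_ext (by
      rw [pair_comp_of_const rfl rfl, f.hom_inv_id, lin_id, baseChange_id]; rfl)
    inv_hom_id := hom_ext (by
      rw [pair_comp_of_const rfl rfl, f.inv_hom_id, lin_id, baseChange_id]; rfl) }

end VMHS

/-- `Φ_C` sends a mixed Hodge structure with `Ω = 0` to a constant variation. -/
def κRepCompPhiIso : κRep J ⋙ Phi T ≅ κ D :=
  NatIso.ofComponents (fun V => VMHS.constIso (x := PhiObj T ((κRep J).obj V)) (y := κObj D V)
      (Iso.refl V.obj)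
      ((zero_wedge _).trans ((congrArg _ (formA_κRep V)).trans (wedge_zero _)).symm)
      ((zero_wedge _).trans ((congrArg _ (formB_κRep V)).trans (wedge_zero _)).symm)
      ((congrArg (fun f => wedge (1 ⊗ₜ LinearMap.id) (1 ⊗ₜ f))
        (baseChange_id (R := K) (A := ℂ) (M := V.obj.V))).trans
        (congrArg₂ (fun f x => wedge (1 ⊗ₜ f) x)
          (baseChange_id (R := K) (A := ℂ) (M := V.obj.V)) (transport_κRep T V)).symm))
    fun {V V'} f => VMHS.hom_ext ((VMHS.pair_comp_of_const (x := PhiObj T ((κRep J).obj V))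
      (y := PhiObj T ((κRep J).obj V')) (z := κObj D V') (f := f.hom) (g := 𝟙 V'.obj) rfl rfl).trans
      ((congrArg (fun g => ((1 : D.A.carrier) ⊗ₜ[K] lin g,
        (1 : D.B.carrier) ⊗ₜ[ℂ] (lin g).baseChange ℂ))
          ((Category.comp_id f.hom).trans (Category.id_comp f.hom).symm)).trans
      (VMHS.pair_comp_of_const (x := PhiObj T ((κRep J).obj V)) (y := κObj D V) (z := κObj D V')
        (f := 𝟙 V.obj) (g := f.hom) rfl rfl).symm))

theorem κ_obj_injective : Function.Injective (κ D).obj := fun _ _ h => congrArg VMHS.toMHS h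

end ExistsNMHS

section Assembly

open CategoryTheory.Limits

theorem isMonoidal_eqToHom_comp {𝒜 𝒟 𝒞 : Type*} [Category* 𝒜] [Category* 𝒞] [Category* 𝒟]
    [MonoidalCategory 𝒜] [MonoidalCategory 𝒞] [MonoidalCategory 𝒟] {k : 𝒜 ⥤ 𝒟} {i : 𝒟 ⥤ 𝒞}
    {k₀ : 𝒜 ⥤ 𝒞} {g : 𝒞 ⥤ 𝒜} [k.Monoidal] [i.Monoidal] [k₀.Monoidal] [g.Monoidal]
    (h : k ⋙ i = k₀) (h' : k₀ ⋙ g = 𝟭 𝒜) [NatTrans.IsMonoidal (eqToHom h)]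
    [NatTrans.IsMonoidal (eqToHom h')] (h'' : k ⋙ i ⋙ g = 𝟭 𝒜) :
    NatTrans.IsMonoidal (eqToHom h'') := by
  have : eqToHom h'' = (Functor.associator k i g).inv ≫ Functor.whiskerRight (eqToHom h) g ≫
      eqToHom h' := by
    ext a
    simp [eqToHom_app, eqToHom_map]
  rw [this]
  infer_instance

variable {J : CanonicalIso ℳ 𝒩 C} (T : Transport J)

/-- Abelian and rigid structures are transported from representations; exactness is tested on the
underlying mixed Hodge structures. -/
theorem isNMHS_of_equivalence [(isMHS K).IsMonoidal] [(isRep J).IsMonoidal]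
    [MonoidalCategory (VMHS D)] [SymmetricCategory (VMHS D)] (e : HodgeRep J ≌ VMHS D)
    (he : e.functor = Phi T) [e.inverse.Braided] [(κ D).Braided] (h : κ D ⋙ e.inverse = κRep J)
    (hm : NatTrans.IsMonoidal (eqToHom h)) :
    IsNMHS K (VMHS D) (e.inverse ⋙ forgetRep J) (κ D) := by
  have _ : e.functor.Additive := he ▸ inferInstance
  have _ : e.functor.Linear K := by
    have : (Phi T).Linear K := inferInstance
    revert this
    rw [← he]
    exact id
  have hV := isConcreteAbelian_forgetMHS (K := K)
  have hU := isConcreteAbelian_forgetRep J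
  have h₁ : κ D ⋙ e.inverse ⋙ forgetRep J = 𝟭 (MHS K) := by
    rw [← Functor.assoc, h]; rfl
  have _ : (forgetRep J).Faithful :=
    have := hU.faithful
    Functor.Faithful.of_comp _ (forgetMHS K)
  have _ : (forgetRep J).Additive := ⟨rfl⟩
  have _ : (forgetRep J).Linear K := ⟨fun _ _ => rfl⟩
  have _ : HasFiniteProducts (HodgeRep J) := hU.hasFiniteProducts
  have _ : HasFiniteProducts (VMHS D) :=
    ⟨fun n => Adjunction.hasLimitsOfShape_of_equivalence e.inverse⟩
  have _ : MonoidalPreadditive (VMHS D) := monoidalPreadditive_of_faithful e.inverse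
  have hκ := κRepCompPhiIso T
  refine
    { abelian := ⟨let _ := hU.abelian
        abelianOfAdjunction e.inverse e.functor e.counitIso e.toAdjunction, rfl⟩
      rigid := ⟨let _ := rigidHodgeRep J
        rigidCategoryOfEquivalence e.symm.toAdjunction⟩
      bilinear := ⟨inferInstance, MonoidalLinear.ofFaithful K e.inverse⟩
      faithful₁ := inferInstance
      linear₁ := ⟨inferInstance, inferInstance⟩
      exact₁ := ⟨?_, ?_⟩
      faithful₂ := Functor.Faithful.of_comp_eq h₁
      linear₂ := ⟨inferInstance, inferInstance⟩
      exact₂ := ⟨?_, ?_⟩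
      tensor := ⟨inferInstance, inferInstance, h₁, ?_⟩ }
  · have _ : PreservesFiniteLimits (forgetRep J) :=
      Functor.preservesFiniteLimits_of_comp hV _ hU.preservesFiniteLimits
    exact comp_preservesFiniteLimits _ _
  · have _ : PreservesFiniteColimits (forgetRep J) :=
      Functor.preservesFiniteColimits_of_comp hV _ hU.preservesFiniteColimits
    exact comp_preservesFiniteColimits _ _
  · have _ : PreservesFiniteLimits (κRep J) :=
      Functor.preservesFiniteLimits_of_comp hU _ hV.preservesFiniteLimits
    have _ : PreservesFiniteLimits (Phi T) := by rw [← he]; infer_instance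
    have _ := comp_preservesFiniteLimits (κRep J) (Phi T)
    exact preservesFiniteLimits_of_natIso hκ
  · have _ : PreservesFiniteColimits (κRep J) :=
      Functor.preservesFiniteColimits_of_comp hU _ hV.preservesFiniteColimits
    have _ : PreservesFiniteColimits (Phi T) := by rw [← he]; infer_instance
    have _ := comp_preservesFiniteColimits (κRep J) (Phi T)
    exact preservesFiniteColimits_of_natIso hκ
  · have _ : NatTrans.IsMonoidal (eqToHom (κRep_comp_forgetRep J)) := isMonoidal_κRep_forgetRep J
    exact isMonoidal_eqToHom_comp h (κRep_comp_forgetRep J) h₁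

end Assembly

end

end NonabelianHodge

theorem mainTheorem2 {K : Type u} [Field K] [Algebra K ℝ] (D : MixedHodgeDiagram K)
    (hW : ∀ i, ∀ x ∈ D.B.gr 0, D.B.d x ∈ D.WB.W i 1 → ∃ y ∈ D.WB.W i 0, D.B.d y = D.B.d x)
    (hF : ∀ p, ∀ x ∈ D.B.gr 0, D.B.d x ∈ D.FB.F p 1 → ∃ y ∈ D.FB.F p 0, D.B.d y = D.B.d x)
    (ℳ : FilteredModel D) (𝒩 : BigradedModel D) (C : Submodule ℂ D.B.carrier)
    (hC : IsSplitting D.B C) :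
    ∃ _ : (isMHS K).IsMonoidal,
      Nonempty (CanonicalIso ℳ 𝒩 C) ∧
      ∀ J : CanonicalIso ℳ 𝒩 C,
        ((∀ x ∈ ℳ.M.gr 1, ℳ.M.d x = 0 → x ∈ ℳ.WM.W 1 1) → ∀ R : HodgeRep J,
          R.obj.Ω ∈ ⨆ k : ℤ, tens K (ℳ.WM.W k 1) (filtHom R.obj.X.W R.obj.X.W (-k))) ∧
        ∃ (_ : (isRep J).IsMonoidal) (T : Transport J),
          ((∀ x ∈ C, ∀ y ∈ C, x * y ∈ C) → ∀ R : HodgeRep J,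
            T.a R - 1 ⊗ₜ LinearMap.id ∈ tens ℂ C (filtHom R.obj.X.WC R.obj.X.WC (-1))) ∧
          (Phi T).IsEquivalence ∧
          ∃ (_ : MonoidalCategory (VMHS D)) (_ : SymmetricCategory (VMHS D)),
            Nonempty (Phi T).Braided ∧
            ∃ e : HodgeRep J ≌ VMHS D, e.functor = Phi T ∧
              IsNMHS K (VMHS D) (e.inverse ⋙ forgetRep J) (κ D) := by
  refine ⟨inferInstance, nonempty_canonicalIso ℳ 𝒩 hC, fun J =>
    ⟨fun h R => mem_weight_of_closed h (isUnipotentRep J R), isMonoidal_isRep J, ?_⟩⟩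
  obtain ⟨T, hT⟩ := exists_transports J
  have _ := isMonoidal_isRep J
  have hΦ := Phi_isEquivalence J T hW hF
  obtain ⟨i₁, i₂, hb, e, he, i₃, i₄, h, hm⟩ :=
    exists_symmetric_of_equivalence (Phi T) (κRepCompPhiIso T) κ_obj_injective
  exact ⟨T, hT, hΦ, i₁, i₂, hb, e, he, isNMHS_of_equivalence T e he h hm⟩
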